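/- Let $d\ge 1$ and $J=(-\infty,0)$. Fix a smooth radial function $\varphi:\mathbb R^d\to[0,1]$ supported in $\{\frac34\le|\xi|\le\frac83\}$ with $\sum_{j\in\mathbb Z}\varphi(2^{-j}\xi)=1$ for all $\xi\ne0$, and set $\dot\Delta_j=\varphi(2^{-j}D)$. For $u\in\mathcal S'(\mathbb R^d)$ (modulo polynomials) and $s\in\mathbb R$ let $$\|u\|_{\dot B^s_{\infty,1}}=\sum_{j\in\mathbb Z}2^{sj}\|\dot\Delta_ju\|_{L^\infty(\mathbb R^d)},\qquad \|g\|_{\widetilde L^1(J;\dot B^s_{\infty,1})}=\sum_{j\in\mathbb Z}2^{sj}\|\dot\Delta_jg\|_{L^1(J;L^\infty(\mathbb R^d))}.$$ For real-valued $\eta,f\in\dot B^1_{\infty,1}$ let $H(x,z)=e^{z|D_x|}\eta(x)$ $(z<0)$; here $\nabla_xH$ and $|D_x|H$ are the sums of their dyadic blocks, and $e^{z|D_x|}f$ is the sum of its dyadic blocks, which is determined up to an additive constant. For $v:\mathbb R^d\times J\to\mathbb R$ put $$Q_a[v]=\nabla_xH\cdot\nabla_xv-\frac{|\nabla_xH|^2-|D_x|H}{1+|D_x|H}\,\partial_zv,\qquad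 Q_b[v]=|D_x|^{-1}\mathrm{div}_x\big(\nabla_xH\,\partial_zv-|D_x|H\,\nabla_xv\big),$$ $$\mathcal T[v](x,z)=e^{z|D_x|}f(x)+\int_0^ze^{(z-z')|D_x|}Q_a[v](x,z')\,dz'+\int_0^ze^{(z-z')|D_x|}\int_{-\infty}^{z'}e^{-(z'-\tau)|D_x|}|D_x|\{Q_b[v]-Q_a[v]\}(x,\tau)\,d\tau\,dz'.$$ Let $\mathcal V_*$ be the space, modulo constants, of $v$ such that $|D_x|v$ and $\partial_zv$ belong to $L^\infty(J;L^\infty(\mathbb R^d))\cap\widetilde L^1(J;\dot B^1_{\infty,1})$. (Such $v$ are taken to be Lipschitz functions on $\mathbb R^d\times J$.) If $\mathcal T$ has a unique fixed point $v$ in $\mathcal V_*$, define $$R^-(\eta)f=\int_{-\infty}^0e^{\tau|D_x|}|D_x|\{Q_b[v]-Q_a[v]\}(\cdot,\tau)\,d\tau .$$ **Proposition.** Let $r\ge0$. There exist constants $c_*>0$ and $C$, depending only on $d$ and $r$ (and on the fixed $\varphi$), such that the following holds for all real-valued $f,\eta_1,\eta_2\in\dot B^1_{\infty,1}\cap\dot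 B^{r+1}_{\infty,1}$ with $\||D_x|\eta_j\|_{\dot B^0_{\infty,1}}<c_*$, $j=1,2$. For $j=1,2$ the operator $\mathcal T$ associated with $(\eta_j,f)$ has a unique fixed point in $\mathcal V_*$, so that $R^-(\eta_j)f$ is well defined, and with $\eta_\delta=\eta_1-\eta_2$ and $\mathcal A_r=\||D_x|\eta_1\|_{\dot B^r_{\infty,1}}+\||D_x|\eta_2\|_{\dot B^r_{\infty,1}}$, $$\begin{aligned}\|[R^-(\eta_1)-R^-(\eta_2)]f\|_{\dot B^r_{\infty,1}}\le{}& C\mathcal A_r\||D_x|\eta_\delta\|_{\dot B^0_{\infty,1}}\||D_x|f\|_{\dot B^0_{\infty,1}}+C\||D_x|\eta_\delta\|_{\dot B^0_{\infty,1}}\||D_x|f\|_{\dot B^r_{\infty,1}}\\&+C\||D_x|\eta_\delta\|_{\dot B^r_{\infty,1}}\||D_x|f\|_{\dot B^0_{\infty,1}}.\end{aligned}$$ -/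

import Mathlib

open MeasureTheory Set
open scoped ENNReal NNReal FourierTransform SchwartzMap ContDiff

noncomputable section

namespace MuskatDN

/-- The horizontal space `ℝᵈ` with its Euclidean norm. -/
abbrev Sp (d : ℕ) : Type := EuclideanSpace ℝ (Fin d)

/-! ### Littlewood-Paley blocks and Fourier multipliers

Symbols are functions of the angular frequency `ξ`, i.e. `m(D) e^{i x·ξ} = m(ξ) e^{i x·ξ}`.  Since
`𝓕` is normalised with `e^{-2π i x·ξ}`, a symbol `m` enters as `ξ ↦ m (2πξ)`. -/

/-- A homogeneous dyadic partition of unity: a smooth radial `φ` with values in `[0,1]`, supported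
in the annulus `3/4 ≤ |ξ| ≤ 8/3`, such that `∑_{j ∈ ℤ} φ(2^{-j} ξ) = 1` for all `ξ ≠ 0`. -/
structure DyadicCutoff (d : ℕ) where
  toFun : Sp d → ℝ
  smooth : ContDiff ℝ ∞ toFun
  radial : ∀ ξ ξ' : Sp d, ‖ξ‖ = ‖ξ'‖ → toFun ξ = toFun ξ'
  mem_Icc : ∀ ξ, toFun ξ ∈ Icc (0 : ℝ) 1
  support : tsupport toFun ⊆ {ξ | 3 / 4 ≤ ‖ξ‖ ∧ ‖ξ‖ ≤ 8 / 3}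
  sum_eq_one : ∀ ξ : Sp d, ξ ≠ 0 → HasSum (fun j : ℤ => toFun ((2 : ℝ) ^ (-j) • ξ)) 1

/-- For a symbol `m`, the symbol `m(ξ) φ(2^{-j} ξ)` of `m(D) Δ̇_j`. -/
def dyad {d : ℕ} (φ : DyadicCutoff d) (m : Sp d → ℂ) (j : ℤ) : Sp d → ℂ :=
  fun ξ => m ξ * (φ.toFun ((2 : ℝ) ^ (-j) • ξ) : ℂ)

theorem wave_hasCompactSupport {d : ℕ} {m : Sp d → ℂ} (h : HasCompactSupport m) (x : Sp d) :
    HasCompactSupport (fun ξ : Sp d =>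
      Complex.exp (2 * Real.pi * Complex.I * (inner ℝ ξ x : ℝ)) * m ((2 * Real.pi) • ξ)) := by
  have h2 : HasCompactSupport (fun ξ : Sp d => m ((2 * Real.pi) • ξ)) :=
    h.comp_homeomorph (Homeomorph.smulOfNeZero (2 * Real.pi) (by positivity))
  exact h2.mul_left

theorem wave_contDiff {d : ℕ} {m : Sp d → ℂ} (h : ContDiff ℝ ∞ m) (x : Sp d) :
    ContDiff ℝ ∞ (fun ξ : Sp d =>
      Complex.exp (2 * Real.pi * Complex.I * (inner ℝ ξ x : ℝ)) * m ((2 * Real.pi) • ξ)) := by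
  have h1 : ContDiff ℝ ∞ (fun ξ : Sp d => ((inner ℝ ξ x : ℝ) : ℂ)) :=
    Complex.ofRealCLM.contDiff.comp (contDiff_id.inner ℝ contDiff_const)
  exact ((contDiff_const.mul h1).cexp).mul (h.comp (contDiff_const_smul _))

open Classical in
/-- The function `m(D)u` for a tempered distribution `u` and a smooth compactly supported symbol
`m`: its value at `x` is `⟨𝓕 u, ξ ↦ e^{2π i x·ξ} m(2πξ)⟩`.  (Only such symbols are used.) -/
def distMult {d : ℕ} (m : Sp d → ℂ) (u : 𝓢'(Sp d, ℂ)) (x : Sp d) : ℂ :=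
  if h : HasCompactSupport m ∧ ContDiff ℝ ∞ m then
    (𝓕 u) ((wave_hasCompactSupport h.1 x).toSchwartzMap (wave_contDiff h.2 x))
  else 0

/-- The function `m(D)g` for a function `g`: convolution with the kernel `𝓕⁻¹(m(2π·))`. -/
def funMult {d : ℕ} (m : Sp d → ℂ) (g : Sp d → ℂ) (x : Sp d) : ℂ :=
  ∫ y, 𝓕⁻ (fun ξ : Sp d => m ((2 * Real.pi) • ξ)) (x - y) * g y

/-- The symbol `1`. -/
def symOne {d : ℕ} : Sp d → ℂ := fun _ => 1

/-- The symbol `|ξ|` of `|D|`. -/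
def symAbs {d : ℕ} : Sp d → ℂ := fun ξ => (‖ξ‖ : ℂ)

/-- The symbol `e^{-t|ξ|}` of `e^{-t|D|}`. -/
def symP {d : ℕ} (t : ℝ) : Sp d → ℂ := fun ξ => (Real.exp (-t * ‖ξ‖) : ℂ)

/-- The symbol `|ξ| e^{-t|ξ|}` of `e^{-t|D|}|D|`. -/
def symAbsP {d : ℕ} (t : ℝ) : Sp d → ℂ := fun ξ => symAbs ξ * symP t ξ

/-- The symbol `i ξ_k e^{-t|ξ|}` of `e^{-t|D|} ∂_k`. -/
def symPartialP {d : ℕ} (k : Fin d) (t : ℝ) : Sp d → ℂ :=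
  fun ξ => Complex.I * (ξ k : ℂ) * symP t ξ

/-! ### Besov norms -/

/-- `∑_{j ∈ ℤ} 2^{sj} ‖b_j‖_{L^∞(ℝᵈ)}`. -/
def besovSum {d : ℕ} (s : ℝ) (b : ℤ → Sp d → ℂ) : ℝ≥0∞ :=
  ∑' j : ℤ, (2 : ℝ≥0∞) ^ (s * (j : ℝ)) * eLpNorm (b j) ⊤ volume

/-- The norm `‖u‖` in `Ḃ^s_{∞,1}` of (the class modulo polynomials of) a tempered distribution. -/
def besov {d : ℕ} (φ : DyadicCutoff d) (s : ℝ) (u : 𝓢'(Sp d, ℂ)) : ℝ≥0∞ :=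
  besovSum s (fun j => distMult (dyad φ symOne j) u)

/-- The norm `‖|D|u‖` in `Ḃ^s_{∞,1}` for a tempered distribution `u`. -/
def besovAbsD {d : ℕ} (φ : DyadicCutoff d) (s : ℝ) (u : 𝓢'(Sp d, ℂ)) : ℝ≥0∞ :=
  besovSum s (fun j => distMult (dyad φ symAbs j) u)

/-- The norm `‖g‖` in `Ḃ^s_{∞,1}` of a function `g`. -/
def besovFun {d : ℕ} (φ : DyadicCutoff d) (s : ℝ) (g : Sp d → ℂ) : ℝ≥0∞ :=
  besovSum s (fun j => funMult (dyad φ symOne j) g)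

/-- `∑_{j ∈ ℤ} 2^{j} ‖b_j‖_{L^1(J; L^∞(ℝᵈ))}`, `J = (-∞, 0)`: if `b_j = Δ̇_j g` this is the
Chemin-Lerner norm of `g` in `L̃^1(J; Ḃ^1_{∞,1})`. -/
def cheminLernerOne {d : ℕ} (b : ℤ → Sp d → ℝ → ℂ) : ℝ≥0∞ :=
  ∑' j : ℤ, (2 : ℝ≥0∞) ^ (j : ℝ) *
    ∫⁻ z in Iio (0 : ℝ), eLpNorm (fun x => b j x z) ⊤ volume

/-- The norm in `L^∞(J; L^∞(ℝᵈ))`, `J = (-∞, 0)`. -/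
def supNorm {d : ℕ} (g : Sp d → ℝ → ℂ) : ℝ≥0∞ :=
  eLpNorm (fun p : Sp d × ℝ => g p.1 p.2) ⊤ (volume.restrict (univ ×ˢ Iio (0 : ℝ)))

/-- A tempered distribution is real if it is real on real test functions. -/
def IsRealDist {d : ℕ} (u : 𝓢'(Sp d, ℂ)) : Prop :=
  ∀ g : 𝓢(Sp d, ℂ), (∀ x, (g x).im = 0) → (u g).im = 0

/-- `u` is a real element of `Ḃ^1_{∞,1} ∩ Ḃ^{r+1}_{∞,1}`. -/
def MemData {d : ℕ} (φ : DyadicCutoff d) (r : ℝ) (u : 𝓢'(Sp d, ℂ)) : Prop :=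
  IsRealDist u ∧ besov φ 1 u < ⊤ ∧ besov φ (r + 1) u < ⊤

/-! ### The space `𝒱_*` -/

/-- `∂_z v (x, z)`. -/
def dz {d : ℕ} (v : Sp d → ℝ → ℝ) (x : Sp d) (z : ℝ) : ℂ :=
  ((deriv (fun s => v x s) z : ℝ) : ℂ)

/-- `∂_k v (x, z)`, the partial derivative in the `k`-th horizontal variable. -/
def dx {d : ℕ} (v : Sp d → ℝ → ℝ) (k : Fin d) (x : Sp d) (z : ℝ) : ℂ :=
  ((lineDeriv ℝ (fun y => v y z) x (EuclideanSpace.single k 1) : ℝ) : ℂ)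

/-- `Δ̇_j |D_x| v (x, z)`. -/
def absDBlock {d : ℕ} (φ : DyadicCutoff d) (v : Sp d → ℝ → ℝ) (j : ℤ) (x : Sp d) (z : ℝ) : ℂ :=
  funMult (dyad φ symAbs j) (fun y => (v y z : ℂ)) x

/-- `v` belongs to `𝒱_*`: `(|D_x| v, ∂_z v) ∈ X_*(J) = L^∞(J; L^∞) ∩ L̃^1(J; Ḃ^1_{∞,1})`.
Such `v` are Lipschitz: `∂_z v` is bounded by definition, and the `L̃^1(J; Ḃ^1_{∞,1})` bounds on
`|D_x| v` and `∂_z v` put `|D_x| v`, hence `∇_x v`, in `L̃^∞(J; Ḃ^0_{∞,1}) ⊂ L^∞`.  Derivatives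
of `v` therefore exist almost everywhere and are its distributional derivatives.  The same bounds
make the series `|D_x| v = ∑_j Δ̇_j |D_x| v` converge absolutely. -/
structure MemVStar {d : ℕ} (φ : DyadicCutoff d) (v : Sp d → ℝ → ℝ) : Prop where
  lipschitz : ∃ K : ℝ≥0,
    LipschitzOnWith K (fun p : Sp d × ℝ => v p.1 p.2) (univ ×ˢ Iio (0 : ℝ))
  absD_sup : supNorm (fun x z => ∑' j : ℤ, absDBlock φ v j x z) < ⊤
  absD_cl : cheminLernerOne (absDBlock φ v) < ⊤
  dz_sup : supNorm (dz v) < ⊤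
  dz_cl : cheminLernerOne
    (fun j x z => funMult (dyad φ symOne j) (fun y => dz v y z) x) < ⊤

/-! ### The fixed-point problem and the operator `R⁻(η)` -/

/-- `∂_k H (x, z)` for `H(x, z) = e^{z|D|} η(x)`, `z < 0`. -/
def dxH {d : ℕ} (φ : DyadicCutoff d) (η : 𝓢'(Sp d, ℂ)) (k : Fin d) (x : Sp d) (z : ℝ) : ℂ :=
  ∑' j : ℤ, distMult (dyad φ (symPartialP k (-z)) j) η x

/-- `|D_x| H (x, z)` for `H(x, z) = e^{z|D|} η(x)`, `z < 0`. -/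
def absDH {d : ℕ} (φ : DyadicCutoff d) (η : 𝓢'(Sp d, ℂ)) (x : Sp d) (z : ℝ) : ℂ :=
  ∑' j : ℤ, distMult (dyad φ (symAbsP (-z)) j) η x

/-- `Q_a[v] = ∇_x H · ∇_x v - (|∇_x H|² - |D_x|H) / (1 + |D_x|H) ∂_z v`. -/
def Qa {d : ℕ} (φ : DyadicCutoff d) (η : 𝓢'(Sp d, ℂ)) (v : Sp d → ℝ → ℝ)
    (x : Sp d) (z : ℝ) : ℂ :=
  (∑ k : Fin d, dxH φ η k x z * dx v k x z) -
    ((∑ k : Fin d, dxH φ η k x z ^ 2) - absDH φ η x z) / (1 + absDH φ η x z) * dz v x z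

/-- The `k`-th component of the vector field `∇_x H ∂_z v - |D_x|H ∇_x v`; thus
`|D_x| Q_b[v] = div_x` of this field, where `Q_b[v] = |D_x|^{-1} div_x` of it. -/
def fluxB {d : ℕ} (φ : DyadicCutoff d) (η : 𝓢'(Sp d, ℂ)) (v : Sp d → ℝ → ℝ) (k : Fin d)
    (x : Sp d) (z : ℝ) : ℂ :=
  dxH φ η k x z * dz v x z - absDH φ η x z * dx v k x z

/-- `w(x, s) = ∫_{-∞}^s e^{-(s-τ)|D|} |D| (Q_b[v] - Q_a[v])(x, τ) dτ`, where
`e^{-t|D|}|D| Q_b[v]` is `e^{-t|D|} div_x` of the field `fluxB`. -/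
def wInt {d : ℕ} (φ : DyadicCutoff d) (η : 𝓢'(Sp d, ℂ)) (v : Sp d → ℝ → ℝ)
    (x : Sp d) (s : ℝ) : ℂ :=
  ∫ τ in Iio s,
    ((∑ k : Fin d, funMult (symPartialP k (s - τ)) (fun y => fluxB φ η v k y τ) x) -
      funMult (symAbsP (s - τ)) (fun y => Qa φ η v y τ) x)

/-- `e^{z|D|} f (x)`, `z < 0`.  For `f ∈ Ḃ^1_{∞,1}` this is determined up to an additive constant
(independent of `x` and `z`), which is fixed here by subtracting `Δ̇_j f(0)` from each block. -/
def heatExt {d : ℕ} (φ : DyadicCutoff d) (f : 𝓢'(Sp d, ℂ)) (x : Sp d) (z : ℝ) : ℂ :=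
  ∑' j : ℤ, (distMult (dyad φ (symP (-z)) j) f x - distMult (dyad φ symOne j) f 0)

/-- The operator `𝒯`:
`𝒯[v](x, z) = e^{z|D|} f(x) + ∫_0^z e^{(z-z')|D|} Q_a[v](x, z') dz'`
`+ ∫_0^z e^{(z-z')|D|} ∫_{-∞}^{z'} e^{-(z'-τ)|D|} |D| (Q_b[v] - Q_a[v])(x, τ) dτ dz'`. -/
def opT {d : ℕ} (φ : DyadicCutoff d) (η f : 𝓢'(Sp d, ℂ)) (v : Sp d → ℝ → ℝ)
    (x : Sp d) (z : ℝ) : ℂ :=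
  heatExt φ f x z
    + (∫ z' in (0 : ℝ)..z, funMult (symP (z' - z)) (fun y => Qa φ η v y z') x)
    + ∫ z' in (0 : ℝ)..z, funMult (symP (z' - z)) (fun y => wInt φ η v y z') x

/-- `v ∈ 𝒱_*` is a fixed point of `𝒯`; elements of `𝒱_*` are taken modulo constants. -/
def IsFixedPt {d : ℕ} (φ : DyadicCutoff d) (η f : 𝓢'(Sp d, ℂ)) (v : Sp d → ℝ → ℝ) : Prop :=
  MemVStar φ v ∧
    ∃ c : ℝ, ∀ (x : Sp d) (z : ℝ), z < 0 → (v x z : ℂ) = opT φ η f v x z + (c : ℂ)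

/-- `𝒯` has a fixed point in `𝒱_*`, unique modulo constants. -/
def UniqueFixedPt {d : ℕ} (φ : DyadicCutoff d) (η f : 𝓢'(Sp d, ℂ)) : Prop :=
  (∃ v, IsFixedPt φ η f v) ∧
    ∀ v v', IsFixedPt φ η f v → IsFixedPt φ η f v' →
      ∃ c : ℝ, ∀ (x : Sp d) (z : ℝ), z < 0 → v x z = v' x z + c

open Classical in
/-- `R⁻(η)f = ∫_{-∞}^0 e^{τ|D|} |D| (Q_b[v] - Q_a[v])(·, τ) dτ`, where `v` is the fixed point of
`𝒯` in `𝒱_*` (the value does not change when a constant is added to `v`). -/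
def Rminus {d : ℕ} (φ : DyadicCutoff d) (η f : 𝓢'(Sp d, ℂ)) : Sp d → ℂ :=
  if h : ∃ v, IsFixedPt φ η f v then fun x => wInt φ η h.choose x 0 else 0

end MuskatDN

end

noncomputable section

namespace MuskatDN

/-! ### Kernels of Fourier multipliers -/

/-! The problem is moved to the gradient V = (∂_z v, ∇_x v), a field indexed by `Option (Fin d)`
with `none` for the vertical direction. Both Q_a[v] and the vector field whose divergence is
|D|Q_b[v] are linear in V: together they form G = M V, where the matrix M is `coefMat φ η`. Put w(s)
= ∫_{-∞}^s e^{-(s-τ)|D|}(div G' - |D|G_0) dτ and h = G_0 + w. Then 𝒯[v] is e^{z|D|}f plus the heat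
integral ∫_0^z e^{(z-z')|D|} h dz', whose vertical derivative is h - ∫_z^0 |D|e^{-(τ-z)|D|} h dτ and
whose k-th horizontal derivative is -∫_z^0 ∂_k e^{-(τ-z)|D|} h dτ. This pair is `gradOp G`. Hence v
is a fixed point exactly when V = V_f + `gradOp` (M V), with V_f = (|D|, ∇)e^{z|D|}f, and V
determines v up to a constant. Moreover R⁻(η)f is w at time 0, that is `duhDiv` of M V.

Three estimates carry the argument. (1) The kernel of |D|e^{-t|D|} or ∂_k e^{-t|D|}, restricted to
frequencies of size 2^j, has L¹ norm at most a constant times 2^j e^{-2^j t/8}. The weight is at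
most 2^j, so a Duhamel integral maps L̃¹(Ḃ^{1+r}) to Ḃ^r at each time. Its integral in time is
independent of j, so the same integral maps L̃¹(Ḃ^s) to itself. Consequently `gradOp` is bounded on
L^∞ ∩ L̃¹(Ḃ¹), and on each L̃¹(Ḃ^s) with one constant (`supF_gradOp_le`, `besF_gradOp_le`). (2) For
s > 0 products are tame: the L̃¹(Ḃ^s) norm of gh is controlled by the L̃¹(Ḃ^s) norm of one factor
times the sup norm of the other (`Bes_mul_le`). (3) The harmonic extension gains one derivative in
L¹ of time, so the coefficients are bounded in sup norm by the Ḃ⁰ norm of |D|η and in L̃¹(Ḃ^{1+r})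
by its Ḃ^r norm. Quotients and differences of coefficients inherit such bounds (`Tame`).

If the Ḃ⁰ norm of |D|η is small, V ↦ `gradOp` (M V) contracts by 1/2 on L^∞ ∩ L̃¹(Ḃ¹). The Neumann
series `solve` gives the unique gradient, and hence existence and uniqueness of v. At regularity 1 +
r only the sup norm of M multiplies the L̃¹(Ḃ^{1+r}) norm of V, and the high norm of M multiplies a
quantity already summed; so no smallness of the Ḃ^r norm of |D|η is needed.

For two interfaces put N = M_1 - M_2. The difference U = V_1 - V_2 solves U = `gradOp` (N V_2) +
`gradOp` (M_1 U), and the two fields differ by M_1 U + N V_2. The tame estimates leave three cases: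
the r extra derivatives fall on the interfaces, on f, or on η_δ. These are the three terms of the
conclusion.

The rest of the work makes these formulas rigorous for functions that are merely bounded and
measurable. Multipliers act on bounded functions by convolution with integrable kernels.
Distributions enter only through their dyadic blocks. Derivatives appear in integrated form, and
vertical derivatives are identified on almost every slice. -/

section Kernels

variable {d : ℕ}

/-- The convolution kernel of the multiplier `m(D)`. -/
def ker (m : Sp d → ℂ) : Sp d → ℂ := 𝓕⁻ (fun ξ => m ((2 * Real.pi) • ξ))

/-- The `L¹` norm of the kernel of `m(D)`. -/
def kn (m : Sp d → ℂ) : ℝ≥0∞ := ∫⁻ y, ‖ker m y‖ₑ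

theorem funMult_eq (m g : Sp d → ℂ) (x : Sp d) : funMult m g x = ∫ y, ker m (x - y) * g y := rfl

theorem ker_apply (m : Sp d → ℂ) (y : Sp d) :
    ker m y = ∫ ξ : Sp d, Complex.exp (2 * Real.pi * Complex.I * (inner ℝ ξ y : ℝ)) *
      m ((2 * Real.pi) • ξ) := by
  simp only [ker, Real.fourierInv_eq', smul_eq_mul]
  congr 1; ext ξ; congr 2; push_cast; ring

theorem integrable_comp_two_pi_smul {m : Sp d → ℂ} (h : Integrable m) :
    Integrable (fun ξ : Sp d => m ((2 * Real.pi) • ξ)) :=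
  (integrable_comp_smul_iff volume m (by positivity)).2 h

theorem norm_wave (ξ y : Sp d) :
    ‖Complex.exp (2 * Real.pi * Complex.I * (inner ℝ ξ y : ℝ))‖ = 1 := by
  rw [show (2 * Real.pi * Complex.I * (inner ℝ ξ y : ℝ) : ℂ)
    = ((2 * Real.pi * inner ℝ ξ y : ℝ) : ℂ) * Complex.I by push_cast; ring,
    Complex.norm_exp_ofReal_mul_I]

theorem integrable_wave_mul {m : Sp d → ℂ} (h : Integrable m) (y : Sp d) :
    Integrable (fun ξ : Sp d => Complex.exp (2 * Real.pi * Complex.I * (inner ℝ ξ y : ℝ)) *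
      m ((2 * Real.pi) • ξ)) :=
  (integrable_comp_two_pi_smul h).bdd_mul (c := 1)
    (by fun_prop) (.of_forall fun ξ => (norm_wave ξ y).le)

theorem norm_ker_le (m : Sp d → ℂ) (y : Sp d) :
    ‖ker m y‖ ≤ ∫ ξ : Sp d, ‖m ((2 * Real.pi) • ξ)‖ := by
  rw [ker_apply]
  refine (norm_integral_le_integral_norm _).trans_eq ?_
  congr 1; ext ξ
  rw [norm_mul, norm_wave, one_mul]

theorem continuous_ker {m : Sp d → ℂ} (h : Integrable m) : Continuous (ker m) := by
  have h2 : Continuous (𝓕 (fun ξ : Sp d => m ((2 * Real.pi) • ξ))) :=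
    VectorFourier.fourierIntegral_continuous Real.continuous_fourierChar
      (by exact continuous_inner) (integrable_comp_two_pi_smul h)
  have : ker m = fun y => 𝓕 (fun ξ : Sp d => m ((2 * Real.pi) • ξ)) (-y) := by
    ext y; rw [ker, Real.fourierInv_eq_fourier_neg]
  rw [this]; exact h2.comp continuous_neg

/-- Continuous integrable symbols with integrable kernel. -/
structure Sym (m : Sp d → ℂ) : Prop where
  cont : Continuous m
  int : Integrable m
  kint : Integrable (ker m)

theorem Sym.fourier_ker {m : Sp d → ℂ} (h : Sym m) :
    𝓕 (ker m) = fun ξ => m ((2 * Real.pi) • ξ) := by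
  refine Continuous.fourier_fourierInv_eq (h.cont.comp (continuous_const_smul _))
    (integrable_comp_two_pi_smul h.int) ?_
  have : 𝓕 (fun ξ : Sp d => m ((2 * Real.pi) • ξ)) = fun y => ker m (-y) := by
    ext y; rw [ker, Real.fourierInv_eq_fourier_neg, neg_neg]
  rw [this]; exact h.kint.comp_neg

theorem Sym.kn_lt_top {m : Sp d → ℂ} (h : Sym m) : kn m < ⊤ := h.kint.2

theorem Sym.integral_ker {m : Sp d → ℂ} (h : Sym m) : ∫ y, ker m y = m 0 := by
  have := congrFun h.fourier_ker 0
  rw [Real.fourier_eq'] at this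
  simpa using this

theorem funMult_enorm_le (m g : Sp d → ℂ) (hm : Continuous (ker m)) (x : Sp d) :
    ‖funMult m g x‖ₑ ≤ kn m * eLpNorm g ⊤ volume := by
  rw [funMult_eq]
  calc ‖∫ y, ker m (x - y) * g y‖ₑ ≤ ∫⁻ y, ‖ker m (x - y) * g y‖ₑ := enorm_integral_le_lintegral_enorm _
    _ ≤ ∫⁻ y, ‖ker m (x - y)‖ₑ * eLpNorm g ⊤ volume := by
        apply lintegral_mono_ae
        filter_upwards [ae_le_eLpNormEssSup (f := g) (μ := volume)] with y hy
        rw [enorm_mul, eLpNorm_exponent_top]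
        gcongr
    _ = (∫⁻ y, ‖ker m (x - y)‖ₑ) * eLpNorm g ⊤ volume := by
        rw [lintegral_mul_const]
        exact (hm.comp (continuous_const.sub continuous_id)).enorm.measurable
    _ = _ := by rw [lintegral_sub_left_eq_self (fun y => ‖ker m y‖ₑ)]; rfl

theorem eLpNorm_funMult_le (m g : Sp d → ℂ) (hm : Continuous (ker m)) :
    eLpNorm (funMult m g) ⊤ volume ≤ kn m * eLpNorm g ⊤ volume := by
  rw [eLpNorm_exponent_top]
  exact eLpNormEssSup_le_of_ae_enorm_bound (.of_forall (funMult_enorm_le m g hm))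

theorem integrable_ker_mul {k g : Sp d → ℂ} (hk : Integrable k)
    (hg : AEStronglyMeasurable g) (hb : eLpNorm g ⊤ volume < ⊤) (x : Sp d) :
    Integrable (fun y => k (x - y) * g y) := by
  refine (hk.comp_sub_left x).mul_bdd (c := (eLpNorm g ⊤ volume).toReal) hg ?_
  filter_upwards [ae_le_eLpNormEssSup (f := g) (μ := volume)] with y hy
  rw [eLpNorm_exponent_top] at *
  rw [← toReal_enorm]
  exact ENNReal.toReal_mono hb.ne hy

/-- Compactly supported continuous kernels are dense in L¹ and g is bounded, so the convolution is a
uniform limit of continuous functions. -/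
theorem continuous_integral_ker_mul {k g : Sp d → ℂ} (hk : Integrable k)
    (hg : AEStronglyMeasurable g) (hb : eLpNorm g ⊤ volume < ⊤) :
    Continuous (fun x => ∫ y, k (x - y) * g y) := by
  have hgl : LocallyIntegrable g volume := by
    have : MemLp g ⊤ volume := ⟨hg, hb⟩
    exact this.locallyIntegrable le_top
  set A : ℝ := (eLpNorm g ⊤ volume).toReal with hA
  have hAb : ∀ᵐ y, ‖g y‖ ≤ A := by
    filter_upwards [ae_le_eLpNormEssSup (f := g) (μ := volume)] with y hy
    rw [hA, ← toReal_enorm]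
    exact ENNReal.toReal_mono hb.ne (by rwa [eLpNorm_exponent_top])
  have hA0 : 0 ≤ A := ENNReal.toReal_nonneg
  have happ : ∀ n : ℕ, ∃ kk : Sp d → ℂ, HasCompactSupport kk ∧ Continuous kk ∧ Integrable kk ∧
      ∫ y, ‖k y - kk y‖ ≤ 1 / (n + 1 : ℝ) := by
    intro n
    obtain ⟨kk, h1, h2, h3, h4⟩ := hk.exists_hasCompactSupport_integral_sub_le
      (ε := 1 / (n + 1 : ℝ)) (by positivity)
    exact ⟨kk, h1, h3, h4, h2⟩
  choose kk hc hcont hint happ using happ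
  have hunif : TendstoUniformly (fun (n : ℕ) x => ∫ y, kk n (x - y) * g y)
      (fun x => ∫ y, k (x - y) * g y) Filter.atTop := by
    rw [Metric.tendstoUniformly_iff]
    intro ε hε
    have hlim : Filter.Tendsto (fun n : ℕ => 1 / ((n : ℝ) + 1) * A) Filter.atTop (nhds 0) := by
      simpa using (tendsto_one_div_add_atTop_nhds_zero_nat (𝕜 := ℝ)).mul_const A
    filter_upwards [hlim.eventually (gt_mem_nhds hε)] with n hn x
    refine lt_of_le_of_lt ?_ hn
    rw [dist_eq_norm, ← integral_sub (integrable_ker_mul hk hg hb x)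
      (integrable_ker_mul (hint n) hg hb x)]
    calc ‖∫ y, (k (x - y) * g y - kk n (x - y) * g y)‖
        ≤ ∫ y, ‖k (x - y) - kk n (x - y)‖ * A := by
          apply norm_integral_le_of_norm_le
          · exact ((hk.sub (hint n)).norm.comp_sub_left x).mul_const A
          · filter_upwards [hAb] with y hy
            rw [← sub_mul, norm_mul]; gcongr
      _ = (∫ y, ‖k y - kk n y‖) * A := by
          rw [integral_mul_const, integral_sub_left_eq_self (fun y => ‖k y - kk n y‖)]
      _ ≤ _ := by gcongr; exact happ n
  refine hunif.continuous (Filter.Frequently.of_forall fun n => ?_)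
  have := (hc n).continuous_convolution_left (ContinuousLinearMap.mul ℝ ℂ) (μ := volume)
    (hcont n) hgl
  convert this using 2 with x
  rw [← convolution_flip, MeasureTheory.convolution]
  simp [mul_comm]

theorem continuous_funMult {m g : Sp d → ℂ} (hk : Integrable (ker m))
    (hg : AEStronglyMeasurable g) (hb : eLpNorm g ⊤ volume < ⊤) : Continuous (funMult m g) :=
  continuous_integral_ker_mul hk hg hb

theorem eLpNorm_ker_lt_top {m : Sp d → ℂ} : eLpNorm (ker m) ⊤ volume < ⊤ := by
  refine lt_of_le_of_lt (eLpNormEssSup_le_of_ae_bound (C := ∫ ξ : Sp d, ‖m ((2 * Real.pi) • ξ)‖)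
    (.of_forall fun y => norm_ker_le m y)) ENNReal.ofReal_lt_top

theorem Sym.norm_le {m : Sp d → ℂ} (h : Sym m) (ξ : Sp d) : ‖m ξ‖ ≤ ∫ y, ‖ker m y‖ := by
  have := congrFun h.fourier_ker ((2 * Real.pi)⁻¹ • ξ)
  simp only [smul_smul] at this
  rw [mul_inv_cancel₀ (by positivity), one_smul] at this
  rw [← this]
  exact VectorFourier.norm_fourierIntegral_le_integral_norm _ _ _ _ _

/-- The convolution of the two kernels is continuous and integrable, and its Fourier transform, the
product of the symbols, is integrable. Fourier inversion therefore holds at every point, not only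
almost everywhere. -/
theorem Sym.ker_mul {m₁ m₂ : Sp d → ℂ} (h₁ : Sym m₁) (h₂ : Sym m₂) (x : Sp d) :
    ker (fun ξ => m₁ ξ * m₂ ξ) x = ∫ y, ker m₁ (x - y) * ker m₂ y := by
  have hcont := continuous_integral_ker_mul h₁.kint h₂.kint.1 eLpNorm_ker_lt_top
  have hconv : convolution (ker m₂) (ker m₁) (ContinuousLinearMap.mul ℂ ℂ) volume
      = fun x => ∫ y, ker m₁ (x - y) * ker m₂ y := by
    ext x; rw [MeasureTheory.convolution]; congr 1; ext y; simp [mul_comm]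
  have hF := Real.fourier_mul_convolution_eq (R := ℂ) h₂.kint h₁.kint
  have hint := h₂.kint.integrable_convolution (ContinuousLinearMap.mul ℂ ℂ) h₁.kint
  rw [hconv] at hF hint
  have hF' : 𝓕 (fun x => ∫ y, ker m₁ (x - y) * ker m₂ y) =
      fun ξ => m₁ ((2 * Real.pi) • ξ) * m₂ ((2 * Real.pi) • ξ) := by
    ext ξ; rw [hF, h₁.fourier_ker, h₂.fourier_ker, mul_comm]
  have hI : Integrable (fun ξ : Sp d => m₁ ((2 * Real.pi) • ξ) * m₂ ((2 * Real.pi) • ξ)) :=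
    (integrable_comp_two_pi_smul h₂.int).bdd_mul
      (h₁.cont.comp (continuous_const_smul _)).aestronglyMeasurable (.of_forall fun ξ => h₁.norm_le _)
  have := hcont.fourierInv_fourier_eq hint (by rw [hF']; exact hI)
  rw [hF'] at this
  exact congrFun this x

theorem funMult_funMult {m₁ m₂ g : Sp d → ℂ} (h₁ : Sym m₁) (h₂ : Sym m₂)
    (hg : AEStronglyMeasurable g) (hb : eLpNorm g ⊤ volume < ⊤) (x : Sp d) :
    funMult m₁ (funMult m₂ g) x = funMult (fun ξ => m₁ ξ * m₂ ξ) g x := by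
  simp only [funMult_eq]
  have hI : Integrable (fun p : Sp d × Sp d => ker m₁ (x - p.2) * ker m₂ (p.2 - p.1) * g p.1)
      (volume.prod volume) := by
    have h := (h₁.kint.comp_sub_left x).convolution_integrand (ContinuousLinearMap.mul ℂ ℂ)
      (h₂.kint.comp_neg)
    simp only [ContinuousLinearMap.mul_apply', neg_sub] at h
    refine h.mul_bdd (c := (eLpNorm g ⊤ volume).toReal) hg.comp_fst ?_
    have : ∀ᵐ y, ‖g y‖ ≤ (eLpNorm g ⊤ volume).toReal := by
      filter_upwards [ae_le_eLpNormEssSup (f := g) (μ := volume)] with y hy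
      rw [← toReal_enorm]
      exact ENNReal.toReal_mono hb.ne (by rwa [eLpNorm_exponent_top])
    exact Measure.quasiMeasurePreserving_fst.ae this
  calc ∫ u, ker m₁ (x - u) * ∫ y, ker m₂ (u - y) * g y
      = ∫ u, ∫ y, ker m₁ (x - u) * ker m₂ (u - y) * g y := by
        congr 1; ext u; rw [← integral_const_mul]; congr 1; ext y; ring
    _ = ∫ y, ∫ u, ker m₁ (x - u) * ker m₂ (u - y) * g y := by
        rw [integral_integral_swap]; exact hI.swap
    _ = ∫ y, ker (fun ξ => m₁ ξ * m₂ ξ) (x - y) * g y := by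
        congr 1; ext y
        rw [integral_mul_const, h₁.ker_mul h₂]
        congr 1
        rw [← integral_add_right_eq_self _ y]
        congr 1; ext u; congr 2 <;> abel_nf

theorem ker_add {m₁ m₂ : Sp d → ℂ} (h₁ : Integrable m₁) (h₂ : Integrable m₂) :
    ker (fun ξ => m₁ ξ + m₂ ξ) = fun y => ker m₁ y + ker m₂ y := by
  ext y
  simp only [ker_apply, mul_add]
  exact integral_add (integrable_wave_mul h₁ y) (integrable_wave_mul h₂ y)

theorem ker_const_mul (c : ℂ) (m : Sp d → ℂ) :
    ker (fun ξ => c * m ξ) = fun y => c * ker m y := by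
  ext y
  simp only [ker_apply]
  rw [← integral_const_mul]
  congr 1; ext ξ; ring

theorem Sym.add {m₁ m₂ : Sp d → ℂ} (h₁ : Sym m₁) (h₂ : Sym m₂) :
    Sym (fun ξ => m₁ ξ + m₂ ξ) where
  cont := h₁.cont.add h₂.cont
  int := h₁.int.add h₂.int
  kint := by rw [ker_add h₁.int h₂.int]; exact h₁.kint.add h₂.kint

theorem Sym.zero : Sym (fun _ : Sp d => (0 : ℂ)) := by
  have : ker (fun _ : Sp d => (0 : ℂ)) = fun _ => 0 := by
    ext y; simp [ker_apply]
  exact ⟨continuous_const, integrable_zero _ _ _, by rw [this]; exact integrable_zero _ _ _⟩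

theorem Sym.sum {ι : Type*} (s : Finset ι) {m : ι → Sp d → ℂ} (h : ∀ i ∈ s, Sym (m i)) :
    Sym (fun ξ => ∑ i ∈ s, m i ξ) := by
  classical
  induction s using Finset.induction_on with
  | empty => simpa using Sym.zero
  | insert a s ha ih =>
    simp only [Finset.sum_insert ha]
    exact (h a (by simp)).add (ih fun i hi => h i (by simp [hi]))

theorem ker_sum {ι : Type*} (s : Finset ι) {m : ι → Sp d → ℂ} (h : ∀ i ∈ s, Sym (m i)) :
    ker (fun ξ => ∑ i ∈ s, m i ξ) = fun y => ∑ i ∈ s, ker (m i) y := by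
  classical
  induction s using Finset.induction_on with
  | empty => ext y; simp [ker_apply]
  | insert a s ha ih =>
    simp only [Finset.sum_insert ha]
    rw [ker_add (h a (by simp)).int (Sym.sum s fun i hi => h i (by simp [hi])).int,
      ih fun i hi => h i (by simp [hi])]

theorem funMult_symbol_sum {ι : Type*} (s : Finset ι) {m : ι → Sp d → ℂ} {g : Sp d → ℂ}
    (h : ∀ i ∈ s, Sym (m i)) (hg : AEStronglyMeasurable g) (hb : eLpNorm g ⊤ volume < ⊤)
    (x : Sp d) : funMult (fun ξ => ∑ i ∈ s, m i ξ) g x = ∑ i ∈ s, funMult (m i) g x := by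
  simp only [funMult_eq, ker_sum s h, Finset.sum_mul]
  exact integral_finsetSum _ fun i hi => integrable_ker_mul (h i hi).kint hg hb x

theorem funMult_symbol_add {m₁ m₂ : Sp d → ℂ} {g : Sp d → ℂ} (h₁ : Sym m₁) (h₂ : Sym m₂)
    (hg : AEStronglyMeasurable g) (hb : eLpNorm g ⊤ volume < ⊤) (x : Sp d) :
    funMult (fun ξ => m₁ ξ + m₂ ξ) g x = funMult m₁ g x + funMult m₂ g x := by
  simp only [funMult_eq, ker_add h₁.int h₂.int, add_mul]
  exact integral_add (integrable_ker_mul h₁.kint hg hb x) (integrable_ker_mul h₂.kint hg hb x)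

theorem funMult_add {m g h : Sp d → ℂ} (hm : Integrable (ker m)) (hg : AEStronglyMeasurable g)
    (hgb : eLpNorm g ⊤ volume < ⊤) (hh : AEStronglyMeasurable h) (hhb : eLpNorm h ⊤ volume < ⊤)
    (x : Sp d) : funMult m (fun y => g y + h y) x = funMult m g x + funMult m h x := by
  simp only [funMult_eq, mul_add]
  exact integral_add (integrable_ker_mul hm hg hgb x) (integrable_ker_mul hm hh hhb x)

theorem funMult_const_mul (c : ℂ) (m g : Sp d → ℂ) (x : Sp d) :
    funMult m (fun y => c * g y) x = c * funMult m g x := by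
  simp only [funMult_eq, ← integral_const_mul]
  congr 1; ext y; ring

theorem funMult_congr {g h : Sp d → ℂ} (m : Sp d → ℂ) (hgh : ∀ᵐ x, g x = h x) :
    funMult m g = funMult m h := by
  ext x
  simp only [funMult_eq]
  refine integral_congr_ae ?_
  filter_upwards [hgh] with y hy
  rw [hy]

theorem ker_comp_smul (m : Sp d → ℂ) {c : ℝ} (hc : 0 < c) (y : Sp d) :
    ker (fun ξ => m (c • ξ)) y = ((c ^ d)⁻¹ : ℝ) * ker m (c⁻¹ • y) := by
  simp only [ker_apply]
  have h := Measure.integral_comp_smul (volume : Measure (Sp d)) (fun ξ : Sp d =>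
    Complex.exp (2 * Real.pi * Complex.I * (inner ℝ ξ (c⁻¹ • y) : ℝ)) * m ((2 * Real.pi) • ξ)) c
  rw [finrank_euclideanSpace, Fintype.card_fin] at h
  rw [abs_of_pos (by positivity)] at h
  rw [← Complex.real_smul, ← h]
  congr 1; ext ξ
  simp only [inner_smul_left, inner_smul_right, smul_smul]
  congr 2
  · congr 2; simp; field_simp
  · ring_nf

/-- Dilating a symbol dilates its kernel with the L¹ normalisation. This reduces every dyadic kernel
bound to a single annulus. -/
theorem kn_comp_smul (m : Sp d → ℂ) {c : ℝ} (hc : 0 < c) : kn (fun ξ => m (c • ξ)) = kn m := by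
  have hmap := Measure.map_addHaar_smul (volume : Measure (Sp d)) (r := c⁻¹) (by positivity)
  have h := lintegral_map_equiv (μ := (volume : Measure (Sp d))) (fun y => ‖ker m y‖ₑ)
    (MeasurableEquiv.smul₀ c⁻¹ (by positivity))
  have hcoe : (⇑(MeasurableEquiv.smul₀ c⁻¹ (by positivity)) : Sp d → Sp d) = (c⁻¹ • ·) := rfl
  rw [hcoe, hmap, lintegral_smul_measure, finrank_euclideanSpace, Fintype.card_fin] at h
  simp only [kn, ker_comp_smul m hc, enorm_mul]
  rw [lintegral_const_mul' _ _ enorm_ne_top, ← h, smul_eq_mul, ← mul_assoc]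
  have : ‖(((c ^ d)⁻¹ : ℝ) : ℂ)‖ₑ * ENNReal.ofReal |((c⁻¹ ^ d)⁻¹ : ℝ)| = 1 := by
    rw [← ofReal_norm, Complex.norm_real, Real.norm_eq_abs, ← ENNReal.ofReal_mul (abs_nonneg _),
      ← abs_mul]
    rw [inv_pow, inv_inv, inv_mul_cancel₀ (by positivity)]
    simp
  rw [this, one_mul]

theorem Sym.comp_smul {m : Sp d → ℂ} (h : Sym m) {c : ℝ} (hc : 0 < c) :
    Sym (fun ξ => m (c • ξ)) where
  cont := h.cont.comp (continuous_const_smul _)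
  int := (integrable_comp_smul_iff volume m hc.ne').2 h.int
  kint := by
    have : ker (fun ξ => m (c • ξ)) = fun y => ((c ^ d)⁻¹ : ℝ) * ker m (c⁻¹ • y) := by
      ext y; exact ker_comp_smul m hc y
    rw [this]
    exact ((integrable_comp_smul_iff volume (ker m) (by positivity)).2 h.kint).const_mul _

end Kernels

/-! ### Smooth compactly supported symbols and uniform kernel bounds on annuli -/

section SmoothSymbols

variable {d : ℕ}

/-- Smooth compactly supported symbols. -/
def CcSym (m : Sp d → ℂ) : Prop := HasCompactSupport m ∧ ContDiff ℝ ∞ m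

theorem CcSym.comp_smul {m : Sp d → ℂ} (h : CcSym m) {c : ℝ} (hc : c ≠ 0) :
    CcSym (fun ξ => m (c • ξ)) :=
  ⟨h.1.comp_homeomorph (Homeomorph.smulOfNeZero c hc), h.2.comp (contDiff_const_smul _)⟩

/-- The kernel of a smooth compactly supported symbol, as a Schwartz function. -/
def CcSym.kerS {m : Sp d → ℂ} (h : CcSym m) : 𝓢(Sp d, ℂ) :=
  𝓕⁻ ((h.comp_smul (c := 2 * Real.pi) (by positivity)).1.toSchwartzMap
    (h.comp_smul (c := 2 * Real.pi) (by positivity)).2)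

theorem CcSym.kerS_apply {m : Sp d → ℂ} (h : CcSym m) (y : Sp d) : h.kerS y = ker m y := by
  rw [CcSym.kerS, SchwartzMap.fourierInv_coe]; rfl

theorem CcSym.sym {m : Sp d → ℂ} (h : CcSym m) : Sym m where
  cont := h.2.continuous
  int := h.2.continuous.integrable_of_hasCompactSupport h.1
  kint := by
    have := h.kerS.integrable (μ := volume)
    exact this.congr (.of_forall fun y => h.kerS_apply y)

theorem CcSym.mul_left {m₁ m₂ : Sp d → ℂ} (h₁ : ContDiff ℝ ∞ m₁) (h₂ : CcSym m₂) :
    CcSym (fun ξ => m₁ ξ * m₂ ξ) := ⟨h₂.1.mul_left, h₁.mul h₂.2⟩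

/-- The L¹ norm of the inverse Fourier transform is a continuous seminorm on Schwartz space, hence
dominated by finitely many Schwartz seminorms. Those are bounded on the family, because its
derivatives are jointly continuous on a compact set of parameters and frequencies. -/
theorem exists_kn_le_of_contDiff {F : ℝ × Sp d → ℂ} (hF : ContDiff ℝ ∞ F) {K : Set (Sp d)}
    (hK : IsCompact K) (h0 : ∀ μ ξ, ξ ∉ K → F (μ, ξ) = 0) :
    ∃ C : ℝ≥0, ∀ μ ∈ Icc (0 : ℝ) 1, kn (fun ξ => F (μ, ξ)) ≤ C := by
  have hcc : ∀ μ, CcSym (fun ξ => F (μ, ξ)) := fun μ =>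
    ⟨HasCompactSupport.intro hK fun ξ hξ => h0 μ ξ hξ, hF.comp (contDiff_const.prodMk contDiff_id)⟩
  have h2pi : (2 * Real.pi) ≠ 0 := by positivity
  set q : Seminorm ℝ 𝓢(Sp d, ℂ) := (normSeminorm ℝ (Lp ℂ 1 (volume : Measure (Sp d)))).comp
    (((SchwartzMap.toLpCLM ℝ ℂ 1 (volume : Measure (Sp d))).comp
      (FourierTransform.fourierInvCLM ℝ 𝓢(Sp d, ℂ))).toLinearMap) with hq
  have hqc : Continuous q := by
    rw [hq]
    exact continuous_norm.comp ((SchwartzMap.toLpCLM ℝ ℂ 1 (volume : Measure (Sp d))).comp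
      (FourierTransform.fourierInvCLM ℝ 𝓢(Sp d, ℂ))).continuous
  obtain ⟨s, C, -, hC⟩ := Seminorm.bound_of_continuous (schwartz_withSeminorms ℝ (Sp d) ℂ) q hqc
  set G : ℝ × Sp d → ℂ := fun p => F (p.1, (2 * Real.pi) • p.2) with hG
  have hGs : ContDiff ℝ ∞ G :=
    hF.comp (contDiff_fst.prodMk (contDiff_snd.const_smul _))
  set K' : Set (Sp d) := (fun ξ => (2 * Real.pi)⁻¹ • ξ) '' K with hK'
  have hK'c : IsCompact K' := hK.image (by fun_prop)
  have hG0 : ∀ μ ξ, ξ ∉ K' → G (μ, ξ) = 0 := by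
    intro μ ξ hξ
    refine h0 _ _ fun hmem => hξ ⟨_, hmem, ?_⟩
    simp only [smul_smul]
    rw [inv_mul_cancel₀ h2pi, one_smul]
  let θ : ℝ → 𝓢(Sp d, ℂ) := fun μ => ((hcc μ).comp_smul h2pi).1.toSchwartzMap
    ((hcc μ).comp_smul h2pi).2
  have hθ : ∀ μ ξ, θ μ ξ = G (μ, ξ) := fun μ ξ => rfl
  have hbound : ∀ i : ℕ × ℕ, ∃ M : ℝ, 0 ≤ M ∧ ∀ μ ∈ Icc (0 : ℝ) 1,
      schwartzSeminormFamily ℝ (Sp d) ℂ i (θ μ) ≤ M := by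
    rintro ⟨k, n⟩
    have hcont : Continuous fun p : ℝ × Sp d => ‖p.2‖ ^ k * ‖iteratedFDeriv ℝ n G p‖ :=
      (continuous_snd.norm.pow k).mul
        (hGs.continuous_iteratedFDeriv (m := n) (by exact_mod_cast le_top)).norm
    obtain ⟨M, hM⟩ := (isCompact_Icc.prod hK'c : IsCompact (Icc (0 : ℝ) 1 ×ˢ K')).bddAbove_image
      hcont.continuousOn
    refine ⟨max M 0, le_max_right _ _, fun μ hμ => ?_⟩
    refine SchwartzMap.seminorm_le_bound ℝ k n (θ μ) (le_max_right _ _) fun ξ => ?_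
    by_cases hξ : ξ ∈ K'
    -- Derivatives in ξ alone are derivatives of the joint function restricted along the inclusion ξ
    -- ↦ (0, ξ), which has norm at most one.
    · have hle : ‖iteratedFDeriv ℝ n (θ μ) ξ‖ ≤ ‖iteratedFDeriv ℝ n G (μ, ξ)‖ := by
        have hcomp : (θ μ : Sp d → ℂ) =
            (fun p => G ((μ, 0) + p)) ∘ (ContinuousLinearMap.inr ℝ ℝ (Sp d)) := by
          ext ξ; simp [hθ]
        have hGμ : ContDiff ℝ ∞ (fun p => G ((μ, 0) + p)) := hGs.comp (contDiff_const.add contDiff_id)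
        rw [hcomp, ContinuousLinearMap.iteratedFDeriv_comp_right (n := ∞) _ hGμ _
          (by exact_mod_cast le_top)]
        refine (ContinuousMultilinearMap.norm_compContinuousLinearMap_le _ _).trans ?_
        rw [iteratedFDeriv_comp_add_left]
        simp only [ContinuousLinearMap.inr_apply, Prod.mk_add_mk, add_zero, zero_add]
        refine mul_le_of_le_one_right (norm_nonneg _) ?_
        refine Finset.prod_le_one (fun _ _ => norm_nonneg _) fun _ _ =>
          ContinuousLinearMap.norm_inr_le_one ..
      refine le_trans ?_ (le_max_left M 0)
      refine le_trans ?_ (hM (mem_image_of_mem _ (show (μ, ξ) ∈ Icc (0 : ℝ) 1 ×ˢ K' from ⟨hμ, hξ⟩)))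
      simp only
      gcongr
    · have : iteratedFDeriv ℝ n (θ μ) ξ = 0 := by
        by_contra hne
        have h1 : ξ ∈ tsupport (θ μ) := support_iteratedFDeriv_subset n hne
        have h2 : tsupport (θ μ) ⊆ K' := by
          refine closure_minimal ?_ hK'c.isClosed
          intro ζ hζ
          by_contra hζK
          exact hζ (by rw [hθ]; exact hG0 μ ζ hζK)
        exact hξ (h2 h1)
      rw [this]; simp
  choose M hM0 hM using hbound
  refine ⟨(C * ∑ i ∈ s, (M i).toNNReal : ℝ≥0), fun μ hμ => ?_⟩
  have h1 : q (θ μ) ≤ C * ∑ i ∈ s, M i := by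
    refine (hC (θ μ)).trans ?_
    rw [_root_.smul_apply, NNReal.smul_def, smul_eq_mul]
    gcongr
    refine Seminorm.finset_sup_apply_le (Finset.sum_nonneg fun i _ => hM0 i) fun i hi => ?_
    exact (hM i μ hμ).trans (Finset.single_le_sum (f := M) (fun j _ => hM0 j) hi)
  have h2 : q (θ μ) = ∫ y, ‖ker (fun ξ => F (μ, ξ)) y‖ := by
    have : q (θ μ) = ‖((𝓕⁻ (θ μ) : 𝓢(Sp d, ℂ))).toLp 1 volume‖ := rfl
    rw [this, SchwartzMap.norm_toLp_one]
    congr 1; ext y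
    rw [← (hcc μ).kerS_apply]; rfl
  rw [kn, ← ofReal_integral_norm_eq_lintegral_enorm (hcc μ).sym.kint, ← h2]
  refine (ENNReal.ofReal_le_ofReal h1).trans ?_
  rw [ENNReal.ofReal_le_iff_le_toReal ENNReal.coe_ne_top, ENNReal.coe_toReal, NNReal.coe_mul,
    NNReal.coe_sum]
  simp only [Real.coe_toNNReal _ (hM0 _), le_refl]

/-- Real functions smooth with compact support in `{3/8 ≤ |ξ|}`. -/
structure Annular (ψ : Sp d → ℝ) : Prop where
  smooth : ContDiff ℝ ∞ ψ
  compact : HasCompactSupport ψ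
  support : tsupport ψ ⊆ {ξ | 3 / 8 ≤ ‖ξ‖}

theorem Annular.contDiff_mul {ψ : Sp d → ℝ} (hψ : Annular ψ) {h : ℝ × Sp d → ℂ}
    (hh : ∀ p : ℝ × Sp d, 3 / 8 ≤ ‖p.2‖ → ContDiffAt ℝ ∞ h p) :
    ContDiff ℝ ∞ (fun p : ℝ × Sp d => h p * (ψ p.2 : ℂ)) := by
  rw [contDiff_iff_contDiffAt]
  intro p
  by_cases hp : p.2 ∈ tsupport ψ
  · refine (hh p (hψ.support hp)).mul ?_
    exact (Complex.ofRealCLM.contDiff.comp (hψ.smooth.comp contDiff_snd)).contDiffAt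
  · have h1 : ψ =ᶠ[nhds p.2] 0 := notMem_tsupport_iff_eventuallyEq.1 hp
    have h2 : (fun p : ℝ × Sp d => h p * (ψ p.2 : ℂ)) =ᶠ[nhds p] fun _ => 0 := by
      filter_upwards [continuous_snd.continuousAt.eventually h1] with q hq
      simp [hq]
    exact contDiffAt_const.congr_of_eventuallyEq h2

/-- Symbols smooth away from the origin. -/
def SmoothOff (m : Sp d → ℂ) : Prop := ∀ ξ, ξ ≠ 0 → ContDiffAt ℝ ∞ m ξ

theorem Annular.ccSym {ψ : Sp d → ℝ} (hψ : Annular ψ) {m : Sp d → ℂ} (hm : SmoothOff m) :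
    CcSym (fun ξ => m ξ * (ψ ξ : ℂ)) := by
  have h1 := hψ.contDiff_mul (h := fun p => m p.2) fun p hp =>
    (hm p.2 (by rintro h; rw [h] at hp; norm_num at hp)).comp p contDiffAt_snd
  refine ⟨?_, h1.comp (contDiff_prodMk_right (0 : ℝ))⟩
  have : HasCompactSupport (fun ξ => (ψ ξ : ℂ)) := hψ.compact.comp_left (g := Complex.ofReal) (by simp)
  exact this.mul_left

theorem contDiffAt_norm_sp {ξ : Sp d} (h : ξ ≠ 0) : ContDiffAt ℝ ∞ (fun ξ : Sp d => ‖ξ‖) ξ :=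
  contDiffAt_norm ℝ h

/-- The half-line of times is compactified by μ = 1/(1 + t). After extraction of e^{-(1+t)/8}, the
remaining symbol is m(ξ) e^{|ξ|} exp(-(|ξ| - 1/8)/μ), which extends smoothly by 0 to μ ≤ 0 because
|ξ| ≥ 3/8 > 1/8 on the support. The uniform bound over μ ∈ [0, 1] then gives all t ≥ 0 at once. -/
theorem Annular.exists_kn_mul_symP_le {ψ : Sp d → ℝ} (hψ : Annular ψ) {m : Sp d → ℂ}
    (hm : SmoothOff m) : ∃ C : ℝ≥0, ∀ t : ℝ, 0 ≤ t →
      kn (fun ξ => m ξ * symP t ξ * (ψ ξ : ℂ)) ≤ C * ENNReal.ofReal (Real.exp (-(t / 8))) := by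
  have h1 := hψ.contDiff_mul (h := fun p => m p.2 * ((Real.exp ‖p.2‖ *
    expNegInvGlue (p.1 / (‖p.2‖ - 1 / 8)) : ℝ) : ℂ)) (by
      intro p hp
      have hp0 : p.2 ≠ 0 := by rintro h; rw [h] at hp; norm_num at hp
      have hn : ContDiffAt ℝ ∞ (fun p : ℝ × Sp d => ‖p.2‖) p :=
        (contDiffAt_norm_sp hp0).comp p contDiffAt_snd
      refine ((hm p.2 hp0).comp p contDiffAt_snd).mul ?_
      refine Complex.ofRealCLM.contDiff.contDiffAt.comp p (hn.exp.mul ?_)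
      exact expNegInvGlue.contDiff.contDiffAt.comp p
        (contDiffAt_fst.div (hn.sub contDiffAt_const) (by linarith)))
  obtain ⟨C, hC⟩ := exists_kn_le_of_contDiff h1 hψ.compact.isCompact (by
    intro μ ξ hξ
    simp [image_eq_zero_of_notMem_tsupport hξ])
  refine ⟨C, fun t ht => ?_⟩
  have hμ : (1 + t)⁻¹ ∈ Icc (0 : ℝ) 1 := ⟨by positivity, inv_le_one_of_one_le₀ (by linarith)⟩
  -- The exponents match: -t|ξ| = -(1+t)/8 + |ξ| - (1+t)(|ξ| - 1/8).
  have heq : (fun ξ => m ξ * symP t ξ * (ψ ξ : ℂ)) = fun ξ => (Real.exp (-((1 + t) / 8)) : ℂ) *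
      (m ξ * ((Real.exp ‖ξ‖ * expNegInvGlue ((1 + t)⁻¹ / (‖ξ‖ - 1 / 8)) : ℝ) : ℂ) * (ψ ξ : ℂ)) := by
    ext ξ
    by_cases hξ : ξ ∈ tsupport ψ
    · have h38 : 3 / 8 ≤ ‖ξ‖ := hψ.support hξ
      have hpos : 0 < ‖ξ‖ - 1 / 8 := by linarith
      have : expNegInvGlue ((1 + t)⁻¹ / (‖ξ‖ - 1 / 8)) = Real.exp (-((1 + t) * (‖ξ‖ - 1 / 8))) := by
        rw [expNegInvGlue, if_neg (by have : 0 < (1 + t)⁻¹ / (‖ξ‖ - 1 / 8) := by positivity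
                                      exact not_le.2 this)]
        congr 2
        field_simp
      rw [this]
      have h3 : symP t ξ = (Real.exp (-((1 + t) / 8)) : ℂ) *
          ((Real.exp ‖ξ‖ * Real.exp (-((1 + t) * (‖ξ‖ - 1 / 8))) : ℝ) : ℂ) := by
        rw [symP]
        norm_cast
        rw [← Real.exp_add, ← Real.exp_add]
        congr 1; ring
      rw [h3]; ring
    · simp [image_eq_zero_of_notMem_tsupport hξ]
  rw [heq, kn, ker_const_mul]
  simp only [enorm_mul]
  rw [lintegral_const_mul' _ _ enorm_ne_top, mul_comm]
  refine mul_le_mul' (hC _ hμ) ?_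
  rw [← ofReal_norm, Complex.norm_real, Real.norm_eq_abs, abs_of_pos (Real.exp_pos _)]
  exact ENNReal.ofReal_le_ofReal (Real.exp_le_exp.2 (by linarith))

/-- The symbol `m(ξ) ψ(2^{-j} ξ)`. -/
def cut (ψ : Sp d → ℝ) (m : Sp d → ℂ) (j : ℤ) : Sp d → ℂ :=
  fun ξ => m ξ * (ψ ((2 : ℝ) ^ (-j) • ξ) : ℂ)

/-- Positive homogeneity of degree `a`. -/
def Homog (a : ℕ) (m : Sp d → ℂ) : Prop := ∀ (c : ℝ) (ξ : Sp d), 0 < c → m (c • ξ) = (c : ℂ) ^ a * m ξ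

theorem kn_const_mul (c : ℂ) (m : Sp d → ℂ) : kn (fun ξ => c * m ξ) = ‖c‖ₑ * kn m := by
  simp only [kn, ker_const_mul, enorm_mul]
  rw [lintegral_const_mul' _ _ enorm_ne_top]

theorem Annular.ccSym_cut {ψ : Sp d → ℝ} (hψ : Annular ψ) {m : Sp d → ℂ} (hm : SmoothOff m)
    (j : ℤ) : CcSym (cut ψ m j) := by
  have h2 : (0 : ℝ) < 2 ^ j := by positivity
  have h1 := (hψ.ccSym (m := fun ξ => m ((2 : ℝ) ^ j • ξ)) (by
    intro ξ hξ
    exact (hm _ (smul_ne_zero h2.ne' hξ)).comp ξ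
      (contDiff_const_smul ((2 : ℝ) ^ j)).contDiffAt)).comp_smul (c := (2 : ℝ) ^ (-j)) (by positivity)
  convert h1 using 1
  ext ξ
  simp only [cut, smul_smul]
  rw [← zpow_add₀ (by norm_num), add_neg_cancel, zpow_zero, one_smul]

/-- Rescaling ξ by 2^j brings the annulus to unit size, turns the time t into 2^j t, and produces
the factor 2^{ja} by homogeneity. -/
theorem Annular.exists_kn_cut_le {ψ : Sp d → ℝ} (hψ : Annular ψ) {m : Sp d → ℂ}
    (hm : SmoothOff m) {a : ℕ} (ha : Homog a m) :
    ∃ C : ℝ≥0, ∀ t : ℝ, 0 ≤ t → ∀ j : ℤ, kn (cut ψ (fun ξ => m ξ * symP t ξ) j) ≤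
      C * ENNReal.ofReal (((2 : ℝ) ^ j) ^ a * Real.exp (-((2 : ℝ) ^ j * t / 8))) := by
  obtain ⟨C, hC⟩ := hψ.exists_kn_mul_symP_le hm
  refine ⟨C, fun t ht j => ?_⟩
  have h2 : (0 : ℝ) < 2 ^ j := by positivity
  have heq : cut ψ (fun ξ => m ξ * symP t ξ) j = fun ξ => (((2 : ℝ) ^ j : ℝ) : ℂ) ^ a *
      (fun ζ => m ζ * symP ((2 : ℝ) ^ j * t) ζ * (ψ ζ : ℂ)) ((2 : ℝ) ^ (-j) • ξ) := by
    ext ξ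
    have hξ : ξ = (2 : ℝ) ^ j • ((2 : ℝ) ^ (-j) • ξ) := by
      rw [smul_smul, ← zpow_add₀ (by norm_num), add_neg_cancel, zpow_zero, one_smul]
    simp only [cut]
    have hP : symP ((2 : ℝ) ^ j * t) ((2 : ℝ) ^ (-j) • ξ) = symP t ξ := by
      simp only [symP, norm_smul]
      congr 2
      rw [Real.norm_of_nonneg (by positivity), zpow_neg]
      field_simp
    rw [hP]
    nth_rw 1 [hξ]
    rw [ha _ _ h2]
    ring
  rw [heq, kn_const_mul, kn_comp_smul (fun ζ => m ζ * symP ((2 : ℝ) ^ j * t) ζ * (ψ ζ : ℂ))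
    (c := (2 : ℝ) ^ (-j)) (by positivity)]
  refine (mul_le_mul_right (hC _ (by positivity)) _).trans_eq ?_
  rw [ENNReal.ofReal_mul (by positivity), ← ofReal_norm, norm_pow, Complex.norm_real,
    Real.norm_of_nonneg h2.le]
  ring

end SmoothSymbols

/-! ### Symbols given as series of smooth pieces -/

section SymbolSeries

variable {d : ℕ}

theorem summable_integral_norm {α ι : Type*} [MeasurableSpace α] {μ : Measure α} {F : ι → α → ℂ}
    (hF : ∀ i, AEStronglyMeasurable (F i) μ) (hs : ∑' i, ∫⁻ a, ‖F i a‖ₑ ∂μ ≠ ⊤) :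
    Summable fun i => ∫ a, ‖F i a‖ ∂μ := by
  have := ENNReal.summable_toReal hs
  refine this.congr fun i => ?_
  rw [integral_norm_eq_lintegral_enorm (hF i)]

theorem integrable_of_tsum_ne_top {α ι : Type*} [MeasurableSpace α] {μ : Measure α}
    {F : ι → α → ℂ} (hF : ∀ i, AEStronglyMeasurable (F i) μ)
    (hs : ∑' i, ∫⁻ a, ‖F i a‖ₑ ∂μ ≠ ⊤) (i : ι) : Integrable (F i) μ :=
  ⟨hF i, (ENNReal.ne_top_of_tsum_ne_top hs i).lt_top⟩

theorem hasSum_integral_of_ae {α ι : Type*} [Countable ι] [MeasurableSpace α] {μ : Measure α}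
    {F : ι → α → ℂ} {f : α → ℂ} (hF : ∀ i, AEStronglyMeasurable (F i) μ)
    (hs : ∑' i, ∫⁻ a, ‖F i a‖ₑ ∂μ ≠ ⊤) (hf : ∀ᵐ a ∂μ, HasSum (fun i => F i a) (f a)) :
    HasSum (fun i => ∫ a, F i a ∂μ) (∫ a, f a ∂μ) := by
  have h := hasSum_integral_of_summable_integral_norm (integrable_of_tsum_ne_top hF hs)
    (summable_integral_norm hF hs)
  have heq : ∫ a, f a ∂μ = ∫ a, ∑' i, F i a ∂μ := by
    refine integral_congr_ae ?_
    filter_upwards [hf] with a ha using ha.tsum_eq.symm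
  rwa [heq]

/-- Dyadic pieces sum to their symbol only away from the origin; the origin is negligible because d
≥ 1. -/
theorem ae_ne_zero [NeZero d] : ∀ᵐ ξ : Sp d, ξ ≠ 0 := by
  have : Nonempty (Fin d) := ⟨0⟩
  exact compl_mem_ae_iff.2 (measure_singleton (0 : Sp d))

theorem hasSum_ker [NeZero d] {ι : Type*} [Countable ι] {m : ι → Sp d → ℂ} {M : Sp d → ℂ}
    (hm : ∀ i, Sym (m i)) (hs : ∑' i, ∫⁻ ξ, ‖m i ξ‖ₑ ≠ ⊤)
    (hM : ∀ ξ, ξ ≠ 0 → HasSum (fun i => m i ξ) (M ξ)) (y : Sp d) :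
    HasSum (fun i => ker (m i) y) (ker M y) := by
  simp only [ker_apply]
  have h2pi : (2 * Real.pi) ≠ 0 := by positivity
  have hsum := summable_integral_norm (fun i => (hm i).cont.aestronglyMeasurable) hs
  have h := hasSum_integral_of_summable_integral_norm (fun i => integrable_wave_mul (hm i).int y) (by
    simp only [norm_mul, norm_wave, one_mul]
    refine (hsum.mul_left |((2 * Real.pi) ^ Module.finrank ℝ (Sp d))⁻¹|).congr fun i => ?_
    rw [Measure.integral_comp_smul volume (fun ξ => ‖m i ξ‖), smul_eq_mul])
  have heq : ∫ ξ : Sp d, Complex.exp (2 * Real.pi * Complex.I * (inner ℝ ξ y : ℝ)) *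
      M ((2 * Real.pi) • ξ) = ∫ ξ : Sp d, ∑' i, Complex.exp (2 * Real.pi * Complex.I *
        (inner ℝ ξ y : ℝ)) * m i ((2 * Real.pi) • ξ) := by
    refine integral_congr_ae ?_
    filter_upwards [ae_ne_zero] with ξ hξ
    exact ((hM _ (smul_ne_zero h2pi hξ)).mul_left _).tsum_eq.symm
  rwa [heq]

theorem kn_le_tsum [NeZero d] {ι : Type*} [Countable ι] {m : ι → Sp d → ℂ} {M : Sp d → ℂ}
    (hm : ∀ i, Sym (m i)) (hs : ∑' i, ∫⁻ ξ, ‖m i ξ‖ₑ ≠ ⊤)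
    (hM : ∀ ξ, ξ ≠ 0 → HasSum (fun i => m i ξ) (M ξ)) : kn M ≤ ∑' i, kn (m i) := by
  simp only [kn]
  rw [← lintegral_tsum fun i => (continuous_ker (hm i).int).enorm.measurable.aemeasurable]
  refine lintegral_mono fun y => ?_
  rw [← (hasSum_ker hm hs hM y).tsum_eq]
  exact enorm_tsum_le_tsum_enorm

/-- This admits symbols that are singular at the origin, such as e^{-t|ξ|}: the kernel is the sum of
the kernels of the pieces, and their L¹ norms are summable. -/
theorem Sym.of_hasSum [NeZero d] {ι : Type*} [Countable ι] {m : ι → Sp d → ℂ} {M : Sp d → ℂ}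
    (hm : ∀ i, Sym (m i)) (hs : ∑' i, ∫⁻ ξ, ‖m i ξ‖ₑ ≠ ⊤)
    (hM : ∀ ξ, ξ ≠ 0 → HasSum (fun i => m i ξ) (M ξ)) (hc : Continuous M) (hi : Integrable M)
    (hk : ∑' i, kn (m i) ≠ ⊤) : Sym M :=
  ⟨hc, hi, (continuous_ker hi).aestronglyMeasurable, (kn_le_tsum hm hs hM).trans_lt hk.lt_top⟩

theorem hasSum_funMult [NeZero d] {ι : Type*} [Countable ι] {m : ι → Sp d → ℂ} {M : Sp d → ℂ}
    (hm : ∀ i, Sym (m i)) (hs : ∑' i, ∫⁻ ξ, ‖m i ξ‖ₑ ≠ ⊤)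
    (hM : ∀ ξ, ξ ≠ 0 → HasSum (fun i => m i ξ) (M ξ)) (hk : ∑' i, kn (m i) ≠ ⊤)
    {g : Sp d → ℂ} (hg : AEStronglyMeasurable g) (hb : eLpNorm g ⊤ volume < ⊤) (x : Sp d) :
    HasSum (fun i => funMult (m i) g x) (funMult M g x) := by
  simp only [funMult_eq]
  refine hasSum_integral_of_ae (fun i => (integrable_ker_mul (hm i).kint hg hb x).1) ?_
    (.of_forall fun y => (hasSum_ker hm hs hM (x - y)).mul_right _)
  refine ne_of_lt (lt_of_le_of_lt (b := ∑' i, kn (m i) * eLpNorm g ⊤ volume) ?_ ?_)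
  · refine ENNReal.tsum_le_tsum fun i => ?_
    calc ∫⁻ y, ‖ker (m i) (x - y) * g y‖ₑ
        ≤ ∫⁻ y, ‖ker (m i) (x - y)‖ₑ * eLpNorm g ⊤ volume := by
          apply lintegral_mono_ae
          filter_upwards [ae_le_eLpNormEssSup (f := g) (μ := volume)] with y hy
          rw [enorm_mul, eLpNorm_exponent_top]
          gcongr
      _ = _ := by
          rw [lintegral_mul_const' _ _ hb.ne, lintegral_sub_left_eq_self (fun y => ‖ker (m i) y‖ₑ)]
          rfl
  · rw [ENNReal.tsum_mul_right]
    exact ENNReal.mul_lt_top hk.lt_top hb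

theorem stronglyMeasurable_ker {α : Type*} [MeasurableSpace α] {m : α → Sp d → ℂ}
    (hm : Measurable (Function.uncurry m)) :
    StronglyMeasurable (fun p : α × Sp d => ker (m p.1) p.2) := by
  simp only [ker_apply]
  refine StronglyMeasurable.integral_prod_right' (f := fun q : (α × Sp d) × Sp d =>
    Complex.exp (2 * Real.pi * Complex.I * (inner ℝ q.2 q.1.2 : ℝ)) *
      m q.1.1 ((2 * Real.pi) • q.2)) ?_
  refine Measurable.stronglyMeasurable (Measurable.mul (by fun_prop) ?_)
  exact hm.comp ((measurable_fst.comp measurable_fst).prodMk (measurable_snd.const_smul (2 * Real.pi)))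

end SymbolSeries

/-! ### The dyadic partition of unity, its fattening and its low-frequency part -/

section Cutoffs

variable {d : ℕ} (φ : DyadicCutoff d)

theorem DyadicCutoff.norm_of_ne_zero {ξ : Sp d} (h : φ.toFun ξ ≠ 0) :
    3 / 4 ≤ ‖ξ‖ ∧ ‖ξ‖ ≤ 8 / 3 := φ.support (subset_tsupport _ h)

theorem norm_two_zpow_smul (j : ℤ) (ξ : Sp d) : ‖(2 : ℝ) ^ j • ξ‖ = 2 ^ j * ‖ξ‖ := by
  rw [norm_smul, Real.norm_of_nonneg (by positivity)]

theorem DyadicCutoff.scale_of_ne_zero {j : ℤ} {ξ : Sp d} (h : φ.toFun ((2 : ℝ) ^ (-j) • ξ) ≠ 0) :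
    3 / 4 * 2 ^ j ≤ ‖ξ‖ ∧ ‖ξ‖ ≤ 8 / 3 * 2 ^ j := by
  have := φ.norm_of_ne_zero h
  rw [norm_two_zpow_smul, zpow_neg] at this
  have h2 : (0 : ℝ) < 2 ^ j := by positivity
  constructor
  · have := mul_le_mul_of_nonneg_right this.1 h2.le
    rwa [mul_comm, mul_comm (_⁻¹) _, mul_assoc, inv_mul_cancel₀ h2.ne', mul_one, mul_comm] at this
  · have := mul_le_mul_of_nonneg_right this.2 h2.le
    rwa [mul_comm (_⁻¹) _, mul_assoc, inv_mul_cancel₀ h2.ne', mul_one] at this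

theorem DyadicCutoff.annular : Annular φ.toFun where
  smooth := φ.smooth
  compact := HasCompactSupport.intro (isCompact_closedBall 0 (8 / 3)) fun ξ hξ => by
    by_contra h
    exact hξ (by simpa using (φ.norm_of_ne_zero h).2)
  support := fun ξ hξ => by
    have := (φ.support hξ).1
    simp only [mem_ofPred_eq]; linarith

/-- A fattened cutoff, equal to `1` on the support of `φ`. -/
def fat (ξ : Sp d) : ℝ := ∑ l ∈ Finset.Icc (-1 : ℤ) 1, φ.toFun ((2 : ℝ) ^ (-l) • ξ)

theorem two_zpow_smul_smul (a b : ℤ) (ξ : Sp d) :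
    (2 : ℝ) ^ a • ((2 : ℝ) ^ b • ξ) = (2 : ℝ) ^ (a + b) • ξ := by
  rw [smul_smul, ← zpow_add₀ (by norm_num)]

/-- The hypothesis says 2^{i-j} ≤ 32/9, which is less than 4. Applied in both directions, it shows
that only neighbouring annuli meet. -/
theorem zpow_lt_iff_aux {i j : ℤ} (h : (3 : ℝ) / 4 * 2 ^ i ≤ 8 / 3 * 2 ^ j) : i ≤ j + 1 := by
  by_contra hlt
  push Not at hlt
  have h2 : (2 : ℝ) ^ (j + 2) ≤ 2 ^ i := zpow_le_zpow_right₀ (by norm_num) (by omega)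
  rw [zpow_add₀ (by norm_num)] at h2
  have h3 : (0 : ℝ) < 2 ^ j := by positivity
  norm_num at h2
  linarith

theorem fat_annular : Annular (fat φ) where
  smooth := ContDiff.sum fun l _ => φ.smooth.comp (contDiff_const_smul _)
  compact := HasCompactSupport.intro (isCompact_closedBall 0 (16 / 3)) fun ξ hξ => by
    refine Finset.sum_eq_zero fun l hl => ?_
    by_contra h
    refine hξ ?_
    have h1 := (φ.scale_of_ne_zero h).2
    have h2 : (2 : ℝ) ^ l ≤ 2 ^ (1 : ℤ) :=
      zpow_le_zpow_right₀ (by norm_num) (Finset.mem_Icc.1 hl).2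
    norm_num at h2
    simp only [Metric.mem_closedBall, dist_zero_right]
    linarith
  support := by
    refine closure_minimal (fun ξ hξ => ?_) (isClosed_le continuous_const continuous_norm)
    obtain ⟨l, hl, h⟩ := Finset.exists_ne_zero_of_sum_ne_zero hξ
    have h1 := (φ.scale_of_ne_zero h).1
    have h2 : (2 : ℝ) ^ (-1 : ℤ) ≤ 2 ^ l :=
      zpow_le_zpow_right₀ (by norm_num) (Finset.mem_Icc.1 hl).1
    norm_num at h2
    simp only [mem_ofPred_eq]
    linarith

/-- On the support of φ all terms of the partition of unity except those with index -1, 0, 1 vanish,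
so `fat` is the full sum there. -/
theorem mul_fat (ξ : Sp d) : φ.toFun ξ * fat φ ξ = φ.toFun ξ := by
  by_cases h : φ.toFun ξ = 0
  · simp [h]
  have hξ : ξ ≠ 0 := by
    rintro rfl; have := (φ.norm_of_ne_zero h).1; norm_num at this
  have h1 := φ.sum_eq_one ξ hξ
  have hn := φ.norm_of_ne_zero h
  have h2 : HasSum (fun j : ℤ => φ.toFun ((2 : ℝ) ^ (-j) • ξ)) (fat φ ξ) := by
    refine hasSum_sum_of_ne_finset_zero fun j hj => ?_
    by_contra hne
    have hs := φ.scale_of_ne_zero hne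
    have ha := zpow_lt_iff_aux (i := j) (j := 0) (by simp; linarith)
    have hb := zpow_lt_iff_aux (i := 0) (j := j) (by simp; linarith)
    exact hj (Finset.mem_Icc.2 ⟨by omega, by omega⟩)
  rw [h2.unique h1, mul_one]

theorem dyad_mul_cut_fat (m m' : Sp d → ℂ) (j : ℤ) :
    (fun ξ => cut (fat φ) m j ξ * dyad φ m' j ξ) = dyad φ (fun ξ => m ξ * m' ξ) j := by
  ext ξ
  simp only [cut, dyad]
  have := congrArg (fun r : ℝ => (r : ℂ)) (mul_fat φ ((2 : ℝ) ^ (-j) • ξ))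
  push_cast at this
  calc m ξ * (fat φ ((2 : ℝ) ^ (-j) • ξ) : ℂ) * (m' ξ * (φ.toFun ((2 : ℝ) ^ (-j) • ξ) : ℂ))
      = m ξ * m' ξ * ((φ.toFun ((2 : ℝ) ^ (-j) • ξ) : ℂ) * (fat φ ((2 : ℝ) ^ (-j) • ξ) : ℂ)) := by ring
    _ = _ := by rw [this]

/-- The low-frequency cutoff `∑_{j ≤ 0} φ(2^{-j} ξ)`, extended by `1` at the origin. -/
def low (ξ : Sp d) : ℝ := 1 - ∑' n : ℕ, φ.toFun ((2 : ℝ) ^ (-((n : ℤ) + 1)) • ξ)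

theorem high_eq_zero {ξ : Sp d} {M n : ℕ} (hM : ‖ξ‖ < 2 ^ M) (hn : M ≤ n) :
    φ.toFun ((2 : ℝ) ^ (-((n : ℤ) + 1)) • ξ) = 0 := by
  by_contra h
  have h1 := (φ.scale_of_ne_zero h).1
  have h2 : (2 : ℝ) ^ M ≤ 2 ^ n := pow_le_pow_right₀ (by norm_num) hn
  rw [zpow_add₀ (by norm_num), zpow_natCast] at h1
  norm_num at h1
  have : (0 : ℝ) < 2 ^ n := by positivity
  linarith

theorem low_eq_sum {ξ : Sp d} {M : ℕ} (hM : ‖ξ‖ < 2 ^ M) :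
    low φ ξ = 1 - ∑ n ∈ Finset.range M, φ.toFun ((2 : ℝ) ^ (-((n : ℤ) + 1)) • ξ) := by
  rw [low, tsum_eq_sum (s := Finset.range M) fun n hn =>
    high_eq_zero φ hM (not_lt.1 fun h => hn (Finset.mem_range.2 h))]

/-- Taking the complement of the high frequencies makes the sum locally finite at every point, the
origin included; the sum over j ≤ 0 is not locally finite there. -/
theorem low_contDiff : ContDiff ℝ ∞ (low φ) := by
  rw [contDiff_iff_contDiffAt]
  intro ξ
  obtain ⟨M, hM⟩ := pow_unbounded_of_one_lt ‖ξ‖ (by norm_num : (1 : ℝ) < 2)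
  have : low φ =ᶠ[nhds ξ]
      fun ξ => 1 - ∑ n ∈ Finset.range M, φ.toFun ((2 : ℝ) ^ (-((n : ℤ) + 1)) • ξ) := by
    filter_upwards [continuous_norm.continuousAt.eventually (gt_mem_nhds hM)] with ζ hζ
    exact low_eq_sum φ hζ
  refine ContDiffAt.congr_of_eventuallyEq ?_ this
  exact (contDiff_const.sub (ContDiff.sum fun l _ => φ.smooth.comp (contDiff_const_smul _))).contDiffAt

theorem low_eq_zero {ξ : Sp d} (h : 8 / 3 < ‖ξ‖) : low φ ξ = 0 := by
  have hξ : ξ ≠ 0 := by rintro rfl; simp at h; linarith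
  have hinj : Function.Injective (fun n : ℕ => (n : ℤ) + 1) := fun a b hab => by simpa using hab
  have := (hinj.hasSum_iff (f := fun j : ℤ => φ.toFun ((2 : ℝ) ^ (-j) • ξ)) (a := 1) (by
    intro j hj
    by_contra hne
    have h1 := (φ.scale_of_ne_zero hne).2
    have hj0 : j ≤ 0 := by
      by_contra hpos
      exact hj ⟨(j - 1).toNat, by simp; omega⟩
    have h2 : (2 : ℝ) ^ j ≤ 1 := zpow_le_one_of_nonpos₀ (by norm_num) hj0
    linarith)).2 (φ.sum_eq_one ξ hξ)
  rw [low, show (∑' n : ℕ, φ.toFun ((2 : ℝ) ^ (-((n : ℤ) + 1)) • ξ)) = 1 from this.tsum_eq, sub_self]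

theorem low_zero : low φ 0 = 1 := by
  rw [low_eq_sum φ (M := 0) (by simp)]; simp

/-- The symbol of the low-frequency projection `∑_{i ≤ k} Δ̇_i`. -/
def lowSym (k : ℤ) : Sp d → ℂ := fun ξ => (low φ ((2 : ℝ) ^ (-k) • ξ) : ℂ)

theorem lowSym_ccSym (k : ℤ) : CcSym (lowSym φ k) := by
  have h : CcSym (fun ξ => (low φ ξ : ℂ)) := by
    refine ⟨HasCompactSupport.intro (isCompact_closedBall 0 (8 / 3)) fun ξ hξ => ?_,
      Complex.ofRealCLM.contDiff.comp (low_contDiff φ)⟩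
    rw [low_eq_zero φ (by simpa using hξ)]; simp
  exact h.comp_smul (by positivity)

theorem lowSym_succ (k : ℤ) (ξ : Sp d) :
    lowSym φ (k + 1) ξ = lowSym φ k ξ + dyad φ symOne (k + 1) ξ := by
  simp only [lowSym, dyad, symOne, one_mul]
  rw [← Complex.ofReal_add]
  congr 1
  obtain ⟨M, hM⟩ := pow_unbounded_of_one_lt (‖(2 : ℝ) ^ (-k) • ξ‖ + ‖(2 : ℝ) ^ (-(k + 1)) • ξ‖)
    (by norm_num : (1 : ℝ) < 2)
  rw [low_eq_sum φ (M := M) (by linarith [norm_nonneg ((2 : ℝ) ^ (-k) • ξ)]),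
    low_eq_sum φ (M := M + 1) (by
      rw [pow_succ]
      linarith [norm_nonneg ((2 : ℝ) ^ (-(k + 1)) • ξ), norm_nonneg ((2 : ℝ) ^ (-k) • ξ)]),
    Finset.sum_range_succ']
  simp only [two_zpow_smul_smul]
  have h1 : ∀ n : ℕ, -((n : ℤ) + 1) + -(k + 1) = -(((n + 1 : ℕ) : ℤ) + 1) + -k := by
    intro n; push_cast; ring
  simp only [h1]
  have h2 : -(((0 : ℕ) : ℤ) + 1) + -k = -(k + 1) := by push_cast; ring
  rw [h2]; ring

theorem dyad_symOne_ccSym (j : ℤ) : CcSym (dyad φ symOne j) :=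
  φ.annular.ccSym_cut (fun _ _ => contDiffAt_const) j

theorem hasSum_dyad (m : Sp d → ℂ) {ξ : Sp d} (hξ : ξ ≠ 0) :
    HasSum (fun j => dyad φ m j ξ) (m ξ) := by
  have := (Complex.hasSum_ofReal.2 (φ.sum_eq_one ξ hξ)).mul_left (m ξ)
  rwa [Complex.ofReal_one, mul_one] at this

theorem tsum_enorm_dyad (m : Sp d → ℂ) {ξ : Sp d} (hξ : ξ ≠ 0) :
    ∑' j, ‖dyad φ m j ξ‖ₑ = ‖m ξ‖ₑ := by
  simp only [dyad, enorm_mul]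
  rw [ENNReal.tsum_mul_left]
  have h : ∀ j : ℤ, ‖(φ.toFun ((2 : ℝ) ^ (-j) • ξ) : ℂ)‖ₑ =
      ENNReal.ofReal (φ.toFun ((2 : ℝ) ^ (-j) • ξ)) := fun j => by
    rw [← ofReal_norm, Complex.norm_real, Real.norm_of_nonneg (φ.mem_Icc _).1]
  simp only [h]
  rw [← ENNReal.ofReal_tsum_of_nonneg (fun j => (φ.mem_Icc _).1) (φ.sum_eq_one ξ hξ).summable,
    (φ.sum_eq_one ξ hξ).tsum_eq, ENNReal.ofReal_one, mul_one]

theorem tsum_lintegral_dyad [NeZero d] {m : Sp d → ℂ} (hm : Measurable m) :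
    ∑' j, ∫⁻ ξ, ‖dyad φ m j ξ‖ₑ = ∫⁻ ξ, ‖m ξ‖ₑ := by
  have hφ := φ.smooth.continuous
  have hmeas : ∀ j : ℤ, AEMeasurable (fun ξ => ‖dyad φ m j ξ‖ₑ) := fun j =>
    Measurable.aemeasurable (Measurable.enorm (hm.mul (by fun_prop)))
  rw [← lintegral_tsum hmeas]
  refine lintegral_congr_ae ?_
  filter_upwards [ae_ne_zero] with ξ hξ using tsum_enorm_dyad φ m hξ

end Cutoffs

/-! ### The Poisson semigroup e^{-t|D|} and its first derivatives as integrable kernels -/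

section HeatSymbols

variable {d : ℕ}

/-- The symbols of `|D|` and of `∂_k`. -/
def rho : Option (Fin d) → Sp d → ℂ
  | none => symAbs
  | some k => fun ξ => Complex.I * (ξ k : ℂ)

/-- The symbols of `|D| e^{-t|D|}` and of `∂_k e^{-t|D|}`. -/
def rhoP (l : Option (Fin d)) (t : ℝ) : Sp d → ℂ := fun ξ => rho l ξ * symP t ξ

theorem contDiff_symPartial (k : Fin d) : ContDiff ℝ ∞ (fun ξ : Sp d => Complex.I * (ξ k : ℂ)) :=
  contDiff_const.mul (Complex.ofRealCLM.contDiff.comp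
    (EuclideanSpace.proj k : Sp d →L[ℝ] ℝ).contDiff)

theorem smoothOff_rho (l : Option (Fin d)) : SmoothOff (rho l) := by
  intro ξ hξ
  cases l with
  | none => exact Complex.ofRealCLM.contDiff.contDiffAt.comp ξ (contDiffAt_norm_sp hξ)
  | some k => exact (contDiff_symPartial k).contDiffAt

theorem SmoothOff.mul {m₁ m₂ : Sp d → ℂ} (h₁ : SmoothOff m₁) (h₂ : SmoothOff m₂) :
    SmoothOff (fun ξ => m₁ ξ * m₂ ξ) := fun ξ hξ => (h₁ ξ hξ).mul (h₂ ξ hξ)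

theorem smoothOff_const (c : ℂ) : SmoothOff (fun _ : Sp d => c) := fun _ _ => contDiffAt_const

theorem smoothOff_symP (t : ℝ) : SmoothOff (symP (d := d) t) := fun ξ hξ =>
  Complex.ofRealCLM.contDiff.contDiffAt.comp ξ
    ((contDiffAt_const.mul (contDiffAt_norm_sp hξ)).exp)

theorem smoothOff_inv_norm : SmoothOff (fun ξ : Sp d => ((‖ξ‖⁻¹ : ℝ) : ℂ)) := fun ξ hξ =>
  Complex.ofRealCLM.contDiff.contDiffAt.comp ξ
    ((contDiffAt_norm_sp hξ).inv (norm_ne_zero_iff.2 hξ))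

theorem smoothOff_rhoP (l : Option (Fin d)) (t : ℝ) : SmoothOff (rhoP l t) :=
  (smoothOff_rho l).mul (smoothOff_symP t)

theorem homog_rho (l : Option (Fin d)) : Homog 1 (rho l) := by
  intro c ξ hc
  cases l with
  | none => simp [rho, symAbs, norm_smul, abs_of_pos hc]
  | some k => simp [rho]; ring

theorem homog_one : Homog 0 (symOne (d := d)) := fun c ξ _ => by simp [symOne]

/-- The symbols of `Id` and of the Riesz transforms `∂_k |D|⁻¹`. -/
def rieszSym (l : Option (Fin d)) : Sp d → ℂ := fun ξ => ((‖ξ‖⁻¹ : ℝ) : ℂ) * rho l ξ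

theorem smoothOff_rieszSym (l : Option (Fin d)) : SmoothOff (rieszSym l) :=
  smoothOff_inv_norm.mul (smoothOff_rho l)

theorem homog_rieszSym (l : Option (Fin d)) : Homog 0 (rieszSym l) := by
  intro c ξ hc
  have h : (c : ℂ) ≠ 0 := by exact_mod_cast hc.ne'
  simp only [rieszSym, homog_rho l c ξ hc, norm_smul, Real.norm_of_nonneg hc.le, mul_inv]
  push_cast
  field_simp

theorem norm_rho_le (l : Option (Fin d)) (ξ : Sp d) : ‖rho l ξ‖ ≤ ‖ξ‖ := by
  cases l with
  | none => simp [rho, symAbs]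
  | some k =>
    simp only [rho, norm_mul, Complex.norm_I, one_mul, Complex.norm_real]
    exact PiLp.norm_apply_le ξ k

theorem continuous_rho (l : Option (Fin d)) : Continuous (rho l) := by
  cases l with
  | none => exact Complex.continuous_ofReal.comp continuous_norm
  | some k => exact (contDiff_symPartial k).continuous

theorem continuous_symP (t : ℝ) : Continuous (symP (d := d) t) := by
  unfold symP; fun_prop

theorem symP_zero : symP (d := d) 0 = symOne := by ext ξ; simp [symP, symOne]

theorem norm_symP (t : ℝ) (ξ : Sp d) : ‖symP t ξ‖ = Real.exp (-t * ‖ξ‖) := by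
  rw [symP, Complex.norm_real, Real.norm_of_nonneg (Real.exp_pos _).le]

theorem integrable_symP {t : ℝ} (ht : 0 < t) : Integrable (symP (d := d) t) := by
  -- The power -(d + 1) of 1 + |ξ| is integrable on ℝᵈ, and the exponential decays faster.
  set n := d + 1
  have h1 : Integrable (fun ξ : Sp d => (1 + ‖ξ‖) ^ (-(n : ℝ))) :=
    integrable_one_add_norm (by simp [n])
  refine (h1.const_mul (Nat.factorial n / t ^ n * Real.exp t)).mono'
    (continuous_symP t).aestronglyMeasurable (.of_forall fun ξ => ?_)
  rw [norm_symP, Real.rpow_neg (by positivity), Real.rpow_natCast]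
  have h2 := Real.pow_div_factorial_le_exp (x := t * (1 + ‖ξ‖)) (by positivity) n
  have h3 : Real.exp (t * (1 + ‖ξ‖)) = Real.exp t * Real.exp (t * ‖ξ‖) := by
    rw [← Real.exp_add]; ring_nf
  rw [h3, mul_pow] at h2
  rw [show -t * ‖ξ‖ = -(t * ‖ξ‖) by ring, Real.exp_neg]
  have h4 : 0 < Real.exp (t * ‖ξ‖) := Real.exp_pos _
  have h5 : (0 : ℝ) < Nat.factorial n := by exact_mod_cast Nat.factorial_pos n
  rw [div_le_iff₀ h5] at h2
  rw [inv_le_iff_one_le_mul₀ h4]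
  have h6 : 0 < t ^ n * (1 + ‖ξ‖) ^ n := by positivity
  calc (1 : ℝ) ≤ (Real.exp t * Real.exp (t * ‖ξ‖) * Nat.factorial n) / (t ^ n * (1 + ‖ξ‖) ^ n) :=
        (one_le_div h6).2 h2
    _ = _ := by field_simp

theorem mul_exp_neg_le {t x : ℝ} (ht : 0 < t) :
    x * Real.exp (-t * x) ≤ 2 / t * Real.exp (-(t / 2) * x) := by
  have h1 := Real.add_one_le_exp (t / 2 * x)
  have h2 : Real.exp (-(t / 2) * x) = Real.exp (t / 2 * x) * Real.exp (-t * x) := by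
    rw [← Real.exp_add]; ring_nf
  rw [h2, ← mul_assoc]
  refine mul_le_mul_of_nonneg_right ?_ (Real.exp_pos _).le
  calc x = 2 / t * (t / 2 * x) := by field_simp
    _ ≤ _ := by gcongr; linarith

theorem integrable_norm_mul_symP {t : ℝ} (ht : 0 < t) :
    Integrable (fun ξ : Sp d => (‖ξ‖ : ℂ) * symP t ξ) := by
  refine ((integrable_symP (half_pos ht)).norm.const_mul (2 / t)).mono'
    ((Complex.continuous_ofReal.comp continuous_norm).mul (continuous_symP t)).aestronglyMeasurable
    (.of_forall fun ξ => ?_)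
  rw [norm_mul, norm_symP, norm_symP, Complex.norm_real, norm_norm]
  exact mul_exp_neg_le ht

theorem integrable_rhoP (l : Option (Fin d)) {t : ℝ} (ht : 0 < t) : Integrable (rhoP l t) := by
  refine (integrable_norm_mul_symP ht).norm.mono'
    ((continuous_rho l).mul (continuous_symP t)).aestronglyMeasurable (.of_forall fun ξ => ?_)
  rw [rhoP, norm_mul, norm_mul]
  gcongr
  rw [Complex.norm_real, norm_norm]
  exact norm_rho_le l ξ

theorem continuous_rhoP (l : Option (Fin d)) (t : ℝ) : Continuous (rhoP l t) :=
  (continuous_rho l).mul (continuous_symP t)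

theorem tsum_two_zpow_neg_abs : ∑' j : ℤ, ENNReal.ofReal ((2 : ℝ) ^ (-|j|)) < ⊤ := by
  have hs : Summable fun j : ℤ => (2 : ℝ) ^ (-|j|) := by
    have hg : Summable fun n : ℕ => ((1 : ℝ) / 2) ^ n := summable_geometric_two
    refine Summable.of_nat_of_neg ?_ ?_ <;>
    · refine hg.congr fun n => ?_
      simp
  exact (hs.tsum_ofReal_lt_top)

/-- For j ≤ 0 the exponential is at most 1. For j ≥ 0 the inequality e^x ≥ x²/2 with x = 2^j t/8
turns the growing factor 2^j into 128 t⁻² 2^{-j}. -/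
theorem two_zpow_mul_exp_le {t : ℝ} (ht : 0 < t) (j : ℤ) :
    (2 : ℝ) ^ j * Real.exp (-((2 : ℝ) ^ j * t / 8)) ≤ max 1 (128 / t ^ 2) * 2 ^ (-|j|) := by
  have h2 : (0 : ℝ) < 2 ^ j := by positivity
  rcases le_total j 0 with hj | hj
  · rw [abs_of_nonpos hj, neg_neg, mul_comm]
    refine mul_le_mul ?_ le_rfl h2.le (by positivity)
    refine le_max_of_le_left (Real.exp_le_one_iff.2 ?_)
    have : 0 ≤ 2 ^ j * t / 8 := by positivity
    linarith
  · rw [abs_of_nonneg hj, Real.exp_neg, zpow_neg]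
    set y := (2 : ℝ) ^ j with hy
    have h1 := Real.quadratic_le_exp_of_nonneg (x := y * t / 8) (by positivity)
    have h3 : (y * t / 8) ^ 2 / 2 ≤ Real.exp (y * t / 8) := by nlinarith [mul_pos h2 ht]
    calc y * (Real.exp (y * t / 8))⁻¹ ≤ y * ((y * t / 8) ^ 2 / 2)⁻¹ := by gcongr
      _ = 128 / t ^ 2 * y⁻¹ := by field_simp; norm_num
      _ ≤ _ := by gcongr; exact le_max_right _ _

theorem exp_neg_two_zpow_le {j : ℤ} (hj : 0 ≤ j) :
    Real.exp (-((2 : ℝ) ^ j * 1 / 8)) ≤ 8 * 2 ^ (-|j|) := by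
  rw [abs_of_nonneg hj, Real.exp_neg, zpow_neg, mul_one]
  have h2 : (0 : ℝ) < 2 ^ j := by positivity
  have h1 := Real.add_one_le_exp ((2 : ℝ) ^ j / 8)
  calc (Real.exp (2 ^ j / 8))⁻¹ ≤ ((2 : ℝ) ^ j / 8)⁻¹ := by gcongr; linarith
    _ = _ := by field_simp

variable (φ : DyadicCutoff d)

theorem dyad_ccSym {m : Sp d → ℂ} (hm : SmoothOff m) (j : ℤ) : CcSym (dyad φ m j) :=
  φ.annular.ccSym_cut hm j

theorem tsum_kn_dyad_rhoP (l : Option (Fin d)) {t : ℝ} (ht : 0 < t) :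
    ∑' j, kn (dyad φ (rhoP l t) j) ≠ ⊤ := by
  obtain ⟨C, hC⟩ := φ.annular.exists_kn_cut_le (smoothOff_rho l) (homog_rho l)
  refine ne_of_lt (lt_of_le_of_lt (b := ∑' j : ℤ, C * (ENNReal.ofReal (max 1 (128 / t ^ 2)) *
    ENNReal.ofReal ((2 : ℝ) ^ (-|j|)))) (ENNReal.tsum_le_tsum fun j => ?_) ?_)
  · refine (hC t ht.le j).trans ?_
    rw [← ENNReal.ofReal_mul (by positivity), pow_one]
    exact mul_le_mul_right (ENNReal.ofReal_le_ofReal (two_zpow_mul_exp_le ht j)) _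
  · rw [ENNReal.tsum_mul_left, ENNReal.tsum_mul_left]
    exact ENNReal.mul_lt_top ENNReal.coe_lt_top
      (ENNReal.mul_lt_top ENNReal.ofReal_lt_top tsum_two_zpow_neg_abs)

theorem tsum_lintegral_dyad_rhoP [NeZero d] (l : Option (Fin d)) {t : ℝ} (ht : 0 < t) :
    ∑' j, ∫⁻ ξ, ‖dyad φ (rhoP l t) j ξ‖ₑ ≠ ⊤ := by
  rw [tsum_lintegral_dyad φ (continuous_rhoP l t).measurable]
  exact (integrable_rhoP l ht).2.ne

/-- The symbol need not be smooth at the origin, but its factor of degree one makes the kernels of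
the low-frequency blocks summable, and the exponential does the same at high frequency. -/
theorem sym_rhoP [NeZero d] (φ : DyadicCutoff d) (l : Option (Fin d)) {t : ℝ} (ht : 0 < t) : Sym (rhoP l t) :=
  Sym.of_hasSum (fun j => (dyad_ccSym φ (smoothOff_rhoP l t) j).sym) (tsum_lintegral_dyad_rhoP φ l ht)
    (fun _ hξ => hasSum_dyad φ _ hξ) (continuous_rhoP l t) (integrable_rhoP l ht)
    (tsum_kn_dyad_rhoP φ l ht)

theorem hasSum_funMult_rhoP [NeZero d] (l : Option (Fin d)) {t : ℝ} (ht : 0 < t) {g : Sp d → ℂ}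
    (hg : AEStronglyMeasurable g) (hb : eLpNorm g ⊤ volume < ⊤) (x : Sp d) :
    HasSum (fun j => funMult (dyad φ (rhoP l t) j) g x) (funMult (rhoP l t) g x) :=
  hasSum_funMult (fun j => (dyad_ccSym φ (smoothOff_rhoP l t) j).sym)
    (tsum_lintegral_dyad_rhoP φ l ht) (fun _ hξ => hasSum_dyad φ _ hξ) (tsum_kn_dyad_rhoP φ l ht)
    hg hb x

theorem symP_sub_symP (a b : ℝ) (ξ : Sp d) :
    symP a ξ - symP b ξ = ∫ s in a..b, symAbsP s ξ := by
  have hd : ∀ s ∈ uIcc a b, HasDerivAt (fun s => -symP s ξ) (symAbsP s ξ) s := by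
    intro s _
    have h1 : HasDerivAt (fun s : ℝ => Real.exp (-s * ‖ξ‖)) (Real.exp (-s * ‖ξ‖) * (-1 * ‖ξ‖)) s :=
      (((hasDerivAt_id s).neg).mul_const ‖ξ‖).exp
    have h2 := h1.ofReal_comp.neg
    refine h2.congr_deriv ?_
    simp only [symAbsP, symAbs, symP]; push_cast; ring
  rw [intervalIntegral.integral_eq_sub_of_hasDerivAt hd]
  · ring
  · apply Continuous.intervalIntegrable
    unfold symAbsP symAbs symP; fun_prop

theorem integrable_mul_symP_of_le {c : Sp d → ℂ} {a b : ℝ} (hab : a ≤ b)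
    (hc : AEStronglyMeasurable c) (h : Integrable (fun ξ => c ξ * symP a ξ)) :
    Integrable (fun ξ => c ξ * symP b ξ) := by
  refine h.norm.mono' (hc.mul (continuous_symP b).aestronglyMeasurable) (.of_forall fun ξ => ?_)
  rw [norm_mul, norm_mul, norm_symP, norm_symP]
  gcongr

theorem measurable_mul_symAbsP {c : Sp d → ℂ} (hc : Measurable c) :
    Measurable (Function.uncurry fun (s : ℝ) (ξ : Sp d) => c ξ * symAbsP s ξ) := by
  unfold Function.uncurry symAbsP symAbs symP
  fun_prop

/-- This is -d/ds e^{-s|ξ|} = |ξ|e^{-s|ξ|} in integrated form, carried to kernels by Fubini. The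
factor c is a cutoff or the constant 1; only the initial time a needs integrability, since the
symbols decrease in time. -/
theorem ker_symP_sub {c : Sp d → ℂ} (hc : Measurable c) {a b : ℝ} (hab : a ≤ b)
    (h1 : Integrable (fun ξ => c ξ * symP a ξ)) (h2 : Integrable (fun ξ => c ξ * symAbsP a ξ))
    (y : Sp d) :
    ker (fun ξ => c ξ * symP a ξ) y - ker (fun ξ => c ξ * symP b ξ) y =
      ∫ s in a..b, ker (fun ξ => c ξ * symAbsP s ξ) y := by
  have h1b := integrable_mul_symP_of_le hab hc.aestronglyMeasurable h1
  simp only [ker_apply]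
  rw [← integral_sub (integrable_wave_mul h1 y) (integrable_wave_mul h1b y),
    intervalIntegral.integral_of_le hab, integral_integral_swap]
  · congr 1; ext ξ
    rw [← mul_sub, ← mul_sub, symP_sub_symP, intervalIntegral.integral_of_le hab,
      ← integral_const_mul, ← integral_const_mul]
  · have hdom : Integrable (fun p : ℝ × Sp d => ‖c ((2 * Real.pi) • p.2) *
        symAbsP a ((2 * Real.pi) • p.2)‖) ((volume.restrict (Ioc a b)).prod volume) :=
      ((integrable_comp_two_pi_smul h2).comp_snd _).norm
    refine hdom.mono' ?_ ?_
    · refine Measurable.aestronglyMeasurable (Measurable.mul (by fun_prop) ?_)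
      exact (measurable_mul_symAbsP hc).comp
        (measurable_fst.prodMk (measurable_snd.const_smul (2 * Real.pi)))
    · have : ∀ᵐ s ∂(volume.restrict (Ioc a b)), s ∈ Ioc a b := ae_restrict_mem measurableSet_Ioc
      filter_upwards [Measure.quasiMeasurePreserving_fst.ae this] with p hp
      simp only [Function.uncurry]
      rw [norm_mul, norm_wave, one_mul, norm_mul, norm_mul, symAbsP, symAbsP, norm_mul, norm_mul,
        norm_symP, norm_symP]
      gcongr
      exact hp.1.le

theorem kn_symP_sub_le {c : Sp d → ℂ} (hc : Measurable c) {a b : ℝ} (hab : a ≤ b)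
    (h1 : Integrable (fun ξ => c ξ * symP a ξ)) (h2 : Integrable (fun ξ => c ξ * symAbsP a ξ)) :
    kn (fun ξ => c ξ * symP a ξ - c ξ * symP b ξ) ≤
      ∫⁻ s in Ioc a b, kn (fun ξ => c ξ * symAbsP s ξ) := by
  have h1b := integrable_mul_symP_of_le hab hc.aestronglyMeasurable h1
  have hk : ker (fun ξ => c ξ * symP a ξ - c ξ * symP b ξ) =
      fun y => ∫ s in a..b, ker (fun ξ => c ξ * symAbsP s ξ) y := by
    ext y
    rw [← ker_symP_sub hc hab h1 h2 y]
    have := congrFun (ker_add h1 (h1b.const_mul (-1))) y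
    simp only [neg_mul, one_mul, ← sub_eq_add_neg] at this
    rw [this, sub_eq_add_neg]
    congr 1
    have := congrFun (ker_const_mul (-1) (fun ξ => c ξ * symP b ξ)) y
    simpa using this
  simp only [kn]
  rw [hk]
  have hm : AEMeasurable (Function.uncurry fun (y : Sp d) (s : ℝ) =>
      ‖ker (fun ξ => c ξ * symAbsP s ξ) y‖ₑ) (volume.prod (volume.restrict (Ioc a b))) := by
    have := (stronglyMeasurable_ker (measurable_mul_symAbsP hc)).comp_measurable
      (measurable_snd.prodMk measurable_fst : Measurable fun p : Sp d × ℝ => (p.2, p.1))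
    exact this.enorm.aemeasurable
  rw [← lintegral_lintegral_swap hm]
  refine lintegral_mono fun y => ?_
  beta_reduce
  rw [intervalIntegral.integral_of_le hab]
  exact enorm_integral_le_lintegral_enorm _

/-- Writing 1 - e^{-|ξ|} as the integral of |ξ|e^{-s|ξ|} over s in [0, 1] shows a gain of 2^j, which
makes the low frequencies summable. -/
theorem exists_kn_dyad_one_sub_symP_le :
    ∃ C : ℝ≥0, ∀ j : ℤ, kn (dyad φ (fun ξ => symP 1 ξ - 1) j) ≤ C * ENNReal.ofReal ((2 : ℝ) ^ j) := by
  obtain ⟨C, hC⟩ := φ.annular.exists_kn_cut_le (smoothOff_rho none) (homog_rho none)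
  refine ⟨C, fun j => ?_⟩
  have hcc := dyad_symOne_ccSym φ j
  have h0 : symP (d := d) 0 = fun _ => 1 := symP_zero
  have h1 := kn_symP_sub_le hcc.2.continuous.measurable (a := 0) (b := 1) zero_le_one
    (by simpa [h0] using hcc.sym.int) (by
      have := (dyad_ccSym φ (smoothOff_rhoP none 0) j).sym.int
      refine this.congr (.of_forall fun ξ => ?_)
      simp only [dyad, symOne, rhoP, rho, symAbsP]; ring)
  have h2 : kn (dyad φ (fun ξ => symP 1 ξ - 1) j) =
      kn (fun ξ => dyad φ symOne j ξ * symP 0 ξ - dyad φ symOne j ξ * symP 1 ξ) := by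
    have : dyad φ (fun ξ => symP 1 ξ - 1) j = fun ξ =>
        (-1) * (dyad φ symOne j ξ * symP 0 ξ - dyad φ symOne j ξ * symP 1 ξ) := by
      ext ξ; simp only [dyad, symOne, h0]; ring
    rw [this, kn_const_mul]; simp
  rw [h2]
  refine h1.trans ?_
  calc ∫⁻ s in Ioc (0 : ℝ) 1, kn (fun ξ => dyad φ symOne j ξ * symAbsP s ξ)
      ≤ ∫⁻ s in Ioc (0 : ℝ) 1, C * ENNReal.ofReal ((2 : ℝ) ^ j) := by
        refine setLIntegral_mono' measurableSet_Ioc fun s hs => ?_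
        have := hC s hs.1.le j
        have he : (fun ξ => dyad φ symOne j ξ * symAbsP s ξ) =
            cut φ.toFun (fun ξ => rho none ξ * symP s ξ) j := by
          ext ξ; simp only [dyad, symOne, cut, rho, symAbsP]; ring
        rw [he]
        refine this.trans ?_
        gcongr
        rw [pow_one]
        refine mul_le_of_le_one_right (by positivity) (Real.exp_le_one_iff.2 ?_)
        have : 0 ≤ 2 ^ j * s / 8 := by have := hs.1.le; positivity
        linarith
    _ = _ := by simp

theorem hasSum_low_dyad {ξ : Sp d} (hξ : ξ ≠ 0) :
    HasSum (fun j : ℤ => if j ≤ 0 then φ.toFun ((2 : ℝ) ^ (-j) • ξ) else 0) (low φ ξ) := by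
  have h1 := φ.sum_eq_one ξ hξ
  have hinj : Function.Injective (fun n : ℕ => (n : ℤ) + 1) := fun a b hab => by simpa using hab
  obtain ⟨M, hM⟩ := pow_unbounded_of_one_lt ‖ξ‖ (by norm_num : (1 : ℝ) < 2)
  have h3 : HasSum (fun n : ℕ => φ.toFun ((2 : ℝ) ^ (-((n : ℤ) + 1)) • ξ))
      (∑' n : ℕ, φ.toFun ((2 : ℝ) ^ (-((n : ℤ) + 1)) • ξ)) :=
    (summable_of_ne_finset_zero (s := Finset.range M) fun n hn =>
      high_eq_zero φ hM (not_lt.1 fun h => hn (Finset.mem_range.2 h))).hasSum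
  have h4 := (hinj.hasSum_iff (f := fun j : ℤ => if j ≤ 0 then 0 else φ.toFun ((2 : ℝ) ^ (-j) • ξ))
    (by
      intro j hj
      have hj0 : j ≤ 0 := by
        by_contra hpos
        exact hj ⟨(j - 1).toNat, by simp; omega⟩
      simp [hj0])).1 (by
      convert h3 using 1
      ext n
      have : ¬ ((n : ℤ) + 1 ≤ 0) := by omega
      simp only [Function.comp_apply, if_neg this])
  have h5 := h1.sub h4
  rw [low]
  have hfun : (fun j : ℤ => if j ≤ 0 then φ.toFun ((2 : ℝ) ^ (-j) • ξ) else 0) = fun j : ℤ =>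
      φ.toFun ((2 : ℝ) ^ (-j) • ξ) - if j ≤ 0 then 0 else φ.toFun ((2 : ℝ) ^ (-j) • ξ) := by
    funext j
    split_ifs <;> simp
  rw [hfun]
  exact h5

theorem lowSym_zero_apply (ξ : Sp d) : lowSym φ 0 ξ = (low φ ξ : ℂ) := by
  simp [lowSym]

theorem lintegral_low_lt_top [NeZero d] :
    ∑' j : ℤ, ∫⁻ ξ : Sp d, ENNReal.ofReal (if j ≤ 0 then φ.toFun ((2 : ℝ) ^ (-j) • ξ) else 0) < ⊤ := by
  have hφ := φ.smooth.continuous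
  rw [← lintegral_tsum fun j => by split_ifs <;> fun_prop]
  have h1 : ∫⁻ ξ, ‖lowSym φ 0 ξ‖ₑ < ⊤ := (lowSym_ccSym φ 0).sym.int.2
  refine lt_of_le_of_lt (lintegral_mono_ae ?_) h1
  filter_upwards [ae_ne_zero] with ξ hξ
  have h2 := hasSum_low_dyad φ hξ
  have h0 : ∀ j : ℤ, 0 ≤ if j ≤ 0 then φ.toFun ((2 : ℝ) ^ (-j) • ξ) else 0 := fun j => by
    split_ifs
    · exact (φ.mem_Icc _).1
    · exact le_rfl
  rw [← ENNReal.ofReal_tsum_of_nonneg h0 h2.summable, h2.tsum_eq, lowSym_zero_apply, ← ofReal_norm,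
    Complex.norm_real]
  exact ENNReal.ofReal_le_ofReal (le_abs_self _)

/-- The blocks of e^{-|ξ|} have kernels of comparable L¹ norm as j → -∞, so their series does not
converge absolutely. Subtracting the smooth low-frequency cutoff replaces them by blocks of e^{-|ξ|}
- 1, of size 2^j, and the cutoff is added back at the end. -/
theorem sym_symP_one [NeZero d] (φ : DyadicCutoff d) : Sym (symP (d := d) 1) := by
  -- The j-th piece of e^{-|ξ|} minus the low-frequency cutoff.
  set q : ℤ → Sp d → ℂ := fun j =>
    if j ≤ 0 then dyad φ (fun ξ => symP 1 ξ - 1) j else dyad φ (symP 1) j with hq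
  have hqs : ∀ j, Sym (q j) := by
    intro j
    simp only [hq]
    split_ifs
    · exact (dyad_ccSym φ (fun ξ hξ => (smoothOff_symP 1 ξ hξ).sub contDiffAt_const) j).sym
    · exact (dyad_ccSym φ (smoothOff_symP 1) j).sym
  have hqv : ∀ j ξ, q j ξ = dyad φ (symP 1) j ξ -
      ((if j ≤ 0 then φ.toFun ((2 : ℝ) ^ (-j) • ξ) else 0 : ℝ) : ℂ) := by
    intro j ξ
    simp only [hq]
    split_ifs
    · simp only [dyad]; ring
    · simp
  have hsum : ∀ ξ, ξ ≠ 0 → HasSum (fun j => q j ξ) (symP 1 ξ - lowSym φ 0 ξ) := by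
    intro ξ hξ
    simp only [hqv, lowSym_zero_apply]
    exact (hasSum_dyad φ _ hξ).sub (Complex.hasSum_ofReal.2 (hasSum_low_dyad φ hξ))
  have hint : ∑' j, ∫⁻ ξ, ‖q j ξ‖ₑ ≠ ⊤ := by
    refine ne_of_lt (lt_of_le_of_lt (b := ∑' j, (∫⁻ ξ, ‖dyad φ (symP 1) j ξ‖ₑ) +
      ∑' j : ℤ, ∫⁻ ξ : Sp d, ENNReal.ofReal (if j ≤ 0 then φ.toFun ((2 : ℝ) ^ (-j) • ξ) else 0)) ?_ ?_)
    · rw [← ENNReal.tsum_add]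
      refine ENNReal.tsum_le_tsum fun j => ?_
      rw [← lintegral_add_left
        (dyad_ccSym φ (smoothOff_symP 1) j).2.continuous.enorm.measurable]
      refine lintegral_mono fun ξ => ?_
      simp only [hqv]
      refine (enorm_sub_le).trans ?_
      gcongr
      rw [← ofReal_norm, Complex.norm_real, Real.norm_of_nonneg]
      split_ifs
      · exact (φ.mem_Icc _).1
      · exact le_rfl
    · rw [tsum_lintegral_dyad φ (continuous_symP 1).measurable]
      exact ENNReal.add_lt_top.2 ⟨(integrable_symP one_pos).2, lintegral_low_lt_top φ⟩
  have hkn : ∑' j, kn (q j) ≠ ⊤ := by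
    obtain ⟨C₁, h₁⟩ := exists_kn_dyad_one_sub_symP_le φ
    obtain ⟨C₂, h₂⟩ := φ.annular.exists_kn_cut_le (smoothOff_const 1) homog_one
    refine ne_of_lt (lt_of_le_of_lt (b := ∑' j : ℤ, (C₁ + C₂ * 8) * ENNReal.ofReal ((2 : ℝ) ^ (-|j|)))
      (ENNReal.tsum_le_tsum fun j => ?_) ?_)
    · simp only [hq]
      split_ifs with hj
      · refine (h₁ j).trans ?_
        rw [abs_of_nonpos hj, neg_neg, add_mul]
        exact le_self_add
      · have h3 : dyad φ (symP 1) j = cut φ.toFun (fun ξ => 1 * symP 1 ξ) j := by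
          ext ξ; simp only [dyad, cut, one_mul]
        rw [h3]
        refine (h₂ 1 zero_le_one j).trans ?_
        rw [add_mul, pow_zero, one_mul, mul_assoc]
        refine le_add_left ?_
        rw [show (8 : ℝ≥0∞) = ENNReal.ofReal 8 by simp, ← ENNReal.ofReal_mul (by norm_num)]
        exact mul_le_mul_right (ENNReal.ofReal_le_ofReal (exp_neg_two_zpow_le (by omega))) _
    · rw [ENNReal.tsum_mul_left]
      exact ENNReal.mul_lt_top (by finiteness) tsum_two_zpow_neg_abs
  have h := Sym.of_hasSum hqs hint hsum
    ((continuous_symP 1).sub (lowSym_ccSym φ 0).2.continuous)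
    ((integrable_symP one_pos).sub (lowSym_ccSym φ 0).sym.int) hkn
  have := h.add (lowSym_ccSym φ 0).sym
  simpa using this

theorem symP_eq_comp_smul (t : ℝ) (ht : 0 < t) : symP (d := d) t = fun ξ => symP 1 (t • ξ) := by
  ext ξ; simp [symP, norm_smul, abs_of_pos ht]

theorem sym_symP [NeZero d] (φ : DyadicCutoff d) {t : ℝ} (ht : 0 < t) : Sym (symP (d := d) t) := by
  rw [symP_eq_comp_smul t ht]
  exact (sym_symP_one φ).comp_smul ht

theorem kn_symP {t : ℝ} (ht : 0 < t) : kn (symP (d := d) t) = kn (symP (d := d) 1) := by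
  rw [symP_eq_comp_smul t ht, kn_comp_smul _ ht]

end HeatSymbols

/-! ### Approximate identities and almost everywhere limits -/

section ApproximateIdentity

variable {d : ℕ}

theorem ae_norm_le_of_eLpNorm_top {α : Type*} [MeasurableSpace α] {μ : Measure α} {g : α → ℂ}
    (hb : eLpNorm g ⊤ μ < ⊤) : ∀ᵐ y ∂μ, ‖g y‖ ≤ (eLpNorm g ⊤ μ).toReal := by
  filter_upwards [ae_le_eLpNormEssSup (f := g) (μ := μ)] with y hy
  rw [← toReal_enorm]
  exact ENNReal.toReal_mono hb.ne (by rwa [eLpNorm_exponent_top])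

theorem eLpNorm_top_le_of_forall {α : Type*} [MeasurableSpace α] {μ : Measure α} {g : α → ℂ}
    {C : ℝ≥0∞} (h : ∀ x, ‖g x‖ₑ ≤ C) : eLpNorm g ⊤ μ ≤ C := by
  rw [eLpNorm_exponent_top]
  exact eLpNormEssSup_le_of_ae_enorm_bound (.of_forall h)

/-- Replacing ξ by c_n ξ concentrates the kernel near the origin without changing its integral,
which is `m 0`. -/
theorem tendsto_funMult_comp_smul {m h : Sp d → ℂ} (hm : Sym m) (hh : Continuous h)
    (hb : eLpNorm h ⊤ volume < ⊤) {c : ℕ → ℝ} (hc : ∀ n, 0 < c n)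
    (hc0 : Filter.Tendsto c Filter.atTop (nhds 0)) (x : Sp d) :
    Filter.Tendsto (fun n => funMult (fun ξ => m (c n • ξ)) h x) Filter.atTop
      (nhds (m 0 * h x)) := by
  have hbound : ∀ y, ‖h y‖ ≤ (eLpNorm h ⊤ volume).toReal := by
    have hs : IsClosed {y | ‖h y‖ ≤ (eLpNorm h ⊤ volume).toReal} :=
      isClosed_le hh.norm continuous_const
    have hd : Dense {y | ‖h y‖ ≤ (eLpNorm h ⊤ volume).toReal} :=
      Measure.dense_of_ae (ae_norm_le_of_eLpNorm_top hb)
    intro y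
    have := hd.closure_eq
    rw [hs.closure_eq] at this
    exact this.ge (mem_univ y)
  have hrepr : ∀ n, funMult (fun ξ => m (c n • ξ)) h x = ∫ u, ker m u * h (x - c n • u) := by
    intro n
    rw [funMult_eq, ← integral_sub_left_eq_self _ volume x]
    simp only [sub_sub_cancel, ker_comp_smul m (hc n)]
    have hi := Measure.integral_comp_smul (volume : Measure (Sp d))
      (fun y => ker m ((c n)⁻¹ • y) * h (x - y)) (c n)
    simp only [smul_smul, inv_mul_cancel₀ (hc n).ne', one_smul] at hi
    rw [hi, finrank_euclideanSpace, Fintype.card_fin, abs_of_pos (by have := hc n; positivity),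
      ← integral_smul]
    congr 1; ext y
    rw [Complex.real_smul]; ring
  simp only [hrepr]
  rw [← hm.integral_ker, ← integral_mul_const]
  refine tendsto_integral_of_dominated_convergence
    (fun u => ‖ker m u‖ * (eLpNorm h ⊤ volume).toReal) (fun n => ?_) (hm.kint.norm.mul_const _)
    (fun n => .of_forall fun u => ?_) (.of_forall fun u => ?_)
  · exact hm.kint.1.mul (by fun_prop)
  · rw [norm_mul]; gcongr; exact hbound _
  · refine Filter.Tendsto.const_mul _ ?_
    have h1 : Filter.Tendsto (fun n => x - c n • u) Filter.atTop (nhds (x - (0 : ℝ) • u)) :=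
      tendsto_const_nhds.sub (hc0.smul_const u)
    rw [zero_smul, sub_zero] at h1
    exact (hh.tendsto x).comp h1

/-- A pairing with a test function thus becomes the value at 0 of a multiplier, so that commutation
of multipliers can be used. -/
theorem exists_sym_ker_eq {θ : Sp d → ℝ} (hs : ContDiff ℝ ∞ θ) (hc : HasCompactSupport θ) :
    ∃ m, Sym m ∧ ∀ y, ker m (0 - y) = (θ y : ℂ) := by
  have hc' : HasCompactSupport (fun y => (θ (-y) : ℂ)) :=
    (hc.comp_homeomorph (Homeomorph.neg (Sp d))).comp_left (g := Complex.ofReal) (by simp)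
  have hs' : ContDiff ℝ ∞ (fun y => (θ (-y) : ℂ)) :=
    Complex.ofRealCLM.contDiff.comp (hs.comp contDiff_neg)
  set T : 𝓢(Sp d, ℂ) := hc'.toSchwartzMap hs' with hT
  set m : Sp d → ℂ := fun ξ => (𝓕 T : 𝓢(Sp d, ℂ)) ((2 * Real.pi)⁻¹ • ξ) with hm
  have h1 : ker m = T := by
    have : (fun ξ : Sp d => m ((2 * Real.pi) • ξ)) = (𝓕 T : 𝓢(Sp d, ℂ)) := by
      ext ξ
      simp only [hm, smul_smul]
      rw [inv_mul_cancel₀ (by positivity), one_smul]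
    rw [ker, this, ← SchwartzMap.fourierInv_coe]
    congr 1
    exact FourierTransform.fourierInv_fourier_eq T
  refine ⟨m, ⟨?_, ?_, ?_⟩, fun y => ?_⟩
  · exact (𝓕 T : 𝓢(Sp d, ℂ)).continuous.comp (continuous_const_smul _)
  · exact (integrable_comp_smul_iff volume _ (by positivity)).2 (𝓕 T : 𝓢(Sp d, ℂ)).integrable
  · rw [h1]; exact T.integrable
  · rw [h1]; simp [hT]

/-- Tested against a smooth θ, the approximations converge in two ways: to the pairing with F by
dominated convergence, and to `m 0` times the pairing with g by moving the approximate identity onto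
the continuous function θ-multiplier of g. So a pointwise limit, once it exists, can only be `m 0`
times g. -/
theorem ae_eq_of_tendsto_funMult {m g F : Sp d → ℂ} (hm : Sym m)
    (hg : AEStronglyMeasurable g) (hb : eLpNorm g ⊤ volume < ⊤) {c : ℕ → ℝ} (hc : ∀ n, 0 < c n)
    (hc0 : Filter.Tendsto c Filter.atTop (nhds 0)) (hF : ∀ᵐ x, Filter.Tendsto
      (fun n => funMult (fun ξ => m (c n • ξ)) g x) Filter.atTop (nhds (F x))) :
    ∀ᵐ x, F x = m 0 * g x := by
  set A : ℝ := (kn m * eLpNorm g ⊤ volume).toReal with hA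
  have hfin : kn m * eLpNorm g ⊤ volume < ⊤ := ENNReal.mul_lt_top hm.kn_lt_top hb
  have hmn : ∀ n, Sym (fun ξ => m (c n • ξ)) := fun n => hm.comp_smul (hc n)
  have hbd : ∀ n x, ‖funMult (fun ξ => m (c n • ξ)) g x‖ ≤ A := by
    intro n x
    rw [← toReal_enorm]
    refine ENNReal.toReal_mono hfin.ne ?_
    rw [← kn_comp_smul m (hc n)]
    exact funMult_enorm_le _ _ (continuous_ker (hmn n).int) x
  have hcont : ∀ n, Continuous (funMult (fun ξ => m (c n • ξ)) g) := fun n =>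
    continuous_funMult (hmn n).kint hg hb
  have hFm : AEStronglyMeasurable F :=
    aestronglyMeasurable_of_tendsto_ae _ (fun n => (hcont n).aestronglyMeasurable) hF
  have hFb : ∀ᵐ x, ‖F x‖ ≤ A := by
    filter_upwards [hF] with x hx
    exact le_of_tendsto hx.norm (.of_forall fun n => hbd n x)
  have hgb := ae_norm_le_of_eLpNorm_top hb
  have hdiff : LocallyIntegrable (fun x => F x - m 0 * g x) volume := by
    have : MemLp (fun x => F x - m 0 * g x) ⊤ volume :=
      memLp_top_of_bound (hFm.sub (hg.const_mul _)) (A + ‖m 0‖ * (eLpNorm g ⊤ volume).toReal) (by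
        filter_upwards [hFb, hgb] with x h1 h2
        refine (norm_sub_le _ _).trans ?_
        rw [norm_mul]; gcongr)
    exact this.locallyIntegrable le_top
  have hz := ae_eq_zero_of_integral_contDiff_smul_eq_zero hdiff (fun θ hs hcs => by
    obtain ⟨m', hm', hk⟩ := exists_sym_ker_eq hs hcs
    have hθ : Integrable (fun y => (θ y : ℂ)) := by
      have := hm'.kint.comp_sub_left 0
      simpa only [hk] using this
    have hh : Continuous (funMult m' g) := continuous_funMult hm'.kint hg hb
    have hhb : eLpNorm (funMult m' g) ⊤ volume < ⊤ :=
      (eLpNorm_funMult_le m' g (continuous_ker hm'.int)).trans_lt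
        (ENNReal.mul_lt_top hm'.kn_lt_top hb)
    have hlim1 := tendsto_funMult_comp_smul hm hh hhb hc hc0 0
    -- The two multipliers commute, so the approximate identity may act before or after the test
    -- function.
    have hcomm : ∀ n, funMult (fun ξ => m (c n • ξ)) (funMult m' g) 0 =
        ∫ y, (θ y : ℂ) * funMult (fun ξ => m (c n • ξ)) g y := by
      intro n
      rw [funMult_funMult (hmn n) hm' hg hb]
      have : (fun ξ => m (c n • ξ) * m' ξ) = fun ξ => m' ξ * m (c n • ξ) := by ext ξ; ring
      rw [this, ← funMult_funMult hm' (hmn n) hg hb, funMult_eq]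
      simp only [hk]
    simp only [hcomm] at hlim1
    have hlim2 : Filter.Tendsto (fun n => ∫ y, (θ y : ℂ) * funMult (fun ξ => m (c n • ξ)) g y)
        Filter.atTop (nhds (∫ y, (θ y : ℂ) * F y)) := by
      refine tendsto_integral_of_dominated_convergence (fun y => ‖(θ y : ℂ)‖ * A)
        (fun n => hθ.1.mul (hcont n).aestronglyMeasurable) (hθ.norm.mul_const _)
        (fun n => .of_forall fun y => ?_) ?_
      · rw [norm_mul]; gcongr; exact hbd n y
      · filter_upwards [hF] with y hy using hy.const_mul _
    have heq := tendsto_nhds_unique hlim1 hlim2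
    rw [funMult_eq] at heq
    simp only [hk] at heq
    have hi1 : Integrable (fun y => (θ y : ℂ) * F y) := hθ.mul_bdd hFm hFb
    have hi2 : Integrable (fun y => (θ y : ℂ) * (m 0 * g y)) := by
      refine hθ.mul_bdd (c := ‖m 0‖ * (eLpNorm g ⊤ volume).toReal) (hg.const_mul _) ?_
      filter_upwards [hgb] with y hy
      rw [norm_mul]; gcongr
    calc ∫ x, θ x • (F x - m 0 * g x) = ∫ x, ((θ x : ℂ) * F x - (θ x : ℂ) * (m 0 * g x)) := by
          congr 1; ext x; rw [Complex.real_smul, mul_sub]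
      _ = 0 := by
          rw [integral_sub hi1 hi2, ← heq, ← integral_const_mul, sub_eq_zero]
          congr 1; ext y; ring)
  filter_upwards [hz] with x hx
  exact sub_eq_zero.1 hx

end ApproximateIdentity

/-! ### Dyadic blocks of products of bounded functions -/

section Products

variable {d : ℕ} (φ : DyadicCutoff d)

theorem lowSym_comp_smul (k : ℤ) (n : ℕ) :
    lowSym φ (k + n) = fun ξ => lowSym φ k (((1 : ℝ) / 2) ^ n • ξ) := by
  ext ξ
  simp only [lowSym]
  congr 2
  have : ((1 : ℝ) / 2) ^ n = 2 ^ (-(n : ℤ)) := by simp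
  rw [this, two_zpow_smul_smul]
  congr 2; ring

theorem lowSym_apply_zero (k : ℤ) : lowSym φ k 0 = 1 := by simp [lowSym, low_zero]

theorem kn_lowSym (k : ℤ) : kn (lowSym φ k) = kn (lowSym φ 0) := by
  have : lowSym φ k = fun ξ => lowSym φ 0 ((2 : ℝ) ^ (-k) • ξ) := by
    ext ξ; simp [lowSym]
  rw [this, kn_comp_smul _ (by positivity)]

theorem kn_dyad_symOne (j : ℤ) : kn (dyad φ symOne j) = kn (dyad φ symOne 0) := by
  have : dyad φ symOne j = fun ξ => dyad φ symOne 0 ((2 : ℝ) ^ (-j) • ξ) := by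
    ext ξ; simp [dyad, symOne]
  rw [this, kn_comp_smul _ (by positivity)]

theorem funMult_lowSym_add {g : Sp d → ℂ} (hg : AEStronglyMeasurable g)
    (hb : eLpNorm g ⊤ volume < ⊤) (k : ℤ) (n : ℕ) (x : Sp d) :
    funMult (lowSym φ (k + n)) g x = funMult (lowSym φ k) g x +
      ∑ i ∈ Finset.range n, funMult (dyad φ symOne (k + 1 + i)) g x := by
  induction n with
  | zero => simp
  | succ n ih =>
    rw [Finset.sum_range_succ, ← add_assoc, ← ih]
    have h1 : lowSym φ (k + (n + 1 : ℕ)) = fun ξ => lowSym φ (k + n) ξ +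
        dyad φ symOne (k + 1 + n) ξ := by
      ext ξ
      have := lowSym_succ φ (k + n) ξ
      push_cast
      rw [← add_assoc, this]
      congr 2; ring
    rw [h1, funMult_symbol_add (lowSym_ccSym φ _).sym (dyad_symOne_ccSym φ _).sym hg hb]

/-- If the right side is finite, the low-frequency truncations of g converge at almost every point,
and as an approximate identity they can converge only to g. Keeping the low part avoids any
reconstruction of g modulo polynomials. -/
theorem eLpNorm_sub_low_le {g : Sp d → ℂ} (hg : AEStronglyMeasurable g)
    (hb : eLpNorm g ⊤ volume < ⊤) (k : ℤ) :
    eLpNorm (fun x => g x - funMult (lowSym φ k) g x) ⊤ volume ≤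
      ∑' n : ℕ, eLpNorm (funMult (dyad φ symOne (k + 1 + n)) g) ⊤ volume := by
  by_cases hfin : ∑' n : ℕ, eLpNorm (funMult (dyad φ symOne (k + 1 + n)) g) ⊤ volume = ⊤
  · rw [hfin]; exact le_top
  have hle : ∀ᵐ x, ∀ n : ℕ, ‖funMult (dyad φ symOne (k + 1 + n)) g x‖ₑ ≤
      eLpNorm (funMult (dyad φ symOne (k + 1 + n)) g) ⊤ volume := by
    rw [ae_all_iff]
    intro n
    filter_upwards [ae_le_eLpNormEssSup (f := funMult (dyad φ symOne (k + 1 + n)) g)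
      (μ := volume)] with x hx
    rwa [eLpNorm_exponent_top]
  have hsum : ∀ᵐ x, Summable (fun n : ℕ => funMult (dyad φ symOne (k + 1 + n)) g x) := by
    filter_upwards [hle] with x hx
    refine Summable.of_norm ?_
    have : ∑' n : ℕ, ‖funMult (dyad φ symOne (k + 1 + n)) g x‖ₑ ≠ ⊤ :=
      ne_top_of_le_ne_top hfin (ENNReal.tsum_le_tsum hx)
    have := ENNReal.summable_toReal this
    simpa only [toReal_enorm] using this
  have hF := ae_eq_of_tendsto_funMult (lowSym_ccSym φ k).sym hg hb
    (c := fun n => ((1 : ℝ) / 2) ^ n) (fun n => by positivity)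
    (tendsto_pow_atTop_nhds_zero_of_lt_one (by norm_num) (by norm_num))
    (F := fun x => funMult (lowSym φ k) g x +
      ∑' n : ℕ, funMult (dyad φ symOne (k + 1 + n)) g x) (by
      filter_upwards [hsum] with x hx
      simp only [← lowSym_comp_smul, funMult_lowSym_add φ hg hb]
      exact tendsto_const_nhds.add hx.hasSum.tendsto_sum_nat)
  rw [eLpNorm_exponent_top]
  refine eLpNormEssSup_le_of_ae_enorm_bound ?_
  filter_upwards [hF, hle] with x hx hlex
  rw [lowSym_apply_zero, one_mul] at hx
  rw [← hx, add_sub_cancel_left]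
  exact enorm_tsum_le_tsum_enorm.trans (ENNReal.tsum_le_tsum hlex)

theorem integral_conv_swap {A L g : Sp d → ℂ} (hA : Integrable A) (hL : Integrable L)
    (hg : AEStronglyMeasurable g) (hb : eLpNorm g ⊤ volume < ⊤) :
    ∫ u, A u * ∫ y, L (u - y) * g y = ∫ y, (∫ u, A u * L (u - y)) * g y := by
  have hI : Integrable (fun p : Sp d × Sp d => A p.2 * L (p.2 - p.1) * g p.1)
      (volume.prod volume) := by
    have h := hA.convolution_integrand (ContinuousLinearMap.mul ℂ ℂ) hL.comp_neg
    simp only [ContinuousLinearMap.mul_apply', neg_sub] at h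
    exact h.mul_bdd (c := (eLpNorm g ⊤ volume).toReal) hg.comp_fst
      (Measure.quasiMeasurePreserving_fst.ae (ae_norm_le_of_eLpNorm_top hb))
  calc ∫ u, A u * ∫ y, L (u - y) * g y = ∫ u, ∫ y, A u * L (u - y) * g y := by
        congr 1; ext u; rw [← integral_const_mul]; congr 1; ext y; ring
    _ = ∫ y, ∫ u, A u * L (u - y) * g y := by rw [integral_integral_swap]; exact hI.swap
    _ = _ := by congr 1; ext y; rw [integral_mul_const]

theorem integral_mul_ker_swap {A m : Sp d → ℂ} (hA : Integrable A) (hm : Integrable m) (y : Sp d) :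
    ∫ u, A u * ker m (u - y) = ∫ ξ : Sp d, (∫ u, A u *
      Complex.exp (2 * Real.pi * Complex.I * (inner ℝ ξ (u - y) : ℝ))) * m ((2 * Real.pi) • ξ) := by
  have hI : Integrable (fun p : Sp d × Sp d => A p.1 *
      Complex.exp (2 * Real.pi * Complex.I * (inner ℝ p.2 (p.1 - y) : ℝ)) *
        m ((2 * Real.pi) • p.2)) (volume.prod volume) := by
    refine (hA.mul_prod (integrable_comp_two_pi_smul hm)).mono ?_ (.of_forall fun p => ?_)
    · exact (hA.1.comp_fst.mul (by fun_prop)).mul (integrable_comp_two_pi_smul hm).1.comp_snd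
    · simp only [norm_mul, norm_wave, mul_one, le_refl]
  calc ∫ u, A u * ker m (u - y) = ∫ u, ∫ ξ : Sp d, A u *
      Complex.exp (2 * Real.pi * Complex.I * (inner ℝ ξ (u - y) : ℝ)) * m ((2 * Real.pi) • ξ) := by
        congr 1; ext u; rw [ker_apply, ← integral_const_mul]; congr 1; ext ξ; ring
    _ = _ := by
        rw [integral_integral_swap hI]
        congr 1; ext ξ; rw [integral_mul_const]

theorem integral_ker_mul_wave {m : Sp d → ℂ} (hm : Sym m) (x η : Sp d) :
    ∫ u, ker m (x - u) * Complex.exp (2 * Real.pi * Complex.I * (inner ℝ η u : ℝ)) =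
      Complex.exp (2 * Real.pi * Complex.I * (inner ℝ η x : ℝ)) * m ((2 * Real.pi) • η) := by
  have h := congrFun hm.fourier_ker η
  rw [Real.fourier_eq'] at h
  rw [← h, ← integral_sub_left_eq_self _ volume x, ← integral_const_mul]
  congr 1; ext w
  rw [sub_sub_cancel, smul_eq_mul, mul_left_comm, mul_comm (ker m w), ← mul_assoc,
    ← Complex.exp_add]
  congr 2
  rw [inner_sub_right, real_inner_comm w η]
  push_cast; ring

/-- The product of two functions with frequencies at most (8/3)2^k has frequencies at most
(16/3)2^k, below the j-th annulus. For merely bounded g and h this is seen by Fubini: the two low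
kernels are expanded in plane waves, on which Δ̇_j acts by its symbol at the sum of the two
frequencies, and that value is 0. -/
theorem funMult_dyad_low_mul_low {g h : Sp d → ℂ} (hg : AEStronglyMeasurable g)
    (hgb : eLpNorm g ⊤ volume < ⊤) (hh : AEStronglyMeasurable h) (hhb : eLpNorm h ⊤ volume < ⊤)
    {k j : ℤ} (hkj : k + 3 ≤ j) (x : Sp d) :
    funMult (dyad φ symOne j)
      (fun u => funMult (lowSym φ k) g u * funMult (lowSym φ k) h u) x = 0 := by
  set K := ker (dyad φ symOne j) with hK
  set L := ker (lowSym φ k) with hL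
  have hl := (lowSym_ccSym φ k).sym
  have hd := (dyad_symOne_ccSym φ j).sym
  have hLc : Continuous L := continuous_ker hl.int
  have hLb : ∀ y, ‖L y‖ ≤ ∫ ξ : Sp d, ‖lowSym φ k ((2 * Real.pi) • ξ)‖ := norm_ker_le _
  have hKx : Integrable (fun u => K (x - u)) := hd.kint.comp_sub_left x
  have hHc : Continuous (funMult (lowSym φ k) h) := continuous_funMult hl.kint hh hhb
  have hHb : eLpNorm (funMult (lowSym φ k) h) ⊤ volume < ⊤ :=
    (eLpNorm_funMult_le _ _ hLc).trans_lt (ENNReal.mul_lt_top hl.kn_lt_top hhb)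
  have hKH : Integrable (fun u => K (x - u) * funMult (lowSym φ k) h u) :=
    hKx.mul_bdd hHc.aestronglyMeasurable (ae_norm_le_of_eLpNorm_top hHb)
  have hKL : ∀ y, Integrable (fun u => K (x - u) * L (u - y)) := fun y =>
    hKx.mul_bdd (hLc.comp (by fun_prop)).aestronglyMeasurable (.of_forall fun u => hLb _)
  have core : ∀ y y', ∫ u, K (x - u) * L (u - y) * L (u - y') = 0 := by
    intro y y'
    rw [integral_mul_ker_swap (hKL y) hl.int y']
    refine integral_eq_zero_of_ae (.of_forall fun ζ => ?_)
    simp only [Pi.zero_apply, mul_eq_zero]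
    by_cases hζ : lowSym φ k ((2 * Real.pi) • ζ) = 0
    · exact Or.inr hζ
    left
    have h1 : Integrable (fun u => K (x - u) *
        Complex.exp (2 * Real.pi * Complex.I * (inner ℝ ζ (u - y') : ℝ))) :=
      hKx.mul_bdd (c := 1) (by fun_prop) (.of_forall fun u => (norm_wave _ _).le)
    have h2 := integral_mul_ker_swap h1 hl.int y
    have h3 : ∀ u, K (x - u) * L (u - y) *
        Complex.exp (2 * Real.pi * Complex.I * (inner ℝ ζ (u - y') : ℝ)) = K (x - u) *
        Complex.exp (2 * Real.pi * Complex.I * (inner ℝ ζ (u - y') : ℝ)) * L (u - y) := fun u => by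
      ring
    simp only [h3]
    rw [h2]
    refine integral_eq_zero_of_ae (.of_forall fun ξ => ?_)
    simp only [Pi.zero_apply, mul_eq_zero]
    by_cases hξ : lowSym φ k ((2 * Real.pi) • ξ) = 0
    · exact Or.inr hξ
    left
    have h4 : ∀ u : Sp d, K (x - u) * Complex.exp (2 * Real.pi * Complex.I * (inner ℝ ζ (u - y') : ℝ)) *
        Complex.exp (2 * Real.pi * Complex.I * (inner ℝ ξ (u - y) : ℝ)) =
        K (x - u) * Complex.exp (2 * Real.pi * Complex.I * (inner ℝ (ζ + ξ) u : ℝ)) *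
        Complex.exp (-(2 * Real.pi * Complex.I * ((inner ℝ ζ y' : ℝ) + (inner ℝ ξ y : ℝ)))) := by
      intro u
      rw [mul_assoc (K (x - u)), mul_assoc (K (x - u)), ← Complex.exp_add, ← Complex.exp_add]
      congr 2
      rw [inner_sub_right, inner_sub_right, inner_add_left]
      push_cast; ring
    simp only [h4]
    rw [integral_mul_const, integral_ker_mul_wave hd]
    have hz : dyad φ symOne j ((2 * Real.pi) • (ζ + ξ)) = 0 := by
      have hlow : ∀ η : Sp d, lowSym φ k η ≠ 0 → ‖η‖ ≤ 8 / 3 * 2 ^ k := by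
        intro η hη
        by_contra hlt
        push Not at hlt
        apply hη
        simp only [lowSym]
        rw [low_eq_zero φ, Complex.ofReal_zero]
        rw [norm_two_zpow_smul, zpow_neg]
        have h2k : (0 : ℝ) < 2 ^ k := by positivity
        rw [lt_inv_mul_iff₀ h2k]; linarith
      by_contra hne
      have h5 : φ.toFun ((2 : ℝ) ^ (-j) • ((2 * Real.pi) • (ζ + ξ))) ≠ 0 := by
        intro h0; apply hne; simp only [dyad, h0]; simp
      have h6 := (φ.scale_of_ne_zero h5).1
      have h7 : ‖(2 * Real.pi) • (ζ + ξ)‖ ≤ 8 / 3 * 2 ^ k + 8 / 3 * 2 ^ k := by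
        rw [smul_add]
        exact (norm_add_le _ _).trans (add_le_add (hlow _ hζ) (hlow _ hξ))
      -- The inner radius (3/4)2^j is at least 6·2^k, larger than (16/3)2^k.
      have h8 : (2 : ℝ) ^ (k + 3) ≤ 2 ^ j := zpow_le_zpow_right₀ (by norm_num) hkj
      rw [zpow_add₀ (by norm_num)] at h8
      norm_num at h8
      have : (0 : ℝ) < 2 ^ k := by positivity
      linarith
    rw [hz]; simp
  calc funMult (dyad φ symOne j)
        (fun u => funMult (lowSym φ k) g u * funMult (lowSym φ k) h u) x
      = ∫ u, (K (x - u) * funMult (lowSym φ k) h u) * ∫ y, L (u - y) * g y := by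
        rw [funMult_eq]; congr 1; ext u; rw [funMult_eq (lowSym φ k) g]; ring
    _ = ∫ y, (∫ u, K (x - u) * funMult (lowSym φ k) h u * L (u - y)) * g y :=
        integral_conv_swap hKH hl.kint hg hgb
    _ = 0 := by
        refine integral_eq_zero_of_ae (.of_forall fun y => ?_)
        simp only [Pi.zero_apply, mul_eq_zero]
        left
        calc ∫ u, K (x - u) * funMult (lowSym φ k) h u * L (u - y)
            = ∫ u, (K (x - u) * L (u - y)) * ∫ y', L (u - y') * h y' := by
              congr 1; ext u; rw [funMult_eq (lowSym φ k) h]; ring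
          _ = ∫ y', (∫ u, K (x - u) * L (u - y) * L (u - y')) * h y' :=
              integral_conv_swap (hKL y) hl.kint hh hhb
          _ = 0 := by simp [core]

theorem eLpNorm_top_mul_le {g h : Sp d → ℂ} :
    eLpNorm (fun x => g x * h x) ⊤ volume ≤ eLpNorm g ⊤ volume * eLpNorm h ⊤ volume := by
  rw [eLpNorm_exponent_top]
  refine eLpNormEssSup_le_of_ae_enorm_bound ?_
  filter_upwards [ae_le_eLpNormEssSup (f := g) (μ := volume),
    ae_le_eLpNormEssSup (f := h) (μ := volume)] with x h1 h2
  rw [enorm_mul, eLpNorm_exponent_top, eLpNorm_exponent_top]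
  gcongr

/-- The constant in the pointwise-in-time product estimate. -/
def prodConst : ℝ≥0∞ := kn (dyad φ symOne 0) * (1 + kn (lowSym φ 0))

theorem prodConst_lt_top : prodConst φ < ⊤ :=
  ENNReal.mul_lt_top (dyad_symOne_ccSym φ 0).sym.kn_lt_top
    (ENNReal.add_lt_top.2 ⟨ENNReal.one_lt_top, (lowSym_ccSym φ 0).sym.kn_lt_top⟩)

/-- The product of the low parts contributes nothing to Δ̇_j(gh), so gh may be replaced by (g - S_k
g)h + S_k g(h - S_k h). Each term has one factor with frequencies at least comparable to 2^j and one
factor measured in sup norm. No paraproduct decomposition is required. -/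
theorem eLpNorm_dyad_mul_le {g h : Sp d → ℂ} (hg : AEStronglyMeasurable g)
    (hgb : eLpNorm g ⊤ volume < ⊤) (hh : AEStronglyMeasurable h) (hhb : eLpNorm h ⊤ volume < ⊤)
    (j : ℤ) :
    eLpNorm (funMult (dyad φ symOne j) (fun x => g x * h x)) ⊤ volume ≤ prodConst φ *
      ((∑' n : ℕ, eLpNorm (funMult (dyad φ symOne (j - 2 + n)) g) ⊤ volume) * eLpNorm h ⊤ volume +
       eLpNorm g ⊤ volume * ∑' n : ℕ, eLpNorm (funMult (dyad φ symOne (j - 2 + n)) h) ⊤ volume) := by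
  -- The largest k for which the low-low product is invisible to Δ̇_j; the remaining blocks start at
  -- k + 1 = j - 2.
  set k := j - 3 with hk
  have hl := (lowSym_ccSym φ k).sym
  have hd := (dyad_symOne_ccSym φ j).sym
  set Sg := funMult (lowSym φ k) g with hSg
  set Sh := funMult (lowSym φ k) h with hSh
  have hSgc : Continuous Sg := continuous_funMult hl.kint hg hgb
  have hShc : Continuous Sh := continuous_funMult hl.kint hh hhb
  have hSgb : eLpNorm Sg ⊤ volume ≤ kn (lowSym φ 0) * eLpNorm g ⊤ volume := by
    rw [← kn_lowSym φ k]; exact eLpNorm_funMult_le _ _ (continuous_ker hl.int)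
  have hShb : eLpNorm Sh ⊤ volume ≤ kn (lowSym φ 0) * eLpNorm h ⊤ volume := by
    rw [← kn_lowSym φ k]; exact eLpNorm_funMult_le _ _ (continuous_ker hl.int)
  have hk0 : kn (lowSym φ 0) < ⊤ := (lowSym_ccSym φ 0).sym.kn_lt_top
  have hSgt : eLpNorm Sg ⊤ volume < ⊤ := hSgb.trans_lt (ENNReal.mul_lt_top hk0 hgb)
  have hSht : eLpNorm Sh ⊤ volume < ⊤ := hShb.trans_lt (ENNReal.mul_lt_top hk0 hhb)
  have hSS : eLpNorm (fun x => Sg x * Sh x) ⊤ volume < ⊤ :=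
    eLpNorm_top_mul_le.trans_lt (ENNReal.mul_lt_top hSgt hSht)
  have hgh : eLpNorm (fun x => g x * h x) ⊤ volume < ⊤ :=
    eLpNorm_top_mul_le.trans_lt (ENNReal.mul_lt_top hgb hhb)
  have hrem : funMult (dyad φ symOne j) (fun x => g x * h x) =
      funMult (dyad φ symOne j) (fun x => g x * h x + (-1) * (Sg x * Sh x)) := by
    ext x
    have hneg : eLpNorm (fun x => (-1) * (Sg x * Sh x)) ⊤ volume < ⊤ := by
      refine lt_of_le_of_lt (eLpNorm_mono fun x => ?_) hSS
      simp
    have hadd := funMult_add (g := fun x => g x * h x) (h := fun x => (-1) * (Sg x * Sh x)) hd.kint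
      (hg.mul hh) hgh ((hSgc.mul hShc).aestronglyMeasurable.const_mul (-1)) hneg x
    rw [hadd, funMult_const_mul, funMult_dyad_low_mul_low φ hg hgb hh hhb (by omega)]
    simp
  rw [hrem]
  refine (eLpNorm_funMult_le _ _ (continuous_ker hd.int)).trans ?_
  rw [kn_dyad_symOne, prodConst, mul_assoc]
  gcongr
  have hR : ∀ f : Sp d → ℂ, (∑' n : ℕ, eLpNorm (funMult (dyad φ symOne (j - 2 + n)) f) ⊤ volume) =
      ∑' n : ℕ, eLpNorm (funMult (dyad φ symOne (k + 1 + n)) f) ⊤ volume := by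
    intro f; congr 1; ext n; rw [hk]; congr 3; ring
  rw [hR, hR]
  have e1 := eLpNorm_sub_low_le φ hg hgb k
  have e2 := eLpNorm_sub_low_le φ hh hhb k
  set Rg := ∑' n : ℕ, eLpNorm (funMult (dyad φ symOne (k + 1 + n)) g) ⊤ volume
  set Rh := ∑' n : ℕ, eLpNorm (funMult (dyad φ symOne (k + 1 + n)) h) ⊤ volume
  have hsplit : (fun x => g x * h x + (-1) * (Sg x * Sh x)) =
      (fun x => (g x - Sg x) * h x) + (fun x => Sg x * (h x - Sh x)) := by
    ext x; simp only [Pi.add_apply]; ring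
  rw [hsplit]
  calc eLpNorm ((fun x => (g x - Sg x) * h x) + (fun x => Sg x * (h x - Sh x))) ⊤ volume
      ≤ eLpNorm (fun x => (g x - Sg x) * h x) ⊤ volume +
        eLpNorm (fun x => Sg x * (h x - Sh x)) ⊤ volume :=
        eLpNorm_add_le ((hg.sub hSgc.aestronglyMeasurable).mul hh)
          (hSgc.aestronglyMeasurable.mul (hh.sub hShc.aestronglyMeasurable)) le_top
    _ ≤ Rg * eLpNorm h ⊤ volume + (kn (lowSym φ 0) * eLpNorm g ⊤ volume) * Rh := by
        refine add_le_add (eLpNorm_top_mul_le.trans ?_) (eLpNorm_top_mul_le.trans ?_)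
        · gcongr
        · gcongr
    _ ≤ _ := by
        rw [mul_add, add_mul, add_mul, one_mul, one_mul, mul_assoc]
        exact add_le_add le_self_add le_add_self

end Products

/-! ### Space-time functions, Chemin-Lerner norms and the tame product law -/

section SpaceTime

variable {d : ℕ}

/-- The supremum of `|g|` over `z < 0`. -/
def LI (g : Sp d → ℝ → ℂ) : ℝ≥0∞ := ⨆ x, ⨆ z : Iio (0 : ℝ), ‖g x z‖ₑ

theorem le_LI (g : Sp d → ℝ → ℂ) (x : Sp d) {z : ℝ} (hz : z < 0) : ‖g x z‖ₑ ≤ LI g :=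
  (le_iSup (fun z : Iio (0 : ℝ) => ‖g x z‖ₑ) ⟨z, hz⟩).trans
    (le_iSup (fun x => ⨆ z : Iio (0 : ℝ), ‖g x z‖ₑ) x)

theorem LI_le {g : Sp d → ℝ → ℂ} {C : ℝ≥0∞} (h : ∀ x z, z < 0 → ‖g x z‖ₑ ≤ C) : LI g ≤ C :=
  iSup_le fun x => iSup_le fun z => h x z z.2

theorem eLpNorm_slice_le (g : Sp d → ℝ → ℂ) {z : ℝ} (hz : z < 0) :
    eLpNorm (fun y => g y z) ⊤ volume ≤ LI g :=
  eLpNorm_top_le_of_forall fun x => le_LI g x hz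

/-- Measurable functions on space-time that are bounded on `z < 0`. -/
structure BM (g : Sp d → ℝ → ℂ) : Prop where
  meas : Measurable (Function.uncurry g)
  fin : LI g < ⊤

theorem BM.slice_meas {g : Sp d → ℝ → ℂ} (hg : BM g) (z : ℝ) : Measurable fun y => g y z :=
  hg.meas.comp measurable_prodMk_right

theorem BM.slice_aesm {g : Sp d → ℝ → ℂ} (hg : BM g) (z : ℝ) :
    AEStronglyMeasurable fun y => g y z := (hg.slice_meas z).aestronglyMeasurable

theorem BM.slice_fin {g : Sp d → ℝ → ℂ} (hg : BM g) {z : ℝ} (hz : z < 0) :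
    eLpNorm (fun y => g y z) ⊤ volume < ⊤ := (eLpNorm_slice_le g hz).trans_lt hg.fin

theorem LI_add_le (g h : Sp d → ℝ → ℂ) : LI (fun x z => g x z + h x z) ≤ LI g + LI h :=
  LI_le fun x _ hz => (enorm_add_le _ _).trans (add_le_add (le_LI g x hz) (le_LI h x hz))

theorem LI_mul_le (g h : Sp d → ℝ → ℂ) : LI (fun x z => g x z * h x z) ≤ LI g * LI h :=
  LI_le fun x z hz => by
    rw [enorm_mul]; exact mul_le_mul' (le_LI g x hz) (le_LI h x hz)

theorem LI_const_mul_le (c : ℂ) (g : Sp d → ℝ → ℂ) : LI (fun x z => c * g x z) ≤ ‖c‖ₑ * LI g :=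
  LI_le fun x z hz => by
    rw [enorm_mul]; gcongr; exact le_LI g x hz

theorem LI_finsetSum_le {ι : Type*} (s : Finset ι) (g : ι → Sp d → ℝ → ℂ) :
    LI (fun x z => ∑ i ∈ s, g i x z) ≤ ∑ i ∈ s, LI (g i) :=
  LI_le fun x _ hz => (enorm_sum_le _ _).trans (Finset.sum_le_sum fun i _ => le_LI (g i) x hz)

theorem LI_tsum_le (g : ℕ → Sp d → ℝ → ℂ) : LI (fun x z => ∑' n, g n x z) ≤ ∑' n, LI (g n) :=
  LI_le fun x _ hz =>
    enorm_tsum_le_tsum_enorm.trans (ENNReal.tsum_le_tsum fun n => le_LI (g n) x hz)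

theorem BM.add {g h : Sp d → ℝ → ℂ} (hg : BM g) (hh : BM h) : BM fun x z => g x z + h x z :=
  ⟨hg.meas.add hh.meas, (LI_add_le g h).trans_lt (ENNReal.add_lt_top.2 ⟨hg.fin, hh.fin⟩)⟩

theorem BM.mul {g h : Sp d → ℝ → ℂ} (hg : BM g) (hh : BM h) : BM fun x z => g x z * h x z :=
  ⟨hg.meas.mul hh.meas, (LI_mul_le g h).trans_lt (ENNReal.mul_lt_top hg.fin hh.fin)⟩

theorem BM.const_mul {g : Sp d → ℝ → ℂ} (hg : BM g) (c : ℂ) : BM fun x z => c * g x z :=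
  ⟨hg.meas.const_mul c, (LI_const_mul_le c g).trans_lt (ENNReal.mul_lt_top (by simp) hg.fin)⟩

theorem BM.neg {g : Sp d → ℝ → ℂ} (hg : BM g) : BM fun x z => -g x z := by
  simpa using hg.const_mul (-1)

theorem BM.sub {g h : Sp d → ℝ → ℂ} (hg : BM g) (hh : BM h) : BM fun x z => g x z - h x z := by
  simpa only [sub_eq_add_neg] using hg.add hh.neg

theorem BM.sum {ι : Type*} (s : Finset ι) {g : ι → Sp d → ℝ → ℂ} (hg : ∀ i, BM (g i)) :
    BM fun x z => ∑ i ∈ s, g i x z := by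
  refine ⟨?_, (LI_finsetSum_le s g).trans_lt (ENNReal.sum_lt_top.2 fun i _ => (hg i).fin)⟩
  exact Finset.measurable_fun_sum s fun i _ => (hg i).meas

theorem summable_of_tsum_LI {g : ℕ → Sp d → ℝ → ℂ} (hs : ∑' n, LI (g n) < ⊤) (x : Sp d) {z : ℝ}
    (hz : z < 0) : Summable fun n => g n x z := by
  refine Summable.of_norm ?_
  have : ∑' n, ‖g n x z‖ₑ ≠ ⊤ :=
    ne_top_of_le_ne_top hs.ne (ENNReal.tsum_le_tsum fun n => le_LI (g n) x hz)
  simpa only [toReal_enorm] using ENNReal.summable_toReal this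

theorem measurable_tsum_nat {α : Type*} [MeasurableSpace α] {f : ℕ → α → ℂ}
    (hf : ∀ n, Measurable (f n)) : Measurable fun x => ∑' n, f n x := by
  exact Measurable.tsum hf

theorem BM.tsum {g : ℕ → Sp d → ℝ → ℂ} (hg : ∀ n, BM (g n)) (hs : ∑' n, LI (g n) < ⊤) :
    BM fun x z => ∑' n, g n x z :=
  ⟨measurable_tsum_nat fun n => (hg n).meas, (LI_tsum_le g).trans_lt hs⟩

theorem BM.const (c : ℂ) : BM (d := d) fun _ _ => c :=
  ⟨measurable_const, (LI_le fun _ _ _ => le_rfl).trans_lt (by simp : ‖c‖ₑ < ⊤)⟩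

/-- The essential supremum of a slice exceeds c exactly when the slice of the set where |g| > c has
positive measure, and the measure of slices is a measurable function. -/
theorem measurable_eLpNorm_slice {α : Type*} [MeasurableSpace α] {g : Sp d → α → ℂ}
    (hg : Measurable (Function.uncurry g)) :
    Measurable fun z => eLpNorm (fun y => g y z) ⊤ volume := by
  refine measurable_of_Ioi fun c => ?_
  have : (fun z => eLpNorm (fun y => g y z) ⊤ volume) ⁻¹' Ioi c =
      (fun z => volume ((fun y => (y, z)) ⁻¹' {p : Sp d × α | c < ‖g p.1 p.2‖ₑ})) ⁻¹' {0}ᶜ := by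
    ext z
    simp only [mem_preimage, mem_Ioi, mem_compl_iff, mem_singleton_iff, eLpNorm_exponent_top]
    rw [← not_le, not_iff_not]
    constructor
    · intro h
      have := (ae_le_eLpNormEssSup (f := fun y => g y z) (μ := volume))
      rw [← nonpos_iff_eq_zero]
      refine (measure_mono ?_).trans_eq this
      intro y hy
      simp only [mem_preimage, mem_ofPred_eq, mem_compl_iff, not_le] at hy ⊢
      exact h.trans_lt hy
    · intro h
      refine eLpNormEssSup_le_of_ae_enorm_bound ?_
      rw [ae_iff]
      simpa using h
  rw [this]
  have hS : MeasurableSet {p : Sp d × α | c < ‖g p.1 p.2‖ₑ} :=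
    measurableSet_lt measurable_const hg.enorm
  exact measurable_measure_prodMk_right hS (measurableSet_singleton 0).compl

theorem measurable_ker_sub_mul {α : Type*} [MeasurableSpace α] {k : α → Sp d → ℂ}
    {g : Sp d → α → ℂ} (hk : Measurable fun p : α × Sp d => k p.1 p.2)
    (hg : Measurable fun p : Sp d × α => g p.1 p.2) :
    Measurable fun p : Sp d × α => ∫ y, k p.2 (p.1 - y) * g y p.2 := by
  have h1 : Measurable fun q : (Sp d × α) × Sp d => (q.1.2, q.1.1 - q.2) := by fun_prop
  have h2 : Measurable fun q : (Sp d × α) × Sp d => (q.2, q.1.2) := by fun_prop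
  have h3 : Measurable fun q : (Sp d × α) × Sp d => k q.1.2 (q.1.1 - q.2) := hk.comp h1
  have h4 : Measurable fun q : (Sp d × α) × Sp d => g q.2 q.1.2 := hg.comp h2
  have h5 : StronglyMeasurable fun q : (Sp d × α) × Sp d =>
      k q.1.2 (q.1.1 - q.2) * g q.2 q.1.2 := (h3.mul h4).stronglyMeasurable
  exact (h5.integral_prod_right' (ν := volume)).measurable

theorem measurable_funMult_uncurry {α : Type*} [MeasurableSpace α] {m : α → Sp d → ℂ}
    {g : Sp d → α → ℂ} (hm : Measurable (Function.uncurry m))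
    (hg : Measurable (Function.uncurry g)) :
    Measurable (Function.uncurry fun (x : Sp d) (a : α) => funMult (m a) (fun y => g y a) x) :=
  measurable_ker_sub_mul (k := fun a => ker (m a)) (stronglyMeasurable_ker hm).measurable hg

theorem measurable_funMult_const {α : Type*} [MeasurableSpace α] {m : Sp d → ℂ}
    {g : Sp d → α → ℂ} (hm : Measurable m) (hg : Measurable (Function.uncurry g)) :
    Measurable (Function.uncurry fun (x : Sp d) (a : α) => funMult m (fun y => g y a) x) :=
  measurable_funMult_uncurry (m := fun _ => m) (hm.comp measurable_snd) hg

theorem hasSum_funMult_tsum {m : Sp d → ℂ} (hm : Integrable (ker m)) {g : ℕ → Sp d → ℂ}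
    (hg : ∀ n, AEStronglyMeasurable (g n)) {G : Sp d → ℂ} (hG : ∀ x, HasSum (fun n => g n x) (G x))
    {b : ℕ → ℝ≥0∞} (hb : ∀ n x, ‖g n x‖ₑ ≤ b n) (hbs : ∑' n, b n ≠ ⊤) (x : Sp d) :
    HasSum (fun n => funMult m (g n) x) (funMult m G x) := by
  have hbf : ∀ n, b n < ⊤ := fun n => (ENNReal.le_tsum n).trans_lt hbs.lt_top
  simp only [funMult_eq]
  have hI : ∀ n, Integrable fun y => ker m (x - y) * g n y := fun n =>
    integrable_ker_mul hm (hg n) ((eLpNorm_top_le_of_forall (hb n)).trans_lt (hbf n)) x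
  have hs : Summable fun n => ∫ y, ‖ker m (x - y) * g n y‖ := by
    refine Summable.of_nonneg_of_le (fun n => by positivity) (fun n => ?_)
      ((ENNReal.summable_toReal hbs).mul_left (∫ y, ‖ker m (x - y)‖))
    rw [← integral_mul_const]
    refine integral_mono (hI n).norm ((hm.comp_sub_left x).norm.mul_const _) fun y => ?_
    simp only [norm_mul]
    gcongr
    rw [← toReal_enorm]
    exact ENNReal.toReal_mono (hbf n).ne (hb n y)
  have h := hasSum_integral_of_summable_integral_norm hI hs
  have e : (fun y => ∑' n, ker m (x - y) * g n y) = fun y => ker m (x - y) * G y := by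
    ext y; rw [tsum_mul_left, (hG y).tsum_eq]
  rwa [e] at h

variable (φ : DyadicCutoff d)

/-- The sup norm of a dyadic block at time `z`. -/
def blk (g : Sp d → ℝ → ℂ) (j : ℤ) (z : ℝ) : ℝ≥0∞ :=
  eLpNorm (funMult (dyad φ symOne j) (fun y => g y z)) ⊤ volume

/-- The Chemin-Lerner norm in `L̃¹(J; Ḃ^s_{∞,1})`. -/
def Bes (s : ℝ) (g : Sp d → ℝ → ℂ) : ℝ≥0∞ :=
  ∑' j : ℤ, (2 : ℝ≥0∞) ^ (s * (j : ℝ)) * ∫⁻ z in Iio (0 : ℝ), blk φ g j z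

theorem dyad_symOne_measurable (j : ℤ) : Measurable (dyad φ symOne j) :=
  (dyad_symOne_ccSym φ j).2.continuous.measurable

theorem measurable_blk {g : Sp d → ℝ → ℂ} (hg : BM g) (j : ℤ) : Measurable (blk φ g j) :=
  measurable_eLpNorm_slice (measurable_funMult_const (dyad_symOne_measurable φ j) hg.meas)

theorem continuous_block {g : Sp d → ℝ → ℂ} (hg : BM g) (j : ℤ) {z : ℝ} (hz : z < 0) :
    Continuous (funMult (dyad φ symOne j) (fun y => g y z)) :=
  continuous_funMult (dyad_symOne_ccSym φ j).sym.kint (hg.slice_aesm z) (hg.slice_fin hz)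

theorem enorm_le_eLpNorm_top {g : Sp d → ℂ} (hg : Continuous g) (x : Sp d) :
    ‖g x‖ₑ ≤ eLpNorm g ⊤ volume := by
  have hs : IsClosed {y | ‖g y‖ₑ ≤ eLpNorm g ⊤ volume} := isClosed_le hg.enorm continuous_const
  have hd : Dense {y | ‖g y‖ₑ ≤ eLpNorm g ⊤ volume} := by
    refine Measure.dense_of_ae (μ := volume) ?_
    rw [eLpNorm_exponent_top]
    exact ae_le_eLpNormEssSup
  have := hd.closure_eq
  rw [hs.closure_eq] at this
  exact this.ge (mem_univ x)

theorem enorm_block_le {g : Sp d → ℝ → ℂ} (hg : BM g) (j : ℤ) {z : ℝ} (hz : z < 0) (x : Sp d) :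
    ‖funMult (dyad φ symOne j) (fun y => g y z) x‖ₑ ≤ blk φ g j z :=
  enorm_le_eLpNorm_top (continuous_block φ hg j hz) x

theorem blk_add_le {g h : Sp d → ℝ → ℂ} (hg : BM g) (hh : BM h) (j : ℤ) {z : ℝ} (hz : z < 0) :
    blk φ (fun x z => g x z + h x z) j z ≤ blk φ g j z + blk φ h j z := by
  refine eLpNorm_top_le_of_forall fun x => ?_
  have := funMult_add (dyad_symOne_ccSym φ j).sym.kint (hg.slice_aesm z) (hg.slice_fin hz)
    (hh.slice_aesm z) (hh.slice_fin hz) x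
  rw [this]
  exact (enorm_add_le _ _).trans (add_le_add (enorm_block_le φ hg j hz x) (enorm_block_le φ hh j hz x))

theorem blk_const_mul (c : ℂ) (g : Sp d → ℝ → ℂ) (j : ℤ) (z : ℝ) :
    blk φ (fun x z => c * g x z) j z = ‖c‖ₑ * blk φ g j z := by
  have : funMult (dyad φ symOne j) (fun y => c * g y z) =
      c • funMult (dyad φ symOne j) (fun y => g y z) := by
    ext x; simp [funMult_const_mul]
  rw [blk, this, eLpNorm_const_smul]; rfl

theorem Bes_add_le (s : ℝ) {g h : Sp d → ℝ → ℂ} (hg : BM g) (hh : BM h) :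
    Bes φ s (fun x z => g x z + h x z) ≤ Bes φ s g + Bes φ s h := by
  simp only [Bes]
  rw [← ENNReal.tsum_add]
  refine ENNReal.tsum_le_tsum fun j => ?_
  rw [← mul_add, ← lintegral_add_left (measurable_blk φ hg j)]
  gcongr 1
  exact setLIntegral_mono' measurableSet_Iio fun z hz => blk_add_le φ hg hh j hz

theorem Bes_const_mul (s : ℝ) (c : ℂ) (g : Sp d → ℝ → ℂ) :
    Bes φ s (fun x z => c * g x z) = ‖c‖ₑ * Bes φ s g := by
  simp only [Bes, blk_const_mul]
  rw [← ENNReal.tsum_mul_left]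
  congr 1; ext j
  rw [lintegral_const_mul' _ _ (by simp)]; ring

theorem Bes_neg (s : ℝ) (g : Sp d → ℝ → ℂ) : Bes φ s (fun x z => -g x z) = Bes φ s g := by
  have := Bes_const_mul φ s (-1) g
  simpa using this

theorem Bes_sub_le (s : ℝ) {g h : Sp d → ℝ → ℂ} (hg : BM g) (hh : BM h) :
    Bes φ s (fun x z => g x z - h x z) ≤ Bes φ s g + Bes φ s h := by
  have := Bes_add_le φ s hg hh.neg
  rw [Bes_neg] at this
  simpa only [sub_eq_add_neg] using this

theorem Bes_zero (s : ℝ) : Bes φ s (fun _ _ => 0) = 0 := by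
  have := Bes_const_mul φ s 0 (fun _ _ => 0)
  simpa using this

theorem Bes_finsetSum_le {ι : Type*} (t : Finset ι) (s : ℝ) {g : ι → Sp d → ℝ → ℂ}
    (hg : ∀ i, BM (g i)) : Bes φ s (fun x z => ∑ i ∈ t, g i x z) ≤ ∑ i ∈ t, Bes φ s (g i) := by
  classical
  induction t using Finset.induction_on with
  | empty => simp [Bes_zero]
  | insert a t ha ih =>
    simp only [Finset.sum_insert ha]
    exact (Bes_add_le φ s (hg a) (BM.sum t hg)).trans (by gcongr)

theorem Bes_tsum_le (s : ℝ) {g : ℕ → Sp d → ℝ → ℂ} (hg : ∀ n, BM (g n))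
    (hs : ∑' n, LI (g n) < ⊤) : Bes φ s (fun x z => ∑' n, g n x z) ≤ ∑' n, Bes φ s (g n) := by
  simp only [Bes]
  rw [ENNReal.tsum_comm]
  refine ENNReal.tsum_le_tsum fun j => ?_
  rw [ENNReal.tsum_mul_left, ← lintegral_tsum fun n => (measurable_blk φ (hg n) j).aemeasurable]
  gcongr 1
  refine setLIntegral_mono' measurableSet_Iio fun z hz => ?_
  refine eLpNorm_top_le_of_forall fun x => ?_
  have := hasSum_funMult_tsum (dyad_symOne_ccSym φ j).sym.kint (fun n => (hg n).slice_aesm z)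
    (fun x => (summable_of_tsum_LI hs x hz).hasSum) (fun n x => le_LI (g n) x hz) hs.ne x
  rw [← this.tsum_eq]
  exact enorm_tsum_le_tsum_enorm.trans
    (ENNReal.tsum_le_tsum fun n => enorm_block_le φ (hg n) j hz x)

theorem funMult_congr_fun {m g h : Sp d → ℂ} (H : ∀ᵐ x, g x = h x) : funMult m g = funMult m h :=
  funMult_congr m H

theorem blk_congr {g h : Sp d → ℝ → ℂ} {j : ℤ} {z : ℝ} (H : ∀ᵐ x, g x z = h x z) :
    blk φ g j z = blk φ h j z := by
  rw [blk, blk, funMult_congr_fun H]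

theorem Bes_congr {s : ℝ} {g h : Sp d → ℝ → ℂ}
    (H : ∀ᵐ z ∂(volume.restrict (Iio (0 : ℝ))), ∀ᵐ x, g x z = h x z) : Bes φ s g = Bes φ s h := by
  simp only [Bes]
  congr 1; ext j; congr 1
  refine lintegral_congr_ae ?_
  filter_upwards [H] with z hz using blk_congr φ hz

/-- The weight summing up the high frequencies in the product estimate. -/
def shiftConst (s : ℝ) : ℝ≥0∞ := ∑' n : ℕ, (2 : ℝ≥0∞) ^ (s * (2 - n))

/-- A geometric series of ratio 2^{-s}. Positive regularity is needed here because a block of a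
product collects all higher frequencies of its factors. -/
theorem shiftConst_lt_top {s : ℝ} (hs : 0 < s) : shiftConst s < ⊤ := by
  have h : ∀ n : ℕ, (2 : ℝ≥0∞) ^ (s * (2 - n)) = 2 ^ (s * 2) * ((2 : ℝ≥0∞) ^ (-s)) ^ n := by
    intro n
    rw [← ENNReal.rpow_natCast, ← ENNReal.rpow_mul, ← ENNReal.rpow_add _ _ (by simp) (by simp)]
    congr 1; ring
  simp only [shiftConst, h]
  rw [ENNReal.tsum_mul_left, ENNReal.tsum_geometric]
  refine ENNReal.mul_lt_top (ENNReal.rpow_lt_top_of_nonneg (by positivity) (by simp)) ?_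
  rw [ENNReal.inv_lt_top, tsub_pos_iff_lt]
  exact ENNReal.rpow_lt_one_of_one_lt_of_neg (by norm_num) (by linarith)

/-- Exchanging the sums and translating j extracts the weight 2^{s(2-n)} from each shift by n - 2, a
discrete convolution identity. -/
theorem tsum_shift (s : ℝ) (a : ℤ → ℝ≥0∞) :
    ∑' j : ℤ, (2 : ℝ≥0∞) ^ (s * (j : ℝ)) * ∑' n : ℕ, a (j - 2 + n) =
      shiftConst s * ∑' j : ℤ, (2 : ℝ≥0∞) ^ (s * (j : ℝ)) * a j := by
  simp only [← ENNReal.tsum_mul_left]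
  rw [ENNReal.tsum_comm, shiftConst, ENNReal.tsum_mul_left, ← ENNReal.tsum_mul_right]
  congr 1; ext n
  rw [← (Equiv.addRight ((2 : ℤ) - n)).tsum_eq, ← ENNReal.tsum_mul_left]
  congr 1; ext j
  rw [← mul_assoc, ← ENNReal.rpow_add _ _ (by simp) (by simp)]
  simp only [Equiv.coe_addRight]
  congr 2
  · push_cast; ring
  · ring

/-- The blockwise estimate is integrated in time with one factor in L¹ and the other in L^∞, and
then summed over j with the weight. The highest norm falls on one factor at a time. -/
theorem Bes_mul_le (s : ℝ) {g h : Sp d → ℝ → ℂ} (hg : BM g) (hh : BM h) :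
    Bes φ s (fun x z => g x z * h x z) ≤
      prodConst φ * shiftConst s * (Bes φ s g * LI h + LI g * Bes φ s h) := by
  have h1 : ∀ j : ℤ, ∫⁻ z in Iio (0 : ℝ), blk φ (fun x z => g x z * h x z) j z ≤ prodConst φ *
      ((∑' n : ℕ, ∫⁻ z in Iio (0 : ℝ), blk φ g (j - 2 + n) z) * LI h +
        LI g * ∑' n : ℕ, ∫⁻ z in Iio (0 : ℝ), blk φ h (j - 2 + n) z) := by
    intro j
    rw [← lintegral_tsum fun n => (measurable_blk φ hg _).aemeasurable,
      ← lintegral_tsum fun n => (measurable_blk φ hh _).aemeasurable,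
      ← lintegral_mul_const' _ _ hh.fin.ne, ← lintegral_const_mul' _ _ hg.fin.ne,
      ← lintegral_add_left, ← lintegral_const_mul' _ _ (prodConst_lt_top φ).ne]
    · refine setLIntegral_mono' measurableSet_Iio fun z hz => ?_
      refine (eLpNorm_dyad_mul_le φ (hg.slice_aesm z) (hg.slice_fin hz) (hh.slice_aesm z)
        (hh.slice_fin hz) j).trans ?_
      gcongr
      · exact le_rfl
      · exact eLpNorm_slice_le h hz
      · exact eLpNorm_slice_le g hz
      · exact le_rfl
    · exact (Measurable.tsum fun n => measurable_blk φ hg _).mul_const _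
  calc Bes φ s (fun x z => g x z * h x z)
      ≤ ∑' j : ℤ, (2 : ℝ≥0∞) ^ (s * (j : ℝ)) * (prodConst φ *
        ((∑' n : ℕ, ∫⁻ z in Iio (0 : ℝ), blk φ g (j - 2 + n) z) * LI h +
        LI g * ∑' n : ℕ, ∫⁻ z in Iio (0 : ℝ), blk φ h (j - 2 + n) z)) :=
        ENNReal.tsum_le_tsum fun j => mul_le_mul_right (h1 j) _
    _ = prodConst φ * ((∑' j : ℤ, (2 : ℝ≥0∞) ^ (s * (j : ℝ)) *
          ∑' n : ℕ, ∫⁻ z in Iio (0 : ℝ), blk φ g (j - 2 + n) z) * LI h +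
        LI g * ∑' j : ℤ, (2 : ℝ≥0∞) ^ (s * (j : ℝ)) *
          ∑' n : ℕ, ∫⁻ z in Iio (0 : ℝ), blk φ h (j - 2 + n) z) := by
        rw [← ENNReal.tsum_mul_right, ← ENNReal.tsum_mul_left, ← ENNReal.tsum_add,
          ← ENNReal.tsum_mul_left]
        congr 1; ext j; ring
    _ = _ := by
        rw [tsum_shift s fun j => ∫⁻ z in Iio (0 : ℝ), blk φ g j z,
          tsum_shift s fun j => ∫⁻ z in Iio (0 : ℝ), blk φ h j z]
        simp only [Bes]; ring

end SpaceTime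

/-! ### Tempered distributions paired with averages of translates -/

section Translates

variable {d : ℕ}

theorem contDiff_iteratedFDeriv_schwartz (ψ : 𝓢(Sp d, ℂ)) (l : ℕ) :
    ContDiff ℝ ∞ (iteratedFDeriv ℝ l ψ) :=
  (ψ.smooth ⊤).iteratedFDeriv_right (m := ∞) (i := l) (mod_cast le_top)

theorem integrable_smul_of_bdd {F : Type*} [NormedAddCommGroup F] [NormedSpace ℂ F] {k : Sp d → ℂ}
    (hk : Integrable k) {H : Sp d → F} (hH : AEStronglyMeasurable H) {c : ℝ} (hb : ∀ y, ‖H y‖ ≤ c) :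
    Integrable fun y => k y • H y :=
  (hk.norm.mul_const c).mono' (hk.1.smul hH) (.of_forall fun y => by
    rw [norm_smul]; gcongr; exact hb y)

theorem hasFDerivAt_integral_smul_comp_sub {F : Type*} [NormedAddCommGroup F] [NormedSpace ℂ F]
    {k : Sp d → ℂ} (hk : Integrable k) {f : Sp d → F} (hf : ContDiff ℝ 1 f) {c c' : ℝ}
    (hc : ∀ y, ‖f y‖ ≤ c) (hc' : ∀ y, ‖fderiv ℝ f y‖ ≤ c') (x : Sp d) :
    HasFDerivAt (fun x => ∫ y, k y • f (x - y)) (∫ y, k y • fderiv ℝ f (x - y)) x := by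
  have hfc := hf.continuous
  have hfc' : Continuous (fderiv ℝ f) := hf.continuous_fderiv one_ne_zero
  refine hasFDerivAt_integral_of_dominated_of_fderiv_le (s := univ)
    (bound := fun y => ‖k y‖ * c') (F' := fun x y => k y • fderiv ℝ f (x - y)) Filter.univ_mem
    (.of_forall fun x => (integrable_smul_of_bdd hk
      (hfc.comp (continuous_sub_left x)).aestronglyMeasurable fun y => hc _).1)
    (integrable_smul_of_bdd hk (hfc.comp (continuous_sub_left x)).aestronglyMeasurable
      fun y => hc _) ?_ (.of_forall fun y x _ => ?_)
    (hk.norm.mul_const _) (.of_forall fun y x _ => ?_)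
  · exact hk.1.smul (hfc'.comp (continuous_sub_left x)).aestronglyMeasurable
  · rw [norm_smul]; gcongr; exact hc' _
  · have h1 : HasFDerivAt f (fderiv ℝ f (x - y)) (x - y) :=
      (hf.differentiable one_ne_zero (x - y)).hasFDerivAt
    have h2 := h1.comp x ((hasFDerivAt_id x).sub_const y)
    exact (h2.const_smul (k y))

theorem iteratedFDeriv_integral_mul_comp_sub {k : Sp d → ℂ} (hk : Integrable k) (ψ : 𝓢(Sp d, ℂ))
    (l : ℕ) (x : Sp d) :
    iteratedFDeriv ℝ l (fun x => ∫ y, k y • ψ (x - y)) x =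
      ∫ y, k y • iteratedFDeriv ℝ l ψ (x - y) := by
  have hbd : ∀ l y, ‖iteratedFDeriv ℝ l ψ y‖ ≤ SchwartzMap.seminorm ℝ 0 l ψ := fun l y =>
    SchwartzMap.norm_iteratedFDeriv_le_seminorm ℝ ψ l y
  induction l generalizing x with
  | zero =>
    simp only [iteratedFDeriv_zero_eq_comp, Function.comp_apply]
    refine Eq.trans ?_ (ContinuousLinearEquiv.integral_comp_comm
      ((continuousMultilinearCurryFin0 ℝ (Sp d) ℂ).symm.toContinuousLinearEquiv)
      (fun y => k y • ψ (x - y))).symm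
    rfl
  | succ l ih =>
    have hf : iteratedFDeriv ℝ l (fun x => ∫ y, k y • ψ (x - y)) =
        fun x => ∫ y, k y • iteratedFDeriv ℝ l ψ (x - y) := funext ih
    have hfd : ∀ z, ‖fderiv ℝ (iteratedFDeriv ℝ l ψ) z‖ ≤ SchwartzMap.seminorm ℝ 0 (l + 1) ψ := by
      intro z; rw [norm_fderiv_iteratedFDeriv]; exact hbd _ z
    have hd := hasFDerivAt_integral_smul_comp_sub hk
      ((contDiff_iteratedFDeriv_schwartz ψ l).of_le (by exact_mod_cast le_top)) (hbd l) hfd x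
    rw [iteratedFDeriv_succ_eq_comp_left, Function.comp_apply, hf, hd.fderiv]
    let e : (Sp d →L[ℝ] (Sp d [×l]→L[ℝ] ℂ)) ≃L[ℝ] (Sp d [×(l + 1)]→L[ℝ] ℂ) :=
      (continuousMultilinearCurryLeftEquiv ℝ (fun _ : Fin (l + 1) => Sp d)
        ℂ).symm.toContinuousLinearEquiv
    exact (ContinuousLinearEquiv.integral_comp_comm (𝕜 := ℝ) (E := Sp d →L[ℝ] (Sp d [×l]→L[ℝ] ℂ))
      (F := Sp d [×(l + 1)]→L[ℝ] ℂ) e (fun y => k y • fderiv ℝ (iteratedFDeriv ℝ l ψ) (x - y))).symm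

/-- Evaluation of an iterated derivative of a Schwartz function. -/
def evalDeriv (l : ℕ) (x : Sp d) : 𝓢(Sp d, ℂ) →ₗ[ℂ] (Sp d [×l]→L[ℝ] ℂ) where
  toFun ψ := iteratedFDeriv ℝ l ψ x
  map_add' f g := by
    exact iteratedFDeriv_add_apply ((f.smooth l).contDiffAt) ((g.smooth l).contDiffAt)
  map_smul' c f := by
    exact iteratedFDeriv_const_smul_apply ((f.smooth l).contDiffAt)

theorem evalDeriv_translate (l : ℕ) (x y : Sp d) (ψ : 𝓢(Sp d, ℂ)) :
    evalDeriv l x (ψ.compSubConstCLM ℂ y) = iteratedFDeriv ℝ l ψ (x - y) := by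
  have : ((ψ.compSubConstCLM ℂ y : 𝓢(Sp d, ℂ)) : Sp d → ℂ) = fun x => ψ (x - y) := rfl
  simp only [evalDeriv, LinearMap.coe_mk, AddHom.coe_mk, this]
  exact iteratedFDeriv_comp_sub l y x

/-- Mean value inequality along the segment from y' to y; the weight |x|^a is split as 2^a(|x - z|^a
+ |z|^a) for z on the segment. The loss is polynomial in y and y', which the decay of a Schwartz
kernel absorbs. -/
theorem exists_translate_sub_le (ψ : 𝓢(Sp d, ℂ)) (a l : ℕ) : ∃ C : ℝ, 0 ≤ C ∧ ∀ x y y' : Sp d,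
    ‖x‖ ^ a * ‖iteratedFDeriv ℝ l ψ (x - y) - iteratedFDeriv ℝ l ψ (x - y')‖ ≤
      C * (1 + (‖y‖ + ‖y'‖) ^ a) * ‖y - y'‖ := by
  set A := SchwartzMap.seminorm ℝ a (l + 1) ψ
  set B := SchwartzMap.seminorm ℝ 0 (l + 1) ψ
  have hA : 0 ≤ A := apply_nonneg _ _
  have hB : 0 ≤ B := apply_nonneg _ _
  have hcd := contDiff_iteratedFDeriv_schwartz ψ l
  refine ⟨2 ^ a * (A + B), by positivity, fun x y y' => ?_⟩
  set R := ‖y‖ + ‖y'‖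
  have hseg : ∀ z ∈ segment ℝ y' y, ‖x‖ ^ a * ‖fderiv ℝ (iteratedFDeriv ℝ l ψ) (x - z)‖ ≤
      2 ^ a * (A + B) * (1 + R ^ a) := by
    intro z hz
    have hzR : ‖z‖ ≤ R := by
      obtain ⟨s, t, hs, ht, hst, rfl⟩ := hz
      refine (norm_add_le _ _).trans ?_
      rw [norm_smul, norm_smul, Real.norm_of_nonneg hs, Real.norm_of_nonneg ht]
      have h1 : s * ‖y'‖ ≤ ‖y'‖ := mul_le_of_le_one_left (norm_nonneg _) (by linarith)
      have h2 : t * ‖y‖ ≤ ‖y‖ := mul_le_of_le_one_left (norm_nonneg _) (by linarith)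
      simp only [R]; linarith
    rw [norm_fderiv_iteratedFDeriv]
    have h1 : ‖x‖ ^ a ≤ 2 ^ a * (‖x - z‖ ^ a + ‖z‖ ^ a) := by
      have h0 : ‖x‖ ≤ 2 * max ‖x - z‖ ‖z‖ := by
        have : ‖x‖ ≤ ‖x - z‖ + ‖z‖ := by simpa using norm_add_le (x - z) z
        have := le_max_left ‖x - z‖ ‖z‖
        have := le_max_right ‖x - z‖ ‖z‖
        linarith
      refine (pow_le_pow_left₀ (norm_nonneg _) h0 a).trans ?_
      rw [mul_pow]
      gcongr
      rcases max_cases ‖x - z‖ ‖z‖ with ⟨h, _⟩ | ⟨h, _⟩ <;> rw [h]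
      · have : 0 ≤ ‖z‖ ^ a := by positivity
        linarith
      · have : 0 ≤ ‖x - z‖ ^ a := by positivity
        linarith
    have h2 : ‖x - z‖ ^ a * ‖iteratedFDeriv ℝ (l + 1) ψ (x - z)‖ ≤ A :=
      SchwartzMap.le_seminorm ℝ a (l + 1) ψ (x - z)
    have h3 : ‖iteratedFDeriv ℝ (l + 1) ψ (x - z)‖ ≤ B :=
      SchwartzMap.norm_iteratedFDeriv_le_seminorm ℝ ψ (l + 1) (x - z)
    have h4 : ‖z‖ ^ a ≤ R ^ a := pow_le_pow_left₀ (norm_nonneg _) hzR a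
    calc ‖x‖ ^ a * ‖iteratedFDeriv ℝ (l + 1) ψ (x - z)‖
        ≤ 2 ^ a * (‖x - z‖ ^ a + ‖z‖ ^ a) * ‖iteratedFDeriv ℝ (l + 1) ψ (x - z)‖ := by gcongr
      _ = 2 ^ a * (‖x - z‖ ^ a * ‖iteratedFDeriv ℝ (l + 1) ψ (x - z)‖ +
          ‖z‖ ^ a * ‖iteratedFDeriv ℝ (l + 1) ψ (x - z)‖) := by ring
      _ ≤ 2 ^ a * (A + R ^ a * B) := by gcongr
      _ ≤ _ := by
        rw [mul_assoc]
        gcongr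
        have : 0 ≤ R ^ a := by positivity
        nlinarith [mul_nonneg hA this]
  have hmv := (convex_segment y' y).norm_image_sub_le_of_norm_hasFDerivWithin_le
    (f := fun z => ‖x‖ ^ a • iteratedFDeriv ℝ l ψ (x - z))
    (f' := fun z => ‖x‖ ^ a • -fderiv ℝ (iteratedFDeriv ℝ l ψ) (x - z))
    (C := 2 ^ a * (A + B) * (1 + R ^ a)) (fun z _ => by
      have h1 : HasFDerivAt (iteratedFDeriv ℝ l ψ) (fderiv ℝ (iteratedFDeriv ℝ l ψ) (x - z))
            (x - z) := (hcd.differentiable (by simp) (x - z)).hasFDerivAt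
      have h2 := h1.comp z ((hasFDerivAt_id z).const_sub x)
      have h3 := (h2.const_smul (‖x‖ ^ a)).hasFDerivWithinAt (s := segment ℝ y' y)
      refine h3.congr_fderiv ?_
      ext; simp) (fun z hz => by
      rw [norm_smul, norm_neg, Real.norm_of_nonneg (by positivity)]
      exact hseg z hz) (left_mem_segment ℝ y' y) (right_mem_segment ℝ y' y)
  rw [← smul_sub, norm_smul, Real.norm_of_nonneg (by positivity)] at hmv
  exact hmv

theorem continuous_apply_translate (u : 𝓢'(Sp d, ℂ)) (ψ : 𝓢(Sp d, ℂ)) :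
    Continuous fun y : Sp d => u (ψ.compSubConstCLM ℂ y) := by
  have h : Continuous fun y : Sp d => (ψ.compSubConstCLM ℂ y : 𝓢(Sp d, ℂ)) := by
    rw [continuous_iff_continuousAt]
    intro y₀
    refine ((schwartz_withSeminorms ℂ (Sp d) ℂ).tendsto_nhds _ _).2 fun i ε hε => ?_
    obtain ⟨C, hC, hle⟩ := exists_translate_sub_le ψ i.1 i.2
    have hlim : Filter.Tendsto (fun y => C * (1 + (‖y‖ + ‖y₀‖) ^ i.1) * ‖y - y₀‖) (nhds y₀)
        (nhds 0) := by
      have : Continuous fun y : Sp d => C * (1 + (‖y‖ + ‖y₀‖) ^ i.1) * ‖y - y₀‖ := by fun_prop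
      simpa using this.tendsto y₀
    filter_upwards [hlim.eventually (gt_mem_nhds hε)] with y hy
    refine lt_of_le_of_lt ?_ hy
    refine SchwartzMap.seminorm_le_bound ℂ _ _ _ (by positivity) fun x => ?_
    have e : iteratedFDeriv ℝ i.2 (ψ.compSubConstCLM ℂ y - ψ.compSubConstCLM ℂ y₀ : 𝓢(Sp d, ℂ)) x =
        evalDeriv i.2 x (ψ.compSubConstCLM ℂ y - ψ.compSubConstCLM ℂ y₀) := rfl
    rw [e, map_sub, evalDeriv_translate, evalDeriv_translate]
    exact hle x y y₀
  exact u.continuous.comp h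

theorem integral_smul_comp_simpleFunc {F : Type*} [NormedAddCommGroup F] [NormedSpace ℂ F]
    [CompleteSpace F]
    {k : Sp d → ℂ} (hk : Integrable k) (f : SimpleFunc (Sp d) (Sp d)) (H : Sp d → F) :
    ∫ y, k y • H (f y) = ∑ a ∈ f.range, (∫ y in f ⁻¹' {a}, k y) • H a := by
  have h1 : ∀ y, k y • H (f y) = ∑ a ∈ f.range, (f ⁻¹' {a}).indicator (fun y => k y • H a) y := by
    intro y
    rw [Finset.sum_eq_single (f y)]
    · simp
    · intro b _ hb
      exact indicator_of_notMem (fun h => hb (by simpa using h.symm)) _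
    · intro h; exact absurd (f.mem_range_self y) h
  simp only [h1]
  rw [integral_finsetSum]
  · refine Finset.sum_congr rfl fun a _ => ?_
    rw [integral_indicator (f.measurableSet_preimage _), integral_smul_const]
  · intro a _
    exact (hk.smul_const (H a)).indicator (f.measurableSet_preimage _)

/-- The convolution J is a limit, in the Schwartz topology, of finite combinations of translates of
ψ obtained by sampling y through simple functions. Continuity and linearity of u move it under the
integral, and dominated convergence finishes since the pairings with translates are bounded. -/
theorem apply_integral_translate (u : 𝓢'(Sp d, ℂ)) (k ψ J : 𝓢(Sp d, ℂ))
    (hJ : ∀ w, J w = ∫ y, k y * ψ (w - y)) {A : ℝ} (hb : ∀ y, ‖u (ψ.compSubConstCLM ℂ y)‖ ≤ A) :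
    u J = ∫ y, k y * u (ψ.compSubConstCLM ℂ y) := by
  set f : ℕ → SimpleFunc (Sp d) (Sp d) := fun n =>
    SimpleFunc.approxOn id measurable_id univ 0 (mem_univ 0) n with hf
  have hft : ∀ y, Filter.Tendsto (fun n => f n y) Filter.atTop (nhds y) := fun y =>
    SimpleFunc.tendsto_approxOn measurable_id (mem_univ 0) (by simp)
  -- Sampling points grow at most linearly, so the polynomial loss of the translation estimate is
  -- integrable against k uniformly in n.
  have hf2 : ∀ n y, ‖f n y‖ ≤ 2 * ‖y‖ := by
    intro n y
    have := SimpleFunc.edist_approxOn_y0_le measurable_id (mem_univ (0 : Sp d)) y n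
    simp only [id, edist_dist, dist_zero_left] at this
    rw [← ENNReal.ofReal_add (norm_nonneg _) (norm_nonneg _),
      ENNReal.ofReal_le_ofReal_iff (by positivity)] at this
    simp only [hf]; linarith
  set G : Sp d → 𝓢(Sp d, ℂ) := fun y => ψ.compSubConstCLM ℂ y with hG
  set c : ℕ → Sp d → ℂ := fun n a => ∫ y in f n ⁻¹' {a}, k y with hc
  set S : ℕ → 𝓢(Sp d, ℂ) := fun n => ∑ a ∈ (f n).range, c n a • G a with hS
  have hk : Integrable k := k.integrable
  have hcont := continuous_apply_translate u ψ
  have hJ' : (J : Sp d → ℂ) = fun x => ∫ y, k y • ψ (x - y) := funext hJ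
  have hlim : Filter.Tendsto S Filter.atTop (nhds J) := by
    refine ((schwartz_withSeminorms ℂ (Sp d) ℂ).tendsto_nhds _ _).2 fun i ε hε => ?_
    obtain ⟨a, l⟩ := i
    obtain ⟨C, hC, hle⟩ := exists_translate_sub_le ψ a l
    have hI : Filter.Tendsto (fun n => ∫ y, ‖k y‖ * (C * (1 + (‖f n y‖ + ‖y‖) ^ a) * ‖f n y - y‖))
        Filter.atTop (nhds (∫ _y : Sp d, (0 : ℝ))) := by
      refine tendsto_integral_of_dominated_convergence
        (fun y => C * 3 * (‖y‖ ^ 1 * ‖k y‖) + C * 3 ^ (a + 1) * (‖y‖ ^ (a + 1) * ‖k y‖)) (fun n => ?_)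
        (((k.integrable_pow_mul volume 1).const_mul _).add
          ((k.integrable_pow_mul volume (a + 1)).const_mul _))
        (fun n => .of_forall fun y => ?_) (.of_forall fun y => ?_)
      · have := (f n).measurable
        have := k.continuous.measurable
        exact Measurable.aestronglyMeasurable (by fun_prop)
      · have h1 : ‖f n y - y‖ ≤ 3 * ‖y‖ := (norm_sub_le _ _).trans (by linarith [hf2 n y])
        have h2 : ‖f n y‖ + ‖y‖ ≤ 3 * ‖y‖ := by linarith [hf2 n y]
        rw [Real.norm_of_nonneg (by positivity)]
        calc ‖k y‖ * (C * (1 + (‖f n y‖ + ‖y‖) ^ a) * ‖f n y - y‖)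
            ≤ ‖k y‖ * (C * (1 + (3 * ‖y‖) ^ a) * (3 * ‖y‖)) := by gcongr
          _ = _ := by rw [mul_pow]; ring
      · have h1 : Filter.Tendsto (fun n => f n y - y) Filter.atTop (nhds (y - y)) :=
          (hft y).sub_const y
        rw [sub_self] at h1
        have h2 : Filter.Tendsto (fun n => ‖k y‖ * (C * (1 + (‖f n y‖ + ‖y‖) ^ a) * ‖f n y - y‖))
            Filter.atTop (nhds (‖k y‖ * (C * (1 + (‖y‖ + ‖y‖) ^ a) * ‖(0 : Sp d)‖))) :=
          (((((((hft y).norm).add_const _).pow a).const_add 1).const_mul C).mul h1.norm).const_mul _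
        simpa using h2
    rw [integral_zero] at hI
    filter_upwards [hI.eventually (gt_mem_nhds hε)] with n hn
    refine lt_of_le_of_lt ?_ hn
    refine SchwartzMap.seminorm_le_bound ℂ _ _ _ (integral_nonneg fun y => by positivity) fun x => ?_
    have e1 : iteratedFDeriv ℝ l (S n - J : 𝓢(Sp d, ℂ)) x = evalDeriv l x (S n - J) := rfl
    have e2 : evalDeriv l x (S n) = ∫ y, k y • iteratedFDeriv ℝ l ψ (x - f n y) := by
      rw [integral_smul_comp_simpleFunc hk (f n) fun a => iteratedFDeriv ℝ l ψ (x - a)]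
      simp only [hS, map_sum, map_smul, hG, evalDeriv_translate]
      rfl
    have e3 : evalDeriv l x J = ∫ y, k y • iteratedFDeriv ℝ l ψ (x - y) := by
      have : evalDeriv l x J = iteratedFDeriv ℝ l (J : Sp d → ℂ) x := rfl
      rw [this, hJ', iteratedFDeriv_integral_mul_comp_sub hk]
    have hcd : Continuous (iteratedFDeriv ℝ l ψ) := (contDiff_iteratedFDeriv_schwartz ψ l).continuous
    have hbd : ∀ y, ‖iteratedFDeriv ℝ l ψ y‖ ≤ SchwartzMap.seminorm ℝ 0 l ψ := fun y =>
      SchwartzMap.norm_iteratedFDeriv_le_seminorm ℝ ψ l y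
    have hi1 : Integrable fun y => k y • iteratedFDeriv ℝ l ψ (x - f n y) :=
      integrable_smul_of_bdd hk (hcd.comp_aestronglyMeasurable (Measurable.aestronglyMeasurable
          (measurable_const.sub (f n).measurable))) fun y => hbd _
    have hi2 : Integrable fun y => k y • iteratedFDeriv ℝ l ψ (x - y) :=
      integrable_smul_of_bdd hk (hcd.comp (continuous_sub_left x)).aestronglyMeasurable fun y => hbd _
    rw [e1, map_sub, e2, e3, ← integral_sub hi1 hi2]
    have hx : ‖x‖ ^ a = ‖(‖x‖ ^ a : ℝ)‖ := (Real.norm_of_nonneg (by positivity)).symm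
    rw [hx, ← norm_smul, ← integral_smul]
    refine norm_integral_le_of_norm_le ?_ (.of_forall fun y => ?_)
    · refine (((k.integrable_pow_mul volume 1).const_mul (C * 3)).add
          ((k.integrable_pow_mul volume (a + 1)).const_mul (C * 3 ^ (a + 1)))).mono' ?_
          (.of_forall fun y => ?_)
      · have := (f n).measurable
        have := k.continuous.measurable
        exact Measurable.aestronglyMeasurable (by fun_prop)
      · have h1 : ‖f n y - y‖ ≤ 3 * ‖y‖ := (norm_sub_le _ _).trans (by linarith [hf2 n y])
        have h2 : ‖f n y‖ + ‖y‖ ≤ 3 * ‖y‖ := by linarith [hf2 n y]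
        rw [Real.norm_of_nonneg (by positivity)]
        calc ‖k y‖ * (C * (1 + (‖f n y‖ + ‖y‖) ^ a) * ‖f n y - y‖)
            ≤ ‖k y‖ * (C * (1 + (3 * ‖y‖) ^ a) * (3 * ‖y‖)) := by gcongr
          _ = _ := by simp only [Pi.add_apply]; rw [mul_pow]; ring
    · rw [norm_smul, ← hx, ← smul_sub, norm_smul, mul_left_comm]
      exact mul_le_mul_of_nonneg_left (hle x (f n y) y) (norm_nonneg _)
  have h1 : Filter.Tendsto (fun n => u (S n)) Filter.atTop (nhds (u J)) :=
    (u.continuous.tendsto J).comp hlim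
  have h2 : ∀ n, u (S n) = ∫ y, k y * u (G (f n y)) := by
    intro n
    have := integral_smul_comp_simpleFunc hk (f n) fun a => u (G a)
    simp only [smul_eq_mul] at this
    rw [this]
    simp only [hS, map_sum, map_smul, smul_eq_mul]
    rfl
  simp only [h2] at h1
  refine tendsto_nhds_unique h1 ?_
  refine tendsto_integral_of_dominated_convergence (fun y => ‖k y‖ * A) (fun n => ?_)
    (hk.norm.mul_const A) (fun n => .of_forall fun y => ?_) (.of_forall fun y => ?_)
  · exact hk.1.mul (hcont.comp_aestronglyMeasurable (f n).measurable.aestronglyMeasurable)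
  · rw [norm_mul]; gcongr; exact hb _
  · exact ((hcont.tendsto y).comp (hft y)).const_mul _

end Translates

/-! ### Dyadic blocks of distributions and the harmonic extension of the data -/

section DistributionMultipliers

variable {d : ℕ}

/-- The Schwartz function `w ↦ ker m (-w)`. -/
def CcSym.refS {m : Sp d → ℂ} (h : CcSym m) : 𝓢(Sp d, ℂ) :=
  𝓕 ((h.comp_smul (c := 2 * Real.pi) (by positivity)).1.toSchwartzMap
    (h.comp_smul (c := 2 * Real.pi) (by positivity)).2)

theorem CcSym.refS_apply {m : Sp d → ℂ} (h : CcSym m) (w : Sp d) : h.refS w = ker m (-w) := by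
  rw [CcSym.refS, SchwartzMap.fourier_coe, ker, Real.fourierInv_eq_fourier_neg, neg_neg]; rfl

/-- Moving the Fourier transform onto the test function turns the modulated symbol into a translate
of the reflected kernel. -/
theorem distMult_eq {m : Sp d → ℂ} (h : CcSym m) (u : 𝓢'(Sp d, ℂ)) (x : Sp d) :
    distMult m u x = u (h.refS.compSubConstCLM ℂ x) := by
  rw [distMult, dif_pos (show HasCompactSupport m ∧ ContDiff ℝ ∞ m from h), TemperedDistribution.fourier_apply]
  congr 1
  ext w
  rw [SchwartzMap.compSubConstCLM_apply, h.refS_apply, SchwartzMap.fourier_coe, neg_sub, ker_apply,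
    Real.fourier_eq']
  congr 1; ext ξ
  simp only [HasCompactSupport.toSchwartzMap_toFun, smul_eq_mul]
  rw [← mul_assoc, ← Complex.exp_add]
  congr 2
  rw [inner_sub_right]
  push_cast; ring

theorem continuous_distMult {m : Sp d → ℂ} (h : CcSym m) (u : 𝓢'(Sp d, ℂ)) :
    Continuous (distMult m u) := by
  have : distMult m u = fun x => u (h.refS.compSubConstCLM ℂ x) := funext (distMult_eq h u)
  rw [this]
  exact continuous_apply_translate u h.refS

theorem distMult_sub (m : Sp d → ℂ) (u v : 𝓢'(Sp d, ℂ)) (x : Sp d) :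
    distMult m (u - v) x = distMult m u x - distMult m v x := by
  by_cases h : CcSym m
  · simp only [distMult_eq h]; rfl
  · have h' : ¬(HasCompactSupport m ∧ ContDiff ℝ ∞ m) := h
    simp [distMult, dif_neg h']

theorem CcSym.zero : CcSym (fun _ : Sp d => (0 : ℂ)) :=
  ⟨HasCompactSupport.zero, contDiff_const⟩

theorem distMult_zero_symbol (u : 𝓢'(Sp d, ℂ)) (x : Sp d) : distMult (fun _ => 0) u x = 0 := by
  have h0 : (CcSym.zero (d := d)).refS.compSubConstCLM ℂ x = 0 := by
    ext w
    rw [SchwartzMap.compSubConstCLM_apply, CcSym.refS_apply, ker_apply]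
    simp
  rw [distMult_eq CcSym.zero, h0, map_zero]

/-- The passage from distributions to functions: once a block of u is known to be bounded, further
multipliers act on it by ordinary convolution. -/
theorem distMult_mul {m₁ m₂ : Sp d → ℂ} (h₁ : CcSym m₁) (h₂ : CcSym m₂) (u : 𝓢'(Sp d, ℂ))
    (hb : eLpNorm (distMult m₂ u) ⊤ volume < ⊤) (x : Sp d) :
    distMult (fun ξ => m₁ ξ * m₂ ξ) u x = funMult m₁ (distMult m₂ u) x := by
  have h := CcSym.mul_left h₁.2 h₂
  have hbd : ∀ y, ‖u (h₂.refS.compSubConstCLM ℂ y)‖ ≤ (eLpNorm (distMult m₂ u) ⊤ volume).toReal := by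
    intro y
    rw [← distMult_eq h₂, ← toReal_enorm]
    exact ENNReal.toReal_mono hb.ne (enorm_le_eLpNorm_top (continuous_distMult h₂ u) y)
  have := apply_integral_translate u (h₁.refS.compSubConstCLM ℂ x) h₂.refS
    (h.refS.compSubConstCLM ℂ x) (fun w => by
      simp only [SchwartzMap.compSubConstCLM_apply, CcSym.refS_apply, neg_sub]
      rw [h₁.sym.ker_mul h₂.sym, ← integral_sub_right_eq_self _ w]
      congr 1; ext y
      congr 2; abel) hbd
  rw [distMult_eq h, this, funMult_eq]
  congr 1; ext y
  rw [SchwartzMap.compSubConstCLM_apply, CcSym.refS_apply, neg_sub, distMult_eq h₂]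

theorem ker_im_eq_zero {m : Sp d → ℂ} (hm : ∀ ξ, (starRingEnd ℂ) (m ξ) = m (-ξ)) (y : Sp d) :
    (ker m y).im = 0 := by
  rw [← Complex.conj_eq_iff_im, ker_apply, ← integral_conj, ← integral_neg_eq_self]
  congr 1; ext ξ
  rw [map_mul, ← Complex.exp_conj, hm]
  congr 2
  · simp [map_ofNat]
  · rw [smul_neg, neg_neg]

theorem distMult_im_eq_zero {m : Sp d → ℂ} (h : CcSym m) (hm : ∀ ξ, (starRingEnd ℂ) (m ξ) = m (-ξ))
    {u : 𝓢'(Sp d, ℂ)} (hu : IsRealDist u) (x : Sp d) : (distMult m u x).im = 0 := by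
  rw [distMult_eq h]
  refine hu _ fun w => ?_
  rw [SchwartzMap.compSubConstCLM_apply, h.refS_apply]
  exact ker_im_eq_zero hm _

variable (φ : DyadicCutoff d)

theorem cut_fat_eq_sum (m : Sp d → ℂ) (j : ℤ) (ξ : Sp d) :
    cut (fat φ) m j ξ = ∑ l ∈ Finset.Icc (-1 : ℤ) 1, dyad φ m (j + l) ξ := by
  simp only [cut, fat, dyad, Complex.ofReal_sum, Finset.mul_sum, two_zpow_smul_smul]
  refine Finset.sum_congr rfl fun l _ => ?_
  congr 4; ring_nf

theorem dyad_mul_dyad_comm (m : Sp d → ℂ) (i j : ℤ) :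
    (fun ξ => dyad φ symOne i ξ * dyad φ m j ξ) = fun ξ => dyad φ symOne j ξ * dyad φ m i ξ := by
  ext ξ; simp only [dyad, symOne]; ring

theorem dyad_mul_dyad_eq_zero (m : Sp d → ℂ) {i j : ℤ} (h : i - j ∉ Finset.Icc (-1 : ℤ) 1) :
    (fun ξ => dyad φ symOne j ξ * dyad φ m i ξ) = fun _ => 0 := by
  ext ξ
  by_contra hne
  simp only [dyad, symOne, one_mul, ← ne_eq, mul_ne_zero_iff, Complex.ofReal_ne_zero] at hne
  have h1 := φ.scale_of_ne_zero hne.1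
  have h2 := φ.scale_of_ne_zero hne.2.2
  have ha := zpow_lt_iff_aux (i := i) (j := j) (by linarith)
  have hb := zpow_lt_iff_aux (i := j) (j := i) (by linarith)
  exact h (Finset.mem_Icc.2 ⟨by omega, by omega⟩)

theorem hasSum_funMult_of_summable {ι : Type*} [Countable ι] {m : Sp d → ℂ} (hm : Integrable (ker m))
    {g : ι → Sp d → ℂ} (hg : ∀ n, AEStronglyMeasurable (g n)) {G : Sp d → ℂ}
    (hG : ∀ x, HasSum (fun n => g n x) (G x)) {b : ι → ℝ≥0∞} (hb : ∀ n x, ‖g n x‖ₑ ≤ b n)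
    (hbs : ∑' n, b n ≠ ⊤) (x : Sp d) :
    HasSum (fun n => funMult m (g n) x) (funMult m G x) := by
  have hbf : ∀ n, b n < ⊤ := fun n => (ENNReal.le_tsum n).trans_lt hbs.lt_top
  simp only [funMult_eq]
  have hI : ∀ n, Integrable fun y => ker m (x - y) * g n y := fun n =>
    integrable_ker_mul hm (hg n) ((eLpNorm_top_le_of_forall (hb n)).trans_lt (hbf n)) x
  have hs : Summable fun n => ∫ y, ‖ker m (x - y) * g n y‖ := by
    refine Summable.of_nonneg_of_le (fun n => by positivity) (fun n => ?_)
      ((ENNReal.summable_toReal hbs).mul_left (∫ y, ‖ker m (x - y)‖))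
    rw [← integral_mul_const]
    refine integral_mono (hI n).norm ((hm.comp_sub_left x).norm.mul_const _) fun y => ?_
    simp only [norm_mul]
    gcongr
    rw [← toReal_enorm]
    exact ENNReal.toReal_mono (hbf n).ne (hb n y)
  have h := hasSum_integral_of_summable_integral_norm hI hs
  have e : (fun y => ∑' n, ker m (x - y) * g n y) = fun y => ker m (x - y) * G y := by
    ext y; rw [tsum_mul_left, (hG y).tsum_eq]
  rwa [e] at h

theorem dyad_symAbs_ccSym (j : ℤ) : CcSym (dyad φ symAbs j) := dyad_ccSym φ (smoothOff_rho none) j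

theorem rieszSym_mul_symAbs (l : Option (Fin d)) (ξ : Sp d) :
    rieszSym l ξ * symAbs ξ = rho l ξ := by
  by_cases h : ξ = 0
  · subst h
    have : rho l (0 : Sp d) = 0 := by
      have := norm_rho_le l (0 : Sp d); simpa using this
    simp [rieszSym, this]
  · have hn : (‖ξ‖ : ℂ) ≠ 0 := by exact_mod_cast norm_ne_zero_iff.2 h
    simp only [rieszSym, symAbs]
    push_cast
    field_simp

/-- The symbol relating the block of `rhoP l t` to the block of `|D|`. -/
def coefSym (l : Option (Fin d)) (t : ℝ) (j : ℤ) : Sp d → ℂ :=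
  cut (fat φ) (fun ξ => rieszSym l ξ * symP t ξ) j

theorem coefSym_ccSym (l : Option (Fin d)) (t : ℝ) (j : ℤ) : CcSym (coefSym φ l t j) :=
  (fat_annular φ).ccSym_cut ((smoothOff_rieszSym l).mul (smoothOff_symP t)) j

theorem coefSym_mul (l : Option (Fin d)) (t : ℝ) (j : ℤ) :
    (fun ξ => coefSym φ l t j ξ * dyad φ symAbs j ξ) = dyad φ (rhoP l t) j := by
  rw [coefSym, dyad_mul_cut_fat]
  congr 1; ext ξ
  rw [rhoP, ← rieszSym_mul_symAbs]; ring

theorem exists_kn_coefSym_le (l : Option (Fin d)) : ∃ C : ℝ≥0, ∀ t : ℝ, 0 ≤ t → ∀ j : ℤ,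
    kn (coefSym φ l t j) ≤ C * ENNReal.ofReal (Real.exp (-((2 : ℝ) ^ j * t / 8))) := by
  obtain ⟨C, hC⟩ := (fat_annular φ).exists_kn_cut_le (smoothOff_rieszSym l) (homog_rieszSym l)
  exact ⟨C, fun t ht j => by simpa [coefSym] using hC t ht j⟩

/-- The blocks of `rho l e^{z|D|} u`. -/
def coefBlk (u : 𝓢'(Sp d, ℂ)) (l : Option (Fin d)) (j : ℤ) (x : Sp d) (z : ℝ) : ℂ :=
  distMult (dyad φ (rhoP l (-z)) j) u x

/-- `rho l e^{z|D|} u`, that is `|D| e^{z|D|} u` or `∂_k e^{z|D|} u`. -/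
def coef (u : 𝓢'(Sp d, ℂ)) (l : Option (Fin d)) (x : Sp d) (z : ℝ) : ℂ :=
  ∑' j : ℤ, coefBlk φ u l j x z

theorem absDH_eq (u : 𝓢'(Sp d, ℂ)) : absDH φ u = coef φ u none := rfl

theorem dxH_eq (u : 𝓢'(Sp d, ℂ)) (k : Fin d) : dxH φ u k = coef φ u (some k) := rfl

/-- The size of the block of `|D|u`. -/
def absBlk (u : 𝓢'(Sp d, ℂ)) (j : ℤ) : ℝ≥0∞ := eLpNorm (distMult (dyad φ symAbs j) u) ⊤ volume

theorem besovAbsD_eq (s : ℝ) (u : 𝓢'(Sp d, ℂ)) :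
    besovAbsD φ s u = ∑' j : ℤ, (2 : ℝ≥0∞) ^ (s * (j : ℝ)) * absBlk φ u j := rfl

theorem besovAbsD_zero (u : 𝓢'(Sp d, ℂ)) : besovAbsD φ 0 u = ∑' j : ℤ, absBlk φ u j := by
  simp [besovAbsD_eq]

theorem two_rpow_ne_zero (s : ℝ) : (2 : ℝ≥0∞) ^ s ≠ 0 :=
  (ENNReal.rpow_pos (by norm_num) (by simp)).ne'

theorem term_lt_top_of_besovSum {s : ℝ} {b : ℤ → Sp d → ℂ} (h : besovSum s b < ⊤) (j : ℤ) :
    eLpNorm (b j) ⊤ volume < ⊤ := by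
  have h1 := (ENNReal.le_tsum (f := fun j : ℤ => (2 : ℝ≥0∞) ^ (s * (j : ℝ)) *
    eLpNorm (b j) ⊤ volume) j).trans_lt h
  exact lt_of_le_of_ne le_top fun htop => by
    rw [htop, ENNReal.mul_top (two_rpow_ne_zero _)] at h1
    exact lt_irrefl _ h1

theorem absBlk_lt_top {s : ℝ} {u : 𝓢'(Sp d, ℂ)} (h : besovAbsD φ s u < ⊤) (j : ℤ) :
    absBlk φ u j < ⊤ := term_lt_top_of_besovSum h j

theorem coefBlk_eq {u : 𝓢'(Sp d, ℂ)} (hu : ∀ j, absBlk φ u j < ⊤) (l : Option (Fin d)) (j : ℤ)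
    (x : Sp d) (z : ℝ) :
    coefBlk φ u l j x z = funMult (coefSym φ l (-z) j) (distMult (dyad φ symAbs j) u) x := by
  rw [coefBlk, ← coefSym_mul]
  exact distMult_mul (coefSym_ccSym φ l (-z) j) (dyad_symAbs_ccSym φ j) u (hu j) x

theorem continuous_coefBlk (u : 𝓢'(Sp d, ℂ)) (l : Option (Fin d)) (j : ℤ) (z : ℝ) :
    Continuous fun x => coefBlk φ u l j x z :=
  continuous_distMult (dyad_ccSym φ (smoothOff_rhoP l _) j) u

theorem continuous_rieszSym_off (l : Option (Fin d)) : Measurable (rieszSym l) := by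
  unfold rieszSym
  have := (continuous_rho l).measurable
  fun_prop

theorem measurable_coefBlk {u : 𝓢'(Sp d, ℂ)} (hu : ∀ j, absBlk φ u j < ⊤) (l : Option (Fin d))
    (j : ℤ) : Measurable (Function.uncurry (coefBlk φ u l j)) := by
  have h : coefBlk φ u l j = fun x z =>
      funMult (coefSym φ l (-z) j) (fun y => distMult (dyad φ symAbs j) u y) x := by
    ext x z; exact coefBlk_eq φ hu l j x z
  rw [h]
  refine measurable_funMult_uncurry (m := fun z => coefSym φ l (-z) j)
    (g := fun y _ => distMult (dyad φ symAbs j) u y) ?_ ?_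
  · have h1 := continuous_rieszSym_off l
    have h2 := (fat_annular φ).smooth.continuous.measurable
    unfold coefSym cut symP Function.uncurry
    fun_prop
  · exact (continuous_distMult (dyad_symAbs_ccSym φ j) u).measurable.comp measurable_fst

theorem exists_coefBlk_le : ∃ C : ℝ≥0, ∀ (u : 𝓢'(Sp d, ℂ)), (∀ j, absBlk φ u j < ⊤) →
    ∀ (l : Option (Fin d)) (j : ℤ) (x : Sp d) (z : ℝ), z ≤ 0 → ‖coefBlk φ u l j x z‖ₑ ≤
      C * ENNReal.ofReal (Real.exp (-((2 : ℝ) ^ j * (-z) / 8))) * absBlk φ u j := by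
  choose C hC using exists_kn_coefSym_le φ
  refine ⟨∑ l, C l, fun u hu l j x z hz => ?_⟩
  rw [coefBlk_eq φ hu]
  refine (funMult_enorm_le _ _ (continuous_ker (coefSym_ccSym φ l _ j).sym.int) x).trans ?_
  refine mul_le_mul' ((hC l (-z) (by linarith) j).trans ?_) le_rfl
  gcongr
  exact Finset.single_le_sum (f := C) (fun _ _ => zero_le) (Finset.mem_univ l)

/-- The constant in the bounds of the coefficients. -/
def coefConst : ℝ≥0 := (exists_coefBlk_le φ).choose

theorem coefBlk_le {u : 𝓢'(Sp d, ℂ)} (hu : ∀ j, absBlk φ u j < ⊤)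
    (l : Option (Fin d)) (j : ℤ) (x : Sp d) {z : ℝ} (hz : z ≤ 0) : ‖coefBlk φ u l j x z‖ₑ ≤
      coefConst φ * ENNReal.ofReal (Real.exp (-((2 : ℝ) ^ j * (-z) / 8))) * absBlk φ u j :=
  (exists_coefBlk_le φ).choose_spec u hu l j x z hz

theorem coefBlk_le' {u : 𝓢'(Sp d, ℂ)} (hu : ∀ j, absBlk φ u j < ⊤)
    (l : Option (Fin d)) (j : ℤ) (x : Sp d) {z : ℝ} (hz : z ≤ 0) : ‖coefBlk φ u l j x z‖ₑ ≤
      coefConst φ * absBlk φ u j := by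
  refine (coefBlk_le φ hu l j x hz).trans ?_
  gcongr
  refine mul_le_of_le_one_right' ?_
  rw [ENNReal.ofReal_le_one, Real.exp_le_one_iff]
  have : (0 : ℝ) < 2 ^ j := by positivity
  nlinarith

theorem tsum_coefBlk_lt_top {u : 𝓢'(Sp d, ℂ)} (hu : besovAbsD φ 0 u < ⊤) :
    ∑' j : ℤ, (coefConst φ : ℝ≥0∞) * absBlk φ u j < ⊤ := by
  rw [ENNReal.tsum_mul_left, ← besovAbsD_zero]
  exact ENNReal.mul_lt_top (by simp) hu

theorem summable_coefBlk {u : 𝓢'(Sp d, ℂ)} (hu : besovAbsD φ 0 u < ⊤)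
    (l : Option (Fin d)) (x : Sp d) {z : ℝ} (hz : z ≤ 0) :
    Summable fun j => coefBlk φ u l j x z := by
  refine Summable.of_norm ?_
  have : ∑' j, ‖coefBlk φ u l j x z‖ₑ ≠ ⊤ := ne_top_of_le_ne_top (tsum_coefBlk_lt_top φ hu).ne
    (ENNReal.tsum_le_tsum fun j => coefBlk_le' φ (absBlk_lt_top φ hu) l j x hz)
  simpa only [toReal_enorm] using ENNReal.summable_toReal this

theorem enorm_coef_le {u : 𝓢'(Sp d, ℂ)} (hu : besovAbsD φ 0 u < ⊤) (l : Option (Fin d)) (x : Sp d)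
    {z : ℝ} (hz : z ≤ 0) : ‖coef φ u l x z‖ₑ ≤ coefConst φ * besovAbsD φ 0 u := by
  rw [besovAbsD_zero, ← ENNReal.tsum_mul_left]
  exact enorm_tsum_le_tsum_enorm.trans
    (ENNReal.tsum_le_tsum fun j => coefBlk_le' φ (absBlk_lt_top φ hu) l j x hz)

theorem LI_coef_le {u : 𝓢'(Sp d, ℂ)} (hu : besovAbsD φ 0 u < ⊤) (l : Option (Fin d)) :
    LI (coef φ u l) ≤ coefConst φ * besovAbsD φ 0 u :=
  LI_le fun x _ hz => enorm_coef_le φ hu l x hz.le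

theorem BM_coef {u : 𝓢'(Sp d, ℂ)} (hu : besovAbsD φ 0 u < ⊤) (l : Option (Fin d)) :
    BM (coef φ u l) :=
  ⟨Measurable.tsum fun j => measurable_coefBlk φ (absBlk_lt_top φ hu) l j,
    (LI_coef_le φ hu l).trans_lt (ENNReal.mul_lt_top (by simp) hu)⟩

/-- Applying Δ̇_j to the series of blocks leaves three neighbours. Exchanging the two cutoffs in
each term puts the three cutoffs around j on one block, where they add up to 1. -/
theorem funMult_dyad_coef {u : 𝓢'(Sp d, ℂ)} (hu : besovAbsD φ 0 u < ⊤) (l : Option (Fin d)) (j : ℤ)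
    (x : Sp d) {z : ℝ} (hz : z ≤ 0) :
    funMult (dyad φ symOne j) (fun y => coef φ u l y z) x = coefBlk φ u l j x z := by
  have hb := absBlk_lt_top φ hu
  have hfin : ∀ i, eLpNorm (distMult (dyad φ (rhoP l (-z)) i) u) ⊤ volume < ⊤ := fun i =>
    (eLpNorm_top_le_of_forall fun x => coefBlk_le' φ hb l i x hz).trans_lt
      (ENNReal.mul_lt_top (by simp) (hb i))
  have hcc : ∀ i, CcSym (dyad φ (rhoP l (-z)) i) := fun i => dyad_ccSym φ (smoothOff_rhoP l _) i
  have h1 := hasSum_funMult_of_summable (dyad_symOne_ccSym φ j).sym.kint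
    (fun i => (continuous_coefBlk φ u l i z).aestronglyMeasurable)
    (fun x => (summable_coefBlk φ hu l x hz).hasSum) (fun i x => coefBlk_le' φ hb l i x hz)
    (tsum_coefBlk_lt_top φ hu).ne x
  have h2 : ∀ i, funMult (dyad φ symOne j) (fun y => coefBlk φ u l i y z) x =
      distMult (fun ξ => dyad φ symOne j ξ * dyad φ (rhoP l (-z)) i ξ) u x := fun i =>
    (distMult_mul (dyad_symOne_ccSym φ j) (hcc i) u (hfin i) x).symm
  have h3 : HasSum (fun i => funMult (dyad φ symOne j) (fun y => coefBlk φ u l i y z) x)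
      (∑ i ∈ (Finset.Icc (-1 : ℤ) 1).map (addLeftEmbedding j),
        funMult (dyad φ symOne j) (fun y => coefBlk φ u l i y z) x) := by
    refine hasSum_sum_of_ne_finset_zero fun i hi => ?_
    rw [h2, dyad_mul_dyad_eq_zero φ (rhoP l (-z)) (i := i) (j := j), distMult_zero_symbol]
    intro hmem
    exact hi (Finset.mem_map.2 ⟨i - j, hmem, by simp⟩)
  have h4 := h1.unique h3
  have h5 : coefBlk φ u l j x z = ∑ i ∈ (Finset.Icc (-1 : ℤ) 1).map (addLeftEmbedding j),
        funMult (dyad φ symOne j) (fun y => coefBlk φ u l i y z) x := by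
    have e1 : dyad φ (rhoP l (-z)) j = fun ξ => cut (fat φ) symOne j ξ * dyad φ (rhoP l (-z)) j ξ := by
      rw [dyad_mul_cut_fat]; simp [symOne]
    have hcf : CcSym (cut (fat φ) symOne j) := (fat_annular φ).ccSym_cut (smoothOff_const 1) j
    have e2 : coefBlk φ u l j x z =
        funMult (cut (fat φ) symOne j) (distMult (dyad φ (rhoP l (-z)) j) u) x := by
      rw [coefBlk]
      nth_rw 1 [e1]
      exact distMult_mul hcf (hcc j) u (hfin j) x
    have e3 : cut (fat φ) symOne j = fun ξ => ∑ l ∈ Finset.Icc (-1 : ℤ) 1, dyad φ symOne (j + l) ξ :=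
      funext fun ξ => cut_fat_eq_sum φ symOne j ξ
    rw [e2, e3, funMult_symbol_sum _ (fun i _ => (dyad_symOne_ccSym φ (j + i)).sym)
      (continuous_distMult (hcc j) u).aestronglyMeasurable (hfin j), Finset.sum_map]
    refine Finset.sum_congr rfl fun i _ => ?_
    rw [h2, ← distMult_mul (dyad_symOne_ccSym φ (j + i)) (hcc j) u (hfin j),
      dyad_mul_dyad_comm φ (rhoP l (-z)) (j + i) j]
    rfl
  rw [h5]
  exact h4

theorem blk_coef_le {u : 𝓢'(Sp d, ℂ)} (hu : besovAbsD φ 0 u < ⊤) (l : Option (Fin d)) (j : ℤ)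
    {z : ℝ} (hz : z ≤ 0) : blk φ (coef φ u l) j z ≤
      coefConst φ * ENNReal.ofReal (Real.exp (-((2 : ℝ) ^ j * (-z) / 8))) * absBlk φ u j :=
  eLpNorm_top_le_of_forall fun x => by
    rw [funMult_dyad_coef φ hu l j x hz]
    exact coefBlk_le φ (absBlk_lt_top φ hu) l j x hz

theorem blk_coef_le' {u : 𝓢'(Sp d, ℂ)} (hu : besovAbsD φ 0 u < ⊤) (l : Option (Fin d)) (j : ℤ)
    {z : ℝ} (hz : z ≤ 0) : blk φ (coef φ u l) j z ≤ coefConst φ * absBlk φ u j :=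
  eLpNorm_top_le_of_forall fun x => by
    rw [funMult_dyad_coef φ hu l j x hz]
    exact coefBlk_le' φ (absBlk_lt_top φ hu) l j x hz

theorem lintegral_exp_Iio {a : ℝ} (ha : 0 < a) (s : ℝ) :
    ∫⁻ z in Iio s, ENNReal.ofReal (Real.exp (-(a * (s - z)))) = ENNReal.ofReal a⁻¹ := by
  have h1 : ∀ z, Real.exp (-(a * (s - z))) = Real.exp (-(a * s)) * Real.exp (a * z) := fun z => by
    rw [← Real.exp_add]; congr 1; ring
  have hI : IntegrableOn (fun z => Real.exp (a * z)) (Iic s) := integrableOn_exp_mul_Iic ha s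
  rw [setLIntegral_congr Iio_ae_eq_Iic, ← ofReal_integral_eq_lintegral_ofReal]
  · congr 1
    simp only [h1]
    rw [integral_const_mul, integral_exp_mul_Iic ha, ← mul_div_assoc, ← Real.exp_add]
    simp
  · simp only [h1]; exact hI.const_mul _
  · exact .of_forall fun z => (Real.exp_pos _).le

theorem ofReal_two_zpow (j : ℤ) : ENNReal.ofReal ((2 : ℝ) ^ j) = (2 : ℝ≥0∞) ^ (j : ℝ) := by
  rw [← Real.rpow_intCast, ← ENNReal.ofReal_rpow_of_pos (by norm_num)]
  simp

/-- The j-th block decays like e^{-2^j|z|/8}, whose integral over z < 0 is 8·2^{-j}. One derivative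
is gained in L¹ of time. -/
theorem Bes_coef_le {u : 𝓢'(Sp d, ℂ)} (hu : besovAbsD φ 0 u < ⊤) (l : Option (Fin d)) (s : ℝ) :
    Bes φ (1 + s) (coef φ u l) ≤ 8 * coefConst φ * besovAbsD φ s u := by
  rw [besovAbsD_eq, ← ENNReal.tsum_mul_left]
  refine ENNReal.tsum_le_tsum fun j => ?_
  have h2 : (0 : ℝ) < 2 ^ j := by positivity
  have h1 : ∫⁻ z in Iio (0 : ℝ), blk φ (coef φ u l) j z ≤
      coefConst φ * (8 * (2 : ℝ≥0∞) ^ (-(j : ℝ))) * absBlk φ u j := by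
    calc ∫⁻ z in Iio (0 : ℝ), blk φ (coef φ u l) j z
        ≤ ∫⁻ z in Iio (0 : ℝ), coefConst φ * absBlk φ u j *
            ENNReal.ofReal (Real.exp (-((2 : ℝ) ^ j / 8 * (0 - z)))) := by
          refine setLIntegral_mono' measurableSet_Iio fun z hz => ?_
          refine (blk_coef_le φ hu l j hz.le).trans_eq ?_
          rw [mul_right_comm]
          congr 3
          ring_nf
      _ = coefConst φ * absBlk φ u j * ENNReal.ofReal ((2 : ℝ) ^ j / 8)⁻¹ := by
          rw [lintegral_const_mul' _ _ (ENNReal.mul_ne_top (by simp)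
            (absBlk_lt_top φ hu j).ne), lintegral_exp_Iio (by positivity)]
      _ = _ := by
          rw [inv_div, div_eq_mul_inv, ENNReal.ofReal_mul (by norm_num), ← zpow_neg,
            ofReal_two_zpow]
          push_cast
          simp only [ENNReal.ofReal_ofNat]
          ring
  refine (mul_le_mul_right h1 _).trans_eq ?_
  rw [show (1 + s) * (j : ℝ) = s * j + j by ring, ENNReal.rpow_add _ _ (by simp) (by simp)]
  have : (2 : ℝ≥0∞) ^ (j : ℝ) * 2 ^ (-(j : ℝ)) = 1 := by
    rw [← ENNReal.rpow_add _ _ (by simp) (by simp)]; simp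
  calc (2 : ℝ≥0∞) ^ (s * j) * 2 ^ (j : ℝ) * (coefConst φ * (8 * 2 ^ (-(j : ℝ))) * absBlk φ u j)
      = 8 * coefConst φ * (2 ^ (s * j) * absBlk φ u j) * (2 ^ (j : ℝ) * 2 ^ (-(j : ℝ))) := by ring
    _ = _ := by rw [this, mul_one]

theorem absBlk_sub_lt_top {u v : 𝓢'(Sp d, ℂ)} {s : ℝ} (hu : besovAbsD φ s u < ⊤)
    (hv : besovAbsD φ s v < ⊤) : besovAbsD φ s (u - v) < ⊤ := by
  refine lt_of_le_of_lt ?_ (ENNReal.add_lt_top.2 ⟨hu, hv⟩)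
  simp only [besovAbsD_eq]
  rw [← ENNReal.tsum_add]
  refine ENNReal.tsum_le_tsum fun j => ?_
  rw [← mul_add]
  gcongr 1
  have : distMult (dyad φ symAbs j) (u - v) =
      distMult (dyad φ symAbs j) u - distMult (dyad φ symAbs j) v := by
    ext x; exact distMult_sub _ _ _ _
  rw [absBlk, this]
  exact eLpNorm_sub_le (continuous_distMult (dyad_symAbs_ccSym φ j) u).aestronglyMeasurable
    (continuous_distMult (dyad_symAbs_ccSym φ j) v).aestronglyMeasurable le_top

theorem coef_sub {u v : 𝓢'(Sp d, ℂ)} (hu : besovAbsD φ 0 u < ⊤) (hv : besovAbsD φ 0 v < ⊤)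
    (l : Option (Fin d)) (x : Sp d) {z : ℝ} (hz : z ≤ 0) :
    coef φ (u - v) l x z = coef φ u l x z - coef φ v l x z := by
  simp only [coef]
  rw [← (summable_coefBlk φ hu l x hz).tsum_sub (summable_coefBlk φ hv l x hz)]
  congr 1; ext j
  exact distMult_sub _ _ _ _

theorem coef_im {u : 𝓢'(Sp d, ℂ)} (hu : IsRealDist u) (l : Option (Fin d)) (x : Sp d) (z : ℝ)
    (hs : Summable fun j => coefBlk φ u l j x z) : (coef φ u l x z).im = 0 := by
  rw [coef, Complex.im_tsum hs]
  have : ∀ j, (coefBlk φ u l j x z).im = 0 := fun j => by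
    refine distMult_im_eq_zero (dyad_ccSym φ (smoothOff_rhoP l _) j) (fun ξ => ?_) hu x
    have hr : φ.toFun ((2 : ℝ) ^ (-j) • -ξ) = φ.toFun ((2 : ℝ) ^ (-j) • ξ) :=
      φ.radial _ _ (by rw [smul_neg, norm_neg])
    simp only [dyad, rhoP, symP, hr, norm_neg, map_mul, Complex.conj_ofReal]
    congr 2
    cases l with
    | none => simp [rho, symAbs]
    | some k => simp [rho]
  simp [this]

/-- Bernstein's inequality: |D| costs a factor 2^j on the j-th annulus. It transfers the assumptions
on the data to the quantities used in the estimates. -/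
theorem exists_besovAbsD_le : ∃ C : ℝ≥0, ∀ (s : ℝ) (u : 𝓢'(Sp d, ℂ)), besov φ (s + 1) u < ⊤ →
    besovAbsD φ s u ≤ C * besov φ (s + 1) u := by
  obtain ⟨C, hC⟩ := (fat_annular φ).exists_kn_cut_le (smoothOff_rho none) (homog_rho none)
  refine ⟨C, fun s u hu => ?_⟩
  rw [besov, besovSum, ← ENNReal.tsum_mul_left, besovAbsD_eq]
  refine ENNReal.tsum_le_tsum fun j => ?_
  have hf := term_lt_top_of_besovSum hu j
  have e : dyad φ symAbs j = fun ξ =>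
      cut (fat φ) (fun ξ => rho none ξ * symP 0 ξ) j ξ * dyad φ symOne j ξ := by
    rw [dyad_mul_cut_fat]
    congr 1; ext ξ; simp [symP_zero, rho, symOne]
  have hcc : CcSym (cut (fat φ) (fun ξ => rho (d := d) none ξ * symP 0 ξ) j) :=
    (fat_annular φ).ccSym_cut ((smoothOff_rho none).mul (smoothOff_symP 0)) j
  have h1 : absBlk φ u j ≤ C * (2 : ℝ≥0∞) ^ (j : ℝ) * eLpNorm (distMult (dyad φ symOne j) u) ⊤ volume := by
    refine eLpNorm_top_le_of_forall fun x => ?_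
    rw [e, distMult_mul hcc (dyad_symOne_ccSym φ j) u hf]
    refine (funMult_enorm_le _ _ (continuous_ker hcc.sym.int) x).trans ?_
    gcongr
    refine (hC 0 le_rfl j).trans_eq ?_
    simp [ofReal_two_zpow]
  refine (mul_le_mul_right h1 _).trans_eq ?_
  rw [show (s + 1) * (j : ℝ) = s * j + j by ring, ENNReal.rpow_add _ _ (by simp) (by simp)]
  ring

end DistributionMultipliers

/-! ### Duhamel integrals of the semigroup in Chemin-Lerner spaces -/

section Duhamel

variable {d : ℕ}

theorem funMult_integral {α : Type*} [MeasurableSpace α] {μ : Measure α} [SFinite μ] {m : Sp d → ℂ}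
    (hm : Integrable (ker m)) {F : Sp d → α → ℂ} (hF : Measurable (Function.uncurry F))
    {B : α → ℝ≥0∞} (hB : ∀ᵐ a ∂μ, ∀ y, ‖F y a‖ₑ ≤ B a) (hBi : ∫⁻ a, B a ∂μ < ⊤) (x : Sp d) :
    funMult m (fun y => ∫ a, F y a ∂μ) x = ∫ a, funMult m (fun y => F y a) x ∂μ := by
  simp only [funMult_eq, ← integral_const_mul]
  refine integral_integral_swap ?_
  have hms : AEStronglyMeasurable (Function.uncurry fun (y : Sp d) (a : α) => ker m (x - y) * F y a)
      (volume.prod μ) :=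
    (hm.comp_sub_left x).1.comp_fst.mul hF.aestronglyMeasurable
  refine ⟨hms, ?_⟩
  rw [HasFiniteIntegral, lintegral_prod _ hms.enorm]
  calc ∫⁻ y, ∫⁻ a, ‖Function.uncurry (fun (y : Sp d) (a : α) => ker m (x - y) * F y a) (y, a)‖ₑ ∂μ
      ≤ ∫⁻ y, ‖ker m (x - y)‖ₑ * ∫⁻ a, B a ∂μ := by
        refine lintegral_mono fun y => ?_
        simp only [Function.uncurry_apply_pair, enorm_mul]
        rw [lintegral_const_mul' _ _ enorm_ne_top]
        gcongr 1
        refine lintegral_mono_ae ?_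
        filter_upwards [hB] with a ha using ha y
    _ = (∫⁻ y, ‖ker m (x - y)‖ₑ) * ∫⁻ a, B a ∂μ := lintegral_mul_const' _ _ hBi.ne
    _ < ⊤ := ENNReal.mul_lt_top (hm.comp_sub_left x).2 hBi

variable (φ : DyadicCutoff d)

/-- The weight `2^j e^{-2^j t / 8}`. -/
def heatWt (j : ℤ) (t : ℝ) : ℝ≥0∞ := ENNReal.ofReal ((2 : ℝ) ^ j * Real.exp (-((2 : ℝ) ^ j * t / 8)))

theorem heatWt_le (j : ℤ) {t : ℝ} (ht : 0 ≤ t) : heatWt j t ≤ (2 : ℝ≥0∞) ^ (j : ℝ) := by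
  rw [← ofReal_two_zpow, heatWt]
  refine ENNReal.ofReal_le_ofReal (mul_le_of_le_one_right (by positivity) (Real.exp_le_one_iff.2 ?_))
  have : (0 : ℝ) < 2 ^ j := by positivity
  have : 0 ≤ 2 ^ j * t / 8 := by positivity
  linarith

theorem measurable_heatWt (j : ℤ) : Measurable (heatWt j) := by
  unfold heatWt; fun_prop

/-- Each half-line contributes 8 whatever j is. This scale invariance is maximal regularity in L¹ of
time. -/
theorem lintegral_heatWt (j : ℤ) (τ : ℝ) : ∫⁻ s, heatWt j |s - τ| = 16 := by
  have h2 : (0 : ℝ) < 2 ^ j := by positivity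
  have e : ∀ t, heatWt j t = ENNReal.ofReal ((2 : ℝ) ^ j) *
      ENNReal.ofReal (Real.exp (-((2 : ℝ) ^ j / 8 * t))) := fun t => by
    rw [heatWt, ENNReal.ofReal_mul h2.le]
    congr 4; ring
  have hL : ∫⁻ s in Iio τ, heatWt j |s - τ| = 8 := by
    calc ∫⁻ s in Iio τ, heatWt j |s - τ| = ∫⁻ s in Iio τ, ENNReal.ofReal ((2 : ℝ) ^ j) *
          ENNReal.ofReal (Real.exp (-((2 : ℝ) ^ j / 8 * (τ - s)))) := by
          refine setLIntegral_congr_fun measurableSet_Iio fun s hs => ?_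
          have hs' : s < τ := hs
          rw [e, abs_of_neg (by linarith), neg_sub]
      _ = 8 := by
          rw [lintegral_const_mul' _ _ ENNReal.ofReal_ne_top, lintegral_exp_Iio (by positivity),
            ← ENNReal.ofReal_mul h2.le, inv_div, mul_div_cancel₀ _ h2.ne']
          simp
  have hR : ∫⁻ s in Ioi τ, heatWt j |s - τ| = 8 := by
    have hmp : MeasurePreserving (fun s : ℝ => 2 * τ - s) volume volume :=
      Measure.measurePreserving_sub_left volume (2 * τ)
    have := hmp.setLIntegral_comp_preimage (measurableSet_Iio (a := τ))
      (f := fun s => heatWt j |s - τ|)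
      ((measurable_heatWt j).comp (by fun_prop))
    rw [hL] at this
    rw [← this]
    have hpre : (fun s : ℝ => 2 * τ - s) ⁻¹' Iio τ = Ioi τ := by
      ext s; simp only [mem_preimage, mem_Iio, mem_Ioi]; constructor <;> intro h <;> linarith
    rw [hpre]
    refine lintegral_congr fun s => ?_
    congr 1
    rw [abs_sub_comm]
    congr 1; ring
  rw [← lintegral_add_compl _ (measurableSet_Iio (a := τ)), compl_Iio,
    setLIntegral_congr Ioi_ae_eq_Ici.symm, hL, hR]
  norm_num

theorem exists_kn_cut_fat_rhoP_le : ∃ C : ℝ≥0, ∀ (l : Option (Fin d)) (t : ℝ), 0 ≤ t → ∀ j : ℤ,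
    kn (cut (fat φ) (rhoP l t) j) ≤ C * heatWt j t := by
  choose C hC using fun l : Option (Fin d) =>
    (fat_annular φ).exists_kn_cut_le (smoothOff_rho l) (homog_rho l)
  refine ⟨∑ l, C l, fun l t ht j => (hC l t ht j).trans ?_⟩
  rw [pow_one, heatWt]
  gcongr
  exact Finset.single_le_sum (f := C) (fun _ _ => zero_le) (Finset.mem_univ l)

/-- The constant in the block estimates of the heat semigroup. -/
def heatConst : ℝ≥0 := (exists_kn_cut_fat_rhoP_le φ).choose

theorem kn_cut_fat_rhoP_le (l : Option (Fin d)) {t : ℝ} (ht : 0 ≤ t) (j : ℤ) :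
    kn (cut (fat φ) (rhoP l t) j) ≤ heatConst φ * heatWt j t :=
  (exists_kn_cut_fat_rhoP_le φ).choose_spec l t ht j

theorem funMult_dyad_eq {m : Sp d → ℂ} (hm : SmoothOff m) (j : ℤ) {g : Sp d → ℂ}
    (hg : AEStronglyMeasurable g) (hb : eLpNorm g ⊤ volume < ⊤) (x : Sp d) :
    funMult (dyad φ m j) g x = funMult (cut (fat φ) m j) (funMult (dyad φ symOne j) g) x := by
  rw [funMult_funMult ((fat_annular φ).ccSym_cut hm j).sym (dyad_symOne_ccSym φ j).sym hg hb,
    dyad_mul_cut_fat]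
  simp [symOne]

theorem enorm_funMult_dyad_le {m : Sp d → ℂ} (hm : SmoothOff m) {g : Sp d → ℝ → ℂ} (hg : BM g)
    (j : ℤ) {τ : ℝ} (hτ : τ < 0) (x : Sp d) :
    ‖funMult (dyad φ m j) (fun y => g y τ) x‖ₑ ≤ kn (cut (fat φ) m j) * blk φ g j τ := by
  rw [funMult_dyad_eq φ hm j (hg.slice_aesm τ) (hg.slice_fin hτ)]
  exact funMult_enorm_le _ _ (continuous_ker ((fat_annular φ).ccSym_cut hm j).sym.int) x

/-- A pointwise majorant of the heat flow. -/
def heatMaj (g : Sp d → ℝ → ℂ) (t τ : ℝ) : ℝ≥0∞ :=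
  ∑' j : ℤ, heatConst φ * heatWt j t * blk φ g j τ

theorem enorm_funMult_rhoP_le [NeZero d] (l : Option (Fin d)) {g : Sp d → ℝ → ℂ} (hg : BM g)
    {t τ : ℝ} (ht : 0 < t) (hτ : τ < 0) (x : Sp d) :
    ‖funMult (rhoP l t) (fun y => g y τ) x‖ₑ ≤ heatMaj φ g t τ := by
  rw [← (hasSum_funMult_rhoP φ l ht (hg.slice_aesm τ) (hg.slice_fin hτ) x).tsum_eq]
  refine enorm_tsum_le_tsum_enorm.trans (ENNReal.tsum_le_tsum fun j => ?_)
  refine (enorm_funMult_dyad_le φ (smoothOff_rhoP l t) hg j hτ x).trans ?_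
  gcongr
  exact kn_cut_fat_rhoP_le φ l ht.le j

theorem lintegral_heatMaj_le {g : Sp d → ℝ → ℂ} (hg : BM g) (s : ℝ) {A : Set ℝ}
    (hA : A ⊆ Iio 0) : ∫⁻ τ in A, heatMaj φ g |s - τ| τ ≤ heatConst φ * Bes φ 1 g := by
  refine (lintegral_mono_set hA).trans ?_
  rw [Bes, ← ENNReal.tsum_mul_left]
  calc ∫⁻ τ in Iio (0 : ℝ), heatMaj φ g |s - τ| τ
      ≤ ∫⁻ τ in Iio (0 : ℝ), ∑' j : ℤ, heatConst φ * (2 : ℝ≥0∞) ^ (j : ℝ) * blk φ g j τ := by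
        refine lintegral_mono fun τ => ENNReal.tsum_le_tsum fun j => ?_
        gcongr
        exact heatWt_le j (abs_nonneg _)
    _ = ∑' j : ℤ, ∫⁻ τ in Iio (0 : ℝ), heatConst φ * (2 : ℝ≥0∞) ^ (j : ℝ) * blk φ g j τ :=
        lintegral_tsum fun j => ((measurable_blk φ hg j).const_mul _).aemeasurable
    _ ≤ _ := by
        refine ENNReal.tsum_le_tsum fun j => ?_
        rw [lintegral_const_mul _ (measurable_blk φ hg j), mul_assoc, one_mul]

/-- A measurable family of time sets for Duhamel integrals. -/
structure TimeSets (A : ℝ → Set ℝ) : Prop where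
  meas : MeasurableSet {p : ℝ × ℝ | p.2 ∈ A p.1}
  neg : ∀ s, A s ⊆ Iio 0
  ne : ∀ s, ∀ τ ∈ A s, s ≠ τ

theorem TimeSets.measurableSet {A : ℝ → Set ℝ} (hA : TimeSets A) (s : ℝ) : MeasurableSet (A s) :=
  hA.meas.preimage (measurable_const.prodMk measurable_id)

/-- The times before `s`. -/
def before (s : ℝ) : Set ℝ := Iio (min s 0)

/-- The times between `s` and `0`. -/
def after (s : ℝ) : Set ℝ := Ioo s 0

theorem timeSets_before : TimeSets before where
  meas := by
    have : {p : ℝ × ℝ | p.2 ∈ before p.1} = {p | p.2 < min p.1 0} := rfl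
    rw [this]
    exact measurableSet_lt (by fun_prop) (by fun_prop)
  neg s τ h := by
    have h' : τ < min s 0 := h
    exact (lt_min_iff.1 h').2
  ne s τ h := by
    have h' : τ < min s 0 := h
    exact (lt_min_iff.1 h').1.ne'

theorem timeSets_after : TimeSets after where
  meas := by
    have : {p : ℝ × ℝ | p.2 ∈ after p.1} = {p | p.1 < p.2} ∩ {p | p.2 < 0} := rfl
    rw [this]
    exact (measurableSet_lt (by fun_prop) (by fun_prop)).inter
      (measurableSet_lt (by fun_prop) (by fun_prop))
  neg s τ h := h.2
  ne s τ h := h.1.ne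

/-- The Duhamel integral `∫_{A s} rho_l(D) e^{-|s-τ||D|} g(τ) dτ`. -/
def Duh (A : ℝ → Set ℝ) (l : Option (Fin d)) (g : Sp d → ℝ → ℂ) (x : Sp d) (s : ℝ) : ℂ :=
  ∫ τ in A s, funMult (rhoP l |s - τ|) (fun y => g y τ) x

theorem measurable_rhoP_abs (l : Option (Fin d)) :
    Measurable (Function.uncurry fun (p : ℝ × ℝ) (ξ : Sp d) => rhoP l |p.1 - p.2| ξ) := by
  have h1 := (continuous_rho l).measurable
  unfold rhoP symP Function.uncurry
  fun_prop

theorem measurable_heatFlow (l : Option (Fin d)) {g : Sp d → ℝ → ℂ}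
    (hg : Measurable (Function.uncurry g)) :
    Measurable (Function.uncurry fun (x : Sp d) (p : ℝ × ℝ) =>
      funMult (rhoP l |p.1 - p.2|) (fun y => g y p.2) x) :=
  measurable_funMult_uncurry (g := fun y (p : ℝ × ℝ) => g y p.2) (measurable_rhoP_abs l)
    (hg.comp (measurable_fst.prodMk (measurable_snd.comp measurable_snd)))

theorem measurable_slice_pair {F : Sp d → ℝ × ℝ → ℂ} (hF : Measurable (Function.uncurry F)) (s : ℝ) :
    Measurable (Function.uncurry fun (x : Sp d) (τ : ℝ) => F x (s, τ)) :=
  hF.comp (measurable_fst.prodMk (measurable_const.prodMk measurable_snd))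

theorem measurable_assoc_pair {F : Sp d → ℝ × ℝ → ℂ} (hF : Measurable (Function.uncurry F)) :
    Measurable fun q : (Sp d × ℝ) × ℝ => F q.1.1 (q.1.2, q.2) :=
  hF.comp ((measurable_fst.comp measurable_fst).prodMk
    ((measurable_snd.comp measurable_fst).prodMk measurable_snd))

theorem measurable_heatFlow_slice (l : Option (Fin d)) {g : Sp d → ℝ → ℂ}
    (hg : Measurable (Function.uncurry g)) (s : ℝ) :
    Measurable (Function.uncurry fun (x : Sp d) (τ : ℝ) =>
      funMult (rhoP l |s - τ|) (fun y => g y τ) x) :=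
  measurable_slice_pair (F := fun x p => funMult (rhoP l |p.1 - p.2|) (fun y => g y p.2) x)
    (measurable_heatFlow l hg) s

variable {A : ℝ → Set ℝ}

theorem Duh_const_mul (l : Option (Fin d)) (c : ℂ) (g : Sp d → ℝ → ℂ) (x : Sp d) (s : ℝ) :
    Duh A l (fun x z => c * g x z) x s = c * Duh A l g x s := by
  simp only [Duh]
  rw [← integral_const_mul]
  congr 1; ext τ
  exact funMult_const_mul c _ _ x

theorem Duh_congr (hA : TimeSets A) (l : Option (Fin d)) {g h : Sp d → ℝ → ℂ}
    (H : ∀ᵐ z ∂(volume.restrict (Iio (0 : ℝ))), ∀ᵐ x, g x z = h x z) : Duh A l g = Duh A l h := by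
  ext x s
  simp only [Duh]
  refine integral_congr_ae ?_
  filter_upwards [ae_restrict_of_ae_restrict_of_subset (hA.neg s) H] with τ hτ
  rw [funMult_congr _ hτ]

theorem measurable_Duh (hA : TimeSets A) (l : Option (Fin d)) {g : Sp d → ℝ → ℂ}
    (hg : Measurable (Function.uncurry g)) : Measurable (Function.uncurry (Duh A l g)) := by
  have h1 : Measurable fun q : (Sp d × ℝ) × ℝ =>
      funMult (rhoP l |q.1.2 - q.2|) (fun y => g y q.2) q.1.1 :=
    measurable_assoc_pair (F := fun x p => funMult (rhoP l |p.1 - p.2|) (fun y => g y p.2) x)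
      (measurable_heatFlow l hg)
  have h2 : MeasurableSet {q : (Sp d × ℝ) × ℝ | q.2 ∈ A q.1.2} :=
    hA.meas.preimage ((measurable_snd.comp measurable_fst).prodMk measurable_snd)
  have h3 : StronglyMeasurable ({q : (Sp d × ℝ) × ℝ | q.2 ∈ A q.1.2}.indicator fun q =>
      funMult (rhoP l |q.1.2 - q.2|) (fun y => g y q.2) q.1.1) :=
    (h1.indicator h2).stronglyMeasurable
  have h4 := (h3.integral_prod_right' (ν := volume)).measurable
  have h5 : Function.uncurry (Duh A l g) = fun p : Sp d × ℝ => ∫ τ,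
      {q : (Sp d × ℝ) × ℝ | q.2 ∈ A q.1.2}.indicator (fun q =>
        funMult (rhoP l |q.1.2 - q.2|) (fun y => g y q.2) q.1.1) (p, τ) := by
    funext p
    rw [Function.uncurry, Duh, ← integral_indicator (hA.measurableSet _)]
    rfl
  rw [h5]
  exact h4

variable [NeZero d]

theorem heatFlow_bound (hA : TimeSets A) (l : Option (Fin d)) {g : Sp d → ℝ → ℂ} (hg : BM g) (s : ℝ) :
    ∀ᵐ τ ∂(volume.restrict (A s)), ∀ x,
      ‖funMult (rhoP l |s - τ|) (fun y => g y τ) x‖ₑ ≤ heatMaj φ g |s - τ| τ := by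
  filter_upwards [ae_restrict_mem (hA.measurableSet s)] with τ hτ x
  exact enorm_funMult_rhoP_le φ l hg (abs_pos.2 (sub_ne_zero.2 (hA.ne s τ hτ))) (hA.neg s hτ) x

theorem lintegral_heatFlow_le (hA : TimeSets A) (l : Option (Fin d)) {g : Sp d → ℝ → ℂ} (hg : BM g)
    (x : Sp d) (s : ℝ) :
    ∫⁻ τ in A s, ‖funMult (rhoP l |s - τ|) (fun y => g y τ) x‖ₑ ≤ heatConst φ * Bes φ 1 g := by
  refine le_trans (lintegral_mono_ae ?_) (lintegral_heatMaj_le φ hg s (hA.neg s))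
  filter_upwards [heatFlow_bound φ hA l hg s] with τ hτ using hτ x

theorem integrableOn_heatFlow (hA : TimeSets A) (l : Option (Fin d)) {g : Sp d → ℝ → ℂ} (hg : BM g)
    (hB : Bes φ 1 g < ⊤) (x : Sp d) (s : ℝ) :
    IntegrableOn (fun τ => funMult (rhoP l |s - τ|) (fun y => g y τ) x) (A s) :=
  ⟨((measurable_heatFlow_slice l hg.meas s).comp measurable_prodMk_left).aestronglyMeasurable,
    (lintegral_heatFlow_le φ hA l hg x s).trans_lt (ENNReal.mul_lt_top (by simp) hB)⟩

theorem enorm_Duh_le (hA : TimeSets A) (l : Option (Fin d)) {g : Sp d → ℝ → ℂ} (hg : BM g)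
    (x : Sp d) (s : ℝ) : ‖Duh A l g x s‖ₑ ≤ heatConst φ * Bes φ 1 g :=
  (enorm_integral_le_lintegral_enorm _).trans (lintegral_heatFlow_le φ hA l hg x s)

theorem LI_Duh_le (hA : TimeSets A) (l : Option (Fin d)) {g : Sp d → ℝ → ℂ} (hg : BM g) :
    LI (Duh A l g) ≤ heatConst φ * Bes φ 1 g :=
  LI_le fun x z _ => enorm_Duh_le φ hA l hg x z

theorem BM_Duh (hA : TimeSets A) (l : Option (Fin d)) {g : Sp d → ℝ → ℂ} (hg : BM g)
    (hB : Bes φ 1 g < ⊤) : BM (Duh A l g) :=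
  ⟨measurable_Duh hA l hg.meas, (LI_Duh_le φ hA l hg).trans_lt (ENNReal.mul_lt_top (by simp) hB)⟩

theorem blk_Duh_le (hA : TimeSets A) (l : Option (Fin d)) {g : Sp d → ℝ → ℂ} (hg : BM g)
    (hB : Bes φ 1 g < ⊤) (j : ℤ) (s : ℝ) :
    blk φ (Duh A l g) j s ≤ ∫⁻ τ in A s, heatConst φ * heatWt j |s - τ| * blk φ g j τ := by
  refine eLpNorm_top_le_of_forall fun x => ?_
  have h1 := funMult_integral (μ := volume.restrict (A s)) (dyad_symOne_ccSym φ j).sym.kint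
    (measurable_heatFlow_slice l hg.meas s) (heatFlow_bound φ hA l hg s)
    ((lintegral_heatMaj_le φ hg s (hA.neg s)).trans_lt (ENNReal.mul_lt_top (by simp) hB)) x
  simp only [Duh]
  rw [h1]
  refine (enorm_integral_le_lintegral_enorm _).trans
    (setLIntegral_mono' (hA.measurableSet s) fun τ hτ => ?_)
  have hpos : 0 < |s - τ| := abs_pos.2 (sub_ne_zero.2 (hA.ne s τ hτ))
  have hneg := hA.neg s hτ
  have hs := hg.slice_aesm τ
  have hf := hg.slice_fin hneg
  have hsym := sym_rhoP φ l hpos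
  rw [funMult_funMult (dyad_symOne_ccSym φ j).sym hsym hs hf]
  have e : (fun ξ => dyad φ symOne j ξ * rhoP l |s - τ| ξ) = dyad φ (rhoP l |s - τ|) j := by
    ext ξ; simp only [dyad, symOne]; ring
  rw [e]
  refine (enorm_funMult_dyad_le φ (smoothOff_rhoP l _) hg j hneg x).trans ?_
  gcongr
  exact kn_cut_fat_rhoP_le φ l hpos.le j

theorem blk_Duh_le' (hA : TimeSets A) (l : Option (Fin d)) {g : Sp d → ℝ → ℂ} (hg : BM g)
    (hB : Bes φ 1 g < ⊤) (j : ℤ) (s : ℝ) :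
    blk φ (Duh A l g) j s ≤
      heatConst φ * ((2 : ℝ≥0∞) ^ (j : ℝ) * ∫⁻ τ in Iio (0 : ℝ), blk φ g j τ) := by
  refine (blk_Duh_le φ hA l hg hB j s).trans ((lintegral_mono_set (hA.neg s)).trans ?_)
  rw [← mul_assoc, ← lintegral_const_mul _ (measurable_blk φ hg j)]
  refine lintegral_mono fun τ => ?_
  gcongr
  exact heatWt_le j (abs_nonneg _)

/-- The heat weight is at most 2^j, which is exactly the derivative lost from Ḃ^{1+r} to Ḃ^r. The
bound holds at each time s, in particular at s = 0 where R⁻ is read off. -/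
theorem tsum_weighted_blk_Duh_le (hA : TimeSets A) (l : Option (Fin d)) {g : Sp d → ℝ → ℂ}
    (hg : BM g) (hB : Bes φ 1 g < ⊤) (r s : ℝ) :
    ∑' j : ℤ, (2 : ℝ≥0∞) ^ (r * (j : ℝ)) * blk φ (Duh A l g) j s ≤
      heatConst φ * Bes φ (1 + r) g := by
  rw [Bes, ← ENNReal.tsum_mul_left]
  refine ENNReal.tsum_le_tsum fun j => ?_
  refine (mul_le_mul_right (blk_Duh_le' φ hA l hg hB j s) _).trans_eq ?_
  rw [show (1 + r) * (j : ℝ) = r * j + j by ring, ENNReal.rpow_add _ _ (by simp) (by simp)]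
  ring

/-- Young's inequality in time: the block of the Duhamel integral is dominated by a convolution with
the heat weight, whose total mass is 16. -/
theorem lintegral_blk_Duh_le (hA : TimeSets A) (l : Option (Fin d)) {g : Sp d → ℝ → ℂ} (hg : BM g)
    (hB : Bes φ 1 g < ⊤) (j : ℤ) :
    ∫⁻ s in Iio (0 : ℝ), blk φ (Duh A l g) j s ≤
      16 * heatConst φ * ∫⁻ τ in Iio (0 : ℝ), blk φ g j τ := by
  have hb := measurable_blk φ hg j
  have hw := measurable_heatWt j
  calc ∫⁻ s in Iio (0 : ℝ), blk φ (Duh A l g) j s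
      ≤ ∫⁻ s, ∫⁻ τ in Iio (0 : ℝ), heatConst φ * heatWt j |s - τ| * blk φ g j τ := by
        refine (setLIntegral_le_lintegral _ _).trans (lintegral_mono fun s => ?_)
        exact (blk_Duh_le φ hA l hg hB j s).trans (lintegral_mono_set (hA.neg s))
    _ = ∫⁻ τ in Iio (0 : ℝ), ∫⁻ s, heatConst φ * heatWt j |s - τ| * blk φ g j τ := by
        refine lintegral_lintegral_swap (Measurable.aemeasurable ?_)
        have h1 : Measurable fun p : ℝ × ℝ => heatWt j |p.1 - p.2| := hw.comp (by fun_prop)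
        have h2 : Measurable fun p : ℝ × ℝ => blk φ g j p.2 := hb.comp measurable_snd
        exact (h1.const_mul _).mul h2
    _ = ∫⁻ τ in Iio (0 : ℝ), 16 * heatConst φ * blk φ g j τ := by
        refine lintegral_congr fun τ => ?_
        have h1 : Measurable fun s : ℝ => heatWt j |s - τ| := hw.comp (by fun_prop)
        rw [lintegral_mul_const _ (h1.const_mul _), lintegral_const_mul _ h1, lintegral_heatWt]
        ring
    _ = _ := lintegral_const_mul _ hb

theorem Bes_Duh_le (hA : TimeSets A) (l : Option (Fin d)) {g : Sp d → ℝ → ℂ} (hg : BM g)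
    (hB : Bes φ 1 g < ⊤) (s : ℝ) : Bes φ s (Duh A l g) ≤ 16 * heatConst φ * Bes φ s g := by
  simp only [Bes]
  rw [← ENNReal.tsum_mul_left]
  refine ENNReal.tsum_le_tsum fun j => ?_
  refine (mul_le_mul_right (lintegral_blk_Duh_le φ hA l hg hB j) _).trans_eq ?_
  ring

theorem Duh_add (hA : TimeSets A) (l : Option (Fin d)) {g h : Sp d → ℝ → ℂ} (hg : BM g) (hh : BM h)
    (hgB : Bes φ 1 g < ⊤) (hhB : Bes φ 1 h < ⊤) (x : Sp d) (s : ℝ) :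
    Duh A l (fun x z => g x z + h x z) x s = Duh A l g x s + Duh A l h x s := by
  simp only [Duh]
  rw [← integral_add (integrableOn_heatFlow φ hA l hg hgB x s)
    (integrableOn_heatFlow φ hA l hh hhB x s)]
  refine setIntegral_congr_fun (hA.measurableSet s) fun τ hτ => ?_
  have hpos : 0 < |s - τ| := abs_pos.2 (sub_ne_zero.2 (hA.ne s τ hτ))
  have hneg := hA.neg s hτ
  exact funMult_add (sym_rhoP φ l hpos).kint (hg.slice_aesm τ) (hg.slice_fin hneg)
    (hh.slice_aesm τ) (hh.slice_fin hneg) x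

theorem Duh_tsum (hA : TimeSets A) (l : Option (Fin d)) {g : ℕ → Sp d → ℝ → ℂ} (hg : ∀ n, BM (g n))
    (hs : ∑' n, LI (g n) < ⊤) (hB : ∑' n, Bes φ 1 (g n) < ⊤) (x : Sp d) (s : ℝ) :
    Duh A l (fun x z => ∑' n, g n x z) x s = ∑' n, Duh A l (g n) x s := by
  simp only [Duh]
  rw [← integral_tsum]
  · refine setIntegral_congr_fun (hA.measurableSet s) fun τ hτ => ?_
    have hpos : 0 < |s - τ| := abs_pos.2 (sub_ne_zero.2 (hA.ne s τ hτ))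
    have hneg := hA.neg s hτ
    exact (hasSum_funMult_of_summable (sym_rhoP φ l hpos).kint (fun n => (hg n).slice_aesm τ)
      (fun x => (summable_of_tsum_LI hs x hneg).hasSum) (fun n x => le_LI (g n) x hneg)
      hs.ne x).tsum_eq.symm
  · exact fun n => ((measurable_heatFlow_slice l (hg n).meas s).comp
      measurable_prodMk_left).aestronglyMeasurable
  · refine ne_of_lt (lt_of_le_of_lt (ENNReal.tsum_le_tsum fun n =>
      lintegral_heatFlow_le φ hA l (hg n) x s) ?_)
    rw [ENNReal.tsum_mul_left]
    exact ENNReal.mul_lt_top (by simp) hB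

end Duhamel

/-! ### Increments of the heat flow in space and time, and its limit at time 0 -/

section IntegratedFormulas

variable {d : ℕ}

theorem integral_conv_param {α : Type*} [MeasurableSpace α] {μ : Measure α} [SFinite μ]
    {K : Sp d → ℂ} {k : α → Sp d → ℂ} (hk : StronglyMeasurable fun p : α × Sp d => k p.1 p.2)
    (hki : ∫⁻ a, (∫⁻ y, ‖k a y‖ₑ) ∂μ < ⊤) (hK : ∀ y, K y = ∫ a, k a y ∂μ) {g : Sp d → ℂ}
    (hg : AEStronglyMeasurable g) (hb : eLpNorm g ⊤ volume < ⊤) (x : Sp d) :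
    ∫ y, K (x - y) * g y = ∫ a, (∫ y, k a (x - y) * g y) ∂μ := by
  simp only [hK, ← integral_mul_const]
  refine integral_integral_swap ?_
  have hms : AEStronglyMeasurable (Function.uncurry fun (y : Sp d) (a : α) => k a (x - y) * g y)
      (volume.prod μ) := by
    refine AEStronglyMeasurable.mul ?_ hg.comp_fst
    exact (hk.comp_measurable (measurable_snd.prodMk
      (measurable_const.sub measurable_fst))).aestronglyMeasurable
  refine ⟨hms, ?_⟩
  rw [HasFiniteIntegral, lintegral_prod_symm _ hms.enorm]
  have hgb := ae_le_eLpNormEssSup (f := g) (μ := volume)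
  calc ∫⁻ a, (∫⁻ y, ‖Function.uncurry (fun (y : Sp d) (a : α) => k a (x - y) * g y) (y, a)‖ₑ) ∂μ
      ≤ ∫⁻ a, (∫⁻ y, ‖k a y‖ₑ) * eLpNorm g ⊤ volume ∂μ := by
        refine lintegral_mono fun a => ?_
        beta_reduce
        rw [← lintegral_sub_left_eq_self (fun y => ‖k a y‖ₑ) x, ← lintegral_mul_const' _ _ hb.ne]
        refine lintegral_mono_ae ?_
        filter_upwards [hgb] with y hy
        simp only [Function.uncurry_apply_pair, enorm_mul]
        rw [eLpNorm_exponent_top]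
        gcongr
    _ = (∫⁻ a, (∫⁻ y, ‖k a y‖ₑ) ∂μ) * eLpNorm g ⊤ volume := lintegral_mul_const' _ _ hb.ne
    _ < ⊤ := ENNReal.mul_lt_top hki hb

/-- The `k`-th coordinate direction. -/
def dir (k : Fin d) : Sp d := EuclideanSpace.single k 1

theorem inner_dir (ξ : Sp d) (k : Fin d) : inner ℝ ξ (dir k) = ξ k := by
  simp [dir, EuclideanSpace.inner_single_right]

theorem norm_dir (k : Fin d) : ‖dir k‖ = 1 := by simp [dir]

theorem wave_sub_wave (ξ y : Sp d) (k : Fin d) (a b : ℝ) :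
    Complex.exp (2 * Real.pi * Complex.I * (inner ℝ ξ (y + b • dir k) : ℝ)) -
      Complex.exp (2 * Real.pi * Complex.I * (inner ℝ ξ (y + a • dir k) : ℝ)) =
    ∫ s in a..b, Complex.exp (2 * Real.pi * Complex.I * (inner ℝ ξ (y + s • dir k) : ℝ)) *
      rho (some k) ((2 * Real.pi) • ξ) := by
  have hd : ∀ s ∈ uIcc a b, HasDerivAt (fun s : ℝ =>
      Complex.exp (2 * Real.pi * Complex.I * (inner ℝ ξ (y + s • dir k) : ℝ)))
      (Complex.exp (2 * Real.pi * Complex.I * (inner ℝ ξ (y + s • dir k) : ℝ)) *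
        rho (some k) ((2 * Real.pi) • ξ)) s := by
    intro s _
    have h1 : HasDerivAt (fun s : ℝ => ((inner ℝ ξ (y + s • dir k) : ℝ) : ℂ)) ((ξ k : ℝ) : ℂ) s := by
      have : (fun s : ℝ => ((inner ℝ ξ (y + s • dir k) : ℝ) : ℂ)) =
          fun s : ℝ => ((inner ℝ ξ y + s * ξ k : ℝ) : ℂ) := by
        ext s; rw [inner_add_right, inner_smul_right, inner_dir]
      rw [this]
      have h2 : HasDerivAt (fun s : ℝ => inner ℝ ξ y + s * ξ k) (1 * ξ k) s :=
        ((hasDerivAt_id s).mul_const _).const_add _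
      simpa using h2.ofReal_comp
    have h2 := (h1.const_mul (2 * Real.pi * Complex.I)).cexp
    refine h2.congr_deriv ?_
    simp only [rho, PiLp.smul_apply, smul_eq_mul]
    push_cast; ring
  rw [intervalIntegral.integral_eq_sub_of_hasDerivAt hd]
  apply Continuous.intervalIntegrable
  fun_prop

theorem ker_shift_sub {m : Sp d → ℂ} (k : Fin d) (h1 : Integrable m)
    (h2 : Integrable fun ξ => rho (some k) ξ * m ξ) {a b : ℝ} (hab : a ≤ b) (y : Sp d) :
    ker m (y + b • dir k) - ker m (y + a • dir k) =
      ∫ s in Ioc a b, ker (fun ξ => rho (some k) ξ * m ξ) (y + s • dir k) := by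
  simp only [ker_apply]
  rw [← integral_sub (integrable_wave_mul h1 _) (integrable_wave_mul h1 _), integral_integral_swap]
  · congr 1; ext ξ
    rw [← sub_mul, wave_sub_wave, intervalIntegral.integral_of_le hab, ← integral_mul_const]
    congr 1; ext s; ring
  · have hdom : Integrable (fun p : ℝ × Sp d => ‖rho (some k) ((2 * Real.pi) • p.2) *
        m ((2 * Real.pi) • p.2)‖) ((volume.restrict (Ioc a b)).prod volume) :=
      ((integrable_comp_two_pi_smul h2).comp_snd _).norm
    refine hdom.mono' ?_ (.of_forall fun p => ?_)
    · exact AEStronglyMeasurable.mul (by fun_prop) (integrable_comp_two_pi_smul h2).1.comp_snd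
    · simp only [Function.uncurry]
      rw [norm_mul, norm_wave, one_mul]

theorem funMult_shift_sub {m : Sp d → ℂ} (k : Fin d) (h1 : Integrable m) (h1k : Integrable (ker m))
    (h2 : Integrable fun ξ => rho (some k) ξ * m ξ)
    (h2k : Integrable (ker fun ξ => rho (some k) ξ * m ξ)) {g : Sp d → ℂ}
    (hg : AEStronglyMeasurable g) (hb : eLpNorm g ⊤ volume < ⊤) {a b : ℝ} (hab : a ≤ b) (x : Sp d) :
    funMult m g (x + b • dir k) - funMult m g (x + a • dir k) =
      ∫ s in Ioc a b, funMult (fun ξ => rho (some k) ξ * m ξ) g (x + s • dir k) := by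
  set mk : Sp d → ℂ := fun ξ => rho (some k) ξ * m ξ with hmk
  have hc := continuous_ker h2
  have key := integral_conv_param (μ := volume.restrict (Ioc a b))
    (K := fun y => ker m (y + b • dir k) - ker m (y + a • dir k))
    (k := fun s y => ker mk (y + s • dir k))
    (by
      have : Continuous fun p : ℝ × Sp d => ker mk (p.2 + p.1 • dir k) := hc.comp (by fun_prop)
      exact this.stronglyMeasurable) (by
      have : ∀ s : ℝ, ∫⁻ y, ‖ker mk (y + s • dir k)‖ₑ = kn mk := fun s =>
        lintegral_add_right_eq_self (fun y => ‖ker mk y‖ₑ) (s • dir k)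
      simp only [this, lintegral_const]
      exact ENNReal.mul_lt_top h2k.2 (by simp))
    (fun y => ker_shift_sub k h1 h2 hab y) hg hb x
  have e : ∀ c : ℝ, ∀ y, x - y + c • dir k = (x + c • dir k) - y := fun c y => by abel
  simp only [e, sub_mul] at key
  rw [integral_sub (integrable_ker_mul h1k hg hb _) (integrable_ker_mul h1k hg hb _)] at key
  simp only [funMult_eq]
  exact key

theorem funMult_symP_sub {c : Sp d → ℂ} (hc : Measurable c) {a b : ℝ} (hab : a ≤ b)
    (h1 : Integrable fun ξ => c ξ * symP a ξ) (h2 : Integrable fun ξ => c ξ * symAbsP a ξ)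
    (ha : Integrable (ker fun ξ => c ξ * symP a ξ)) (hbk : Integrable (ker fun ξ => c ξ * symP b ξ))
    (hfin : ∫⁻ s in Ioc a b, kn (fun ξ => c ξ * symAbsP s ξ) < ⊤) {g : Sp d → ℂ}
    (hg : AEStronglyMeasurable g) (hb : eLpNorm g ⊤ volume < ⊤) (x : Sp d) :
    funMult (fun ξ => c ξ * symP a ξ) g x - funMult (fun ξ => c ξ * symP b ξ) g x =
      ∫ s in Ioc a b, funMult (fun ξ => c ξ * symAbsP s ξ) g x := by
  have key := integral_conv_param (μ := volume.restrict (Ioc a b))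
    (K := fun y => ker (fun ξ => c ξ * symP a ξ) y - ker (fun ξ => c ξ * symP b ξ) y)
    (k := fun s y => ker (fun ξ => c ξ * symAbsP s ξ) y)
    (stronglyMeasurable_ker (measurable_mul_symAbsP hc)) hfin
    (fun y => by rw [ker_symP_sub hc hab h1 h2 y, intervalIntegral.integral_of_le hab]) hg hb x
  simp only [sub_mul] at key
  rw [integral_sub (integrable_ker_mul ha hg hb _) (integrable_ker_mul hbk hg hb _)] at key
  simp only [funMult_eq]
  exact key

/-- The size 1/t is not integrable at t = 0, so for a general bounded function the heat flow can be
integrated only from a positive time. -/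
theorem kn_symAbsP {t : ℝ} (ht : 0 < t) :
    kn (symAbsP (d := d) t) = ENNReal.ofReal t⁻¹ * kn (symAbsP (d := d) 1) := by
  have : symAbsP (d := d) t = fun ξ => ((t⁻¹ : ℝ) : ℂ) * (fun ξ => symAbsP 1 (t • ξ)) ξ := by
    ext ξ
    simp only [symAbsP, symAbs, symP, norm_smul, Real.norm_of_nonneg ht.le]
    push_cast
    have : (t : ℂ) ≠ 0 := by exact_mod_cast ht.ne'
    field_simp
  rw [this, kn_const_mul, kn_comp_smul _ ht, ← ofReal_norm, Complex.norm_real,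
    Real.norm_of_nonneg (by positivity)]

theorem one_mul_symAbsP (s : ℝ) : (fun ξ : Sp d => (1 : ℂ) * symAbsP s ξ) = rhoP none s := by
  ext ξ; rw [one_mul]; rfl

theorem one_mul_symP (s : ℝ) : (fun ξ : Sp d => (1 : ℂ) * symP s ξ) = symP s := by
  ext ξ; rw [one_mul]

theorem heat_sub_heat [NeZero d] (φ : DyadicCutoff d) {a b : ℝ} (ha : 0 < a) (hab : a ≤ b)
    {g : Sp d → ℂ} (hg : AEStronglyMeasurable g) (hb : eLpNorm g ⊤ volume < ⊤) (x : Sp d) :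
    funMult (symP a) g x - funMult (symP b) g x = ∫ s in Ioc a b, funMult (rhoP none s) g x := by
  have h := funMult_symP_sub (c := fun _ => 1) measurable_const hab
    (by rw [one_mul_symP]; exact integrable_symP ha)
    (by rw [one_mul_symAbsP]; exact integrable_rhoP none ha)
    (by rw [one_mul_symP]; exact (sym_symP φ ha).kint)
    (by rw [one_mul_symP]; exact (sym_symP φ (ha.trans_le hab)).kint)
    (by
      simp only [one_mul_symAbsP]
      calc ∫⁻ s in Ioc a b, kn (rhoP (d := d) none s)
          ≤ ∫⁻ s in Ioc a b, ENNReal.ofReal a⁻¹ * kn (rhoP (d := d) none 1) := by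
            refine setLIntegral_mono' measurableSet_Ioc fun s hs => ?_
            refine (kn_symAbsP (ha.trans hs.1)).trans_le ?_
            refine mul_le_mul' (ENNReal.ofReal_le_ofReal ?_) le_rfl
            gcongr
            exact hs.1.le
        _ < ⊤ := by
            rw [lintegral_const]
            exact ENNReal.mul_lt_top (ENNReal.mul_lt_top (by simp)
              (sym_rhoP φ none one_pos).kn_lt_top) (by simp)) hg hb x
  simpa only [one_mul_symAbsP, one_mul_symP] using h

theorem heat_sub_heat' [NeZero d] (φ : DyadicCutoff d) {a b : ℝ} (ha : 0 < a) (hb0 : 0 < b)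
    {g : Sp d → ℂ} (hg : AEStronglyMeasurable g) (hb : eLpNorm g ⊤ volume < ⊤) (x : Sp d) :
    funMult (symP a) g x - funMult (symP b) g x = ∫ s in a..b, funMult (rhoP none s) g x := by
  rcases le_total a b with hab | hab
  · rw [intervalIntegral.integral_of_le hab, heat_sub_heat φ ha hab hg hb]
  · rw [intervalIntegral.integral_of_ge hab, ← heat_sub_heat φ hb0 hab hg hb]; ring

/-- A representative of `g(·, z)` obtained from the heat flow. -/
def smooth (g : Sp d → ℝ → ℂ) (x : Sp d) (z : ℝ) : ℂ :=
  funMult (symP 1) (fun y => g y z) x + ∫ s in (0 : ℝ)..1, funMult (rhoP none s) (fun y => g y z) x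

theorem measurable_rhoP (l : Option (Fin d)) :
    Measurable (Function.uncurry fun (t : ℝ) (ξ : Sp d) => rhoP l t ξ) := by
  have h1 := (continuous_rho l).measurable
  unfold rhoP symP Function.uncurry
  fun_prop

theorem measurable_rhoP_flow (l : Option (Fin d)) {g : Sp d → ℝ → ℂ}
    (hg : Measurable (Function.uncurry g)) :
    Measurable (Function.uncurry fun (x : Sp d) (p : ℝ × ℝ) =>
      funMult (rhoP l p.2) (fun y => g y p.1) x) :=
  measurable_funMult_uncurry (m := fun p : ℝ × ℝ => rhoP l p.2) (g := fun y (p : ℝ × ℝ) => g y p.1)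
    ((measurable_rhoP l).comp ((measurable_snd.comp measurable_fst).prodMk measurable_snd))
    (hg.comp (measurable_fst.prodMk (measurable_fst.comp measurable_snd)))

theorem measurable_smooth {g : Sp d → ℝ → ℂ} (hg : Measurable (Function.uncurry g)) :
    Measurable (Function.uncurry (smooth g)) := by
  have h1 : Measurable (Function.uncurry fun (x : Sp d) (z : ℝ) =>
      funMult (symP 1) (fun y => g y z) x) :=
    measurable_funMult_const (continuous_symP 1).measurable hg
  have h2 : Measurable fun q : (Sp d × ℝ) × ℝ => funMult (rhoP none q.2) (fun y => g y q.1.2) q.1.1 :=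
    measurable_assoc_pair (F := fun x p => funMult (rhoP none p.2) (fun y => g y p.1) x)
      (measurable_rhoP_flow none hg)
  have h3 := (h2.stronglyMeasurable.integral_prod_right'
    (ν := volume.restrict (Ioc (0 : ℝ) 1))).measurable
  have h4 : Function.uncurry (smooth g) = fun p : Sp d × ℝ =>
      funMult (symP 1) (fun y => g y p.2) p.1 +
        ∫ s in Ioc (0 : ℝ) 1, funMult (rhoP none s) (fun y => g y p.2) p.1 := by
    funext p
    simp only [Function.uncurry, smooth, intervalIntegral.integral_of_le zero_le_one]
  rw [h4]
  exact h1.add h3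

variable (φ : DyadicCutoff d)

/-- The times at which the block norms of `g` are summable with weight `2^j`. -/
def GoodTime (g : Sp d → ℝ → ℂ) (z : ℝ) : Prop :=
  z < 0 ∧ ∑' j : ℤ, (2 : ℝ≥0∞) ^ (j : ℝ) * blk φ g j z < ⊤

theorem ae_goodTime {g : Sp d → ℝ → ℂ} (hg : BM g) (hB : Bes φ 1 g < ⊤) :
    ∀ᵐ z ∂(volume.restrict (Iio (0 : ℝ))), GoodTime φ g z := by
  have h1 : ∫⁻ z in Iio (0 : ℝ), ∑' j : ℤ, (2 : ℝ≥0∞) ^ (j : ℝ) * blk φ g j z < ⊤ := by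
    rw [lintegral_tsum fun j => ((measurable_blk φ hg j).const_mul _).aemeasurable]
    refine lt_of_le_of_lt (ENNReal.tsum_le_tsum fun j => ?_) hB
    rw [lintegral_const_mul _ (measurable_blk φ hg j), one_mul]
  filter_upwards [ae_lt_top (Measurable.tsum fun j => (measurable_blk φ hg j).const_mul _) h1.ne,
    ae_restrict_mem measurableSet_Iio] with z hz hz0
  exact ⟨hz0, hz⟩

theorem measurable_fix_pair {F : Sp d → ℝ × ℝ → ℂ} (hF : Measurable (Function.uncurry F))
    (x : Sp d) (z : ℝ) : Measurable fun t => F x (z, t) :=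
  hF.comp (measurable_const.prodMk (measurable_const.prodMk measurable_id))

variable [NeZero d]

/-- The block sum replaces the kernel bound of order 1/t by one uniform in t > 0, so the flow can be
integrated down to t = 0. -/
theorem GoodTime.bound {g : Sp d → ℝ → ℂ} (hg : BM g) {z : ℝ} (hz : GoodTime φ g z)
    (l : Option (Fin d)) {t : ℝ} (ht : 0 < t) (x : Sp d) :
    ‖funMult (rhoP l t) (fun y => g y z) x‖ₑ ≤
      heatConst φ * ∑' j : ℤ, (2 : ℝ≥0∞) ^ (j : ℝ) * blk φ g j z := by
  refine (enorm_funMult_rhoP_le φ l hg ht hz.1 x).trans ?_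
  rw [heatMaj, ← ENNReal.tsum_mul_left]
  refine ENNReal.tsum_le_tsum fun j => ?_
  rw [mul_assoc]
  gcongr
  exact heatWt_le j ht.le

theorem GoodTime.intervalIntegrable {g : Sp d → ℝ → ℂ} (hg : BM g) {z : ℝ} (hz : GoodTime φ g z)
    (l : Option (Fin d)) (x : Sp d) {a b : ℝ} (ha : 0 ≤ a) (hb : 0 ≤ b) :
    IntervalIntegrable (fun t => funMult (rhoP l t) (fun y => g y z) x) volume a b := by
  have key : ∀ {a b : ℝ}, 0 ≤ a →
      IntegrableOn (fun t => funMult (rhoP l t) (fun y => g y z) x) (Ioc a b) := by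
    intro a b ha
    refine ⟨Measurable.aestronglyMeasurable ?_, ?_⟩
    · exact measurable_fix_pair (F := fun x p => funMult (rhoP l p.2) (fun y => g y p.1) x)
        (measurable_rhoP_flow l hg.meas) x z
    · refine lt_of_le_of_lt (b := ∫⁻ _t in Ioc a b, heatConst φ *
        ∑' j : ℤ, (2 : ℝ≥0∞) ^ (j : ℝ) * blk φ g j z) ?_ ?_
      · exact setLIntegral_mono' measurableSet_Ioc fun t ht =>
          GoodTime.bound φ hg hz l (ha.trans_lt ht.1) x
      · rw [lintegral_const]
        exact ENNReal.mul_lt_top (ENNReal.mul_lt_top (by simp) hz.2) (by simp)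
  exact ⟨key ha, key hb⟩

theorem GoodTime.heat_eq {g : Sp d → ℝ → ℂ} (hg : BM g) {z : ℝ} (hz : GoodTime φ g z)
    {t : ℝ} (ht : 0 < t) (x : Sp d) :
    funMult (symP t) (fun y => g y z) x =
      smooth g x z - ∫ s in (0 : ℝ)..t, funMult (rhoP none s) (fun y => g y z) x := by
  have h1 := heat_sub_heat' φ ht one_pos (hg.slice_aesm z) (hg.slice_fin hz.1) x
  have h2 := intervalIntegral.integral_add_adjacent_intervals
    (GoodTime.intervalIntegrable φ hg hz none x le_rfl ht.le)
    (GoodTime.intervalIntegrable φ hg hz none x ht.le zero_le_one)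
  rw [smooth, ← h2, ← h1]
  ring

theorem GoodTime.tendsto {g : Sp d → ℝ → ℂ} (hg : BM g) {z : ℝ} (hz : GoodTime φ g z) (x : Sp d) :
    Filter.Tendsto (fun n : ℕ => funMult (symP (1 / ((n : ℝ) + 1))) (fun y => g y z) x) Filter.atTop
      (nhds (smooth g x z)) := by
  have h1 : ∀ n : ℕ, (0 : ℝ) < 1 / ((n : ℝ) + 1) := fun n => by positivity
  simp only [fun n : ℕ => GoodTime.heat_eq φ hg hz (h1 n) x]
  have h2 : Filter.Tendsto (fun n : ℕ => ∫ s in (0 : ℝ)..(1 / ((n : ℝ) + 1)),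
      funMult (rhoP none s) (fun y => g y z) x) Filter.atTop (nhds 0) := by
    have hI := GoodTime.intervalIntegrable φ hg hz none x le_rfl zero_le_one
    have hc := intervalIntegral.continuousOn_primitive_interval (a := 0) (b := 1)
      (f := fun s => funMult (rhoP none s) (fun y => g y z) x) (μ := volume) (by
        rw [uIcc_of_le zero_le_one]
        exact (integrableOn_Icc_iff_integrableOn_Ioc).2
          ((intervalIntegrable_iff_integrableOn_Ioc_of_le zero_le_one).1 hI))
    have h0 := hc 0 left_mem_uIcc
    have h3 : Filter.Tendsto (fun n : ℕ => 1 / ((n : ℝ) + 1)) Filter.atTop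
        (nhdsWithin 0 (uIcc 0 1)) := by
      refine tendsto_nhdsWithin_iff.2 ⟨tendsto_one_div_add_atTop_nhds_zero_nat, .of_forall fun n => ?_⟩
      rw [uIcc_of_le zero_le_one]
      refine ⟨(h1 n).le, ?_⟩
      rw [div_le_one (by positivity)]
      have : (0 : ℝ) ≤ n := by positivity
      linarith
    have h4 := Filter.Tendsto.comp h0 h3
    simpa [Function.comp_def] using h4
  simpa using tendsto_const_nhds.sub h2

/-- At a good time e^{-t|D|}g converges at every x to `smooth g` as t → 0, and an approximate
identity can converge only to g almost everywhere. Having a representative defined at every x is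
what allows integration along vertical lines. -/
theorem GoodTime.ae_eq {g : Sp d → ℝ → ℂ} (hg : BM g) {z : ℝ} (hz : GoodTime φ g z) :
    ∀ᵐ x, smooth g x z = g x z := by
  have h := ae_eq_of_tendsto_funMult (sym_symP_one φ) (hg.slice_aesm z) (hg.slice_fin hz.1)
    (c := fun n : ℕ => 1 / ((n : ℝ) + 1)) (fun n => by positivity)
    tendsto_one_div_add_atTop_nhds_zero_nat (F := fun x => smooth g x z)
    (.of_forall fun x => by
      have := GoodTime.tendsto φ hg hz x
      refine this.congr fun n => ?_
      rw [symP_eq_comp_smul _ (by positivity)])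
  filter_upwards [h] with x hx
  simpa [symP] using hx

theorem GoodTime.smooth_le {g : Sp d → ℝ → ℂ} (hg : BM g) {z : ℝ} (hz : GoodTime φ g z) (x : Sp d) :
    ‖smooth g x z‖ₑ ≤ kn (symP (d := d) 1) * LI g := by
  refine le_of_tendsto (GoodTime.tendsto φ hg hz x).enorm (.of_forall fun n => ?_)
  have hp : (0 : ℝ) < 1 / ((n : ℝ) + 1) := by positivity
  refine (funMult_enorm_le _ _ (continuous_ker (sym_symP φ hp).int) x).trans ?_
  rw [kn_symP hp]
  gcongr
  exact eLpNorm_slice_le g hz.1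

end IntegratedFormulas

/-! ### The heat integral and its increments -/

section HeatIntegral

variable {d : ℕ}

/-- The heat integral `∫_0^z e^{(z-z')|D|} h(z') dz'`. -/
def heatInt (h : Sp d → ℝ → ℂ) (x : Sp d) (z : ℝ) : ℂ :=
  ∫ z' in (0 : ℝ)..z, funMult (symP (z' - z)) (fun y => h y z') x

theorem heatInt_eq (h : Sp d → ℝ → ℂ) (x : Sp d) {z : ℝ} (hz : z < 0) :
    heatInt h x z = -∫ τ in after z, funMult (symP |z - τ|) (fun y => h y τ) x := by
  rw [heatInt, intervalIntegral.integral_of_ge hz.le, integral_Ioc_eq_integral_Ioo, after]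
  congr 1
  refine setIntegral_congr_fun measurableSet_Ioo fun τ hτ => ?_
  rw [abs_sub_comm, abs_of_pos (sub_pos.2 hτ.1)]

theorem heatInt_congr {g h : Sp d → ℝ → ℂ}
    (H : ∀ᵐ z ∂(volume.restrict (Iio (0 : ℝ))), ∀ᵐ x, g x z = h x z) (x : Sp d) {z : ℝ}
    (hz : z < 0) : heatInt g x z = heatInt h x z := by
  rw [heatInt_eq g x hz, heatInt_eq h x hz]
  congr 1
  refine integral_congr_ae ?_
  filter_upwards [ae_restrict_of_ae_restrict_of_subset (timeSets_after.neg z) H] with τ hτ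
  rw [funMult_congr _ hτ]

theorem measurable_symP_abs :
    Measurable (Function.uncurry fun (p : ℝ × ℝ) (ξ : Sp d) => symP |p.1 - p.2| ξ) := by
  unfold symP Function.uncurry
  fun_prop

theorem measurable_heatFlowP {g : Sp d → ℝ → ℂ} (hg : Measurable (Function.uncurry g)) :
    Measurable (Function.uncurry fun (x : Sp d) (p : ℝ × ℝ) =>
      funMult (symP |p.1 - p.2|) (fun y => g y p.2) x) :=
  measurable_funMult_uncurry (g := fun y (p : ℝ × ℝ) => g y p.2) measurable_symP_abs
    (hg.comp (measurable_fst.prodMk (measurable_snd.comp measurable_snd)))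

theorem measurable_comp_prodMk {α β : Type*} [MeasurableSpace α] [MeasurableSpace β]
    {F : Sp d → α → ℂ} (hF : Measurable (Function.uncurry F)) {u : β → Sp d} {v : β → α}
    (hu : Measurable u) (hv : Measurable v) : Measurable fun p => F (u p) (v p) :=
  hF.comp (hu.prodMk hv)

variable (φ : DyadicCutoff d) [NeZero d]

theorem heatFlowP_le (φ : DyadicCutoff d) {g : Sp d → ℝ → ℂ} {s τ : ℝ} (h : s ≠ τ) (hτ : τ < 0)
    (x : Sp d) : ‖funMult (symP |s - τ|) (fun y => g y τ) x‖ₑ ≤ kn (symP (d := d) 1) * LI g := by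
  have hp : 0 < |s - τ| := abs_pos.2 (sub_ne_zero.2 h)
  refine (funMult_enorm_le _ _ (continuous_ker (sym_symP φ hp).int) x).trans ?_
  rw [kn_symP hp]
  gcongr
  exact eLpNorm_slice_le g hτ

theorem integrableOn_heatFlowP (φ : DyadicCutoff d) {g : Sp d → ℝ → ℂ} (hg : BM g) (x : Sp d) (z : ℝ) :
    IntegrableOn (fun τ => funMult (symP |z - τ|) (fun y => g y τ) x) (after z) := by
  refine ⟨?_, ?_⟩
  · exact ((measurable_slice_pair (F := fun x p => funMult (symP |p.1 - p.2|) (fun y => g y p.2) x)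
      (measurable_heatFlowP hg.meas) z).comp measurable_prodMk_left).aestronglyMeasurable
  · refine lt_of_le_of_lt (setLIntegral_mono' (timeSets_after.measurableSet z) fun τ hτ =>
      heatFlowP_le φ (timeSets_after.ne z τ hτ) (timeSets_after.neg z hτ) x) ?_
    rw [lintegral_const]
    exact ENNReal.mul_lt_top (ENNReal.mul_lt_top (sym_symP φ one_pos).kn_lt_top hg.fin)
      (by simp [after])

theorem heatInt_add (φ : DyadicCutoff d) {g h : Sp d → ℝ → ℂ} (hg : BM g) (hh : BM h) (x : Sp d) {z : ℝ} (hz : z < 0) :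
    heatInt (fun x z => g x z + h x z) x z = heatInt g x z + heatInt h x z := by
  simp only [heatInt_eq _ x hz]
  rw [← neg_add, ← integral_add (integrableOn_heatFlowP φ hg x z) (integrableOn_heatFlowP φ hh x z)]
  congr 1
  refine setIntegral_congr_fun (timeSets_after.measurableSet z) fun τ hτ => ?_
  have hpos : 0 < |z - τ| := abs_pos.2 (sub_ne_zero.2 (timeSets_after.ne z τ hτ))
  have hneg := timeSets_after.neg z hτ
  exact funMult_add (sym_symP φ hpos).kint (hg.slice_aesm τ) (hg.slice_fin hneg)
    (hh.slice_aesm τ) (hh.slice_fin hneg) x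

theorem continuous_Duh {A : ℝ → Set ℝ} (hA : TimeSets A) (l : Option (Fin d)) {g : Sp d → ℝ → ℂ}
    (hg : BM g) (hB : Bes φ 1 g < ⊤) (s : ℝ) : Continuous fun x => Duh A l g x s := by
  have hfin := ((lintegral_heatMaj_le φ hg s (hA.neg s)).trans_lt (ENNReal.mul_lt_top (by simp) hB))
  have hm : Measurable fun τ => heatMaj φ g |s - τ| τ := by
    refine Measurable.tsum fun j => ?_
    have h1 : Measurable fun τ : ℝ => heatWt j |s - τ| := (measurable_heatWt j).comp (by fun_prop)
    exact (h1.const_mul _).mul (measurable_blk φ hg j)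
  simp only [Duh]
  refine continuous_of_dominated (bound := fun τ => (heatMaj φ g |s - τ| τ).toReal) ?_ ?_ ?_ ?_
  · exact fun x => ((measurable_heatFlow_slice l hg.meas s).comp
      measurable_prodMk_left).aestronglyMeasurable
  · intro x
    filter_upwards [heatFlow_bound φ hA l hg s, ae_lt_top hm hfin.ne] with τ h1 h2
    rw [← toReal_enorm]
    exact ENNReal.toReal_mono h2.ne (h1 x)
  · exact integrable_toReal_of_lintegral_ne_top hm.aemeasurable hfin.ne
  · filter_upwards [ae_restrict_mem (hA.measurableSet s)] with τ hτ
    exact continuous_funMult (sym_rhoP φ l (abs_pos.2 (sub_ne_zero.2 (hA.ne s τ hτ)))).kint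
      (hg.slice_aesm τ) (hg.slice_fin (hA.neg s hτ))

theorem heatInt_shift_sub {h : Sp d → ℝ → ℂ} (hg : BM h) (hB : Bes φ 1 h < ⊤) (k : Fin d) {z : ℝ}
    (hz : z < 0) {a b : ℝ} (hab : a ≤ b) (x : Sp d) :
    heatInt h (x + b • dir k) z - heatInt h (x + a • dir k) z =
      -∫ s in Ioc a b, Duh after (some k) h (x + s • dir k) z := by
  simp only [heatInt_eq _ _ hz]
  rw [neg_sub_neg, ← neg_sub, ← integral_sub (integrableOn_heatFlowP φ hg _ z)
    (integrableOn_heatFlowP φ hg _ z)]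
  congr 1
  have hmeas : Measurable (Function.uncurry fun τ s : ℝ =>
      funMult (rhoP (some k) |z - τ|) (fun y => h y τ) (x + s • dir k)) := by
    exact measurable_comp_prodMk (F := fun x τ => funMult (rhoP (some k) |z - τ|) (fun y => h y τ) x)
      (measurable_heatFlow_slice (some k) hg.meas z) (u := fun p : ℝ × ℝ => x + p.2 • dir k)
      (by fun_prop) measurable_fst
  calc ∫ τ in after z, (funMult (symP |z - τ|) (fun y => h y τ) (x + b • dir k) -
        funMult (symP |z - τ|) (fun y => h y τ) (x + a • dir k))
      = ∫ τ in after z, ∫ s in Ioc a b,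
          funMult (rhoP (some k) |z - τ|) (fun y => h y τ) (x + s • dir k) := by
        refine setIntegral_congr_fun (timeSets_after.measurableSet z) fun τ hτ => ?_
        have hpos : 0 < |z - τ| := abs_pos.2 (sub_ne_zero.2 (timeSets_after.ne z τ hτ))
        exact funMult_shift_sub k (integrable_symP hpos) (sym_symP φ hpos).kint
          (integrable_rhoP (some k) hpos) (sym_rhoP φ (some k) hpos).kint (hg.slice_aesm τ)
          (hg.slice_fin (timeSets_after.neg z hτ)) hab x
    _ = ∫ s in Ioc a b, ∫ τ in after z,
          funMult (rhoP (some k) |z - τ|) (fun y => h y τ) (x + s • dir k) := by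
        refine integral_integral_swap ⟨hmeas.aestronglyMeasurable, ?_⟩
        rw [HasFiniteIntegral, lintegral_prod_symm _ hmeas.enorm.aemeasurable]
        refine lt_of_le_of_lt (lintegral_mono fun s =>
          lintegral_heatFlow_le φ timeSets_after (some k) hg (x + s • dir k) z) ?_
        rw [lintegral_const]
        exact ENNReal.mul_lt_top (ENNReal.mul_lt_top (by simp) hB) (by simp)

/-- This is the equation ∂_z F = h + |D|F in integrated form, with zero value at z = 0. Each
e^{-(τ-z)|D|}h(τ) is written as the representative of h(τ) minus the integral of |D|e^{-s|D|}h(τ)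
for 0 < s < τ - z, and Fubini is applied on the triangle z < s < τ < 0. -/
theorem heatInt_eq_integral {h : Sp d → ℝ → ℂ} (hg : BM h) (hB : Bes φ 1 h < ⊤) {z : ℝ}
    (hz : z < 0) (x : Sp d) :
    heatInt h x z = -∫ s in after z, (smooth h x s - Duh after none h x s) := by
  -- Integrating over τ gives the Duhamel integral at time s; integrating over s gives the
  -- correction at time τ.
  set K : ℝ → ℝ → ℂ := fun s τ =>
    if s < τ then funMult (rhoP none |s - τ|) (fun y => h y τ) x else 0 with hK
  have hKm : Measurable (Function.uncurry K) := by
    refine Measurable.ite (measurableSet_lt measurable_fst measurable_snd) ?_ measurable_const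
    exact measurable_comp_prodMk
      (F := fun x (p : ℝ × ℝ) => funMult (rhoP none |p.1 - p.2|) (fun y => h y p.2) x)
      (measurable_heatFlow none hg.meas) measurable_const measurable_id
  have hK1 : ∀ s ∈ after z, ∫ τ in after z, K s τ = Duh after none h x s := by
    intro s hs
    have e : ∀ τ, K s τ = (Ioi s).indicator
        (fun τ => funMult (rhoP none |s - τ|) (fun y => h y τ) x) τ := fun τ => by
      simp [hK, indicator_apply]
    simp only [e]
    rw [setIntegral_indicator measurableSet_Ioi, Duh]
    congr 2
    ext τ
    constructor
    · exact fun hτ => ⟨hτ.2, hτ.1.2⟩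
    · exact fun hτ => ⟨⟨hs.1.trans hτ.1, hτ.2⟩, hτ.1⟩
  have hK2 : ∀ τ ∈ after z, ∫ s in after z, K s τ =
      ∫ s in (0 : ℝ)..(τ - z), funMult (rhoP none s) (fun y => h y τ) x := by
    intro τ hτ
    have e : ∀ s, K s τ = (Iio τ).indicator
        (fun s => funMult (rhoP none |s - τ|) (fun y => h y τ) x) s := fun τ => by
      simp [hK, indicator_apply]
    simp only [e]
    have h1 := intervalIntegral.integral_comp_sub_left (a := z) (b := τ)
      (fun s => funMult (rhoP none s) (fun y => h y τ) x) τ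
    rw [sub_self] at h1
    rw [setIntegral_indicator measurableSet_Iio, ← h1, intervalIntegral.integral_of_le hτ.1.le,
      integral_Ioc_eq_integral_Ioo]
    have h2 : after z ∩ Iio τ = Ioo z τ := by
      ext s
      constructor
      · exact fun hs => ⟨hs.1.1, hs.2⟩
      · exact fun hs => ⟨⟨hs.1, hs.2.trans hτ.2⟩, hs.2⟩
    rw [h2]
    refine setIntegral_congr_fun measurableSet_Ioo fun s hs => ?_
    rw [abs_sub_comm, abs_of_pos (sub_pos.2 hs.2)]
  have hKi : Integrable (Function.uncurry K)
      ((volume.restrict (after z)).prod (volume.restrict (after z))) := by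
    refine ⟨hKm.aestronglyMeasurable, ?_⟩
    rw [HasFiniteIntegral, lintegral_prod _ hKm.enorm.aemeasurable]
    refine lt_of_le_of_lt (b := ∫⁻ _s in after z, heatConst φ * Bes φ 1 h) ?_ ?_
    · refine setLIntegral_mono' (timeSets_after.measurableSet z) fun s hs => ?_
      refine le_trans ?_ (lintegral_heatFlow_le φ timeSets_after none hg x s)
      rw [← lintegral_indicator (timeSets_after.measurableSet z),
        ← lintegral_indicator (timeSets_after.measurableSet s)]
      refine lintegral_mono fun τ => ?_
      by_cases hτ : τ ∈ after z
      · rw [indicator_of_mem hτ]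
        simp only [hK, Function.uncurry]
        split_ifs with hlt
        · rw [indicator_of_mem (show τ ∈ after s from ⟨hlt, hτ.2⟩)]
        · simp
      · simp [hτ]
    · rw [lintegral_const]
      exact ENNReal.mul_lt_top (ENNReal.mul_lt_top (by simp) hB) (by simp [after])
  have hsm : IntegrableOn (fun τ => smooth h x τ) (after z) := by
    refine ⟨((measurable_smooth hg.meas).comp measurable_prodMk_left).aestronglyMeasurable, ?_⟩
    refine lt_of_le_of_lt (lintegral_mono_ae (g := fun _ => kn (symP (d := d) 1) * LI h) ?_) ?_
    · filter_upwards [ae_restrict_of_ae_restrict_of_subset (timeSets_after.neg z)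
        (ae_goodTime φ hg hB)] with τ hτ using GoodTime.smooth_le φ hg hτ x
    · rw [lintegral_const]
      exact ENNReal.mul_lt_top (ENNReal.mul_lt_top (sym_symP φ one_pos).kn_lt_top hg.fin)
        (by simp [after])
  have hD : IntegrableOn (fun s => Duh after none h x s) (after z) :=
    (IntegrableOn.congr_fun hKi.integral_prod_left (fun s hs => hK1 s hs)
      (timeSets_after.measurableSet z))
  rw [heatInt_eq _ _ hz]
  congr 1
  calc ∫ τ in after z, funMult (symP |z - τ|) (fun y => h y τ) x
      = ∫ τ in after z, (smooth h x τ - ∫ s in after z, K s τ) := by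
        refine integral_congr_ae ?_
        filter_upwards [ae_restrict_of_ae_restrict_of_subset (timeSets_after.neg z)
          (ae_goodTime φ hg hB), ae_restrict_mem (timeSets_after.measurableSet z)] with τ hτ hτ2
        rw [hK2 τ hτ2, abs_sub_comm, abs_of_pos (sub_pos.2 hτ2.1),
          GoodTime.heat_eq φ hg hτ (sub_pos.2 hτ2.1)]
    _ = (∫ τ in after z, smooth h x τ) - ∫ τ in after z, ∫ s in after z, K s τ :=
        integral_sub hsm hKi.integral_prod_right
    _ = (∫ τ in after z, smooth h x τ) - ∫ s in after z, Duh after none h x s := by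
        rw [← integral_integral_swap hKi]
        congr 1
        exact setIntegral_congr_fun (timeSets_after.measurableSet z) hK1
    _ = _ := (integral_sub hsm hD).symm

end HeatIntegral

/-! ### Integrated gradients, Lipschitz bounds and differentiation -/

section Derivatives

variable {d : ℕ}

/-- `F` is Lipschitz on `z < 0`, with horizontal derivatives `X (some k)` (continuous in `x`) and
vertical derivative `X none`, in integrated form. -/
structure HasGrad (F : Sp d → ℝ → ℂ) (X : Option (Fin d) → Sp d → ℝ → ℂ) (C : ℝ≥0) : Prop where
  horiz : ∀ (k : Fin d) (x : Sp d) (z : ℝ), z < 0 → ∀ a b : ℝ, a ≤ b →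
    F (x + b • dir k) z - F (x + a • dir k) z = ∫ s in Ioc a b, X (some k) (x + s • dir k) z
  cont : ∀ (k : Fin d) (z : ℝ), z < 0 → Continuous fun x => X (some k) x z
  vert : ∀ (x : Sp d) (z z' : ℝ), z ≤ z' → z' < 0 → F x z' - F x z = ∫ s in Ioc z z', X none x s
  meas : ∀ l, Measurable (Function.uncurry (X l))
  horiz_le : ∀ (k : Fin d) (x : Sp d) (z : ℝ), z < 0 → ‖X (some k) x z‖ ≤ C
  vert_le : ∀ x : Sp d, ∀ᵐ z ∂(volume.restrict (Iio (0 : ℝ))), ‖X none x z‖ ≤ C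

variable {F G : Sp d → ℝ → ℂ} {X Y : Option (Fin d) → Sp d → ℝ → ℂ} {C C' : ℝ≥0}

theorem HasGrad.integrable_vert (h : HasGrad F X C) (x : Sp d) {z z' : ℝ} (hz' : z' < 0) :
    IntegrableOn (fun s => X none x s) (Ioc z z') := by
  refine Measure.integrableOn_of_bounded (M := C) (by simp)
    ((h.meas none).comp measurable_prodMk_left).aestronglyMeasurable ?_
  exact ae_restrict_of_ae_restrict_of_subset (fun s hs => hs.2.trans_lt hz') (h.vert_le x)

theorem HasGrad.integrable_horiz (h : HasGrad F X C) (k : Fin d) (x : Sp d) {z : ℝ} (hz : z < 0)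
    (a b : ℝ) : IntegrableOn (fun s : ℝ => X (some k) (x + s • dir k) z) (Ioc a b) := by
  have h1 : Continuous fun s : ℝ => X (some k) (x + s • dir k) z :=
    (h.cont k z hz).comp (by fun_prop)
  exact (h1.integrableOn_Icc).mono_set Ioc_subset_Icc_self

theorem HasGrad.add (h : HasGrad F X C) (h' : HasGrad G Y C') :
    HasGrad (fun x z => F x z + G x z) (fun l x z => X l x z + Y l x z) (C + C') where
  horiz k x z hz a b hab := by
    rw [integral_add (h.integrable_horiz k x hz a b) (h'.integrable_horiz k x hz a b),
      ← h.horiz k x z hz a b hab, ← h'.horiz k x z hz a b hab]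
    ring
  cont k z hz := (h.cont k z hz).add (h'.cont k z hz)
  vert x z z' hzz hz' := by
    rw [integral_add (h.integrable_vert x hz') (h'.integrable_vert x hz'),
      ← h.vert x z z' hzz hz', ← h'.vert x z z' hzz hz']
    ring
  meas l := (h.meas l).add (h'.meas l)
  horiz_le k x z hz := (norm_add_le _ _).trans
    (by push_cast; exact add_le_add (h.horiz_le k x z hz) (h'.horiz_le k x z hz))
  vert_le x := by
    filter_upwards [h.vert_le x, h'.vert_le x] with z h1 h2
    push_cast
    exact (norm_add_le _ _).trans (add_le_add h1 h2)

theorem HasGrad.horiz_interval (h : HasGrad F X C) (k : Fin d) (x : Sp d) {z : ℝ} (hz : z < 0)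
    (a b : ℝ) : F (x + b • dir k) z - F (x + a • dir k) z =
      ∫ s in a..b, X (some k) (x + s • dir k) z := by
  rcases le_total a b with hab | hab
  · rw [intervalIntegral.integral_of_le hab, h.horiz k x z hz a b hab]
  · rw [intervalIntegral.integral_of_ge hab, ← h.horiz k x z hz b a hab, neg_sub]

theorem HasGrad.vert_interval (h : HasGrad F X C) (x : Sp d) {z z' : ℝ} (hz : z < 0)
    (hz' : z' < 0) : F x z' - F x z = ∫ s in z..z', X none x s := by
  rcases le_total z z' with hab | hab
  · rw [intervalIntegral.integral_of_le hab, h.vert x z z' hab hz']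
  · rw [intervalIntegral.integral_of_ge hab, ← h.vert x z' z hab hz, neg_sub]

theorem HasGrad.norm_vert_sub_le (h : HasGrad F X C) (x : Sp d) {z z' : ℝ} (hz : z < 0)
    (hz' : z' < 0) : ‖F x z' - F x z‖ ≤ C * |z' - z| := by
  rw [h.vert_interval x hz hz']
  refine intervalIntegral.norm_integral_le_of_norm_le_const_ae ?_
  have := (ae_restrict_iff' measurableSet_Iio).1 (h.vert_le x)
  filter_upwards [this] with s hs hsm
  exact hs (hsm.2.trans_lt (max_lt hz hz'))

theorem HasGrad.norm_horiz_sub_le (h : HasGrad F X C) (k : Fin d) (x : Sp d) {z : ℝ} (hz : z < 0)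
    (b : ℝ) : ‖F (x + b • dir k) z - F x z‖ ≤ C * |b| := by
  have h1 := h.horiz_interval k x hz 0 b
  rw [zero_smul, add_zero] at h1
  rw [h1]
  have := intervalIntegral.norm_integral_le_of_norm_le_const (a := 0) (b := b) (C := C)
    (f := fun s => X (some k) (x + s • dir k) z) fun s _ => h.horiz_le k _ z hz
  simpa using this

theorem sum_smul_dir (x : Sp d) : ∑ k, x k • dir k = x := by
  ext i
  simp [dir, Finset.sum_apply, Pi.single_apply]

theorem HasGrad.norm_sub_le (h : HasGrad F X C) (x y : Sp d) {z : ℝ} (hz : z < 0) :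
    ‖F (x + y) z - F x z‖ ≤ (d * C) * ‖y‖ := by
  have key : ∀ t : Finset (Fin d), ‖F (x + ∑ k ∈ t, y k • dir k) z - F x z‖ ≤
      ∑ k ∈ t, C * |y k| := by
    intro t
    classical
    induction t using Finset.induction_on with
    | empty => simp
    | insert k t hk ih =>
      rw [Finset.sum_insert hk, Finset.sum_insert hk]
      have h1 := h.norm_horiz_sub_le k (x + ∑ k ∈ t, y k • dir k) hz (y k)
      rw [show x + (y k • dir k + ∑ k ∈ t, y k • dir k) =
        x + ∑ k ∈ t, y k • dir k + y k • dir k by abel]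
      calc _ = ‖(F (x + ∑ k ∈ t, y k • dir k + y k • dir k) z - F (x + ∑ k ∈ t, y k • dir k) z) +
            (F (x + ∑ k ∈ t, y k • dir k) z - F x z)‖ := by congr 1; ring
        _ ≤ _ := (norm_add_le _ _).trans (add_le_add h1 ih)
  have h1 := key Finset.univ
  rw [sum_smul_dir] at h1
  refine h1.trans ?_
  calc ∑ k, (C : ℝ) * |y k| ≤ ∑ _k : Fin d, (C : ℝ) * ‖y‖ := by
        gcongr with k
        exact PiLp.norm_apply_le y k
    _ = _ := by simp; ring

theorem HasGrad.lipschitz (h : HasGrad F X C) :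
    LipschitzOnWith (d * C + C) (fun p : Sp d × ℝ => F p.1 p.2) (univ ×ˢ Iio (0 : ℝ)) := by
  refine LipschitzOnWith.of_dist_le_mul fun p hp q hq => ?_
  have hp2 : p.2 < 0 := hp.2
  have hq2 : q.2 < 0 := hq.2
  have h1 := h.norm_sub_le q.1 (p.1 - q.1) hp2
  rw [add_sub_cancel] at h1
  have h2 := h.norm_vert_sub_le q.1 hq2 hp2
  have h3 : ‖p.1 - q.1‖ ≤ dist p q := by
    rw [← dist_eq_norm]; exact le_max_left _ _
  have h4 : |p.2 - q.2| ≤ dist p q := by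
    rw [← Real.dist_eq]; exact le_max_right _ _
  rw [dist_eq_norm]
  calc ‖F p.1 p.2 - F q.1 q.2‖
      = ‖(F p.1 p.2 - F q.1 p.2) + (F q.1 p.2 - F q.1 q.2)‖ := by congr 1; ring
    _ ≤ (d * C) * ‖p.1 - q.1‖ + C * |p.2 - q.2| := (norm_add_le _ _).trans (add_le_add h1 h2)
    _ ≤ (d * C) * dist p q + C * dist p q := by gcongr
    _ = _ := by push_cast; ring

theorem HasGrad.hasDerivAt_horiz (h : HasGrad F X C) (k : Fin d) (x : Sp d) {z : ℝ} (hz : z < 0) :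
    HasDerivAt (fun t : ℝ => F (x + t • dir k) z) (X (some k) x z) 0 := by
  have hc : Continuous fun s : ℝ => X (some k) (x + s • dir k) z :=
    (h.cont k z hz).comp (by fun_prop)
  have h1 := intervalIntegral.integral_hasDerivAt_right (hc.intervalIntegrable 0 0)
    (hc.stronglyMeasurableAtFilter _ _) hc.continuousAt
  rw [zero_smul, add_zero] at h1
  refine (h1.const_add (F x z)).congr_of_eventuallyEq (.of_forall fun t => ?_)
  have h2 := h.horiz_interval k x hz 0 t
  rw [zero_smul, add_zero] at h2
  beta_reduce
  rw [← h2]; ring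

/-- The vertical density is only bounded and measurable, so Lebesgue differentiation gives the
derivative at almost every z; in the horizontal directions continuity of the density gives it
everywhere. -/
theorem HasGrad.ae_hasDerivAt_vert (h : HasGrad F X C) (x : Sp d) :
    ∀ᵐ z ∂(volume.restrict (Iio (0 : ℝ))), HasDerivAt (fun s => F x s) (X none x z) z := by
  set f : ℝ → ℂ := (Iio (0 : ℝ)).indicator fun s => X none x s with hf
  have hm : AEStronglyMeasurable f :=
    (((h.meas none).comp measurable_prodMk_left).indicator measurableSet_Iio).aestronglyMeasurable
  have hloc : LocallyIntegrable f := by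
    refine (locallyIntegrable_const (C : ℝ)).mono hm ?_
    filter_upwards [(ae_restrict_iff' measurableSet_Iio).1 (h.vert_le x)] with s hs
    rw [Real.norm_of_nonneg (show (0 : ℝ) ≤ (C : ℝ) from C.2)]
    by_cases h0 : s ∈ Iio (0 : ℝ)
    · rw [hf, indicator_of_mem h0]; exact hs h0
    · rw [hf, indicator_of_notMem h0, norm_zero]; exact C.2
  filter_upwards [ae_restrict_of_ae (_root_.LocallyIntegrable.ae_hasDerivAt_integral hloc), ae_restrict_mem measurableSet_Iio]
    with z hz hz0
  have h1 := (hz (-1)).const_add (F x (-1))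
  have h2 : f z = X none x z := by rw [hf, indicator_of_mem hz0]
  rw [h2] at h1
  refine h1.congr_of_eventuallyEq ?_
  filter_upwards [Iio_mem_nhds hz0] with s hs
  have h3 := h.vert_interval x (show (-1 : ℝ) < 0 by norm_num) hs
  have h4 : ∫ t in (-1 : ℝ)..s, f t = ∫ t in (-1 : ℝ)..s, X none x t := by
    refine intervalIntegral.integral_congr fun t ht => ?_
    rw [hf, indicator_of_mem]
    exact ht.2.trans_lt (max_lt (by norm_num) hs)
  rw [h4, ← h3]
  ring

/-! ### Gradients of Lipschitz functions -/

/-- The gradient of `v` on `z < 0`; the index `none` is the vertical direction. -/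
def grad (v : Sp d → ℝ → ℝ) : Option (Fin d) → Sp d → ℝ → ℂ
  | none => fun x z => if z < 0 then dz v x z else 0
  | some k => fun x z => if z < 0 then dx v k x z else 0

theorem grad_none (v : Sp d → ℝ → ℝ) (x : Sp d) {z : ℝ} (hz : z < 0) :
    grad v none x z = dz v x z := if_pos hz

theorem grad_some (v : Sp d → ℝ → ℝ) (k : Fin d) (x : Sp d) {z : ℝ} (hz : z < 0) :
    grad v (some k) x z = dx v k x z := if_pos hz

/-- The extension to all z makes v continuous on the whole space, which measurability of its
derivatives requires; derivatives at z < 0 are unchanged. -/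
theorem exists_extension {v : Sp d → ℝ → ℝ} {K : ℝ≥0}
    (hv : LipschitzOnWith K (fun p : Sp d × ℝ => v p.1 p.2) (univ ×ˢ Iio (0 : ℝ))) :
    ∃ w : Sp d → ℝ → ℝ, LipschitzWith K (fun p : Sp d × ℝ => w p.1 p.2) ∧
      ∀ x z, z < 0 → w x z = v x z := by
  obtain ⟨w, hw, he⟩ := hv.extend_real
  exact ⟨fun x z => w (x, z), hw, fun x z hz =>
    (he (show (x, z) ∈ univ ×ˢ Iio (0 : ℝ) from ⟨mem_univ x, hz⟩)).symm⟩

theorem dz_congr {v w : Sp d → ℝ → ℝ} (h : ∀ x z, z < 0 → w x z = v x z) (x : Sp d) {z : ℝ}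
    (hz : z < 0) : dz w x z = dz v x z := by
  have : (fun s => w x s) =ᶠ[nhds z] fun s => v x s := by
    filter_upwards [Iio_mem_nhds hz] with s hs using h x s hs
  simp only [dz, this.deriv_eq]

theorem dx_congr {v w : Sp d → ℝ → ℝ} (h : ∀ x z, z < 0 → w x z = v x z) (k : Fin d) (x : Sp d)
    {z : ℝ} (hz : z < 0) : dx w k x z = dx v k x z := by
  simp only [dx]
  congr 2
  ext x; exact h x z hz

theorem lipschitz_slice_x {w : Sp d → ℝ → ℝ} {K : ℝ≥0}
    (hw : LipschitzWith K (fun p : Sp d × ℝ => w p.1 p.2)) (z : ℝ) :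
    LipschitzWith K fun x => w x z := by
  have := hw.comp (LipschitzWith.prodMk_right (α := Sp d) z)
  rwa [mul_one] at this

theorem lipschitz_slice_z {w : Sp d → ℝ → ℝ} {K : ℝ≥0}
    (hw : LipschitzWith K (fun p : Sp d × ℝ => w p.1 p.2)) (x : Sp d) :
    LipschitzWith K fun z => w x z := by
  have := hw.comp (LipschitzWith.prodMk_left (β := ℝ) x)
  rwa [mul_one] at this

theorem BM_grad {v : Sp d → ℝ → ℝ} {K : ℝ≥0}
    (hv : LipschitzOnWith K (fun p : Sp d × ℝ => v p.1 p.2) (univ ×ˢ Iio (0 : ℝ)))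
    (l : Option (Fin d)) : BM (grad v l) := by
  obtain ⟨w, hw, he⟩ := exists_extension hv
  have hset : MeasurableSet {p : Sp d × ℝ | p.2 < 0} := measurableSet_lt measurable_snd measurable_const
  cases l with
  | none =>
    refine ⟨?_, (LI_le (C := K) fun x z hz => ?_).trans_lt (by simp)⟩
    · have h1 : Measurable fun p : Sp d × ℝ => dz w p.1 p.2 :=
        Complex.measurable_ofReal.comp
          (measurable_deriv_with_param (f := fun x s => w x s) hw.continuous)
      have h2 : Function.uncurry (grad v none) =
          fun p : Sp d × ℝ => if p.2 < 0 then dz w p.1 p.2 else 0 := by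
        ext p
        simp only [Function.uncurry, grad]
        split_ifs with h
        · exact (dz_congr he p.1 h).symm
        · rfl
      rw [h2]
      exact Measurable.ite hset h1 measurable_const
    · rw [grad_none v x hz, ← dz_congr he x hz, dz, ← ofReal_norm, Complex.norm_real]
      have := norm_deriv_le_of_lipschitz (x₀ := z) (lipschitz_slice_z hw x)
      exact (ENNReal.ofReal_le_ofReal this).trans_eq (by simp)
  | some k =>
    refine ⟨?_, (LI_le (C := K) fun x z hz => ?_).trans_lt (by simp)⟩
    · have h1 : Measurable fun p : Sp d × ℝ => dx w k p.1 p.2 := by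
        have h3 : Continuous (Function.uncurry fun (p : Sp d × ℝ) (t : ℝ) =>
            w (p.1 + t • EuclideanSpace.single k 1) p.2) := by
          have h4 : Continuous fun q : (Sp d × ℝ) × ℝ =>
              (q.1.1 + q.2 • (EuclideanSpace.single k 1 : Sp d), q.1.2) := by fun_prop
          exact hw.continuous.comp h4
        have h5 := (measurable_deriv_with_param h3).comp
          (measurable_prodMk_right (y := (0 : ℝ)) (α := Sp d × ℝ))
        exact Complex.measurable_ofReal.comp h5
      have h2 : Function.uncurry (grad v (some k)) =
          fun p : Sp d × ℝ => if p.2 < 0 then dx w k p.1 p.2 else 0 := by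
        ext p
        simp only [Function.uncurry, grad]
        split_ifs with h
        · exact (dx_congr he k p.1 h).symm
        · rfl
      rw [h2]
      exact Measurable.ite hset h1 measurable_const
    · rw [grad_some v k x hz, ← dx_congr he k x hz, dx, ← ofReal_norm, Complex.norm_real]
      have := norm_lineDeriv_le_of_lipschitz ℝ (x₀ := x) (v := EuclideanSpace.single k (1 : ℝ))
        (lipschitz_slice_x hw z)
      simp only [PiLp.norm_single, norm_one, mul_one] at this
      exact (ENNReal.ofReal_le_ofReal this).trans_eq (by simp)

theorem deriv_eq_of_ofReal {w : ℝ → ℝ} {D : ℂ} {t : ℝ} (h : HasDerivAt (fun s => (w s : ℂ)) D t) :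
    ((deriv w t : ℝ) : ℂ) = D := by
  have h1 : HasDerivAt w D.re t := by
    have := (Complex.reCLM.hasFDerivAt.comp_hasDerivAt t h)
    simpa [Function.comp_def] using this
  rw [h1.deriv]
  exact h1.ofReal_comp.unique h

variable {v : Sp d → ℝ → ℝ} {c : ℂ}

theorem HasGrad.lipschitz_real (h : HasGrad F X C)
    (hv : ∀ x z, z < 0 → (v x z : ℂ) = F x z + c) :
    LipschitzOnWith (d * C + C) (fun p : Sp d × ℝ => v p.1 p.2) (univ ×ˢ Iio (0 : ℝ)) := by
  intro p hp q hq
  have h1 := h.lipschitz hp hq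
  have h2 : edist (v p.1 p.2) (v q.1 q.2) = edist (F p.1 p.2) (F q.1 q.2) := by
    rw [← edist_add_right (F p.1 p.2) (F q.1 q.2) c, ← hv _ _ hp.2, ← hv _ _ hq.2, edist_dist, edist_dist,
      Complex.dist_of_im_eq (by simp)]
    simp
  beta_reduce
  rwa [h2]

theorem HasGrad.grad_some_eq (h : HasGrad F X C)
    (hv : ∀ x z, z < 0 → (v x z : ℂ) = F x z + c) (k : Fin d) (x : Sp d) {z : ℝ} (hz : z < 0) :
    grad v (some k) x z = X (some k) x z := by
  rw [grad_some v k x hz, dx, lineDeriv]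
  refine deriv_eq_of_ofReal ?_
  refine ((h.hasDerivAt_horiz k x hz).add_const c).congr_of_eventuallyEq (.of_forall fun t => ?_)
  exact hv _ z hz

/-- The derivative is identified for every x at almost every z; Fubini converts this to almost every
x on almost every slice, the form seen by convolutions in x. -/
theorem HasGrad.grad_none_eq (h : HasGrad F X C)
    (hv : ∀ x z, z < 0 → (v x z : ℂ) = F x z + c) :
    ∀ᵐ z ∂(volume.restrict (Iio (0 : ℝ))), ∀ᵐ x, grad v none x z = X none x z := by
  have hm := (BM_grad (h.lipschitz_real hv) none).meas
  have hset : MeasurableSet {p : Sp d × ℝ | grad v none p.1 p.2 = X none p.1 p.2} :=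
    measurableSet_eq_fun hm (h.meas none)
  refine (Measure.ae_ae_comm hset).1 (.of_forall fun x => ?_)
  filter_upwards [h.ae_hasDerivAt_vert x, ae_restrict_mem measurableSet_Iio] with z hz hz0
  rw [grad_none v x hz0, dz]
  refine deriv_eq_of_ofReal ((hz.add_const c).congr_of_eventuallyEq ?_)
  filter_upwards [Iio_mem_nhds hz0] with s hs using hv x s hs

end Derivatives

/-! ### Gradients of the heat integral and of the heat extension -/

section HeatGradients

variable {d : ℕ} (φ : DyadicCutoff d)

/-! ### The heat integral -/

section

variable [NeZero d]

/-- The gradient of `heatInt h`. -/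
def heatIntGrad (h : Sp d → ℝ → ℂ) : Option (Fin d) → Sp d → ℝ → ℂ
  | none => fun x z => smooth h x z - Duh after none h x z
  | some k => fun x z => -Duh after (some k) h x z

theorem heatIntGrad_none_le {h : Sp d → ℝ → ℂ} (hg : BM h) (hB : Bes φ 1 h < ⊤) (x : Sp d) :
    ∀ᵐ z ∂(volume.restrict (Iio (0 : ℝ))), ‖heatIntGrad h none x z‖ₑ ≤
      kn (symP (d := d) 1) * LI h + heatConst φ * Bes φ 1 h := by
  filter_upwards [ae_goodTime φ hg hB] with z hz
  simp only [heatIntGrad]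
  exact enorm_sub_le.trans
    (add_le_add (GoodTime.smooth_le φ hg hz x) (enorm_Duh_le φ timeSets_after none hg x z))

theorem norm_le_of_enorm_le {z : ℂ} {a : ℝ≥0∞} (ha : a < ⊤) (h : ‖z‖ₑ ≤ a) :
    ‖z‖ ≤ (a.toNNReal : ℝ) := by
  rw [← toReal_enorm]
  exact ENNReal.toReal_mono ha.ne h

theorem hasGrad_heatInt {h : Sp d → ℝ → ℂ} (hg : BM h) (hB : Bes φ 1 h < ⊤) :
    HasGrad (heatInt h) (heatIntGrad h)
      (kn (symP (d := d) 1) * LI h + heatConst φ * Bes φ 1 h).toNNReal := by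
  have hfin : kn (symP (d := d) 1) * LI h + heatConst φ * Bes φ 1 h < ⊤ :=
    ENNReal.add_lt_top.2 ⟨ENNReal.mul_lt_top (sym_symP φ one_pos).kn_lt_top hg.fin,
      ENNReal.mul_lt_top (by simp) hB⟩
  have hmeas : ∀ l, Measurable (Function.uncurry (heatIntGrad h l)) := by
    intro l
    cases l with
    | none => exact (measurable_smooth hg.meas).sub (measurable_Duh timeSets_after none hg.meas)
    | some k => exact (measurable_Duh timeSets_after (some k) hg.meas).neg
  have hvle : ∀ x : Sp d, ∀ᵐ z ∂(volume.restrict (Iio (0 : ℝ))), ‖heatIntGrad h none x z‖ ≤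
      (kn (symP (d := d) 1) * LI h + heatConst φ * Bes φ 1 h).toNNReal := fun x => by
    filter_upwards [heatIntGrad_none_le φ hg hB x] with z hz using norm_le_of_enorm_le hfin hz
  refine ⟨fun k x z hz a b hab => ?_, fun k z hz => ?_, fun x z z' hzz hz' => ?_, hmeas,
    fun k x z hz => ?_, hvle⟩
  · simp only [heatIntGrad, integral_neg]
    exact heatInt_shift_sub φ hg hB k hz hab x
  · exact (continuous_Duh φ timeSets_after (some k) hg hB z).neg
  · have hI : IntegrableOn (fun s => heatIntGrad h none x s) (after z) :=
      Measure.integrableOn_of_bounded (by simp [after])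
        ((hmeas none).comp measurable_prodMk_left).aestronglyMeasurable
        (ae_restrict_of_ae_restrict_of_subset (timeSets_after.neg z) (hvle x))
    have hU : after z = Ioc z z' ∪ after z' := by
      ext s
      constructor
      · intro hs
        rcases le_or_gt s z' with h1 | h1
        · exact Or.inl ⟨hs.1, h1⟩
        · exact Or.inr ⟨h1, hs.2⟩
      · rintro (hs | hs)
        · exact ⟨hs.1, hs.2.trans_lt hz'⟩
        · exact ⟨hzz.trans_lt hs.1, hs.2⟩
    have hdis : Disjoint (Ioc z z') (after z') :=
      Set.disjoint_left.2 fun s h1 h2 => absurd h2.1 (not_lt.2 h1.2)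
    have h1 := heatInt_eq_integral φ hg hB (hzz.trans_lt hz') x
    have h2 := heatInt_eq_integral φ hg hB hz' x
    change heatInt h x z = -∫ s in after z, heatIntGrad h none x s at h1
    change heatInt h x z' = -∫ s in after z', heatIntGrad h none x s at h2
    rw [h1, h2]
    have h3 : ∫ s in after z, heatIntGrad h none x s =
        (∫ s in Ioc z z', heatIntGrad h none x s) + ∫ s in after z', heatIntGrad h none x s := by
      rw [← setIntegral_union hdis (timeSets_after.measurableSet z')
        (hI.mono_set (hU ▸ subset_union_left)) (hI.mono_set (hU ▸ subset_union_right)), ← hU]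
    rw [h3]; ring
  · refine norm_le_of_enorm_le hfin ?_
    simp only [heatIntGrad, enorm_neg]
    exact (enorm_Duh_le φ timeSets_after (some k) hg x z).trans le_add_self

end

/-! ### The heat extension -/

/-- The symbol of `|D|⁻¹` cut off to a dyadic annulus. -/
def invCut (j : ℤ) : Sp d → ℂ := cut (fat φ) (fun ξ => ((‖ξ‖⁻¹ : ℝ) : ℂ)) j

theorem invCut_mul_symP (t : ℝ) (j : ℤ) : (fun ξ => invCut φ j ξ * symP t ξ) =
    cut (fat φ) (fun ξ => ((‖ξ‖⁻¹ : ℝ) : ℂ) * symP t ξ) j := by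
  ext ξ; simp only [invCut, cut]; ring

theorem invCut_mul_symP_ccSym (t : ℝ) (j : ℤ) : CcSym fun ξ => invCut φ j ξ * symP t ξ := by
  rw [invCut_mul_symP]
  exact (fat_annular φ).ccSym_cut (smoothOff_inv_norm.mul (smoothOff_symP t)) j

theorem invCut_mul_symAbsP (t : ℝ) (j : ℤ) :
    (fun ξ => invCut φ j ξ * symAbsP t ξ) = coefSym φ none t j := by
  ext ξ; simp only [invCut, cut, coefSym, symAbsP, rieszSym, rho]; ring

theorem rho_mul_invCut (l : Option (Fin d)) (t : ℝ) (j : ℤ) :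
    (fun ξ => rho l ξ * (invCut φ j ξ * symP t ξ)) = coefSym φ l t j := by
  ext ξ; simp only [invCut, cut, coefSym, rieszSym]; ring

theorem DyadicCutoff.toFun_zero : φ.toFun 0 = 0 := by
  by_contra h
  have := φ.norm_of_ne_zero h
  norm_num at this

theorem invCut_mul_dyad (t : ℝ) (j : ℤ) :
    (fun ξ => invCut φ j ξ * symP t ξ * dyad φ symAbs j ξ) = dyad φ (symP t) j := by
  rw [funext fun ξ => congrArg (· * dyad φ symAbs j ξ) (congrFun (invCut_mul_symP φ t j) ξ),
    dyad_mul_cut_fat]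
  ext ξ
  by_cases h : ξ = 0
  · simp [dyad, h, φ.toFun_zero]
  · have hn : (‖ξ‖ : ℂ) ≠ 0 := by exact_mod_cast norm_ne_zero_iff.2 h
    simp only [dyad, symAbs]
    push_cast
    field_simp

/-- The blocks of `e^{z|D|} f`. -/
def heatBlk (f : 𝓢'(Sp d, ℂ)) (j : ℤ) (x : Sp d) (z : ℝ) : ℂ :=
  distMult (dyad φ (symP (-z)) j) f x

theorem heatBlk_eq {f : 𝓢'(Sp d, ℂ)} (hf : ∀ j, absBlk φ f j < ⊤) (j : ℤ) (x : Sp d) (z : ℝ) :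
    heatBlk φ f j x z =
      funMult (fun ξ => invCut φ j ξ * symP (-z) ξ) (distMult (dyad φ symAbs j) f) x := by
  rw [heatBlk, ← invCut_mul_dyad]
  exact distMult_mul (invCut_mul_symP_ccSym φ (-z) j) (dyad_symAbs_ccSym φ j) f (hf j) x

theorem absField_aesm (f : 𝓢'(Sp d, ℂ)) (j : ℤ) :
    AEStronglyMeasurable (distMult (dyad φ symAbs j) f) :=
  (continuous_distMult (dyad_symAbs_ccSym φ j) f).aestronglyMeasurable

theorem heatBlk_shift_sub {f : 𝓢'(Sp d, ℂ)} (hf : ∀ j, absBlk φ f j < ⊤) (j : ℤ) (k : Fin d)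
    (x : Sp d) (z : ℝ) {a b : ℝ} (hab : a ≤ b) :
    heatBlk φ f j (x + b • dir k) z - heatBlk φ f j (x + a • dir k) z =
      ∫ s in Ioc a b, coefBlk φ f (some k) j (x + s • dir k) z := by
  have h1 := (invCut_mul_symP_ccSym φ (-z) j).sym
  have h2 := (coefSym_ccSym φ (some k) (-z) j).sym
  have e := rho_mul_invCut φ (some k) (-z) j
  have key := funMult_shift_sub k h1.int h1.kint (by rw [e]; exact h2.int) (by rw [e]; exact h2.kint)
    (absField_aesm φ f j) (hf j) hab x
  rw [e] at key
  simpa only [heatBlk_eq φ hf, coefBlk_eq φ hf] using key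

theorem heatBlk_vert_sub {f : 𝓢'(Sp d, ℂ)} (hf : ∀ j, absBlk φ f j < ⊤) (j : ℤ)
    (x : Sp d) {z z' : ℝ} (hz : z ≤ z') (hz' : z' ≤ 0) :
    heatBlk φ f j x z' - heatBlk φ f j x z = ∫ s in Ioc z z', coefBlk φ f none j x s := by
  obtain ⟨C, hC⟩ := exists_kn_coefSym_le φ none
  have hm : Measurable (invCut φ j) :=
    ((fat_annular φ).ccSym_cut smoothOff_inv_norm j).2.continuous.measurable
  have key := funMult_symP_sub hm (neg_le_neg hz) (invCut_mul_symP_ccSym φ (-z') j).sym.int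
    (by rw [invCut_mul_symAbsP]; exact (coefSym_ccSym φ none (-z') j).sym.int)
    (invCut_mul_symP_ccSym φ (-z') j).sym.kint (invCut_mul_symP_ccSym φ (-z) j).sym.kint
    (by
      simp only [invCut_mul_symAbsP]
      refine lt_of_le_of_lt (setLIntegral_mono' (g := fun _ => (C : ℝ≥0∞)) measurableSet_Ioc
        fun s hs => ?_) (by rw [lintegral_const]; exact ENNReal.mul_lt_top (by simp) (by simp))
      have hs0 : 0 ≤ s := by linarith [hs.1]
      refine (hC s hs0 j).trans (mul_le_of_le_one_right' ?_)
      rw [ENNReal.ofReal_le_one, Real.exp_le_one_iff]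
      have : 0 ≤ (2 : ℝ) ^ j * s / 8 := by positivity
      linarith)
    (absField_aesm φ f j) (hf j) x
  rw [heatBlk_eq φ hf, heatBlk_eq φ hf, key, ← intervalIntegral.integral_of_le hz,
    ← intervalIntegral.integral_of_le (neg_le_neg hz), ← intervalIntegral.integral_comp_neg]
  simp only [coefBlk_eq φ hf, invCut_mul_symAbsP]

variable {f : 𝓢'(Sp d, ℂ)}

theorem hasGrad_heatBlk (hf : besovAbsD φ 0 f < ⊤) (j : ℤ) :
    HasGrad (heatBlk φ f j) (fun l => coefBlk φ f l j) (coefConst φ * absBlk φ f j).toNNReal := by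
  have hb := absBlk_lt_top φ hf
  have hfin : (coefConst φ : ℝ≥0∞) * absBlk φ f j < ⊤ := ENNReal.mul_lt_top (by simp) (hb j)
  refine ⟨fun k x z _ a b hab => heatBlk_shift_sub φ hb j k x z hab,
    fun k z _ => continuous_coefBlk φ f (some k) j z,
    fun x z z' hzz hz' => heatBlk_vert_sub φ hb j x hzz hz'.le,
    fun l => measurable_coefBlk φ hb l j,
    fun k x z hz => norm_le_of_enorm_le hfin (coefBlk_le' φ hb _ j x hz.le), fun x => ?_⟩
  filter_upwards [ae_restrict_mem measurableSet_Iio] with z hz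
  exact norm_le_of_enorm_le hfin (coefBlk_le' φ hb _ j x (le_of_lt hz))

theorem heatExt_eq (x : Sp d) (z : ℝ) :
    heatExt φ f x z = ∑' j, (heatBlk φ f j x z - heatBlk φ f j 0 0) := by
  simp only [heatExt, heatBlk, neg_zero, symP_zero]

/-- The increment of a block from (0, 0) to (x, z) is at most d|x| + |z| times the sup norm of its
gradient, and these norms are summable when the Ḃ⁰ norm of |D|f is finite. This is why subtracting
the values at the origin makes the series converge. -/
theorem summable_heatBlk (hf : besovAbsD φ 0 f < ⊤) (x : Sp d) {z : ℝ} (hz : z < 0) :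
    Summable fun j => heatBlk φ f j x z - heatBlk φ f j 0 0 := by
  have hb := absBlk_lt_top φ hf
  have hs : Summable fun j => ((coefConst φ * absBlk φ f j).toNNReal : ℝ) :=
    ENNReal.summable_toReal (tsum_coefBlk_lt_top φ hf).ne
  refine Summable.of_norm_bounded (g := fun j =>
    (d * ‖x‖ + |z|) * ((coefConst φ * absBlk φ f j).toNNReal : ℝ)) (hs.mul_left _) fun j => ?_
  have h1 := (hasGrad_heatBlk φ hf j).norm_sub_le 0 x hz
  rw [zero_add] at h1
  have h2 : ‖heatBlk φ f j 0 z - heatBlk φ f j 0 0‖ ≤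
      ((coefConst φ * absBlk φ f j).toNNReal : ℝ) * |z| := by
    rw [← norm_neg, neg_sub, heatBlk_vert_sub φ hb j 0 hz.le le_rfl,
      ← intervalIntegral.integral_of_le hz.le]
    have := intervalIntegral.norm_integral_le_of_norm_le_const (a := z) (b := 0)
      (f := fun s => coefBlk φ f none j 0 s) (C := ((coefConst φ * absBlk φ f j).toNNReal : ℝ))
      fun s hs => norm_le_of_enorm_le (ENNReal.mul_lt_top (by simp) (hb j))
        (coefBlk_le' φ hb _ j 0 (by rw [uIoc_of_le hz.le] at hs; exact hs.2))
    simpa using this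
  calc ‖heatBlk φ f j x z - heatBlk φ f j 0 0‖
      = ‖(heatBlk φ f j x z - heatBlk φ f j 0 z) + (heatBlk φ f j 0 z - heatBlk φ f j 0 0)‖ := by
        congr 1; ring
    _ ≤ _ := (norm_add_le _ _).trans (add_le_add h1 h2)
    _ = _ := by ring

theorem integral_tsum_coefBlk (hf : besovAbsD φ 0 f < ⊤) (l : Option (Fin d)) {p : ℝ → Sp d}
    {q : ℝ → ℝ} (hp : Measurable p) (hq : Measurable q) {a b : ℝ}
    (hq0 : ∀ s ∈ Ioc a b, q s ≤ 0) :
    ∫ s in Ioc a b, coef φ f l (p s) (q s) = ∑' j, ∫ s in Ioc a b, coefBlk φ f l j (p s) (q s) := by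
  have hb := absBlk_lt_top φ hf
  simp only [coef]
  refine integral_tsum (fun j => ?_) (ne_of_lt ?_)
  · exact ((measurable_coefBlk φ hb l j).comp (hp.prodMk hq)).aestronglyMeasurable
  · refine lt_of_le_of_lt (ENNReal.tsum_le_tsum (g := fun j =>
      coefConst φ * absBlk φ f j * volume (Ioc a b)) fun j => ?_) ?_
    · refine (setLIntegral_mono' measurableSet_Ioc fun s hs =>
        coefBlk_le' φ hb l j (p s) (hq0 s hs)).trans_eq ?_
      rw [setLIntegral_const]
    · rw [ENNReal.tsum_mul_right]
      exact ENNReal.mul_lt_top (tsum_coefBlk_lt_top φ hf) (by simp)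

theorem continuous_coef (hf : besovAbsD φ 0 f < ⊤) (l : Option (Fin d)) {z : ℝ} (hz : z ≤ 0) :
    Continuous fun x => coef φ f l x z := by
  have hb := absBlk_lt_top φ hf
  refine continuous_tsum (fun j => continuous_coefBlk φ f l j z)
    (ENNReal.summable_toReal (tsum_coefBlk_lt_top φ hf).ne) fun j x => ?_
  exact norm_le_of_enorm_le (ENNReal.mul_lt_top (by simp) (hb j)) (coefBlk_le' φ hb l j x hz)

theorem hasGrad_heatExt (hf : besovAbsD φ 0 f < ⊤) :
    HasGrad (heatExt φ f) (fun l => coef φ f l) (coefConst φ * besovAbsD φ 0 f).toNNReal := by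
  have hb := absBlk_lt_top φ hf
  have hfin : (coefConst φ : ℝ≥0∞) * besovAbsD φ 0 f < ⊤ := ENNReal.mul_lt_top (by simp) hf
  refine ⟨fun k x z hz a b hab => ?_, fun k z hz => continuous_coef φ hf _ hz.le,
    fun x z z' hzz hz' => ?_, fun l => (BM_coef φ hf l).meas,
    fun k x z hz => norm_le_of_enorm_le hfin (enorm_coef_le φ hf _ x hz.le), fun x => ?_⟩
  · rw [heatExt_eq, heatExt_eq, ← (summable_heatBlk φ hf _ hz).tsum_sub (summable_heatBlk φ hf _ hz),
      integral_tsum_coefBlk φ hf (some k) (by fun_prop) measurable_const fun _ _ => hz.le]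
    congr 1; ext j
    rw [← heatBlk_shift_sub φ hb j k x z hab]; ring
  · rw [heatExt_eq, heatExt_eq, ← (summable_heatBlk φ hf _ hz').tsum_sub
      (summable_heatBlk φ hf _ (hzz.trans_lt hz'))]
    refine Eq.trans ?_ (integral_tsum_coefBlk φ hf none (p := fun _ => x) (q := fun s => s)
      measurable_const measurable_id fun s hs => hs.2.trans hz'.le).symm
    congr 1; ext j
    rw [← heatBlk_vert_sub φ hb j x hzz hz'.le]; ring
  · filter_upwards [ae_restrict_mem measurableSet_Iio] with z hz
    exact norm_le_of_enorm_le hfin (enorm_coef_le φ hf _ x (le_of_lt hz))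

end HeatGradients

/-! ### Fields indexed by directions and the bounded operator `gradOp` -/

section Fields

variable {d : ℕ}

/-- Equality of almost all horizontal slices, almost everywhere. -/
def SliceEq (g h : Sp d → ℝ → ℂ) : Prop :=
  ∀ᵐ z ∂(volume.restrict (Iio (0 : ℝ))), ∀ᵐ x, g x z = h x z

theorem SliceEq.of_forall {g h : Sp d → ℝ → ℂ} (H : ∀ x z, z < 0 → g x z = h x z) : SliceEq g h := by
  filter_upwards [ae_restrict_mem measurableSet_Iio] with z hz
  exact .of_forall fun x => H x z hz

theorem SliceEq.symm {g h : Sp d → ℝ → ℂ} (H : SliceEq g h) : SliceEq h g := by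
  filter_upwards [H] with z hz
  filter_upwards [hz] with x hx using hx.symm

theorem SliceEq.trans {g h k : Sp d → ℝ → ℂ} (H : SliceEq g h) (H' : SliceEq h k) :
    SliceEq g k := by
  filter_upwards [H, H'] with z hz hz'
  filter_upwards [hz, hz'] with x hx hx' using hx.trans hx'

theorem SliceEq.map₂ {g h g' h' : Sp d → ℝ → ℂ} (op : ℂ → ℂ → ℂ) (H : SliceEq g h)
    (H' : SliceEq g' h') : SliceEq (fun x z => op (g x z) (g' x z)) fun x z => op (h x z) (h' x z) := by
  filter_upwards [H, H'] with z hz hz'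
  filter_upwards [hz, hz'] with x hx hx'
  rw [hx, hx']

theorem SliceEq.sum {ι : Type*} [Fintype ι] {g h : ι → Sp d → ℝ → ℂ} (H : ∀ i, SliceEq (g i) (h i)) :
    SliceEq (fun x z => ∑ i, g i x z) fun x z => ∑ i, h i x z := by
  filter_upwards [ae_all_iff.2 H] with z hz
  filter_upwards [ae_all_iff.2 hz] with x hx
  exact Finset.sum_congr rfl fun i _ => hx i

/-- Functions that are real on `z < 0`. -/
def RealOn (g : Sp d → ℝ → ℂ) : Prop := ∀ x z, z < 0 → (g x z).im = 0

theorem RealOn.sum {ι : Type*} [Fintype ι] {g : ι → Sp d → ℝ → ℂ} (H : ∀ i, RealOn (g i)) :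
    RealOn fun x z => ∑ i, g i x z := fun x z hz => by
  rw [Complex.im_sum]
  exact Finset.sum_eq_zero fun i _ => H i x z hz

theorem RealOn.mul {g h : Sp d → ℝ → ℂ} (H : RealOn g) (H' : RealOn h) :
    RealOn fun x z => g x z * h x z := fun x z hz => by
  rw [Complex.mul_im, H x z hz, H' x z hz]; simp

theorem RealOn.add {g h : Sp d → ℝ → ℂ} (H : RealOn g) (H' : RealOn h) :
    RealOn fun x z => g x z + h x z := fun x z hz => by
  rw [Complex.add_im, H x z hz, H' x z hz]; simp

theorem RealOn.sub {g h : Sp d → ℝ → ℂ} (H : RealOn g) (H' : RealOn h) :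
    RealOn fun x z => g x z - h x z := fun x z hz => by
  rw [Complex.sub_im, H x z hz, H' x z hz]; simp

theorem RealOn.neg {g : Sp d → ℝ → ℂ} (H : RealOn g) : RealOn fun x z => -g x z := fun x z hz => by
  rw [Complex.neg_im, H x z hz]; simp

theorem integral_im_eq_zero {α : Type*} [MeasurableSpace α] {μ : Measure α} {f : α → ℂ}
    (h : ∀ᵐ a ∂μ, (f a).im = 0) : (∫ a, f a ∂μ).im = 0 := by
  have : ∫ a, f a ∂μ = ∫ a, ((f a).re : ℂ) ∂μ := by
    refine integral_congr_ae ?_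
    filter_upwards [h] with a ha
    exact Complex.ext (by simp) (by simp [ha])
  rw [this, integral_complex_ofReal, Complex.ofReal_im]

theorem funMult_im_eq_zero {m : Sp d → ℂ} (hm : ∀ ξ, (starRingEnd ℂ) (m ξ) = m (-ξ)) {g : Sp d → ℂ}
    (hg : ∀ x, (g x).im = 0) (x : Sp d) : (funMult m g x).im = 0 := by
  rw [funMult_eq]
  refine integral_im_eq_zero (.of_forall fun y => ?_)
  rw [Complex.mul_im, hg y, ker_im_eq_zero hm]
  simp

theorem rhoP_neg (l : Option (Fin d)) (t : ℝ) (ξ : Sp d) :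
    (starRingEnd ℂ) (rhoP l t ξ) = rhoP l t (-ξ) := by
  cases l with
  | none => simp [rhoP, rho, symAbs, symP, -Complex.ofReal_exp]
  | some k => simp [rhoP, rho, symP, -Complex.ofReal_exp]

theorem symP_neg (t : ℝ) (ξ : Sp d) : (starRingEnd ℂ) (symP t ξ) = symP t (-ξ) := by
  simp [symP, -Complex.ofReal_exp]

theorem RealOn.Duh {A : ℝ → Set ℝ} (hA : TimeSets A) (l : Option (Fin d)) {g : Sp d → ℝ → ℂ}
    (H : RealOn g) (x : Sp d) (s : ℝ) : (Duh A l g x s).im = 0 := by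
  refine integral_im_eq_zero ?_
  filter_upwards [ae_restrict_mem (hA.measurableSet s)] with τ hτ
  exact funMult_im_eq_zero (rhoP_neg l _) (fun y => H y τ (hA.neg s hτ)) x

theorem RealOn.heatInt {g : Sp d → ℝ → ℂ} (H : RealOn g) : RealOn (heatInt g) := fun x z hz => by
  rw [heatInt_eq g x hz, Complex.neg_im, neg_eq_zero]
  refine integral_im_eq_zero ?_
  filter_upwards [ae_restrict_mem (timeSets_after.measurableSet z)] with τ hτ
  exact funMult_im_eq_zero (symP_neg _) (fun y => H y τ hτ.2) x

theorem Duh_congr_fun {A : ℝ → Set ℝ} (hA : TimeSets A) (l : Option (Fin d)) {g h : Sp d → ℝ → ℂ}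
    (H : ∀ x z, z < 0 → g x z = h x z) : Duh A l g = Duh A l h :=
  Duh_congr hA l (SliceEq.of_forall H)

/-- `w = ∫_{-∞}^s e^{-(s-τ)|D|} (div G' - |D| G_0) dτ` for a field `G = (G_0, G')`. -/
def duhDiv (G : Option (Fin d) → Sp d → ℝ → ℂ) (x : Sp d) (s : ℝ) : ℂ :=
  (∑ k, Duh before (some k) (G (some k)) x s) - Duh before none (G none) x s

/-- The source term `G_0 + w` of the heat integral. -/
def source (G : Option (Fin d) → Sp d → ℝ → ℂ) (x : Sp d) (s : ℝ) : ℂ := G none x s + duhDiv G x s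

/-- The gradient of the heat integral of the source term. -/
def gradOp (G : Option (Fin d) → Sp d → ℝ → ℂ) : Option (Fin d) → Sp d → ℝ → ℂ
  | none => fun x s => source G x s - Duh after none (source G) x s
  | some k => fun x s => -Duh after (some k) (source G) x s

variable (φ : DyadicCutoff d)

/-- Bounded fields in `L̃¹(J; Ḃ¹_{∞,1})`. -/
structure GoodField (G : Option (Fin d) → Sp d → ℝ → ℂ) : Prop where
  bm : ∀ l, BM (G l)
  bes : ∀ l, Bes φ 1 (G l) < ⊤

/-- The sup norm of a field. -/
def supF (G : Option (Fin d) → Sp d → ℝ → ℂ) : ℝ≥0∞ := ∑ l, LI (G l)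

/-- The Chemin-Lerner norm of a field. -/
def besF (s : ℝ) (G : Option (Fin d) → Sp d → ℝ → ℂ) : ℝ≥0∞ := ∑ l, Bes φ s (G l)

variable {φ} in
theorem GoodField.supF_lt_top {G : Option (Fin d) → Sp d → ℝ → ℂ} (hG : GoodField φ G) :
    supF G < ⊤ := ENNReal.sum_lt_top.2 fun l _ => (hG.bm l).fin

variable {φ} in
theorem GoodField.besF_lt_top {G : Option (Fin d) → Sp d → ℝ → ℂ} (hG : GoodField φ G) :
    besF φ 1 G < ⊤ := ENNReal.sum_lt_top.2 fun l _ => hG.bes l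

theorem le_supF (G : Option (Fin d) → Sp d → ℝ → ℂ) (l : Option (Fin d)) : LI (G l) ≤ supF G :=
  Finset.single_le_sum (f := fun l => LI (G l)) (fun _ _ => zero_le) (Finset.mem_univ l)

theorem le_besF (s : ℝ) (G : Option (Fin d) → Sp d → ℝ → ℂ) (l : Option (Fin d)) :
    Bes φ s (G l) ≤ besF φ s G :=
  Finset.single_le_sum (f := fun l => Bes φ s (G l)) (fun _ _ => zero_le) (Finset.mem_univ l)

variable {φ} in
theorem GoodField.of_lt_top {G : Option (Fin d) → Sp d → ℝ → ℂ} (hG : ∀ l, BM (G l))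
    (h : besF φ 1 G < ⊤) : GoodField φ G := ⟨hG, fun l => (le_besF φ 1 G l).trans_lt h⟩

variable {φ} in
theorem GoodField.sub {G G' : Option (Fin d) → Sp d → ℝ → ℂ} (hG : GoodField φ G)
    (hG' : GoodField φ G') : GoodField φ fun l x z => G l x z - G' l x z :=
  ⟨fun l => (hG.bm l).sub (hG'.bm l), fun l => (Bes_sub_le φ 1 (hG.bm l) (hG'.bm l)).trans_lt
    (ENNReal.add_lt_top.2 ⟨hG.bes l, hG'.bes l⟩)⟩

/-- Convolution in x and integration in τ ignore null sets, so equality of almost all slices becomes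
equality at every point. It therefore suffices to know the gradient of v up to slice equality. -/
theorem duhDiv_congr {G G' : Option (Fin d) → Sp d → ℝ → ℂ} (H : ∀ l, SliceEq (G l) (G' l)) :
    duhDiv G = duhDiv G' := by
  ext x s
  simp only [duhDiv, Duh_congr timeSets_before _ (H _)]

theorem source_congr {G G' : Option (Fin d) → Sp d → ℝ → ℂ} (H : ∀ l, SliceEq (G l) (G' l)) :
    SliceEq (source G) (source G') := by
  have h := SliceEq.map₂ (· + ·) (H none) (SliceEq.of_forall (g := duhDiv G) (h := duhDiv G')
    fun x z _ => by rw [duhDiv_congr H])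
  exact h

theorem gradOp_congr {G G' : Option (Fin d) → Sp d → ℝ → ℂ} (H : ∀ l, SliceEq (G l) (G' l))
    (l : Option (Fin d)) : SliceEq (gradOp G l) (gradOp G' l) := by
  have hs := source_congr H
  cases l with
  | none =>
    exact SliceEq.map₂ (· - ·) hs (SliceEq.of_forall fun x z _ => by
      rw [Duh_congr timeSets_after none hs])
  | some k =>
    exact SliceEq.of_forall fun x z _ => by
      simp only [gradOp, Duh_congr timeSets_after (some k) hs]

theorem RealOn.duhDiv {G : Option (Fin d) → Sp d → ℝ → ℂ} (H : ∀ l, RealOn (G l)) (x : Sp d) (s : ℝ) :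
    (duhDiv G x s).im = 0 := by
  rw [MuskatDN.duhDiv, Complex.sub_im, Complex.im_sum, RealOn.Duh timeSets_before none (H none),
    Finset.sum_eq_zero fun k _ => RealOn.Duh timeSets_before (some k) (H (some k)) x s, sub_zero]

theorem RealOn.source {G : Option (Fin d) → Sp d → ℝ → ℂ} (H : ∀ l, RealOn (G l)) :
    RealOn (source G) := (H none).add fun x z _ => RealOn.duhDiv H x z

theorem RealOn.gradOp {G : Option (Fin d) → Sp d → ℝ → ℂ} (H : ∀ l, RealOn (G l))
    (l : Option (Fin d)) : RealOn (gradOp G l) := by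
  have hs := RealOn.source H
  cases l with
  | none => exact hs.sub fun x z _ => RealOn.Duh timeSets_after none hs x z
  | some k => exact RealOn.neg fun x z _ => RealOn.Duh timeSets_after (some k) hs x z

/-- The operator bound of `gradOp`. -/
def gradConst : ℝ≥0∞ := (d + 1) * (1 + 16 * heatConst φ) ^ 2

theorem gradConst_lt_top : gradConst φ < ⊤ := by
  have : gradConst φ = (((d + 1) * (1 + 16 * heatConst φ) ^ 2 : ℝ≥0) : ℝ≥0∞) := by
    simp [gradConst]
  rw [this]; exact ENNReal.coe_lt_top

theorem sum_option_const (c : ℝ≥0∞) : ∑ _l : Option (Fin d), c = (d + 1) * c := by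
  simp

variable [NeZero d]

theorem BM_duhDiv {G : Option (Fin d) → Sp d → ℝ → ℂ} (hG : GoodField φ G) : BM (duhDiv G) :=
  (BM.sum _ fun k => BM_Duh φ timeSets_before (some k) (hG.bm _) (hG.bes _)).sub
    (BM_Duh φ timeSets_before none (hG.bm _) (hG.bes _))

theorem BM_source {G : Option (Fin d) → Sp d → ℝ → ℂ} (hG : GoodField φ G) : BM (source G) :=
  (hG.bm none).add (BM_duhDiv φ hG)

theorem enorm_duhDiv_le {G : Option (Fin d) → Sp d → ℝ → ℂ} (hG : GoodField φ G) (x : Sp d) (s : ℝ) :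
    ‖duhDiv G x s‖ₑ ≤ heatConst φ * besF φ 1 G := by
  rw [besF, Fintype.sum_option, mul_add, add_comm, Finset.mul_sum]
  refine enorm_sub_le.trans (add_le_add ((enorm_sum_le _ _).trans ?_) ?_)
  · exact Finset.sum_le_sum fun k _ => enorm_Duh_le φ timeSets_before (some k) (hG.bm _) x s
  · exact enorm_Duh_le φ timeSets_before none (hG.bm _) x s

theorem Bes_duhDiv_le {G : Option (Fin d) → Sp d → ℝ → ℂ} (hG : GoodField φ G) (s : ℝ) :
    Bes φ s (duhDiv G) ≤ 16 * heatConst φ * besF φ s G := by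
  rw [besF, Fintype.sum_option, mul_add, add_comm, Finset.mul_sum]
  have hb : ∀ l, BM (Duh before l (G l)) := fun l => BM_Duh φ timeSets_before l (hG.bm _) (hG.bes _)
  refine (Bes_sub_le φ s (BM.sum Finset.univ fun k => hb (some k)) (hb none)).trans
    (add_le_add ((Bes_finsetSum_le φ _ s fun k => hb (some k)).trans ?_) ?_)
  · exact Finset.sum_le_sum fun k _ => Bes_Duh_le φ timeSets_before (some k) (hG.bm _) (hG.bes _) s
  · exact Bes_Duh_le φ timeSets_before none (hG.bm _) (hG.bes _) s

theorem LI_source_le {G : Option (Fin d) → Sp d → ℝ → ℂ} (hG : GoodField φ G) :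
    LI (source G) ≤ supF G + heatConst φ * besF φ 1 G :=
  (LI_add_le _ _).trans (add_le_add (le_supF G none) (LI_le fun x z _ => enorm_duhDiv_le φ hG x z))

theorem Bes_source_le {G : Option (Fin d) → Sp d → ℝ → ℂ} (hG : GoodField φ G) (s : ℝ) :
    Bes φ s (source G) ≤ (1 + 16 * heatConst φ) * besF φ s G := by
  rw [add_mul, one_mul]
  exact (Bes_add_le φ s (hG.bm none) (BM_duhDiv φ hG)).trans
    (add_le_add (le_besF φ s G none) (Bes_duhDiv_le φ hG s))

theorem Bes_source_lt_top {G : Option (Fin d) → Sp d → ℝ → ℂ} (hG : GoodField φ G) :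
    Bes φ 1 (source G) < ⊤ :=
  (Bes_source_le φ hG 1).trans_lt (ENNReal.mul_lt_top
    (ENNReal.add_lt_top.2 ⟨by simp, ENNReal.mul_lt_top (by simp) (by simp)⟩) hG.besF_lt_top)

theorem BM_gradOp {G : Option (Fin d) → Sp d → ℝ → ℂ} (hG : GoodField φ G) (l : Option (Fin d)) :
    BM (gradOp G l) := by
  have hb : ∀ l, BM (Duh after l (source G)) := fun l =>
    BM_Duh φ timeSets_after l (BM_source φ hG) (Bes_source_lt_top φ hG)
  cases l with
  | none => exact (BM_source φ hG).sub (hb none)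
  | some k => exact (hb (some k)).neg

/-- Two successive Duhamel integrals, each bounded on L̃¹(Ḃ^s) with a constant independent of s;
finiteness is needed only at regularity 1, where the integrals converge. -/
theorem besF_gradOp_le {G : Option (Fin d) → Sp d → ℝ → ℂ} (hG : GoodField φ G) (s : ℝ) :
    besF φ s (gradOp G) ≤ gradConst φ * besF φ s G := by
  have hb := BM_source φ hG
  have hB := Bes_source_lt_top φ hG
  have h1 : ∀ l, Bes φ s (gradOp G l) ≤ (1 + 16 * heatConst φ) * Bes φ s (source G) := by
    intro l
    cases l with
    | none =>
      rw [add_mul, one_mul]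
      exact (Bes_sub_le φ s hb (BM_Duh φ timeSets_after none hb hB)).trans
        (add_le_add le_rfl (Bes_Duh_le φ timeSets_after none hb hB s))
    | some k =>
      simp only [gradOp, Bes_neg]
      refine (Bes_Duh_le φ timeSets_after (some k) hb hB s).trans ?_
      gcongr
      exact le_add_self
  calc besF φ s (gradOp G) ≤ ∑ _l : Option (Fin d), (1 + 16 * heatConst φ) *
        ((1 + 16 * heatConst φ) * besF φ s G) :=
        Finset.sum_le_sum fun l _ => (h1 l).trans (by gcongr; exact Bes_source_le φ hG s)
    _ = _ := by rw [sum_option_const, gradConst]; ring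

/-- The sup norm does not close by itself: Duhamel integrals with one derivative are bounded in L^∞
through the L̃¹(Ḃ¹) norm of the field. -/
theorem supF_gradOp_le {G : Option (Fin d) → Sp d → ℝ → ℂ} (hG : GoodField φ G) :
    supF (gradOp G) ≤ gradConst φ * (supF G + besF φ 1 G) := by
  have hb := BM_source φ hG
  have h1 : ∀ l, LI (gradOp G l) ≤ LI (source G) + heatConst φ * Bes φ 1 (source G) := by
    intro l
    refine LI_le fun x z hz => ?_
    cases l with
    | none =>
      exact enorm_sub_le.trans (add_le_add (le_LI _ x hz) (enorm_Duh_le φ timeSets_after none hb x z))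
    | some k =>
      simp only [gradOp, enorm_neg]
      exact (enorm_Duh_le φ timeSets_after (some k) hb x z).trans le_add_self
  have h2 : ∀ l, LI (gradOp G l) ≤ (1 + 16 * heatConst φ) ^ 2 * (supF G + besF φ 1 G) := by
    intro l
    set H : ℝ≥0∞ := (heatConst φ : ℝ≥0∞)
    calc LI (gradOp G l) ≤ (supF G + H * besF φ 1 G) + H * ((1 + 16 * H) * besF φ 1 G) :=
          (h1 l).trans (add_le_add (LI_source_le φ hG) (by gcongr; exact Bes_source_le φ hG 1))
      _ = 1 * supF G + (2 * H + 16 * H ^ 2) * besF φ 1 G := by ring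
      -- Nonnegative terms are added to complete both coefficients to (1 + 16H)².
      _ ≤ (1 + (32 * H + 256 * H ^ 2)) * supF G +
          (2 * H + 16 * H ^ 2 + (1 + 30 * H + 240 * H ^ 2)) * besF φ 1 G := by
          exact add_le_add (mul_le_mul' le_self_add le_rfl) (mul_le_mul' le_self_add le_rfl)
      _ = _ := by ring
  calc supF (gradOp G) ≤ ∑ _l : Option (Fin d), (1 + 16 * heatConst φ) ^ 2 *
        (supF G + besF φ 1 G) := Finset.sum_le_sum fun l _ => h2 l
    _ = _ := by rw [sum_option_const, gradConst]; ring

theorem GoodField.gradOp {G : Option (Fin d) → Sp d → ℝ → ℂ} (hG : GoodField φ G) :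
    GoodField φ (gradOp G) :=
  .of_lt_top (BM_gradOp φ hG) ((besF_gradOp_le φ hG 1).trans_lt
    (ENNReal.mul_lt_top (gradConst_lt_top φ) hG.besF_lt_top))

/-! ### Linearity -/

theorem Duh_sub {A : ℝ → Set ℝ} (hA : TimeSets A) (l : Option (Fin d)) {g h : Sp d → ℝ → ℂ}
    (hg : BM g) (hh : BM h) (hgB : Bes φ 1 g < ⊤) (hhB : Bes φ 1 h < ⊤) (x : Sp d) (s : ℝ) :
    Duh A l (fun x z => g x z - h x z) x s = Duh A l g x s - Duh A l h x s := by
  have h1 := Duh_add φ hA l hg (hh.const_mul (-1)) hgB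
    (by rw [Bes_const_mul]; simpa using hhB) x s
  rw [Duh_const_mul] at h1
  simpa [sub_eq_add_neg] using h1

theorem duhDiv_sub {G G' : Option (Fin d) → Sp d → ℝ → ℂ} (hG : GoodField φ G)
    (hG' : GoodField φ G') (x : Sp d) (s : ℝ) :
    duhDiv (fun l x z => G l x z - G' l x z) x s = duhDiv G x s - duhDiv G' x s := by
  simp only [duhDiv, Duh_sub φ timeSets_before _ (hG.bm _) (hG'.bm _) (hG.bes _) (hG'.bes _),
    Finset.sum_sub_distrib]
  ring

theorem gradOp_sub {G G' : Option (Fin d) → Sp d → ℝ → ℂ} (hG : GoodField φ G)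
    (hG' : GoodField φ G') (l : Option (Fin d)) (x : Sp d) (s : ℝ) :
    gradOp (fun l x z => G l x z - G' l x z) l x s = gradOp G l x s - gradOp G' l x s := by
  have hs : source (fun l x z => G l x z - G' l x z) = fun x z => source G x z - source G' x z := by
    ext x s
    simp only [source, duhDiv_sub φ hG hG']
    ring
  have hD : ∀ l, Duh after l (source fun l x z => G l x z - G' l x z) x s =
      Duh after l (source G) x s - Duh after l (source G') x s := fun l => by
    rw [hs]
    exact Duh_sub φ timeSets_after l (BM_source φ hG) (BM_source φ hG') (Bes_source_lt_top φ hG)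
      (Bes_source_lt_top φ hG') x s
  cases l with
  | none =>
    have h1 := congrFun (congrFun hs x) s
    simp only [gradOp, hD, h1]; ring
  | some k => simp only [gradOp, hD]; ring

theorem hasSum_Duh {A : ℝ → Set ℝ} (hA : TimeSets A) (l : Option (Fin d)) {g : ℕ → Sp d → ℝ → ℂ}
    (hg : ∀ n, BM (g n)) (hs : ∑' n, LI (g n) < ⊤) (hB : ∑' n, Bes φ 1 (g n) < ⊤) (x : Sp d) (s : ℝ) :
    HasSum (fun n => Duh A l (g n) x s) (Duh A l (fun x z => ∑' n, g n x z) x s) := by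
  rw [Duh_tsum φ hA l hg hs hB x s]
  refine Summable.hasSum (Summable.of_norm ?_)
  have : ∑' n, ‖Duh A l (g n) x s‖ₑ ≠ ⊤ := ne_top_of_le_ne_top
    (ENNReal.mul_lt_top (ENNReal.coe_lt_top (r := heatConst φ)) hB).ne
    (by rw [← ENNReal.tsum_mul_left]
        exact ENNReal.tsum_le_tsum fun n => enorm_Duh_le φ hA l (hg n) x s)
  simpa only [toReal_enorm] using ENNReal.summable_toReal this

theorem hasSum_source {G : ℕ → Option (Fin d) → Sp d → ℝ → ℂ} (hG : ∀ n, GoodField φ (G n))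
    (hs : ∑' n, supF (G n) < ⊤) (hB : ∑' n, besF φ 1 (G n) < ⊤) (x : Sp d) {z : ℝ} (hz : z < 0) :
    HasSum (fun n => source (G n) x z) (source (fun l x z => ∑' n, G n l x z) x z) := by
  have hs' : ∀ l, ∑' n, LI (G n l) < ⊤ := fun l =>
    (ENNReal.tsum_le_tsum fun n => le_supF (G n) l).trans_lt hs
  have hB' : ∀ l, ∑' n, Bes φ 1 (G n l) < ⊤ := fun l =>
    (ENNReal.tsum_le_tsum fun n => le_besF φ 1 (G n) l).trans_lt hB
  have hD := fun l => hasSum_Duh φ timeSets_before l (fun n => (hG n).bm l) (hs' l) (hB' l) x z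
  exact (summable_of_tsum_LI (hs' none) x hz).hasSum.add
    ((hasSum_sum fun k _ => hD (some k)).sub (hD none))

theorem hasSum_gradOp {G : ℕ → Option (Fin d) → Sp d → ℝ → ℂ} (hG : ∀ n, GoodField φ (G n))
    (hs : ∑' n, supF (G n) < ⊤) (hB : ∑' n, besF φ 1 (G n) < ⊤) (l : Option (Fin d)) (x : Sp d) {z : ℝ}
    (hz : z < 0) :
    HasSum (fun n => gradOp (G n) l x z) (gradOp (fun l x z => ∑' n, G n l x z) l x z) := by
  have hsrc := fun (x : Sp d) (z : ℝ) (hz : z < 0) => hasSum_source φ hG hs hB x hz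
  have h1 : ∑' n, LI (source (G n)) < ⊤ := by
    refine (ENNReal.tsum_le_tsum fun n => LI_source_le φ (hG n)).trans_lt ?_
    rw [ENNReal.tsum_add, ENNReal.tsum_mul_left]
    exact ENNReal.add_lt_top.2 ⟨hs, ENNReal.mul_lt_top (by simp) hB⟩
  have h2 : ∑' n, Bes φ 1 (source (G n)) < ⊤ := by
    refine (ENNReal.tsum_le_tsum fun n => Bes_source_le φ (hG n) 1).trans_lt ?_
    rw [ENNReal.tsum_mul_left]
    exact ENNReal.mul_lt_top
      (ENNReal.add_lt_top.2 ⟨by simp, ENNReal.mul_lt_top (by simp) (by simp)⟩) hB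
  have hD : ∀ l, HasSum (fun n => Duh after l (source (G n)) x z)
      (Duh after l (source fun l x z => ∑' n, G n l x z) x z) := fun l => by
    rw [Duh_congr_fun timeSets_after l (h := fun x z => ∑' n, source (G n) x z)
      fun x z hz => (hsrc x z hz).tsum_eq.symm]
    exact hasSum_Duh φ timeSets_after l (fun n => BM_source φ (hG n)) h1 h2 x z
  cases l with
  | none => exact (hsrc x z hz).sub (hD none)
  | some k => exact (hD (some k)).neg

end Fields

/-! ### The linear fixed point equation and its Neumann series -/

section LinearProblem

/-- A partial sum S satisfies S ≤ x_0 + ∑ c + S/2, and S/2 is absorbed because S is finite. The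
forcing c lets a high norm be summed from a low norm already under control. -/
theorem tsum_le_of_contraction {x c : ℕ → ℝ≥0∞} {q : ℝ≥0∞} (hq : q ≤ 2⁻¹)
    (h : ∀ n, x (n + 1) ≤ q * x n + c n) : ∑' n, x n ≤ 2 * (x 0 + ∑' n, c n) := by
  rcases eq_or_ne (x 0 + ∑' n, c n) ⊤ with htop | hfin
  · rw [htop]; simp
  have h0 : x 0 ≠ ⊤ := fun h => hfin (by simp [h])
  have hc : ∀ n, c n ≠ ⊤ := fun n => ne_top_of_le_ne_top
    (fun h => hfin (by simp [h])) (ENNReal.le_tsum n)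
  have hx : ∀ n, x n ≠ ⊤ := by
    intro n
    induction n with
    | zero => exact h0
    | succ n ih =>
      exact ne_top_of_le_ne_top (ENNReal.add_ne_top.2
        ⟨ENNReal.mul_ne_top (ne_top_of_le_ne_top (by simp) hq) ih, hc n⟩) (h n)
  refine ENNReal.tsum_le_of_sum_range_le fun N => ?_
  have h1 : ∀ N, ∑ n ∈ Finset.range N, x n ≤
      x 0 + ∑' n, c n + 2⁻¹ * ∑ n ∈ Finset.range N, x n := by
    intro N
    cases N with
    | zero => simp
    | succ N =>
      rw [Finset.sum_range_succ']
      calc ∑ n ∈ Finset.range N, x (n + 1) + x 0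
          ≤ ∑ n ∈ Finset.range N, (2⁻¹ * x n + c n) + x 0 := by
            gcongr with n hn
            exact (h n).trans (by gcongr)
        _ = 2⁻¹ * ∑ n ∈ Finset.range N, x n + ∑ n ∈ Finset.range N, c n + x 0 := by
            rw [Finset.sum_add_distrib, Finset.mul_sum]
        _ ≤ 2⁻¹ * (∑ n ∈ Finset.range N, x (n + 1) + x 0) + ∑' n, c n + x 0 := by
            gcongr
            · rw [← Finset.sum_range_succ' x]
              exact Finset.sum_le_sum_of_subset (Finset.range_mono N.le_succ)
            · exact ENNReal.sum_le_tsum _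
        _ = _ := by ring
  set S := ∑ n ∈ Finset.range N, x n with hS
  have hSf : S ≠ ⊤ := ENNReal.sum_ne_top.2 fun n _ => hx n
  have h2 := h1 N
  rw [← hS] at h2
  -- Finiteness of S permits cancelling one half in the extended nonnegative reals.
  have h3 : S = 2⁻¹ * S + 2⁻¹ * S := by
    rw [← add_mul, ENNReal.inv_two_add_inv_two, one_mul]
  nth_rewrite 1 [h3] at h2
  have h4 : 2⁻¹ * S ≤ x 0 + ∑' n, c n :=
    ENNReal.le_of_add_le_add_right (ENNReal.mul_ne_top (by simp) hSf) h2
  calc S = 2 * (2⁻¹ * S) := by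
        rw [← mul_assoc, ENNReal.mul_inv_cancel (by simp) (by simp), one_mul]
    _ ≤ _ := by gcongr

variable {d : ℕ}

/-- The product of a matrix and a field. -/
def mulF (M : Option (Fin d) → Option (Fin d) → Sp d → ℝ → ℂ) (V : Option (Fin d) → Sp d → ℝ → ℂ)
    (i : Option (Fin d)) (x : Sp d) (z : ℝ) : ℂ := ∑ l, M i l x z * V l x z

variable (φ : DyadicCutoff d)

/-- Matrices with bounded coefficients in `L̃¹(J; Ḃ¹_{∞,1})`. -/
structure GoodMat (M : Option (Fin d) → Option (Fin d) → Sp d → ℝ → ℂ) : Prop where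
  bm : ∀ i l, BM (M i l)
  bes : ∀ i l, Bes φ 1 (M i l) < ⊤

/-- The sup norm of a matrix. -/
def supM (M : Option (Fin d) → Option (Fin d) → Sp d → ℝ → ℂ) : ℝ≥0∞ := ∑ i, supF (M i)

/-- The Chemin-Lerner norm of a matrix. -/
def besM (s : ℝ) (M : Option (Fin d) → Option (Fin d) → Sp d → ℝ → ℂ) : ℝ≥0∞ := ∑ i, besF φ s (M i)

/-- The constant in the product estimate. -/
def mulConst (s : ℝ) : ℝ≥0∞ := prodConst φ * shiftConst s

theorem mulConst_lt_top {s : ℝ} (hs : 0 < s) : mulConst φ s < ⊤ :=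
  ENNReal.mul_lt_top (prodConst_lt_top φ) (shiftConst_lt_top hs)

variable {M : Option (Fin d) → Option (Fin d) → Sp d → ℝ → ℂ} {V W : Option (Fin d) → Sp d → ℝ → ℂ}

theorem BM_mulF (hM : ∀ i l, BM (M i l)) (hV : ∀ l, BM (V l)) (i : Option (Fin d)) :
    BM (mulF M V i) := BM.sum Finset.univ fun l => (hM i l).mul (hV l)

theorem supF_mulF_le : supF (mulF M V) ≤ supM M * supF V := by
  rw [supM, Finset.sum_mul]
  refine Finset.sum_le_sum fun i _ => ?_
  refine (LI_finsetSum_le _ _).trans ?_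
  rw [supF, Finset.sum_mul]
  refine Finset.sum_le_sum fun l _ => (LI_mul_le _ _).trans ?_
  gcongr
  exact le_supF V l

theorem besF_mulF_le (hM : ∀ i l, BM (M i l)) (hV : ∀ l, BM (V l)) (s : ℝ) :
    besF φ s (mulF M V) ≤ mulConst φ s * (besM φ s M * supF V + supM M * besF φ s V) := by
  rw [supM, besM, Finset.sum_mul, Finset.sum_mul, ← Finset.sum_add_distrib, Finset.mul_sum]
  refine Finset.sum_le_sum fun i _ => ?_
  refine (Bes_finsetSum_le φ _ s fun l => (hM i l).mul (hV l)).trans ?_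
  have e1 : supF (M i) = ∑ l, LI (M i l) := rfl
  have e2 : besF φ s (M i) = ∑ l, Bes φ s (M i l) := rfl
  rw [e1, e2, Finset.sum_mul, Finset.sum_mul, ← Finset.sum_add_distrib, Finset.mul_sum]
  refine Finset.sum_le_sum fun l _ => (Bes_mul_le φ s (hM i l) (hV l)).trans ?_
  rw [mulConst]
  gcongr
  · exact le_supF V l
  · exact le_besF φ s V l

variable {φ}

theorem GoodMat.supM_lt_top (hM : GoodMat φ M) : supM M < ⊤ :=
  ENNReal.sum_lt_top.2 fun i _ => ENNReal.sum_lt_top.2 fun l _ => (hM.bm i l).fin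

theorem GoodMat.besM_lt_top (hM : GoodMat φ M) : besM φ 1 M < ⊤ :=
  ENNReal.sum_lt_top.2 fun i _ => ENNReal.sum_lt_top.2 fun l _ => hM.bes i l

theorem GoodField.mulF (hM : GoodMat φ M) (hV : GoodField φ V) : GoodField φ (mulF M V) :=
  .of_lt_top (BM_mulF hM.bm hV.bm) ((besF_mulF_le φ hM.bm hV.bm 1).trans_lt
    (ENNReal.mul_lt_top (mulConst_lt_top φ one_pos) (ENNReal.add_lt_top.2
      ⟨ENNReal.mul_lt_top hM.besM_lt_top hV.supF_lt_top,
        ENNReal.mul_lt_top hM.supM_lt_top hV.besF_lt_top⟩)))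

theorem mulF_congr (H : ∀ l, SliceEq (V l) (W l)) (i : Option (Fin d)) :
    SliceEq (mulF M V i) (mulF M W i) :=
  SliceEq.sum fun l => SliceEq.map₂ (· * ·) (SliceEq.of_forall fun _ _ _ => rfl) (H l)

theorem mulF_sub (i : Option (Fin d)) (x : Sp d) (z : ℝ) :
    mulF M (fun l x z => V l x z - W l x z) i x z = mulF M V i x z - mulF M W i x z := by
  simp only [mulF, mul_sub, Finset.sum_sub_distrib]

theorem RealOn.mulF (hM : ∀ i l, RealOn (M i l)) (hV : ∀ l, RealOn (V l)) (i : Option (Fin d)) :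
    RealOn (mulF M V i) := RealOn.sum fun l => (hM i l).mul (hV l)

variable (φ)

/-- The size of a field controlling the fixed point problem. -/
def sizeF (V : Option (Fin d) → Sp d → ℝ → ℂ) : ℝ≥0∞ := supF V + besF φ 1 V

/-- The contraction factor of `V ↦ gradOp (mulF M V)`. -/
def factor (M : Option (Fin d) → Option (Fin d) → Sp d → ℝ → ℂ) : ℝ≥0∞ :=
  2 * gradConst φ * (1 + mulConst φ 1) * (supM M + besM φ 1 M)

variable {φ}

theorem GoodField.sizeF_lt_top (hV : GoodField φ V) : sizeF φ V < ⊤ :=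
  ENNReal.add_lt_top.2 ⟨hV.supF_lt_top, hV.besF_lt_top⟩

theorem sizeF_mulF_le (hM : GoodMat φ M) (hV : GoodField φ V) :
    sizeF φ (mulF M V) ≤ (1 + mulConst φ 1) * (supM M + besM φ 1 M) * sizeF φ V := by
  calc sizeF φ (MuskatDN.mulF M V)
      ≤ supM M * supF V + mulConst φ 1 * (besM φ 1 M * supF V + supM M * besF φ 1 V) :=
        add_le_add supF_mulF_le (besF_mulF_le φ hM.bm hV.bm 1)
    -- The added terms complete the product (1 + c)(|M| + |M|₁)(|V| + |V|₁).
    _ ≤ supM M * supF V + mulConst φ 1 * (besM φ 1 M * supF V + supM M * besF φ 1 V) +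
        (besM φ 1 M * supF V + supM M * besF φ 1 V + besM φ 1 M * besF φ 1 V + mulConst φ 1 *
          (supM M * supF V + besM φ 1 M * besF φ 1 V)) := le_self_add
    _ = _ := by rw [sizeF]; ring

variable [NeZero d]

theorem sizeF_step_le (hM : GoodMat φ M) (hV : GoodField φ V) :
    sizeF φ (gradOp (mulF M V)) ≤ factor φ M * sizeF φ V := by
  have hG := GoodField.mulF hM hV
  calc sizeF φ (gradOp (mulF M V))
      ≤ gradConst φ * sizeF φ (mulF M V) + gradConst φ * besF φ 1 (mulF M V) :=
        add_le_add (supF_gradOp_le φ hG) (besF_gradOp_le φ hG 1)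
    _ ≤ gradConst φ * sizeF φ (mulF M V) + gradConst φ * sizeF φ (mulF M V) := by
        gcongr; exact le_add_self
    _ = 2 * gradConst φ * sizeF φ (mulF M V) := by ring
    _ ≤ 2 * gradConst φ * ((1 + mulConst φ 1) * (supM M + besM φ 1 M) * sizeF φ V) := by
        gcongr; exact sizeF_mulF_le hM hV
    _ = _ := by rw [factor]; ring

/-- The tame structure: the high norm of V is multiplied only by the sup norm of M, the small
quantity, while the high norm of M meets only the low size of V. -/
theorem besF_step_le (hM : GoodMat φ M) (hV : GoodField φ V) (s : ℝ) :
    besF φ s (gradOp (mulF M V)) ≤ gradConst φ * mulConst φ s * supM M * besF φ s V +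
      gradConst φ * mulConst φ s * besM φ s M * sizeF φ V := by
  refine (besF_gradOp_le φ (GoodField.mulF hM hV) s).trans ?_
  calc gradConst φ * besF φ s (mulF M V)
      ≤ gradConst φ * (mulConst φ s * (besM φ s M * sizeF φ V + supM M * besF φ s V)) := by
        gcongr
        refine (besF_mulF_le φ hM.bm hV.bm s).trans ?_
        gcongr
        exact le_self_add
    _ = _ := by ring

/-- The iterates of `V ↦ gradOp (mulF M V)`. -/
def iter (M : Option (Fin d) → Option (Fin d) → Sp d → ℝ → ℂ)
    (V : Option (Fin d) → Sp d → ℝ → ℂ) : ℕ → Option (Fin d) → Sp d → ℝ → ℂ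
  | 0 => V
  | n + 1 => gradOp (mulF M (iter M V n))

theorem GoodField.iter (hM : GoodMat φ M) (hV : GoodField φ V) (n : ℕ) : GoodField φ (iter M V n) := by
  induction n with
  | zero => exact hV
  | succ n ih => exact GoodField.gradOp φ (GoodField.mulF hM ih)

theorem sizeF_iter_le (hM : GoodMat φ M) (hV : GoodField φ V) (hq : factor φ M ≤ 2⁻¹) (n : ℕ) :
    sizeF φ (iter M V n) ≤ 2⁻¹ ^ n * sizeF φ V := by
  induction n with
  | zero => simp [MuskatDN.iter]
  | succ n ih =>
    refine (sizeF_step_le hM (GoodField.iter hM hV n)).trans ?_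
    rw [pow_succ', mul_assoc]
    gcongr

/-- The solution `∑ (gradOp ∘ mulF M)^n V` of `U = V + gradOp (mulF M U)`. -/
def solve (M : Option (Fin d) → Option (Fin d) → Sp d → ℝ → ℂ)
    (V : Option (Fin d) → Sp d → ℝ → ℂ) (l : Option (Fin d)) (x : Sp d) (z : ℝ) : ℂ :=
  ∑' n, iter M V n l x z

theorem tsum_sizeF_iter_le (hM : GoodMat φ M) (hV : GoodField φ V) (hq : factor φ M ≤ 2⁻¹) :
    ∑' n, sizeF φ (iter M V n) ≤ 2 * sizeF φ V := by
  have h : ∀ n, sizeF φ (iter M V (n + 1)) ≤ factor φ M * sizeF φ (iter M V n) + 0 := fun n => by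
    rw [add_zero]; exact sizeF_step_le hM (GoodField.iter hM hV n)
  have := tsum_le_of_contraction (x := fun n => sizeF φ (iter M V n)) (c := fun _ => 0) hq h
  rwa [tsum_zero, add_zero] at this

theorem tsum_LI_iter_lt_top (hM : GoodMat φ M) (hV : GoodField φ V) (hq : factor φ M ≤ 2⁻¹)
    (l : Option (Fin d)) : ∑' n, LI (iter M V n l) < ⊤ :=
  (ENNReal.tsum_le_tsum fun n => (le_supF (iter M V n) l).trans le_self_add).trans_lt
    ((tsum_sizeF_iter_le hM hV hq).trans_lt (ENNReal.mul_lt_top (by simp) hV.sizeF_lt_top))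

theorem sizeF_solve_le (hM : GoodMat φ M) (hV : GoodField φ V) (hq : factor φ M ≤ 2⁻¹) :
    sizeF φ (solve M V) ≤ 2 * sizeF φ V := by
  refine le_trans ?_ (tsum_sizeF_iter_le hM hV hq)
  simp only [sizeF, supF, besF]
  rw [ENNReal.tsum_add]
  refine add_le_add ?_ ?_
  · rw [Summable.tsum_finsetSum fun _ _ => ENNReal.summable]
    exact Finset.sum_le_sum fun l _ => LI_tsum_le _
  · rw [Summable.tsum_finsetSum fun _ _ => ENNReal.summable]
    exact Finset.sum_le_sum fun l _ => Bes_tsum_le φ 1 (fun n => (GoodField.iter hM hV n).bm l)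
      (tsum_LI_iter_lt_top hM hV hq l)

theorem GoodField.solve (hM : GoodMat φ M) (hV : GoodField φ V) (hq : factor φ M ≤ 2⁻¹) :
    GoodField φ (solve M V) := by
  refine .of_lt_top (fun l => BM.tsum (fun n => (GoodField.iter hM hV n).bm l)
    (tsum_LI_iter_lt_top hM hV hq l)) ?_
  exact (le_add_self.trans (sizeF_solve_le hM hV hq)).trans_lt
    (ENNReal.mul_lt_top (by simp) hV.sizeF_lt_top)

/-- The recursion for the high norm contracts up to a forcing proportional to the low sizes of the
iterates, whose sum is at most twice the size of V. No smallness of the high norm of M enters. -/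
theorem besF_solve_le (hM : GoodMat φ M) (hV : GoodField φ V) (hq : factor φ M ≤ 2⁻¹) {s : ℝ}
    (hs : gradConst φ * mulConst φ s * supM M ≤ 2⁻¹) :
    besF φ s (solve M V) ≤ 2 * (besF φ s V +
      gradConst φ * mulConst φ s * besM φ s M * (2 * sizeF φ V)) := by
  have h1 := tsum_le_of_contraction (x := fun n => besF φ s (iter M V n))
    (c := fun n => gradConst φ * mulConst φ s * besM φ s M * sizeF φ (iter M V n)) hs
    fun n => besF_step_le hM (GoodField.iter hM hV n) s
  rw [ENNReal.tsum_mul_left] at h1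
  refine le_trans ?_ (h1.trans ?_)
  · simp only [besF]
    rw [Summable.tsum_finsetSum fun _ _ => ENNReal.summable]
    exact Finset.sum_le_sum fun l _ => Bes_tsum_le φ s (fun n => (GoodField.iter hM hV n).bm l)
      (tsum_LI_iter_lt_top hM hV hq l)
  · gcongr
    · exact le_rfl
    · exact tsum_sizeF_iter_le hM hV hq

/-- `gradOp` and multiplication by M may be applied termwise to the absolutely convergent series,
which shifts the index of the iterates by one. -/
theorem solve_eq (hM : GoodMat φ M) (hV : GoodField φ V) (hq : factor φ M ≤ 2⁻¹)
    (l : Option (Fin d)) (x : Sp d) {z : ℝ} (hz : z < 0) :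
    solve M V l x z = V l x z + gradOp (mulF M (solve M V)) l x z := by
  have hI := GoodField.iter hM hV
  have hfin : ∑' n, sizeF φ (mulF M (iter M V n)) < ⊤ := by
    refine (ENNReal.tsum_le_tsum fun n => sizeF_mulF_le hM (hI n)).trans_lt ?_
    rw [ENNReal.tsum_mul_left]
    exact ENNReal.mul_lt_top (ENNReal.mul_lt_top
      (ENNReal.add_lt_top.2 ⟨by simp, mulConst_lt_top φ one_pos⟩)
      (ENNReal.add_lt_top.2 ⟨hM.supM_lt_top, hM.besM_lt_top⟩))
      ((tsum_sizeF_iter_le hM hV hq).trans_lt (ENNReal.mul_lt_top (by simp) hV.sizeF_lt_top))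
  have h1 := hasSum_gradOp φ (fun n => GoodField.mulF hM (hI n))
    ((ENNReal.tsum_le_tsum fun n => le_self_add).trans_lt hfin)
    ((ENNReal.tsum_le_tsum fun n => le_add_self).trans_lt hfin) l x hz
  have h2 : ∀ i, SliceEq (fun x z => ∑' n, mulF M (iter M V n) i x z) (mulF M (solve M V) i) :=
    fun i => SliceEq.of_forall fun x z hz => by
      have : HasSum (fun n => mulF M (iter M V n) i x z) (mulF M (solve M V) i x z) :=
        hasSum_sum fun l _ =>
          (summable_of_tsum_LI (tsum_LI_iter_lt_top hM hV hq l) x hz).hasSum.mul_left _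
      exact this.tsum_eq
  have h3 : gradOp (fun l x z => ∑' n, mulF M (iter M V n) l x z) l x z =
      gradOp (mulF M (solve M V)) l x z := by
    have e : source (fun l x z => ∑' n, mulF M (iter M V n) l x z) x z =
        source (mulF M (solve M V)) x z := by
      simp only [source]
      rw [duhDiv_congr h2]
      congr 1
      exact (hasSum_sum fun l _ => (summable_of_tsum_LI
        (tsum_LI_iter_lt_top hM hV hq l) x hz).hasSum.mul_left _).tsum_eq
    cases l with
    | none => simp only [gradOp, Duh_congr timeSets_after none (source_congr h2), e]
    | some k => simp only [gradOp, Duh_congr timeSets_after (some k) (source_congr h2)]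
  rw [h3] at h1
  have h4 := (hasSum_nat_add_iff' 1).2
    (summable_of_tsum_LI (tsum_LI_iter_lt_top hM hV hq l) x hz).hasSum
  have h5 := h4.unique h1
  simp only [Finset.range_one, Finset.sum_singleton, iter] at h5
  rw [← h5, solve]
  ring

theorem RealOn.solve (hM : GoodMat φ M) (hV : GoodField φ V) (hq : factor φ M ≤ 2⁻¹)
    (hMr : ∀ i l, RealOn (M i l)) (hVr : ∀ l, RealOn (V l)) (l : Option (Fin d)) :
    RealOn (solve M V l) := by
  have hr : ∀ n l, RealOn (iter M V n l) := by
    intro n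
    induction n with
    | zero => exact hVr
    | succ n ih => exact RealOn.gradOp (RealOn.mulF hMr ih)
  intro x z hz
  have h1 := Complex.hasSum_im (summable_of_tsum_LI (tsum_LI_iter_lt_top hM hV hq l) x hz).hasSum
  rw [show (fun n => (iter M V n l x z).im) = fun _ => 0 from funext fun n => hr n l x z hz] at h1
  exact h1.unique hasSum_zero

/-- The difference of two solutions agrees slicewise with its own n-th iterate for every n, hence is
bounded by 2^{-n} times its finite size and vanishes. -/
theorem solve_unique (hM : GoodMat φ M) (hV : GoodField φ V) (hq : factor φ M ≤ 2⁻¹)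
    (hW : GoodField φ W)
    (H : ∀ l, SliceEq (W l) fun x z => V l x z + gradOp (mulF M W) l x z) (l : Option (Fin d)) :
    SliceEq (W l) (MuskatDN.solve M V l) := by
  have hS := GoodField.solve hM hV hq
  set U : Option (Fin d) → Sp d → ℝ → ℂ := fun l x z => W l x z - MuskatDN.solve M V l x z with hU
  have hUg : GoodField φ U := hW.sub hS
  have hstep : ∀ l, SliceEq (U l) (gradOp (MuskatDN.mulF M U) l) := by
    intro l
    have h1 : ∀ i, SliceEq (MuskatDN.mulF M U i)
        (fun x z => MuskatDN.mulF M W i x z - MuskatDN.mulF M (MuskatDN.solve M V) i x z) := fun i =>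
      SliceEq.of_forall fun x z _ => mulF_sub i x z
    refine SliceEq.trans ?_ (gradOp_congr h1 l).symm
    filter_upwards [H l, ae_restrict_mem measurableSet_Iio] with z hz hz0
    filter_upwards [hz] with x hx
    rw [gradOp_sub φ (GoodField.mulF hM hW) (GoodField.mulF hM hS)]
    simp only [hU]
    rw [hx, solve_eq hM hV hq l x hz0]
    ring
  have hall : ∀ n l, SliceEq (U l) (MuskatDN.iter M U n l) := by
    intro n
    induction n with
    | zero => exact fun l => SliceEq.of_forall fun _ _ _ => rfl
    | succ n ih => exact fun l => (hstep l).trans (gradOp_congr (mulF_congr ih) l)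
  filter_upwards [ae_all_iff.2 fun n => hall n l, ae_restrict_mem measurableSet_Iio] with z hz hz0
  filter_upwards [ae_all_iff.2 hz] with x hx
  have h1 : ∀ n : ℕ, ‖U l x z‖ₑ ≤ 2⁻¹ ^ n * sizeF φ U := fun n => by
    rw [hx n]
    exact ((le_LI _ x hz0).trans (le_supF _ l)).trans
      (le_self_add.trans (sizeF_iter_le hM hUg hq n))
  have h2 : Filter.Tendsto (fun n : ℕ => (2⁻¹ : ℝ≥0∞) ^ n * sizeF φ U) Filter.atTop (nhds 0) := by
    have := ENNReal.Tendsto.mul_const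
      (ENNReal.tendsto_pow_atTop_nhds_zero_of_lt_one (r := 2⁻¹) (by simp))
      (Or.inr hUg.sizeF_lt_top.ne)
    simpa using this
  have h3 : ‖U l x z‖ₑ = 0 := le_antisymm (ge_of_tendsto' h2 h1) zero_le
  rw [enorm_eq_zero] at h3
  exact sub_eq_zero.1 h3

end LinearProblem

/-! ### Tame calculus for the coefficient matrix and its differences -/

section Coefficients

variable {d : ℕ} (φ : DyadicCutoff d)

/-- `g` is bounded by `K a` in sup norm and by `K b` in Chemin-Lerner norm. -/
structure Tame (s : ℝ) (K : ℝ≥0) (a b : ℝ≥0∞) (g : Sp d → ℝ → ℂ) : Prop where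
  bm : BM g
  li : LI g ≤ K * a
  bes : Bes φ s g ≤ K * b

variable {φ} {s : ℝ} {K K' : ℝ≥0} {a a' b b' : ℝ≥0∞} {g h : Sp d → ℝ → ℂ}

theorem LI_congr (H : ∀ x z, z < 0 → g x z = h x z) : LI g = LI h :=
  le_antisymm (LI_le fun x z hz => by rw [H x z hz]; exact le_LI h x hz)
    (LI_le fun x z hz => by rw [← H x z hz]; exact le_LI g x hz)

theorem Tame.congr (hg : Tame φ s K a b g) (hm : Measurable (Function.uncurry h))
    (H : ∀ x z, z < 0 → g x z = h x z) : Tame φ s K a b h where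
  bm := ⟨hm, LI_congr H ▸ hg.bm.fin⟩
  li := LI_congr H ▸ hg.li
  bes := Bes_congr φ (SliceEq.of_forall H) ▸ hg.bes

theorem Tame.mono_const (hg : Tame φ s K a b g) (hK : K ≤ K') : Tame φ s K' a b g where
  bm := hg.bm
  li := hg.li.trans (by gcongr)
  bes := hg.bes.trans (by gcongr)

theorem Tame.mono (hg : Tame φ s K a b g) (ha : a ≤ a') (hb : b ≤ b') : Tame φ s K a' b' g where
  bm := hg.bm
  li := hg.li.trans (by gcongr)
  bes := hg.bes.trans (by gcongr)

theorem Tame.neg (hg : Tame φ s K a b g) : Tame φ s K a b fun x z => -g x z where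
  bm := hg.bm.neg
  li := (LI_le fun x z hz => by rw [enorm_neg]; exact le_LI g x hz).trans hg.li
  bes := (Bes_neg φ s g).trans_le hg.bes

theorem Tame.add (hg : Tame φ s K a b g) (hh : Tame φ s K' a b h) :
    Tame φ s (K + K') a b fun x z => g x z + h x z where
  bm := hg.bm.add hh.bm
  li := (LI_add_le g h).trans (by push_cast; rw [add_mul]; exact add_le_add hg.li hh.li)
  bes := (Bes_add_le φ s hg.bm hh.bm).trans
    (by push_cast; rw [add_mul]; exact add_le_add hg.bes hh.bes)

theorem Tame.sub (hg : Tame φ s K a b g) (hh : Tame φ s K' a b h) :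
    Tame φ s (K + K') a b fun x z => g x z - h x z := by
  simpa only [sub_eq_add_neg] using hg.add hh.neg

theorem Tame.zero : Tame φ s 0 a b fun _ _ => 0 where
  bm := BM.const 0
  li := LI_le fun x z _ => by simp
  bes := by rw [Bes_zero]; exact zero_le

theorem Tame.sum {ι : Type*} [Fintype ι] {g : ι → Sp d → ℝ → ℂ} (hg : ∀ i, Tame φ s K a b (g i)) :
    Tame φ s (Fintype.card ι * K) a b fun x z => ∑ i, g i x z where
  bm := BM.sum _ fun i => (hg i).bm
  li := (LI_finsetSum_le _ g).trans ((Finset.sum_le_sum fun i _ => (hg i).li).trans_eq (by simp; ring))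
  bes := (Bes_finsetSum_le φ _ s fun i => (hg i).bm).trans
    ((Finset.sum_le_sum fun i _ => (hg i).bes).trans_eq (by simp; ring))

variable (φ s) in
/-- The constant in the product estimate. -/
def mulConst' : ℝ≥0 := (mulConst φ s).toNNReal

theorem coe_mulConst' (hs : 0 < s) : (mulConst' φ s : ℝ≥0∞) = mulConst φ s :=
  ENNReal.coe_toNNReal (mulConst_lt_top φ hs).ne

/-- The second factor is normalised to sup size 1. The condition a b' ≤ b is what the term with all
extra derivatives on the second factor requires, so the pair (a, b) survives multiplication. -/
theorem Tame.mul (hs : 0 < s) (hab : a * b' ≤ b) (hg : Tame φ s K a b g)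
    (hh : Tame φ s K' 1 b' h) :
    Tame φ s (2 * K * K' * (1 + mulConst' φ s)) a b fun x z => g x z * h x z where
  bm := hg.bm.mul hh.bm
  li := by
    calc LI (fun x z => g x z * h x z) ≤ (K * a) * (K' * 1) :=
          (LI_mul_le g h).trans (mul_le_mul' hg.li hh.li)
      _ = K * K' * a := by ring
      _ ≤ K * K' * a + (K * K' + 2 * K * K' * mulConst' φ s) * a := le_self_add
      _ = _ := by push_cast; ring
  bes := by
    calc Bes φ s (fun x z => g x z * h x z)
        ≤ mulConst φ s * (Bes φ s g * LI h + LI g * Bes φ s h) := Bes_mul_le φ s hg.bm hh.bm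
      _ ≤ mulConst φ s * ((K * b) * (K' * 1) + (K * a) * (K' * b')) := by
          gcongr
          exacts [hg.bes, hh.li, hg.li, hh.bes]
      _ = mulConst φ s * K * K' * (b + a * b') := by ring
      _ ≤ mulConst φ s * K * K' * (b + b) := by gcongr
      _ ≤ mulConst φ s * K * K' * (b + b) + 2 * K * K' * b := le_self_add
      _ = _ := by push_cast; rw [coe_mulConst' hs]; ring

theorem one_add_ne_zero_of_LI (hh : LI h ≤ 2⁻¹) (x : Sp d) {z : ℝ} (hz : z < 0) :
    1 + h x z ≠ 0 := by
  intro h0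
  have h1 : h x z = -1 := by linear_combination h0
  have h2 := (le_LI h x hz).trans hh
  rw [h1] at h2
  simp at h2

/-- The quotient is the geometric series of g(-h)^n. One smallness condition on h makes the sup
norms contract, the other makes the Chemin-Lerner norms contract up to a forcing proportional to the
sup norms. -/
theorem Tame.div (hs : 0 < s) (hab : a * b' ≤ b) (hg : Tame φ s K a b g)
    (hh : Tame φ s K' 1 b' h) (h1 : LI h ≤ 2⁻¹) (h2 : mulConst φ s * LI h ≤ 2⁻¹) :
    Tame φ s (2 * K + 4 * mulConst' φ s * K * K') a b fun x z => g x z / (1 + h x z) := by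
  set w : ℕ → Sp d → ℝ → ℂ := fun n x z => g x z * (-h x z) ^ n with hw
  have hstep : ∀ n, w (n + 1) = fun x z => -(h x z * w n x z) := fun n => by
    ext x z; simp only [hw]; ring
  have hbm : ∀ n, BM (w n) := by
    intro n
    induction n with
    | zero => simpa [hw] using hg.bm
    | succ n ih => rw [hstep]; exact (hh.bm.mul ih).neg
  have hLneg : ∀ f : Sp d → ℝ → ℂ, LI (fun x z => -f x z) ≤ LI f := fun f =>
    LI_le fun x z hz => by rw [enorm_neg]; exact le_LI f x hz
  have hw0 : w 0 = g := by ext x z; simp [hw]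
  have hL : ∑' n, LI (w n) ≤ 2 * LI g := by
    have := tsum_le_of_contraction (x := fun n => LI (w n)) (c := fun _ => 0) h1 fun n => by
      rw [hstep, add_zero]; exact (hLneg _).trans (LI_mul_le _ _)
    rwa [tsum_zero, add_zero, hw0] at this
  have hB : ∑' n, Bes φ s (w n) ≤ 2 * (Bes φ s g + mulConst φ s * Bes φ s h * (2 * LI g)) := by
    have := tsum_le_of_contraction (x := fun n => Bes φ s (w n))
      (c := fun n => mulConst φ s * Bes φ s h * LI (w n)) h2 fun n => by
        rw [hstep, Bes_neg]
        refine (Bes_mul_le φ s hh.bm (hbm n)).trans_eq ?_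
        rw [mulConst]; ring
    rw [ENNReal.tsum_mul_left, hw0] at this
    refine this.trans ?_
    gcongr
  have hLt : ∑' n, LI (w n) < ⊤ := hL.trans_lt (ENNReal.mul_lt_top (by simp) hg.bm.fin)
  have hsum : ∀ x z, z < 0 → ∑' n, w n x z = g x z / (1 + h x z) := by
    intro x z hz
    have hn : ‖-h x z‖ < 1 := by
      have := (le_LI h x hz).trans h1
      rw [norm_neg, ← toReal_enorm]
      calc (‖h x z‖ₑ).toReal ≤ (2⁻¹ : ℝ≥0∞).toReal := ENNReal.toReal_mono (by simp) this
        _ < 1 := by simp; norm_num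
    simp only [hw]
    rw [tsum_mul_left, tsum_geometric_of_norm_lt_one hn, sub_neg_eq_add, div_eq_mul_inv]
  have hfin : Tame φ s (2 * K + 4 * mulConst' φ s * K * K') a b fun x z => ∑' n, w n x z := by
    refine ⟨BM.tsum hbm hLt, ?_, ?_⟩
    · calc LI (fun x z => ∑' n, w n x z) ≤ 2 * LI g := (LI_tsum_le w).trans hL
        _ ≤ 2 * (K * a) := by gcongr; exact hg.li
        _ ≤ 2 * (K * a) + 4 * mulConst' φ s * K * K' * a := le_self_add
        _ = _ := by push_cast; ring
    · calc Bes φ s (fun x z => ∑' n, w n x z)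
          ≤ 2 * (Bes φ s g + mulConst φ s * Bes φ s h * (2 * LI g)) :=
            (Bes_tsum_le φ s hbm hLt).trans hB
        _ ≤ 2 * (K * b + mulConst φ s * (K' * b') * (2 * (K * a))) := by
            gcongr
            exacts [hg.bes, hh.bes, hg.li]
        _ = 2 * (K * b) + 4 * mulConst φ s * K * K' * (a * b') := by ring
        _ ≤ 2 * (K * b) + 4 * mulConst φ s * K * K' * b := by gcongr
        _ = _ := by push_cast; rw [coe_mulConst' hs]; ring
  exact hfin.congr (hg.bm.meas.div (hh.bm.meas.const_add 1)) hsum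

variable (φ)

/-- The coefficient of `∂_z v` in `-Q_a[v]`. -/
def vertCoef (η : 𝓢'(Sp d, ℂ)) (x : Sp d) (z : ℝ) : ℂ :=
  ((∑ k : Fin d, coef φ η (some k) x z ^ 2) - coef φ η none x z) / (1 + coef φ η none x z)

/-- The matrix of coefficients of `(Q_a, ∇H ∂_z v - |D|H ∇v)`. -/
def coefMat (η : 𝓢'(Sp d, ℂ)) : Option (Fin d) → Option (Fin d) → Sp d → ℝ → ℂ
  | none, none => fun x z => -vertCoef φ η x z
  | none, some k => coef φ η (some k)
  | some k, none => coef φ η (some k)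
  | some k, some l => if l = k then fun x z => -coef φ η none x z else fun _ _ => 0

theorem mulF_coefMat_none (η : 𝓢'(Sp d, ℂ)) (V : Option (Fin d) → Sp d → ℝ → ℂ) (x : Sp d) (z : ℝ) :
    mulF (coefMat φ η) V none x z =
      (∑ k, coef φ η (some k) x z * V (some k) x z) - vertCoef φ η x z * V none x z := by
  simp only [mulF, Fintype.sum_option, coefMat]; ring

theorem mulF_coefMat_some (η : 𝓢'(Sp d, ℂ)) (V : Option (Fin d) → Sp d → ℝ → ℂ) (k : Fin d) (x : Sp d)
    (z : ℝ) : mulF (coefMat φ η) V (some k) x z =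
      coef φ η (some k) x z * V none x z - coef φ η none x z * V (some k) x z := by
  simp only [mulF, Fintype.sum_option, coefMat, ite_apply, ite_mul, zero_mul, Finset.sum_ite_eq',
    Finset.mem_univ, if_true]
  ring

variable (s)

/-- The smallness threshold for the coefficients. -/
def smallConst : ℝ≥0 := (2 * (1 + coefConst φ) * (1 + mulConst' φ s))⁻¹

theorem smallConst_pos : 0 < smallConst φ s := by unfold smallConst; positivity

variable {s}

theorem smallConst_mul_le (c : ℝ≥0) (hc : c ≤ (1 + coefConst φ) * (1 + mulConst' φ s)) :
    c * smallConst φ s ≤ 2⁻¹ := by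
  have h : 0 < (1 + coefConst φ) * (1 + mulConst' φ s) := by positivity
  calc c * smallConst φ s ≤ ((1 + coefConst φ) * (1 + mulConst' φ s)) * smallConst φ s := by gcongr
    _ = 2⁻¹ := by
      rw [smallConst, mul_assoc 2, mul_inv, mul_comm, mul_assoc, inv_mul_cancel₀ h.ne', mul_one]

/-- One threshold serves all needs: size at most 1, sup norm of the coefficients at most 1/2, and
the same after multiplication by the product constant. -/
theorem ennreal_smallConst_mul_le (c : ℝ≥0) (hc : c ≤ (1 + coefConst φ) * (1 + mulConst' φ s))
    {t : ℝ≥0∞} (ht : t < smallConst φ s) : c * t ≤ 2⁻¹ := by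
  calc (c : ℝ≥0∞) * t ≤ c * smallConst φ s := by gcongr
    _ = ((c * smallConst φ s : ℝ≥0) : ℝ≥0∞) := by push_cast; rfl
    _ ≤ ((2⁻¹ : ℝ≥0) : ℝ≥0∞) := by exact_mod_cast smallConst_mul_le φ c hc
    _ = 2⁻¹ := by simp

variable {η : 𝓢'(Sp d, ℂ)}

theorem lt_top_of_small (h : besovAbsD φ 0 η < smallConst φ s) : besovAbsD φ 0 η < ⊤ :=
  h.trans ENNReal.coe_lt_top

theorem le_one_of_small (h : besovAbsD φ 0 η < smallConst φ s) : besovAbsD φ 0 η ≤ 1 := by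
  have h1 : (1 : ℝ≥0) ≤ (1 + coefConst φ) * (1 + mulConst' φ s) :=
    one_le_mul_of_one_le_of_one_le le_self_add le_self_add
  have := ennreal_smallConst_mul_le φ 1 h1 h
  rw [ENNReal.coe_one, one_mul] at this
  exact this.trans (by simp)

theorem LI_coef_small (h : besovAbsD φ 0 η < smallConst φ s) (l : Option (Fin d)) :
    LI (coef φ η l) ≤ 2⁻¹ := by
  refine (LI_coef_le φ (lt_top_of_small φ h) l).trans (ennreal_smallConst_mul_le φ _ ?_ h)
  calc coefConst φ = coefConst φ * 1 := by ring
    _ ≤ (1 + coefConst φ) * (1 + mulConst' φ s) := mul_le_mul' le_add_self le_self_add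

theorem mulConst_mul_LI_coef_small (hs : 0 < s) (h : besovAbsD φ 0 η < smallConst φ s)
    (l : Option (Fin d)) : mulConst φ s * LI (coef φ η l) ≤ 2⁻¹ := by
  rw [← coe_mulConst' hs]
  calc (mulConst' φ s : ℝ≥0∞) * LI (coef φ η l)
      ≤ mulConst' φ s * (coefConst φ * besovAbsD φ 0 η) := by
        gcongr; exact LI_coef_le φ (lt_top_of_small φ h) l
    _ = ((coefConst φ * mulConst' φ s : ℝ≥0) : ℝ≥0∞) * besovAbsD φ 0 η := by push_cast; ring
    _ ≤ 2⁻¹ := ennreal_smallConst_mul_le φ _ (mul_le_mul' le_add_self le_add_self) h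

variable {r : ℝ}

theorem tame_coef (h : besovAbsD φ 0 η < ⊤) (l : Option (Fin d)) :
    Tame φ (1 + r) (8 * coefConst φ) (besovAbsD φ 0 η) (besovAbsD φ r η) (coef φ η l) where
  bm := BM_coef φ h l
  li := by
    refine (LI_coef_le φ h l).trans ?_
    push_cast
    gcongr
    exact le_mul_of_one_le_left' (by norm_num)
  bes := (Bes_coef_le φ h l r).trans_eq (by push_cast; ring)

theorem tame_numerator (hr : 0 ≤ r) : ∃ K, ∀ η : 𝓢'(Sp d, ℂ), besovAbsD φ 0 η < smallConst φ (1 + r) →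
    Tame φ (1 + r) K (besovAbsD φ 0 η) (besovAbsD φ r η)
      fun x z => (∑ k : Fin d, coef φ η (some k) x z ^ 2) - coef φ η none x z := by
  have hsq : ∀ η : 𝓢'(Sp d, ℂ), besovAbsD φ 0 η < smallConst φ (1 + r) → ∀ k : Fin d,
      Tame φ (1 + r) (2 * (8 * coefConst φ) * (8 * coefConst φ) * (1 + mulConst' φ (1 + r)))
        (besovAbsD φ 0 η) (besovAbsD φ r η) fun x z => coef φ η (some k) x z ^ 2 := by
    intro η h k
    have h1 := tame_coef φ (r := r) (lt_top_of_small φ h) (some k)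
    have h2 := Tame.mul (by linarith) (mul_le_of_le_one_left' (le_one_of_small φ h)) h1
      (h1.mono (le_one_of_small φ h) le_rfl)
    simpa only [pow_two] using h2
  exact ⟨_, fun η h => Tame.sub (Tame.sum (hsq η h)) (tame_coef φ (lt_top_of_small φ h) none)⟩

theorem tame_vertCoef (hr : 0 ≤ r) : ∃ K, ∀ η : 𝓢'(Sp d, ℂ), besovAbsD φ 0 η < smallConst φ (1 + r) →
    Tame φ (1 + r) K (besovAbsD φ 0 η) (besovAbsD φ r η) (vertCoef φ η) := by
  obtain ⟨K, hK⟩ := tame_numerator φ hr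
  refine ⟨_, fun η h => Tame.div (by linarith) (mul_le_of_le_one_left' (le_one_of_small φ h)) (hK η h)
    ((tame_coef φ (lt_top_of_small φ h) none).mono (le_one_of_small φ h) le_rfl)
    (LI_coef_small φ h none) (mulConst_mul_LI_coef_small φ (by linarith) h none)⟩

theorem tame_coefMat (hr : 0 ≤ r) : ∃ K, ∀ η : 𝓢'(Sp d, ℂ), besovAbsD φ 0 η < smallConst φ (1 + r) →
    ∀ i l, Tame φ (1 + r) K (besovAbsD φ 0 η) (besovAbsD φ r η) (coefMat φ η i l) := by
  obtain ⟨K, hK⟩ := tame_vertCoef φ hr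
  refine ⟨K + 8 * coefConst φ, fun η h i l => ?_⟩
  have hc := fun l => (tame_coef φ (r := r) (lt_top_of_small φ h) l).mono_const
    (K' := K + 8 * coefConst φ) le_add_self
  cases i with
  | none =>
    cases l with
    | none => exact (hK η h).neg.mono_const le_self_add
    | some k => exact hc (some k)
  | some k =>
    cases l with
    | none => exact hc (some k)
    | some l =>
      simp only [coefMat]
      split_ifs
      · exact (hc none).neg
      · exact Tame.zero.mono_const zero_le

variable {η' : 𝓢'(Sp d, ℂ)}

theorem tame_coef_sub (h : besovAbsD φ 0 η < ⊤) (h' : besovAbsD φ 0 η' < ⊤) (l : Option (Fin d)) :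
    Tame φ (1 + r) (8 * coefConst φ) (besovAbsD φ 0 (η - η')) (besovAbsD φ r (η - η'))
      fun x z => coef φ η l x z - coef φ η' l x z :=
  (tame_coef φ (absBlk_sub_lt_top φ h h') l).congr ((BM_coef φ h l).sub (BM_coef φ h' l)).meas
    fun x _ hz => coef_sub φ h h' l x hz.le

/-- The Chemin-Lerner size of a difference of coefficients. -/
def diffSize (r : ℝ) (η η' : 𝓢'(Sp d, ℂ)) : ℝ≥0∞ :=
  besovAbsD φ r (η - η') + besovAbsD φ 0 (η - η') * (besovAbsD φ r η + besovAbsD φ r η')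

/-- The difference of squares factors as difference times sum: the difference carries the sizes of η
- η', the sum is of sup size 1. The high norm of the sum times the low norm of the difference is the
second term of `diffSize`. -/
theorem tame_numerator_sub (hr : 0 ≤ r) : ∃ K, ∀ η η' : 𝓢'(Sp d, ℂ),
    besovAbsD φ 0 η < smallConst φ (1 + r) → besovAbsD φ 0 η' < smallConst φ (1 + r) →
    Tame φ (1 + r) K (besovAbsD φ 0 (η - η')) (diffSize φ r η η') fun x z =>
      ((∑ k : Fin d, coef φ η (some k) x z ^ 2) - coef φ η none x z) -
        ((∑ k : Fin d, coef φ η' (some k) x z ^ 2) - coef φ η' none x z) := by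
  have hD : ∀ η η' : 𝓢'(Sp d, ℂ), besovAbsD φ 0 η < smallConst φ (1 + r) →
      besovAbsD φ 0 η' < smallConst φ (1 + r) → ∀ l, Tame φ (1 + r) (8 * coefConst φ)
      (besovAbsD φ 0 (η - η')) (diffSize φ r η η') fun x z => coef φ η l x z - coef φ η' l x z :=
    fun η η' h h' l => (tame_coef_sub φ (lt_top_of_small φ h) (lt_top_of_small φ h') l).mono le_rfl
      le_self_add
  have hsum : ∀ η η' : 𝓢'(Sp d, ℂ), besovAbsD φ 0 η < smallConst φ (1 + r) →
      besovAbsD φ 0 η' < smallConst φ (1 + r) → ∀ l, Tame φ (1 + r) (8 * coefConst φ + 8 * coefConst φ)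
      1 (besovAbsD φ r η + besovAbsD φ r η') fun x z => coef φ η l x z + coef φ η' l x z :=
    fun η η' h h' l =>
      ((tame_coef φ (lt_top_of_small φ h) l).mono (le_one_of_small φ h) le_self_add).add
      ((tame_coef φ (lt_top_of_small φ h') l).mono (le_one_of_small φ h') le_add_self)
  refine ⟨_, fun η η' h h' => ((Tame.sum fun k => Tame.mul (by linarith) le_add_self
    (hD η η' h h' (some k)) (hsum η η' h h' (some k))).sub (hD η η' h h' none)).congr ?_ ?_⟩
  · have hm := fun l => (BM_coef φ (lt_top_of_small φ h) l).meas
    have hm' := fun l => (BM_coef φ (lt_top_of_small φ h') l).meas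
    exact ((Finset.univ.measurable_fun_sum fun k _ => (hm (some k)).pow_const 2).sub (hm none)).sub
      ((Finset.univ.measurable_fun_sum fun k _ => (hm' (some k)).pow_const 2).sub (hm' none))
  · intro x z _
    have : ∀ k : Fin d, (coef φ η (some k) x z - coef φ η' (some k) x z) *
        (coef φ η (some k) x z + coef φ η' (some k) x z) =
        coef φ η (some k) x z ^ 2 - coef φ η' (some k) x z ^ 2 := fun k => by ring
    simp only [this, Finset.sum_sub_distrib]
    ring

/-- With N and N' the numerators and h, h' the coefficients |D|H, the difference N/(1+h) - N'/(1+h')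
equals (N - N')/(1+h) - ((h - h')/(1+h)) · N'/(1+h'). Every term carries exactly one difference. -/
theorem tame_vertCoef_sub (hr : 0 ≤ r) : ∃ K, ∀ η η' : 𝓢'(Sp d, ℂ),
    besovAbsD φ 0 η < smallConst φ (1 + r) → besovAbsD φ 0 η' < smallConst φ (1 + r) →
    Tame φ (1 + r) K (besovAbsD φ 0 (η - η')) (diffSize φ r η η')
      fun x z => vertCoef φ η x z - vertCoef φ η' x z := by
  obtain ⟨K₁, h₁⟩ := tame_numerator_sub φ hr
  obtain ⟨K₂, h₂⟩ := tame_vertCoef φ hr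
  have hs : 0 < 1 + r := by linarith
  have hunit : ∀ η η' : 𝓢'(Sp d, ℂ), besovAbsD φ 0 η < smallConst φ (1 + r) →
      Tame φ (1 + r) (8 * coefConst φ) 1 (besovAbsD φ r η + besovAbsD φ r η') (coef φ η none) :=
    fun η η' h => (tame_coef φ (lt_top_of_small φ h) none).mono (le_one_of_small φ h) le_self_add
  have hdiv : ∀ (K : ℝ≥0) (η η' : 𝓢'(Sp d, ℂ)) (u : Sp d → ℝ → ℂ),
      besovAbsD φ 0 η < smallConst φ (1 + r) →
      Tame φ (1 + r) K (besovAbsD φ 0 (η - η')) (diffSize φ r η η') u →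
      Tame φ (1 + r) (2 * K + 4 * mulConst' φ (1 + r) * K * (8 * coefConst φ))
        (besovAbsD φ 0 (η - η')) (diffSize φ r η η') fun x z => u x z / (1 + coef φ η none x z) :=
    fun K η η' u h hu => Tame.div hs le_add_self hu (hunit η η' h) (LI_coef_small φ h none)
      (mulConst_mul_LI_coef_small φ hs h none)
  refine ⟨_, fun η η' h h' => ((hdiv _ η η' _ h (h₁ η η' h h')).sub (Tame.mul hs le_add_self
    (hdiv _ η η' _ h ((tame_coef_sub φ (lt_top_of_small φ h) (lt_top_of_small φ h') none).mono le_rfl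
      le_self_add))
    ((h₂ η' h').mono (le_one_of_small φ h') (b' := besovAbsD φ r η + besovAbsD φ r η')
      le_add_self))).congr ?_ ?_⟩
  · exact ((h₂ η h).bm.sub (h₂ η' h').bm).meas
  · intro x z hz
    have e1 := one_add_ne_zero_of_LI (LI_coef_small φ h none) x hz
    have e2 := one_add_ne_zero_of_LI (LI_coef_small φ h' none) x hz
    simp only [vertCoef]
    field_simp
    ring

theorem tame_coefMat_sub (hr : 0 ≤ r) : ∃ K, ∀ η η' : 𝓢'(Sp d, ℂ),
    besovAbsD φ 0 η < smallConst φ (1 + r) → besovAbsD φ 0 η' < smallConst φ (1 + r) → ∀ i l,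
    Tame φ (1 + r) K (besovAbsD φ 0 (η - η')) (diffSize φ r η η')
      fun x z => coefMat φ η i l x z - coefMat φ η' i l x z := by
  obtain ⟨K, hK⟩ := tame_vertCoef_sub φ hr
  refine ⟨K + 8 * coefConst φ, fun η η' h h' i l => ?_⟩
  have hc := fun l => ((tame_coef_sub φ (r := r) (lt_top_of_small φ h) (lt_top_of_small φ h') l).mono
    le_rfl (le_self_add : _ ≤ diffSize φ r η η')).mono_const (K' := K + 8 * coefConst φ) le_add_self
  cases i with
  | none =>
    cases l with
    | none =>
      have := (hK η η' h h').neg.mono_const (K' := K + 8 * coefConst φ) le_self_add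
      simpa only [coefMat, neg_sub, neg_sub_neg] using this
    | some k => exact hc (some k)
  | some k =>
    cases l with
    | none => exact hc (some k)
    | some l =>
      simp only [coefMat]
      split_ifs
      · have h1 := (hc none).neg
        simp only [neg_sub] at h1
        simp only [neg_sub_neg]
        exact h1
      · simpa only [sub_zero] using
          (Tame.zero (φ := φ) (s := 1 + r)).mono_const (K' := K + 8 * coefConst φ) zero_le

theorem RealOn.coefMat {η : 𝓢'(Sp d, ℂ)} (hη : IsRealDist η) (h : besovAbsD φ 0 η < ⊤)
    (i l : Option (Fin d)) : RealOn (coefMat φ η i l) := by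
  have hc : ∀ l, RealOn (coef φ η l) := fun l x z hz =>
    coef_im φ hη l x z (summable_coefBlk φ h l x hz.le)
  cases i with
  | none =>
    cases l with
    | none =>
      refine RealOn.neg fun x z hz => ?_
      have h1 : RealOn fun x z => (∑ k : Fin d, coef φ η (some k) x z ^ 2) - coef φ η none x z := by
        simp only [pow_two]
        exact (RealOn.sum fun k => (hc (some k)).mul (hc (some k))).sub (hc none)
      have h2 : (1 + coef φ η none x z).im = 0 := by
        rw [Complex.add_im, hc none x z hz]; simp
      have h3 := h1 x z hz
      rw [vertCoef, Complex.div_im, h2]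
      rw [h3]
      simp
    | some k => exact hc (some k)
  | some k =>
    cases l with
    | none => exact hc (some k)
    | some l =>
      simp only [MuskatDN.coefMat]
      split_ifs
      · exact (hc none).neg
      · exact fun _ _ _ => rfl

end Coefficients

/-! ### Multipliers with Schwartz kernels acting on Lipschitz functions of linear growth -/

section LipschitzMultipliers

variable {d : ℕ} {m : Sp d → ℂ} {u : Sp d → ℝ} {K : ℝ≥0}

theorem norm_lip_le (hu : LipschitzWith K u) (x y : Sp d) : ‖(u (x - y) : ℂ)‖ ≤ |u x| + K * ‖y‖ := by
  rw [Complex.norm_real, Real.norm_eq_abs]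
  have h1 := hu.dist_le_mul (x - y) x
  rw [Real.dist_eq, dist_eq_norm, sub_sub_cancel_left, norm_neg] at h1
  have h2 := abs_sub_abs_le_abs_sub (u (x - y)) (u x)
  linarith

theorem integrable_ker_majorant (h : CcSym m) (A B : ℝ) :
    Integrable fun y => ‖ker m y‖ * (A + B * ‖y‖) := by
  have h1 := (h.kerS.integrable_pow_mul volume 1).const_mul B
  have h0 := (h.sym.kint.norm).const_mul A
  refine (h0.add h1).congr (.of_forall fun y => ?_)
  simp only [Pi.add_apply, h.kerS_apply, pow_one]
  ring

theorem integrable_ker_mul_lip' (h : CcSym m) (hu : LipschitzWith K u) (x : Sp d) :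
    Integrable fun y => ker m y * (u (x - y) : ℂ) := by
  refine (integrable_ker_majorant h |u x| K).mono' ?_ (.of_forall fun y => ?_)
  · have h1 : Continuous fun y => (u (x - y) : ℂ) :=
      Complex.continuous_ofReal.comp (hu.continuous.comp (by fun_prop))
    exact h.sym.kint.1.mul h1.aestronglyMeasurable
  · rw [norm_mul]
    gcongr
    exact norm_lip_le hu x y

theorem integrable_ker_mul_lip (h : CcSym m) (hu : LipschitzWith K u) (x : Sp d) :
    Integrable fun y => ker m (x - y) * (u y : ℂ) := by
  have := (integrable_ker_mul_lip' h hu x).comp_sub_left x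
  simpa using this

theorem funMult_comm (g : Sp d → ℂ) (x : Sp d) : funMult m g x = ∫ y, ker m y * g (x - y) := by
  rw [funMult_eq, ← integral_sub_left_eq_self _ _ x]
  simp

theorem continuous_funMult_lip (h : CcSym m) (hu : LipschitzWith K u) :
    Continuous (funMult m fun y => (u y : ℂ)) := by
  have : LipschitzWith ((∫ y, ‖ker m y‖).toNNReal * K) (funMult m fun y => (u y : ℂ)) := by
    refine LipschitzWith.of_dist_le_mul fun x x' => ?_
    rw [dist_eq_norm, funMult_comm, funMult_comm, ← integral_sub (integrable_ker_mul_lip' h hu x)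
      (integrable_ker_mul_lip' h hu x')]
    push_cast
    rw [Real.coe_toNNReal _ (integral_nonneg fun _ => norm_nonneg _), mul_assoc, ← integral_mul_const]
    refine norm_integral_le_of_norm_le (h.sym.kint.norm.mul_const _) (.of_forall fun y => ?_)
    rw [← mul_sub, norm_mul, ← Complex.ofReal_sub, Complex.norm_real, ← dist_eq_norm]
    gcongr
    refine (hu.dist_le_mul _ _).trans_eq ?_
    rw [dist_sub_right]
  exact this.continuous

theorem funMult_lip_shift_sub (h : CcSym m) (k : Fin d) (h' : CcSym fun ξ => rho (some k) ξ * m ξ)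
    (hu : LipschitzWith K u) {a b : ℝ} (hab : a ≤ b) (x : Sp d) :
    funMult m (fun y => (u y : ℂ)) (x + b • dir k) - funMult m (fun y => (u y : ℂ)) (x + a • dir k) =
      ∫ s in Ioc a b, funMult (fun ξ => rho (some k) ξ * m ξ) (fun y => (u y : ℂ)) (x + s • dir k) := by
  set mk : Sp d → ℂ := fun ξ => rho (some k) ξ * m ξ with hmk
  simp only [funMult_eq]
  rw [← integral_sub (integrable_ker_mul_lip h hu _) (integrable_ker_mul_lip h hu _)]
  have hc : Continuous (Function.uncurry fun (s : ℝ) (y : Sp d) =>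
      ker mk (x + s • dir k - y) * (u y : ℂ)) := by
    have h1 : Continuous fun p : ℝ × Sp d => ker mk (x + p.1 • dir k - p.2) :=
      (continuous_ker h'.sym.int).comp (by fun_prop)
    exact h1.mul (Complex.continuous_ofReal.comp (hu.continuous.comp continuous_snd))
  rw [integral_integral_swap]
  · congr 1; ext y
    have := ker_shift_sub k h.sym.int h'.sym.int hab (x - y)
    rw [← sub_mul, integral_mul_const, show x + b • dir k - y = x - y + b • dir k by abel,
      show x + a • dir k - y = x - y + a • dir k by abel, this]
    congr 2; ext s
    rw [show x + s • dir k - y = x - y + s • dir k by abel]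
  · refine ⟨hc.aestronglyMeasurable, ?_⟩
    rw [HasFiniteIntegral, lintegral_prod _ hc.enorm.aemeasurable]
    set A : ℝ := |u x| + K * max |a| |b| with hA
    refine lt_of_le_of_lt (b := ∫⁻ _s in Ioc a b, ∫⁻ y, ‖‖ker mk y‖ * (A + K * ‖y‖)‖ₑ) ?_ ?_
    · refine setLIntegral_mono' measurableSet_Ioc fun s hs => ?_
      simp only [Function.uncurry]
      rw [← lintegral_sub_left_eq_self _ (x + s • dir k)]
      refine lintegral_mono fun y => ?_
      rw [sub_sub_cancel]
      rw [← ofReal_norm, ← ofReal_norm]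
      refine ENNReal.ofReal_le_ofReal ?_
      have h0 : 0 ≤ A + K * ‖y‖ := by positivity
      rw [norm_mul, norm_mul, norm_norm, Real.norm_of_nonneg h0]
      gcongr
      refine (norm_lip_le hu _ y).trans ?_
      rw [hA]
      gcongr
      have h1 := norm_lip_le hu x (-(s • dir k))
      rw [sub_neg_eq_add, Complex.norm_real, norm_neg, norm_smul, norm_dir, mul_one,
        Real.norm_eq_abs] at h1
      refine h1.trans ?_
      rw [Real.norm_eq_abs]
      gcongr
      exact abs_le_max_abs_abs hs.1.le hs.2
    · rw [lintegral_const]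
      exact ENNReal.mul_lt_top (integrable_ker_majorant h' A K).2 (by simp)

/-- The derivative at s = 0 of m(D)u at x + s e_k is computed twice: with the derivative on the
kernel, using the increment formula, and with the derivative on u, which exists almost everywhere
along the direction, under dominated convergence. -/
theorem funMult_lip_deriv (h : CcSym m) (k : Fin d) (h' : CcSym fun ξ => rho (some k) ξ * m ξ)
    (hu : LipschitzWith K u) (x : Sp d) :
    funMult m (fun y => ((lineDeriv ℝ u y (dir k) : ℝ) : ℂ)) x =
      funMult (fun ξ => rho (some k) ξ * m ξ) (fun y => (u y : ℂ)) x := by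
  set mk : Sp d → ℂ := fun ξ => rho (some k) ξ * m ξ with hmk
  have h1 : HasDerivAt (fun s : ℝ => funMult m (fun y => (u y : ℂ)) (x + s • dir k))
      (funMult mk (fun y => (u y : ℂ)) x) 0 := by
    have hc : Continuous fun s : ℝ => funMult mk (fun y => (u y : ℂ)) (x + s • dir k) :=
      (continuous_funMult_lip h' hu).comp (by fun_prop)
    have h2 := intervalIntegral.integral_hasDerivAt_right (hc.intervalIntegrable 0 0)
      (hc.stronglyMeasurableAtFilter _ _) hc.continuousAt
    rw [zero_smul, add_zero] at h2
    refine (h2.const_add (funMult m (fun y => (u y : ℂ)) x)).congr_of_eventuallyEq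
      (.of_forall fun t => ?_)
    beta_reduce
    rcases le_total 0 t with ht | ht
    · rw [intervalIntegral.integral_of_le ht, ← funMult_lip_shift_sub h k h' hu ht, zero_smul, add_zero]
      ring
    · rw [intervalIntegral.integral_of_ge ht, ← funMult_lip_shift_sub h k h' hu ht, zero_smul, add_zero]
      ring
  have hq : ∀ᵐ y, LineDifferentiableAt ℝ u (x - y) (dir k) :=
    (Measure.measurePreserving_sub_left volume x).quasiMeasurePreserving.ae
      (hu.ae_lineDifferentiableAt (dir k))
  have h2 : HasDerivAt (fun s : ℝ => ∫ y, ker m y * (u (x + s • dir k - y) : ℂ))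
      (∫ y, ker m y * ((lineDeriv ℝ u (x - y) (dir k) : ℝ) : ℂ)) 0 := by
    refine (hasDerivAt_integral_of_dominated_loc_of_lip (s := univ) (bound := fun y => ‖ker m y‖ * K)
      (F := fun (s : ℝ) y => ker m y * (u (x + s • dir k - y) : ℂ))
      (F' := fun y => ker m y * ((lineDeriv ℝ u (x - y) (dir k) : ℝ) : ℂ))
      Filter.univ_mem (.of_forall fun s => (integrable_ker_mul_lip' h hu _).1) ?_ ?_ ?_ ?_ ?_).2
    · simpa using integrable_ker_mul_lip' h hu x
    · refine h.sym.kint.1.mul (Measurable.aestronglyMeasurable ?_)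
      exact Complex.measurable_ofReal.comp ((measurable_lineDeriv hu.continuous).comp (by fun_prop))
    · refine .of_forall fun y => LipschitzWith.lipschitzOnWith (LipschitzWith.of_dist_le_mul fun s t => ?_)
      rw [dist_eq_norm, ← mul_sub, norm_mul, ← Complex.ofReal_sub, Complex.norm_real, ← dist_eq_norm,
        Real.coe_nnabs, abs_of_nonneg (by positivity), mul_assoc]
      gcongr
      refine (hu.dist_le_mul _ _).trans_eq ?_
      rw [dist_sub_right, dist_add_left, dist_eq_norm, ← sub_smul, norm_smul, norm_dir, mul_one,
        ← dist_eq_norm]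
    · exact h.sym.kint.norm.mul_const _
    · filter_upwards [hq] with y hy
      have h3 := (hy.hasLineDerivAt : HasDerivAt _ _ _).ofReal_comp.const_mul (ker m y)
      refine h3.congr_of_eventuallyEq (.of_forall fun s => ?_)
      beta_reduce
      rw [show x + s • dir k - y = x - y + s • dir k by abel]
  have h3 : (fun s : ℝ => funMult m (fun y => (u y : ℂ)) (x + s • dir k)) =
      fun s : ℝ => ∫ y, ker m y * (u (x + s • dir k - y) : ℂ) := by
    ext s; exact funMult_comm _ _
  rw [← h3] at h2
  rw [funMult_comm]
  exact h2.unique h1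

theorem sum_funMult_lip_deriv {n : Fin d → Sp d → ℂ} {q : Sp d → ℂ} (hn : ∀ k, CcSym (n k))
    (hn' : ∀ k, CcSym fun ξ => rho (some k) ξ * n k ξ)
    (hq : ∀ ξ, ∑ k, rho (some k) ξ * n k ξ = q ξ) (hu : LipschitzWith K u) (x : Sp d) :
    ∑ k, funMult (n k) (fun y => ((lineDeriv ℝ u y (dir k) : ℝ) : ℂ)) x =
      funMult q (fun y => (u y : ℂ)) x := by
  simp only [funMult_lip_deriv (hn _) _ (hn' _) hu]
  simp only [funMult_eq]
  rw [← integral_finsetSum _ fun k _ => integrable_ker_mul_lip (hn' k) hu x]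
  congr 1; ext y
  rw [← Finset.sum_mul]
  congr 1
  simp only [ker_apply]
  rw [← integral_finsetSum _ fun k _ => integrable_wave_mul (hn' k).sym.int _]
  congr 1; ext ξ
  rw [← Finset.mul_sum, hq]

end LipschitzMultipliers

/-! ### The space 𝒱_*: passing between |D|v and the gradient of v -/

section SpaceVStar

variable {d : ℕ} (φ : DyadicCutoff d)

/-- The identity |D| = -∑ ∂_k R_k on symbols, with R_k = ∂_k|D|⁻¹; it expresses blocks of |D|v
through the bounded functions ∂_k v. -/
theorem sum_rho_mul_rieszSym (ξ : Sp d) :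
    ∑ k, rho (some k) ξ * rieszSym (some k) ξ = -symAbs ξ := by
  have h1 : ∀ k, rho (some k) ξ * rieszSym (some k) ξ = -(((‖ξ‖⁻¹ * ξ k ^ 2 : ℝ)) : ℂ) := fun k => by
    simp only [rieszSym, rho]
    push_cast
    linear_combination ((‖ξ‖ : ℂ)⁻¹ * (ξ k : ℂ) ^ 2) * Complex.I_mul_I
  simp only [h1, Finset.sum_neg_distrib, symAbs]
  rw [← Complex.ofReal_sum, ← Finset.mul_sum]
  have h2 : ∑ k, ξ k ^ 2 = ‖ξ‖ ^ 2 := by rw [EuclideanSpace.real_norm_sq_eq]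
  rw [h2]
  by_cases h : ξ = 0
  · simp [h]
  · have : ‖ξ‖ ≠ 0 := norm_ne_zero_iff.2 h
    congr 2
    field_simp

variable {v : Sp d → ℝ → ℝ} {K : ℝ≥0}

theorem exists_slice_extension
    (hv : LipschitzOnWith K (fun p : Sp d × ℝ => v p.1 p.2) (univ ×ˢ Iio (0 : ℝ))) {z : ℝ}
    (hz : z < 0) : LipschitzWith K fun x => v x z := by
  obtain ⟨w, hw, he⟩ := exists_extension hv
  have := lipschitz_slice_x hw z
  rwa [show (fun x => w x z) = fun x => v x z from funext fun x => he x z hz] at this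

theorem ccSym_rho_mul_dyad (l : Option (Fin d)) {n : Sp d → ℂ} (hn : SmoothOff n) (j : ℤ) :
    CcSym fun ξ => rho l ξ * dyad φ n j ξ := by
  have e : (fun ξ => rho l ξ * dyad φ n j ξ) = dyad φ (fun ξ => rho l ξ * n ξ) j := by
    ext ξ; simp only [dyad]; ring
  rw [e]
  exact dyad_ccSym φ ((smoothOff_rho l).mul hn) j

theorem smoothOff_neg_rieszSym (l : Option (Fin d)) : SmoothOff fun ξ : Sp d => -rieszSym l ξ := by
  have := (smoothOff_const (d := d) (-1)).mul (smoothOff_rieszSym l)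
  simpa using this

/-- `Δ̇_j |D| v` in terms of the gradient of `v`. -/
theorem absDBlock_eq
    (hv : LipschitzOnWith K (fun p : Sp d × ℝ => v p.1 p.2) (univ ×ˢ Iio (0 : ℝ))) (j : ℤ) (x : Sp d)
    {z : ℝ} (hz : z < 0) : absDBlock φ v j x z =
      ∑ k, funMult (dyad φ (fun ξ => -rieszSym (some k) ξ) j) (fun y => grad v (some k) y z) x := by
  have hneg : ∀ k : Fin d, SmoothOff fun ξ : Sp d => -rieszSym (some k) ξ := fun k =>
    smoothOff_neg_rieszSym (some k)
  have h1 := sum_funMult_lip_deriv (n := fun k => dyad φ (fun ξ => -rieszSym (some k) ξ) j)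
    (q := dyad φ symAbs j) (fun k => dyad_ccSym φ (hneg k) j) (fun k => ?_) (fun ξ => ?_)
    (exists_slice_extension hv hz) x
  · rw [absDBlock, ← h1]
    refine Finset.sum_congr rfl fun k _ => ?_
    congr 1
    ext y
    rw [grad_some v k y hz]; rfl
  · exact ccSym_rho_mul_dyad φ (some k) (hneg k) j
  · have h2 := sum_rho_mul_rieszSym ξ
    simp only [dyad]
    rw [show symAbs ξ = -∑ k, rho (some k) ξ * rieszSym (some k) ξ by rw [h2, neg_neg],
      ← Finset.sum_neg_distrib, Finset.sum_mul]
    refine Finset.sum_congr rfl fun k _ => ?_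
    ring

/-- `Δ̇_j ∂_k v` in terms of `Δ̇_j |D| v`. -/
theorem block_grad_eq
    (hv : LipschitzOnWith K (fun p : Sp d × ℝ => v p.1 p.2) (univ ×ˢ Iio (0 : ℝ))) (j : ℤ) (k : Fin d)
    (x : Sp d) {z : ℝ} (hz : z < 0) :
    funMult (dyad φ symOne j) (fun y => grad v (some k) y z) x =
      funMult (cut (fat φ) (rieszSym (some k)) j) (fun y => absDBlock φ v j y z) x := by
  have hneg : ∀ k : Fin d, SmoothOff fun ξ : Sp d => -rieszSym (some k) ξ := fun k =>
    smoothOff_neg_rieszSym (some k)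
  have hbm := fun l => BM_grad hv l
  have hu := exists_slice_extension hv hz
  have hcut := ((fat_annular φ).ccSym_cut (smoothOff_rieszSym (some k)) j).sym
  have hdy := fun l => (dyad_ccSym φ (hneg l) j).sym
  have e1 : ∀ l, funMult (cut (fat φ) (rieszSym (some k)) j)
      (funMult (dyad φ (fun ξ => -rieszSym (some l) ξ) j) (fun y => grad v (some l) y z)) x =
      funMult (dyad φ (fun ξ => rieszSym (some k) ξ * -rieszSym (some l) ξ) j)
        (fun y => grad v (some l) y z) x := fun l => by
    rw [funMult_funMult hcut (hdy l) ((hbm _).slice_aesm z) ((hbm _).slice_fin hz), dyad_mul_cut_fat]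
  have hfin : ∀ l, eLpNorm (funMult (dyad φ (fun ξ => -rieszSym (some l) ξ) j)
      (fun y => grad v (some l) y z)) ⊤ volume < ⊤ := fun l =>
    (eLpNorm_top_le_of_forall fun x => funMult_enorm_le _ _ (continuous_ker (hdy l).int) x).trans_lt
      (ENNReal.mul_lt_top (hdy l).kn_lt_top ((hbm _).slice_fin hz))
  have hcont : ∀ l, Continuous (funMult (dyad φ (fun ξ => -rieszSym (some l) ξ) j)
      (fun y => grad v (some l) y z)) := fun l =>
    continuous_funMult (hdy l).kint ((hbm _).slice_aesm z) ((hbm _).slice_fin hz)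
  have e2 : funMult (cut (fat φ) (rieszSym (some k)) j) (fun y => absDBlock φ v j y z) x =
      ∑ l, funMult (cut (fat φ) (rieszSym (some k)) j)
        (funMult (dyad φ (fun ξ => -rieszSym (some l) ξ) j) (fun y => grad v (some l) y z)) x := by
    simp only [funMult_eq (cut (fat φ) (rieszSym (some k)) j)]
    rw [← integral_finsetSum _ fun l _ => integrable_ker_mul hcut.kint
      (hcont l).aestronglyMeasurable (hfin l) x]
    congr 1; ext y
    rw [absDBlock_eq φ hv j y hz, Finset.mul_sum]
  rw [e2]
  simp only [e1]
  have e3 : ∀ l : Fin d, (fun y => grad v (some l) y z) =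
      fun y => ((lineDeriv ℝ (fun y => v y z) y (dir l) : ℝ) : ℂ) := fun l => by
    ext y; rw [grad_some v l y hz]; rfl
  simp only [e3]
  have hkl : ∀ l : Fin d, SmoothOff fun ξ : Sp d => rieszSym (some k) ξ * -rieszSym (some l) ξ :=
    fun l => (smoothOff_rieszSym (some k)).mul (hneg l)
  -- Summing -R_k R_l ∂_l over l gives ∂_k; the identity is applied to symbols acting on the
  -- Lipschitz function itself.
  rw [sum_funMult_lip_deriv (q := fun ξ => rho (some k) ξ * dyad φ symOne j ξ)
    (fun l => dyad_ccSym φ (hkl l) j) (fun l => ?_) (fun ξ => ?_) hu x]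
  · exact funMult_lip_deriv (dyad_symOne_ccSym φ j) k
      (ccSym_rho_mul_dyad φ (some k) (smoothOff_const 1) j) hu x
  · exact ccSym_rho_mul_dyad φ (some l) (hkl l) j
  · have h2 := sum_rho_mul_rieszSym ξ
    have h3 := rieszSym_mul_symAbs (some k) ξ
    simp only [dyad, symOne]
    rw [← h3, show symAbs ξ = -∑ k, rho (some k) ξ * rieszSym (some k) ξ by rw [h2, neg_neg],
      ← Finset.sum_neg_distrib, Finset.mul_sum, Finset.sum_mul]
    refine Finset.sum_congr rfl fun k _ => ?_
    ring

theorem exists_kn_riesz_le : ∃ C : ℝ≥0, ∀ (k : Fin d) (j : ℤ),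
    kn (cut (fat φ) (rieszSym (some k)) j) ≤ C ∧
    kn (cut (fat φ) (fun ξ => -rieszSym (some k) ξ) j) ≤ C := by
  choose C hC using fun k : Fin d => exists_kn_coefSym_le φ (some k)
  have h1 : ∀ (k : Fin d) (j : ℤ), kn (cut (fat φ) (rieszSym (some k)) j) ≤ C k := fun k j => by
    have h := hC k 0 le_rfl j
    have e : coefSym φ (some k) 0 j = cut (fat φ) (rieszSym (some k)) j := by
      simp [coefSym, symP_zero, symOne]
    rw [e] at h
    simpa using h
  have hle : ∀ k, (C k : ℝ≥0∞) ≤ ((∑ k, C k : ℝ≥0) : ℝ≥0∞) := fun k => by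
    exact_mod_cast Finset.single_le_sum (f := C) (fun _ _ => zero_le) (Finset.mem_univ k)
  refine ⟨∑ k, C k, fun k j => ⟨(h1 k j).trans (hle k), ?_⟩⟩
  have e : cut (fat φ) (fun ξ => -rieszSym (some k) ξ) j =
      fun ξ => (-1 : ℂ) * cut (fat φ) (rieszSym (some k)) j ξ := by
    ext ξ; simp [cut]
  rw [e, kn_const_mul]
  simpa using (h1 k j).trans (hle k)

end SpaceVStar

/-! ### Equivalence of the fixed point problem with the linear equation for the gradient -/

section FixedPoint

variable {d : ℕ} {φ : DyadicCutoff d} {v : Sp d → ℝ → ℝ} {K : ℝ≥0}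

theorem supNorm_le {g : Sp d → ℝ → ℂ} {C : ℝ≥0∞} (h : ∀ x z, z < 0 → ‖g x z‖ₑ ≤ C) :
    supNorm g ≤ C := by
  rw [supNorm, eLpNorm_exponent_top]
  refine eLpNormEssSup_le_of_ae_enorm_bound ?_
  filter_upwards [ae_restrict_mem (MeasurableSet.univ.prod measurableSet_Iio)] with p hp
  exact h p.1 p.2 hp.2

theorem blk_grad_none (j : ℤ) {z : ℝ} (hz : z < 0) : blk φ (grad v none) j z =
    eLpNorm (fun x => funMult (dyad φ symOne j) (fun y => dz v y z) x) ⊤ volume := by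
  have : (fun y => grad v none y z) = fun y => dz v y z := funext fun y => grad_none v y hz
  rw [blk, this]

theorem cheminLernerOne_dz : cheminLernerOne
    (fun j x z => funMult (dyad φ symOne j) (fun y => dz v y z) x) = Bes φ 1 (grad v none) := by
  refine tsum_congr fun j => ?_
  rw [one_mul]
  congr 1
  exact setLIntegral_congr_fun measurableSet_Iio fun z hz => (blk_grad_none j hz).symm

/-- Riesz transforms are bounded on each dyadic annulus uniformly in j, so the blocks of ∇v are
controlled by those of |D|v. -/
theorem goodField_grad (hv : MemVStar φ v) : GoodField φ (grad v) := by
  obtain ⟨K, hK⟩ := hv.lipschitz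
  refine ⟨fun l => BM_grad hK l, fun l => ?_⟩
  cases l with
  | none => rw [← cheminLernerOne_dz]; exact hv.dz_cl
  | some k =>
    obtain ⟨C, hC⟩ := exists_kn_riesz_le φ
    refine lt_of_le_of_lt ?_ (ENNReal.mul_lt_top (ENNReal.coe_lt_top (r := C)) hv.absD_cl)
    rw [Bes, cheminLernerOne, ← ENNReal.tsum_mul_left]
    refine ENNReal.tsum_le_tsum fun j => ?_
    rw [one_mul, mul_left_comm]
    gcongr 1
    rw [← lintegral_const_mul' _ _ ENNReal.coe_ne_top]
    refine setLIntegral_mono' measurableSet_Iio fun z hz => ?_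
    refine eLpNorm_top_le_of_forall fun x => ?_
    rw [block_grad_eq φ hK j k x hz]
    refine (funMult_enorm_le _ _ (continuous_ker
      ((fat_annular φ).ccSym_cut (smoothOff_rieszSym (some k)) j).sym.int) x).trans ?_
    gcongr
    exact (hC k j).1

/-- Riesz transforms are not bounded on L^∞, so a sup bound on |D|v requires the blocks of ∇_x v to
be summable uniformly in z, and not only a bound on ∇_x v. -/
theorem memVStar_of_grad
    (hK : LipschitzOnWith K (fun p : Sp d × ℝ => v p.1 p.2) (univ ×ˢ Iio (0 : ℝ)))
    (hB : ∀ l, Bes φ 1 (grad v l) < ⊤) {B : ℝ≥0∞} (hB0 : B < ⊤)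
    (hs : ∀ (k : Fin d) z, z < 0 → ∑' j, blk φ (grad v (some k)) j z ≤ B) : MemVStar φ v := by
  obtain ⟨C, hC⟩ := exists_kn_riesz_le φ
  have hbm := fun l => BM_grad hK l
  have key : ∀ j x z, z < 0 → ‖absDBlock φ v j x z‖ₑ ≤ ∑ k, C * blk φ (grad v (some k)) j z := by
    intro j x z hz
    rw [absDBlock_eq φ hK j x hz]
    refine (enorm_sum_le _ _).trans (Finset.sum_le_sum fun k _ => ?_)
    refine (enorm_funMult_dyad_le φ (smoothOff_neg_rieszSym (some k)) (hbm _) j hz x).trans ?_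
    gcongr
    exact (hC k j).2
  refine ⟨⟨K, hK⟩, ?_, ?_, ?_, ?_⟩
  · refine (supNorm_le (C := ∑ _k : Fin d, C * B) fun x z hz => ?_).trans_lt
      (ENNReal.sum_lt_top.2 fun _ _ => ENNReal.mul_lt_top (by simp) hB0)
    calc ‖∑' j, absDBlock φ v j x z‖ₑ ≤ ∑' j, ∑ k, C * blk φ (grad v (some k)) j z :=
          enorm_tsum_le_tsum_enorm.trans (ENNReal.tsum_le_tsum fun j => key j x z hz)
      _ = ∑ k, C * ∑' j, blk φ (grad v (some k)) j z := by
          rw [Summable.tsum_finsetSum fun _ _ => ENNReal.summable]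
          simp only [ENNReal.tsum_mul_left]
      _ ≤ _ := by
          gcongr with k
          exact hs k z hz
  · refine lt_of_le_of_lt (b := ∑ k, C * Bes φ 1 (grad v (some k))) ?_
      (ENNReal.sum_lt_top.2 fun k _ => ENNReal.mul_lt_top (by simp) (hB _))
    simp only [Bes, ← ENNReal.tsum_mul_left]
    rw [← Summable.tsum_finsetSum fun _ _ => ENNReal.summable]
    refine ENNReal.tsum_le_tsum fun j => ?_
    calc (2 : ℝ≥0∞) ^ (j : ℝ) * ∫⁻ z in Iio (0 : ℝ), eLpNorm (fun x => absDBlock φ v j x z) ⊤ volume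
        ≤ (2 : ℝ≥0∞) ^ (j : ℝ) * ∫⁻ z in Iio (0 : ℝ), ∑ k, C * blk φ (grad v (some k)) j z := by
          gcongr 1
          exact setLIntegral_mono' measurableSet_Iio fun z hz =>
            eLpNorm_top_le_of_forall fun x => key j x z hz
      _ = _ := by
          rw [lintegral_finsetSum _ fun k _ => (measurable_blk φ (hbm _) j).const_mul _,
            Finset.mul_sum]
          refine Finset.sum_congr rfl fun k _ => ?_
          rw [lintegral_const_mul _ (measurable_blk φ (hbm _) j), one_mul]
          ring
  · refine (supNorm_le (C := LI (grad v none)) fun x z hz => ?_).trans_lt (hbm none).fin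
    rw [← grad_none v x hz]
    exact le_LI _ x hz
  · rw [cheminLernerOne_dz]; exact hB none

/-! ### The operator in terms of gradients -/

variable (φ) in
theorem Qa_eq (η : 𝓢'(Sp d, ℂ)) (v : Sp d → ℝ → ℝ) (x : Sp d) {z : ℝ} (hz : z < 0) :
    Qa φ η v x z = mulF (coefMat φ η) (grad v) none x z := by
  rw [mulF_coefMat_none]
  simp only [Qa, dxH_eq, absDH_eq, vertCoef, grad_none v x hz, grad_some v _ x hz]

variable (φ) in
theorem fluxB_eq (η : 𝓢'(Sp d, ℂ)) (v : Sp d → ℝ → ℝ) (k : Fin d) (x : Sp d) {z : ℝ} (hz : z < 0) :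
    fluxB φ η v k x z = mulF (coefMat φ η) (grad v) (some k) x z := by
  rw [mulF_coefMat_some]
  simp only [fluxB, dxH_eq, absDH_eq, grad_none v x hz, grad_some v _ x hz]

variable {η f : 𝓢'(Sp d, ℂ)}

theorem goodField_coef (hf : besovAbsD φ 0 f < ⊤) : GoodField φ (coef φ f) :=
  ⟨fun l => BM_coef φ hf l, fun l => by
    have := Bes_coef_le φ hf l 0
    rw [add_zero] at this
    exact this.trans_lt (ENNReal.mul_lt_top (ENNReal.mul_lt_top (by simp) (by simp)) hf)⟩

theorem heatExt_im (hfr : IsRealDist f) (hf : besovAbsD φ 0 f < ⊤) : RealOn (heatExt φ f) := by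
  intro x z hz
  rw [heatExt_eq]
  have h1 : ∀ j x z, (heatBlk φ f j x z).im = 0 := fun j x z => by
    refine distMult_im_eq_zero (dyad_ccSym φ (smoothOff_symP _) j) (fun ξ => ?_) hfr x
    have hr : φ.toFun ((2 : ℝ) ^ (-j) • -ξ) = φ.toFun ((2 : ℝ) ^ (-j) • ξ) :=
      φ.radial _ _ (by rw [smul_neg, norm_neg])
    simp only [dyad, hr, map_mul, Complex.conj_ofReal, symP_neg]
  have h2 := Complex.hasSum_im (summable_heatBlk φ hf x hz).hasSum
  rw [show (fun j => (heatBlk φ f j x z - heatBlk φ f j 0 0).im) = fun _ => 0 from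
    funext fun j => by rw [Complex.sub_im, h1, h1, sub_zero]] at h2
  exact h2.unique hasSum_zero

variable [NeZero d]

theorem wInt_eq (hG : GoodField φ (mulF (coefMat φ η) (grad v))) (x : Sp d) {s : ℝ} (hs : s ≤ 0) :
    wInt φ η v x s = duhDiv (mulF (coefMat φ η) (grad v)) x s := by
  have hI := fun l => integrableOn_heatFlow φ timeSets_before l (hG.bm l) (hG.bes l) x s
  have hb : before s = Iio s := by rw [before, min_eq_left hs]
  simp only [duhDiv, Duh]
  rw [← integral_finsetSum _ fun k _ => hI (some k),
    ← integral_sub (integrable_finsetSum _ fun k _ => hI (some k)) (hI none), hb, wInt]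
  refine setIntegral_congr_fun measurableSet_Iio fun τ hτ => ?_
  have hτ' : τ < s := hτ
  have hτ0 : τ < 0 := hτ'.trans_le hs
  simp only [abs_of_pos (sub_pos.2 hτ'), fluxB_eq φ η v _ _ hτ0, Qa_eq φ η v _ hτ0]
  rfl

theorem opT_eq (hG : GoodField φ (mulF (coefMat φ η) (grad v))) (x : Sp d) {z : ℝ} (hz : z < 0) :
    opT φ η f v x z = heatExt φ f x z + heatInt (source (mulF (coefMat φ η) (grad v))) x z := by
  have h1 : heatInt (Qa φ η v) x z = heatInt (mulF (coefMat φ η) (grad v) none) x z :=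
    heatInt_congr (SliceEq.of_forall fun x z hz => Qa_eq φ η v x hz) x hz
  have h2 : heatInt (wInt φ η v) x z = heatInt (duhDiv (mulF (coefMat φ η) (grad v))) x z :=
    heatInt_congr (SliceEq.of_forall fun x z hz => wInt_eq hG x hz.le) x hz
  have h3 := heatInt_add φ (hG.bm none) (BM_duhDiv φ hG) x hz
  have h4 : opT φ η f v x z = heatExt φ f x z + heatInt (Qa φ η v) x z + heatInt (wInt φ η v) x z :=
    rfl
  rw [h4, h1, h2, add_assoc, ← h3]
  rfl

theorem hasGrad_heat (hf : besovAbsD φ 0 f < ⊤) {G : Option (Fin d) → Sp d → ℝ → ℂ}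
    (hG : GoodField φ G) : ∃ C, HasGrad (fun x z => heatExt φ f x z + heatInt (source G) x z)
      (fun l x z => coef φ f l x z + heatIntGrad (source G) l x z) C :=
  ⟨_, (hasGrad_heatExt φ hf).add (hasGrad_heatInt φ (BM_source φ hG) (Bes_source_lt_top φ hG))⟩

/-- Only the vertical components differ, by the choice of representative of the source, which agrees
with it on almost every slice. -/
theorem heatIntGrad_sliceEq {G : Option (Fin d) → Sp d → ℝ → ℂ} (hG : GoodField φ G)
    (l : Option (Fin d)) : SliceEq (heatIntGrad (source G) l) (gradOp G l) := by
  cases l with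
  | none =>
    filter_upwards [ae_goodTime φ (BM_source φ hG) (Bes_source_lt_top φ hG)] with z hz
    filter_upwards [GoodTime.ae_eq φ (BM_source φ hG) hz] with x hx
    simp only [heatIntGrad, gradOp, hx]
  | some k => exact SliceEq.of_forall fun _ _ _ => rfl

/-- The gradient of the heat representation turns the nonlocal equation for v into a linear equation
for its gradient. -/
theorem grad_sliceEq (hf : besovAbsD φ 0 f < ⊤) {G : Option (Fin d) → Sp d → ℝ → ℂ}
    (hG : GoodField φ G) {c : ℂ}
    (hv : ∀ x z, z < 0 → (v x z : ℂ) = heatExt φ f x z + heatInt (source G) x z + c)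
    (l : Option (Fin d)) : SliceEq (grad v l) fun x z => coef φ f l x z + gradOp G l x z := by
  obtain ⟨C, hC⟩ := hasGrad_heat hf hG
  refine SliceEq.trans ?_ (SliceEq.map₂ (· + ·) (SliceEq.of_forall (g := coef φ f l)
    (h := coef φ f l) fun _ _ _ => rfl) (heatIntGrad_sliceEq hG l))
  cases l with
  | none => exact hC.grad_none_eq hv
  | some k => exact SliceEq.of_forall fun x z hz => hC.grad_some_eq hv k x hz

/-- The field `(Q_a, ∇H ∂_z v - |D|H ∇v)` of the fixed point. -/
def fixedField (φ : DyadicCutoff d) (η f : 𝓢'(Sp d, ℂ)) : Option (Fin d) → Sp d → ℝ → ℂ :=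
  mulF (coefMat φ η) (solve (coefMat φ η) (coef φ f))

theorem goodField_fixedField (hM : GoodMat φ (coefMat φ η)) (hq : factor φ (coefMat φ η) ≤ 2⁻¹)
    (hf : besovAbsD φ 0 f < ⊤) :
    GoodField φ (fixedField φ η f) :=
  GoodField.mulF hM (GoodField.solve hM (goodField_coef hf) hq)

/-- The gradient is found first, as the Neumann series U. The function with heat representation
given by the field M U has gradient U by the linear equation, so it satisfies the equation for v as
well. -/
theorem exists_isFixedPt (hM : GoodMat φ (coefMat φ η)) (hq : factor φ (coefMat φ η) ≤ 2⁻¹)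
    (hf : besovAbsD φ 0 f < ⊤)
    (hηr : IsRealDist η) (hη : besovAbsD φ 0 η < ⊤) (hfr : IsRealDist f) :
    ∃ v, IsFixedPt φ η f v := by
  have hV := goodField_coef hf
  have hS := GoodField.solve hM hV hq
  have hG := goodField_fixedField hM hq hf
  have hreal : ∀ l, RealOn (fixedField φ η f l) := RealOn.mulF (RealOn.coefMat φ hηr hη)
    (RealOn.solve hM hV hq (RealOn.coefMat φ hηr hη) fun l x z hz =>
      coef_im φ hfr l x z (summable_coefBlk φ hf l x hz.le))
  set F : Sp d → ℝ → ℂ := fun x z => heatExt φ f x z + heatInt (source (fixedField φ η f)) x z with hF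
  have hFr : RealOn F := (heatExt_im hfr hf).add (RealOn.heatInt (RealOn.source hreal))
  -- Nothing is lost by the real part: real data give real coefficients, kernels and iterates, so F
  -- is real on z < 0.
  set v : Sp d → ℝ → ℝ := fun x z => (F x z).re with hvdef
  have hv : ∀ x z, z < 0 → (v x z : ℂ) = F x z + 0 := fun x z hz => by
    rw [add_zero]
    exact Complex.ext (by simp [hvdef]) (by simp [hFr x z hz])
  obtain ⟨C, hC⟩ := hasGrad_heat hf hG
  have hlip := hC.lipschitz_real hv
  have hgrad : ∀ l, SliceEq (grad v l) (solve (coefMat φ η) (coef φ f) l) := fun l =>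
    (grad_sliceEq hf hG hv l).trans
      (SliceEq.of_forall fun x z hz => (solve_eq hM hV hq l x hz).symm)
  have hgood : GoodField φ (grad v) := ⟨fun l => BM_grad hlip l, fun l => by
    rw [Bes_congr φ (hgrad l)]; exact hS.bes l⟩
  refine ⟨v, memVStar_of_grad (B := coefConst φ * besovAbsD φ 0 f +
    heatConst φ * Bes φ 1 (source (fixedField φ η f))) hlip hgood.bes ?_ ?_, 0, fun x z hz => ?_⟩
  · exact ENNReal.add_lt_top.2 ⟨ENNReal.mul_lt_top (by simp) hf,
      ENNReal.mul_lt_top (by simp) (Bes_source_lt_top φ hG)⟩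
  · intro k z hz
    have hb := BM_source φ hG
    have hB := Bes_source_lt_top φ hG
    have h1 : ∀ j, blk φ (grad v (some k)) j z ≤ coefConst φ * absBlk φ f j +
        blk φ (Duh after (some k) (source (fixedField φ η f))) j z := fun j => by
      have e : blk φ (grad v (some k)) j z = blk φ (fun x z => coef φ f (some k) x z +
          (-1) * Duh after (some k) (source (fixedField φ η f)) x z) j z := by
        refine blk_congr φ (.of_forall fun x => ?_)
        rw [hC.grad_some_eq hv k x hz, neg_one_mul]; rfl
      rw [e]
      have hD := BM_Duh φ timeSets_after (some k) hb hB
      refine (blk_add_le φ (BM_coef φ hf _) (hD.const_mul (-1)) j hz).trans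
        (add_le_add (blk_coef_le' φ hf _ j hz.le) ?_)
      rw [blk_const_mul]; simp
    refine (ENNReal.tsum_le_tsum h1).trans ?_
    rw [ENNReal.tsum_add, ENNReal.tsum_mul_left, besovAbsD_zero]
    gcongr 1
    have h2 := tsum_weighted_blk_Duh_le φ timeSets_after (some k) hb hB 0 z
    simpa using h2
  · rw [opT_eq (GoodField.mulF hM hgood) x hz, Complex.ofReal_zero, hv x z hz]
    congr 1
    exact congrArg (heatExt φ f x z + ·) <| heatInt_congr (source_congr (mulF_congr fun l => (hgrad l).symm)) x hz

/-- The gradient of any fixed point solves the linear equation, so by uniqueness its field M V is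
the canonical one, whichever fixed point is chosen. -/
theorem IsFixedPt.sliceEq (hM : GoodMat φ (coefMat φ η)) (hq : factor φ (coefMat φ η) ≤ 2⁻¹)
    (hf : besovAbsD φ 0 f < ⊤)
    (h : IsFixedPt φ η f v) (l : Option (Fin d)) :
    SliceEq (mulF (coefMat φ η) (grad v) l) (fixedField φ η f l) := by
  obtain ⟨hv, c, hc⟩ := h
  have hg := goodField_grad hv
  have hG := GoodField.mulF hM hg
  refine mulF_congr (fun l => solve_unique hM (goodField_coef hf) hq hg (fun l => ?_) l) l
  exact grad_sliceEq hf hG (c := c) (fun x z hz => by rw [hc x z hz, opT_eq hG x hz]) l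

theorem IsFixedPt.eq (hM : GoodMat φ (coefMat φ η)) (hq : factor φ (coefMat φ η) ≤ 2⁻¹)
    (hf : besovAbsD φ 0 f < ⊤)
    (h : IsFixedPt φ η f v) : ∃ c : ℝ, ∀ x z, z < 0 →
    (v x z : ℂ) = heatExt φ f x z + heatInt (source (fixedField φ η f)) x z + c := by
  have hs := IsFixedPt.sliceEq hM hq hf h
  obtain ⟨hv, c, hc⟩ := h
  refine ⟨c, fun x z hz => ?_⟩
  rw [hc x z hz, opT_eq (GoodField.mulF hM (goodField_grad hv)) x hz,
    heatInt_congr (source_congr hs) x hz]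

theorem IsFixedPt.wInt_eq (hM : GoodMat φ (coefMat φ η)) (hq : factor φ (coefMat φ η) ≤ 2⁻¹)
    (hf : besovAbsD φ 0 f < ⊤)
    (h : IsFixedPt φ η f v) (x : Sp d) :
    wInt φ η v x 0 = duhDiv (fixedField φ η f) x 0 := by
  rw [MuskatDN.wInt_eq (GoodField.mulF hM (goodField_grad h.1)) x le_rfl,
    duhDiv_congr (IsFixedPt.sliceEq hM hq hf h)]

/-- Every fixed point equals one and the same heat representation up to a real constant. -/
theorem uniqueFixedPt (hM : GoodMat φ (coefMat φ η)) (hq : factor φ (coefMat φ η) ≤ 2⁻¹)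
    (hf : besovAbsD φ 0 f < ⊤)
    (hηr : IsRealDist η) (hη : besovAbsD φ 0 η < ⊤) (hfr : IsRealDist f) :
    UniqueFixedPt φ η f := by
  refine ⟨exists_isFixedPt hM hq hf hηr hη hfr, fun v v' h h' => ?_⟩
  obtain ⟨c, hc⟩ := IsFixedPt.eq hM hq hf h
  obtain ⟨c', hc'⟩ := IsFixedPt.eq hM hq hf h'
  refine ⟨c - c', fun x z hz => ?_⟩
  have : (v x z : ℂ) = ((v' x z + (c - c') : ℝ) : ℂ) := by
    push_cast
    rw [hc x z hz, hc' x z hz]; ring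
  exact_mod_cast this

theorem Rminus_eq (hM : GoodMat φ (coefMat φ η)) (hq : factor φ (coefMat φ η) ≤ 2⁻¹)
    (hf : besovAbsD φ 0 f < ⊤)
    (hηr : IsRealDist η) (hη : besovAbsD φ 0 η < ⊤) (hfr : IsRealDist f) :
    Rminus φ η f = fun x => duhDiv (fixedField φ η f) x 0 := by
  have h := exists_isFixedPt hM hq hf hηr hη hfr
  rw [Rminus, dif_pos h]
  ext x
  exact IsFixedPt.wInt_eq hM hq hf h.choose_spec x

end FixedPoint

/-! ### Difference of two solutions and the bound on R⁻ -/

section FinalEstimate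

variable {d : ℕ} {φ : DyadicCutoff d}

theorem supM_le_of_tame {s : ℝ} {K : ℝ≥0} {a b : ℝ≥0∞}
    {M : Option (Fin d) → Option (Fin d) → Sp d → ℝ → ℂ} (hM : ∀ i l, Tame φ s K a b (M i l)) :
    supM M ≤ ((d + 1) ^ 2 * K : ℝ≥0) * a := by
  refine (Finset.sum_le_sum fun i _ => Finset.sum_le_sum fun l _ => (hM i l).li).trans_eq ?_
  simp only [sum_option_const]
  push_cast; ring

theorem besM_le_of_tame {s : ℝ} {K : ℝ≥0} {a b : ℝ≥0∞}
    {M : Option (Fin d) → Option (Fin d) → Sp d → ℝ → ℂ} (hM : ∀ i l, Tame φ s K a b (M i l)) :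
    besM φ s M ≤ ((d + 1) ^ 2 * K : ℝ≥0) * b := by
  refine (Finset.sum_le_sum fun i _ => Finset.sum_le_sum fun l _ => (hM i l).bes).trans_eq ?_
  simp only [sum_option_const]
  push_cast; ring

variable (φ) in
-- The entrywise bounds are used twice: with r = 0 for the norms entering the contraction, and with
-- r for the high norm. The threshold is the smaller of the two.
theorem exists_coefMat_bounds {r : ℝ} (hr : 0 ≤ r) : ∃ K c : ℝ≥0, 0 < c ∧
    ∀ η : 𝓢'(Sp d, ℂ), besovAbsD φ 0 η < c → GoodMat φ (coefMat φ η) ∧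
      supM (coefMat φ η) ≤ K * besovAbsD φ 0 η ∧ besM φ 1 (coefMat φ η) ≤ K * besovAbsD φ 0 η ∧
      besM φ (1 + r) (coefMat φ η) ≤ K * besovAbsD φ r η := by
  obtain ⟨K₀, h₀⟩ := tame_coefMat φ le_rfl
  obtain ⟨K₁, h₁⟩ := tame_coefMat φ hr
  rw [add_zero] at h₀
  refine ⟨(d + 1) ^ 2 * (K₀ + K₁), min (smallConst φ 1) (smallConst φ (1 + r)),
    lt_min (smallConst_pos φ _) (smallConst_pos φ _), fun η hη => ?_⟩
  rw [ENNReal.coe_min, lt_min_iff] at hη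
  have t₀ := fun i l => (h₀ η hη.1 i l).mono_const (K' := K₀ + K₁) le_self_add
  have t₁ := fun i l => (h₁ η hη.2 i l).mono_const (K' := K₀ + K₁) le_add_self
  exact ⟨⟨fun i l => (t₀ i l).bm, fun i l => (t₀ i l).bes.trans_lt
    (ENNReal.mul_lt_top ENNReal.coe_lt_top (hη.1.trans ENNReal.coe_lt_top))⟩,
    supM_le_of_tame t₀, besM_le_of_tame t₀, besM_le_of_tame t₁⟩

variable (φ) in
theorem exists_coefMat_sub_bounds {r : ℝ} (hr : 0 ≤ r) : ∃ K c : ℝ≥0, 0 < c ∧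
    ∀ η η' : 𝓢'(Sp d, ℂ), besovAbsD φ 0 η < c → besovAbsD φ 0 η' < c →
      GoodMat φ (fun i l x z => coefMat φ η i l x z - coefMat φ η' i l x z) ∧
      supM (fun i l x z => coefMat φ η i l x z - coefMat φ η' i l x z) ≤
        K * besovAbsD φ 0 (η - η') ∧
      besM φ 1 (fun i l x z => coefMat φ η i l x z - coefMat φ η' i l x z) ≤
        K * besovAbsD φ 0 (η - η') ∧
      besM φ (1 + r) (fun i l x z => coefMat φ η i l x z - coefMat φ η' i l x z) ≤
        K * diffSize φ r η η' := by
  obtain ⟨K₀, h₀⟩ := tame_coefMat_sub φ le_rfl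
  obtain ⟨K₁, h₁⟩ := tame_coefMat_sub φ hr
  rw [add_zero] at h₀
  refine ⟨(d + 1) ^ 2 * (K₀ + K₁) * 3, min (smallConst φ 1) (smallConst φ (1 + r)),
    lt_min (smallConst_pos φ _) (smallConst_pos φ _), fun η η' hη hη' => ?_⟩
  rw [ENNReal.coe_min, lt_min_iff] at hη hη'
  have t₀ := fun i l => (h₀ η η' hη.1 hη'.1 i l).mono_const (K' := K₀ + K₁) le_self_add
  have t₁ := fun i l => (h₁ η η' hη.2 hη'.2 i l).mono_const (K' := K₀ + K₁) le_add_self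
  -- At regularity 0 both |D|η and |D|η' have norm at most 1, so the quadratic term costs at most
  -- twice the linear one.
  have hD : diffSize φ 0 η η' ≤ 3 * besovAbsD φ 0 (η - η') := by
    calc diffSize φ 0 η η' ≤ besovAbsD φ 0 (η - η') + besovAbsD φ 0 (η - η') * (1 + 1) := by
          rw [diffSize]
          gcongr
          exacts [le_one_of_small φ hη.1, le_one_of_small φ hη'.1]
      _ = _ := by ring
  have hK : ((d + 1) ^ 2 * (K₀ + K₁) : ℝ≥0) ≤ (d + 1) ^ 2 * (K₀ + K₁) * 3 :=
    le_mul_of_one_le_right' (by norm_num)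
  have hfin : besovAbsD φ 0 (η - η') < ⊤ :=
    absBlk_sub_lt_top φ (lt_top_of_small φ hη.1) (lt_top_of_small φ hη'.1)
  refine ⟨⟨fun i l => (t₀ i l).bm, fun i l => (t₀ i l).bes.trans_lt (ENNReal.mul_lt_top
    ENNReal.coe_lt_top (hD.trans_lt (ENNReal.mul_lt_top (by simp) hfin)))⟩,
    (supM_le_of_tame t₀).trans (by gcongr), (besM_le_of_tame t₀).trans ?_,
    (besM_le_of_tame t₁).trans (by gcongr)⟩
  rw [ENNReal.coe_mul _ 3, mul_assoc]
  gcongr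
  exact hD

theorem sizeF_coef_le {f : 𝓢'(Sp d, ℂ)} (hf : besovAbsD φ 0 f < ⊤) :
    sizeF φ (coef φ f) ≤ (9 * (d + 1) * coefConst φ : ℝ≥0) * besovAbsD φ 0 f := by
  have h := fun l => Bes_coef_le φ hf l 0
  rw [add_zero] at h
  refine (add_le_add (Finset.sum_le_sum fun l _ => LI_coef_le φ hf l)
    (Finset.sum_le_sum fun l _ => h l)).trans_eq ?_
  simp only [sum_option_const]
  push_cast; ring

theorem besF_coef_le {f : 𝓢'(Sp d, ℂ)} (hf : besovAbsD φ 0 f < ⊤) (r : ℝ) :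
    besF φ (1 + r) (coef φ f) ≤ (9 * (d + 1) * coefConst φ : ℝ≥0) * besovAbsD φ r f := by
  refine (Finset.sum_le_sum fun l _ => Bes_coef_le φ hf l r).trans ?_
  simp only [sum_option_const]
  calc (d + 1) * (8 * coefConst φ * besovAbsD φ r f)
      ≤ (d + 1) * (8 * coefConst φ * besovAbsD φ r f) + (d + 1) * coefConst φ * besovAbsD φ r f :=
        le_self_add
    _ = _ := by push_cast; ring

variable {M M' : Option (Fin d) → Option (Fin d) → Sp d → ℝ → ℂ} {V : Option (Fin d) → Sp d → ℝ → ℂ}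

theorem mulF_sub_mulF (W W' : Option (Fin d) → Sp d → ℝ → ℂ) (i : Option (Fin d)) (x : Sp d) (z : ℝ) :
    mulF M W i x z - mulF M' W' i x z = mulF M (fun l x z => W l x z - W' l x z) i x z +
      mulF (fun i l x z => M i l x z - M' i l x z) W' i x z := by
  simp only [mulF, ← Finset.sum_sub_distrib, ← Finset.sum_add_distrib]
  exact Finset.sum_congr rfl fun l _ => by ring

variable [NeZero d]

/-- The Ḃ^r norm at time 0 is the pointwise-in-time Duhamel bound, in which one derivative is paid
by the L̃¹ norm in time. -/
theorem besovFun_duhDiv_le {G : Option (Fin d) → Sp d → ℝ → ℂ} (hG : GoodField φ G) (r : ℝ) :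
    besovFun φ r (fun x => duhDiv G x 0) ≤ heatConst φ * besF φ (1 + r) G := by
  -- The slice at time 0 is extended as a time-independent function, because the block estimates are
  -- stated for z < 0; the time -1 used below is arbitrary.
  set u : Option (Fin d) → Sp d → ℝ → ℂ := fun l x _ => Duh before l (G l) x 0 with hu
  have hub : ∀ l, BM (u l) := fun l =>
    ⟨((measurable_Duh timeSets_before l (hG.bm l).meas).comp measurable_prodMk_right).comp
      measurable_fst, (LI_le fun x _ _ => enorm_Duh_le φ timeSets_before l (hG.bm l) x 0).trans_lt
        (ENNReal.mul_lt_top (by simp) (hG.bes l))⟩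
  have hneg : (-1 : ℝ) < 0 := by norm_num
  have key : ∀ j, eLpNorm (funMult (dyad φ symOne j) fun x => duhDiv G x 0) ⊤ volume ≤
      ∑ l, blk φ (Duh before l (G l)) j 0 := by
    intro j
    have e : (funMult (dyad φ symOne j) fun x => duhDiv G x 0) =
        fun x => (∑ k, funMult (dyad φ symOne j) (fun y => u (some k) y (-1)) x) -
          funMult (dyad φ symOne j) (fun y => u none y (-1)) x := by
      ext x
      have hk := (dyad_symOne_ccSym φ j).sym.kint
      have hI := fun l => integrable_ker_mul hk ((hub l).slice_aesm (-1)) ((hub l).slice_fin hneg) x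
      simp only [funMult_eq, hu] at hI ⊢
      rw [← integral_finsetSum _ fun k _ => hI (some k),
        ← integral_sub (integrable_finsetSum _ fun k _ => hI (some k)) (hI none)]
      simp only [duhDiv, mul_sub, Finset.mul_sum]
    rw [e]
    refine eLpNorm_top_le_of_forall fun x => ?_
    rw [Fintype.sum_option, add_comm]
    exact enorm_sub_le.trans (add_le_add ((enorm_sum_le _ _).trans
      (Finset.sum_le_sum fun k _ => enorm_block_le φ (hub (some k)) j hneg x))
      (enorm_block_le φ (hub none) j hneg x))
  rw [besF, Finset.mul_sum]
  calc besovFun φ r (fun x => duhDiv G x 0)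
      ≤ ∑' j : ℤ, (2 : ℝ≥0∞) ^ (r * (j : ℝ)) * ∑ l, blk φ (Duh before l (G l)) j 0 :=
        ENNReal.tsum_le_tsum fun j => mul_le_mul_right (key j) _
    _ = ∑ l, ∑' j : ℤ, (2 : ℝ≥0∞) ^ (r * (j : ℝ)) * blk φ (Duh before l (G l)) j 0 := by
        rw [← Summable.tsum_finsetSum fun _ _ => ENNReal.summable]
        simp only [Finset.mul_sum]
    _ ≤ _ := Finset.sum_le_sum fun l _ =>
        tsum_weighted_blk_Duh_le φ timeSets_before l (hG.bm l) (hG.bes l) r 0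

/-- The source of the equation satisfied by a difference of solutions. -/
def diffSource (M M' : Option (Fin d) → Option (Fin d) → Sp d → ℝ → ℂ)
    (V : Option (Fin d) → Sp d → ℝ → ℂ) : Option (Fin d) → Sp d → ℝ → ℂ :=
  mulF (fun i l x z => M i l x z - M' i l x z) (solve M' V)

theorem gradOp_add {G G' : Option (Fin d) → Sp d → ℝ → ℂ} (hG : GoodField φ G)
    (hG' : GoodField φ G') (l : Option (Fin d)) (x : Sp d) (s : ℝ) :
    gradOp (fun l x z => G l x z + G' l x z) l x s = gradOp G l x s + gradOp G' l x s := by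
  have hS : GoodField φ fun l x z => G l x z + G' l x z :=
    ⟨fun l => (hG.bm l).add (hG'.bm l), fun l => (Bes_add_le φ 1 (hG.bm l) (hG'.bm l)).trans_lt
      (ENNReal.add_lt_top.2 ⟨hG.bes l, hG'.bes l⟩)⟩
  have := gradOp_sub φ hS hG' l x s
  simp only [add_sub_cancel_right] at this
  exact (sub_eq_iff_eq_add.1 this.symm)

/-- Subtracting the two linear equations, the difference of solutions solves the equation with
matrix M and data `gradOp` of (M - M') applied to the second solution. By uniqueness it is again a
Neumann series. -/
theorem mulF_solve_sub (hM : GoodMat φ M) (hM' : GoodMat φ M')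
    (hN : GoodMat φ fun i l x z => M i l x z - M' i l x z) (hV : GoodField φ V)
    (hq : factor φ M ≤ 2⁻¹) (hq' : factor φ M' ≤ 2⁻¹) (i : Option (Fin d)) :
    SliceEq (fun x z => mulF M (solve M V) i x z - mulF M' (solve M' V) i x z) fun x z =>
      mulF M (solve M (gradOp (diffSource M M' V))) i x z + diffSource M M' V i x z := by
  have hW := GoodField.solve hM hV hq
  have hW' := GoodField.solve hM' hV hq'
  have hP : GoodField φ (diffSource M M' V) := GoodField.mulF hN hW'
  have hU := solve_unique hM (GoodField.gradOp φ hP) hq (hW.sub hW') fun l =>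
    SliceEq.of_forall fun x z hz => by
      have e : ∀ l x z, mulF M (solve M V) l x z - mulF M' (solve M' V) l x z = _ :=
        mulF_sub_mulF (M := M) (M' := M') (solve M V) (solve M' V)
      rw [solve_eq hM hV hq l x hz, solve_eq hM' hV hq' l x hz, add_sub_add_left_eq_sub,
        ← gradOp_sub φ (GoodField.mulF hM hW) (GoodField.mulF hM' hW'), add_comm]
      simp only [e]
      exact gradOp_add (GoodField.mulF hM (hW.sub hW')) hP l x z
  refine (SliceEq.of_forall fun x z _ => mulF_sub_mulF _ _ i x z).trans ?_
  exact SliceEq.map₂ (· + ·) (mulF_congr hU i) (SliceEq.of_forall fun _ _ _ => rfl)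

/-- The estimate of a difference of two solutions in terms of bounds on the coefficients. -/
theorem exists_besF_mulF_solve_sub_le {s : ℝ} (hs : 0 < s) (K : ℝ≥0) : ∃ C : ℝ≥0,
    ∀ (M M' : Option (Fin d) → Option (Fin d) → Sp d → ℝ → ℂ) (V : Option (Fin d) → Sp d → ℝ → ℂ)
      (A δ δs a as : ℝ≥0∞), GoodMat φ M → GoodMat φ M' →
      GoodMat φ (fun i l x z => M i l x z - M' i l x z) → GoodField φ V →
      factor φ M ≤ 2⁻¹ → factor φ M' ≤ 2⁻¹ → supM M ≤ 1 →
      gradConst φ * mulConst φ s * supM M ≤ 2⁻¹ → gradConst φ * mulConst φ s * supM M' ≤ 2⁻¹ →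
      besM φ s M ≤ K * A → besM φ s M' ≤ K * A →
      supM (fun i l x z => M i l x z - M' i l x z) ≤ K * δ →
      besM φ 1 (fun i l x z => M i l x z - M' i l x z) ≤ K * δ →
      besM φ s (fun i l x z => M i l x z - M' i l x z) ≤ K * (δs + δ * A) →
      sizeF φ V ≤ K * a → besF φ s V ≤ K * as →
      besF φ s (fun i x z => mulF M (solve M (gradOp (diffSource M M' V))) i x z +
        diffSource M M' V i x z) ≤ C * (A * δ * a + δ * as + δs * a) := by
  obtain ⟨g, hg⟩ := ENNReal.lt_iff_exists_coe.1 (gradConst_lt_top φ)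
  obtain ⟨m, hm, -⟩ := ENNReal.lt_iff_exists_coe.1 (mulConst_lt_top φ hs)
  obtain ⟨m₁, hm₁, -⟩ := ENNReal.lt_iff_exists_coe.1 (mulConst_lt_top φ one_pos)
  have hg := hg.1
  -- These constants bound, in order, the high norm of the second solution, the high norm of the
  -- difference source, the low size of the difference of solutions, and its high norm.
  set c₁ : ℝ≥0 := 2 * K + 4 * g * m * K ^ 2 with hc₁
  set c₂ : ℝ≥0 := m * (2 * K ^ 2 + K * c₁) with hc₂
  set c₃ : ℝ≥0 := 16 * g * (1 + m₁) * K ^ 2 with hc₃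
  set c₄ : ℝ≥0 := 2 * (g * c₂ + g * m * K * c₃) with hc₄
  refine ⟨m * (K * c₃ + c₄) + c₂, fun M M' V A δ δs a as hM hM' hN hV hq hq' hM1 hk hk' hA hA' h0 h1 hD
    hVa hVs => ?_⟩
  set T := A * δ * a + δ * as + δs * a with hT
  have hW' := GoodField.solve hM' hV hq'
  have hP : GoodField φ (diffSource M M' V) := GoodField.mulF hN hW'
  have hP' := GoodField.gradOp φ hP
  have hU := GoodField.solve hM hP' hq
  -- Three combinations arise, according to whether the extra derivatives fall on M, on the
  -- difference of the matrices, or on the second solution; each is part of T.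
  have T1 : A * (δ * a) ≤ T := by rw [hT, add_assoc, ← mul_assoc]; exact le_self_add
  have T2 : (δs + δ * A) * a ≤ T := by
    calc (δs + δ * A) * a ≤ (δs + δ * A) * a + δ * as := le_self_add
      _ = T := by rw [hT]; ring
  have T3 : δ * (as + A * a) ≤ T := by
    calc δ * (as + A * a) ≤ δ * (as + A * a) + δs * a := le_self_add
      _ = T := by rw [hT]; ring
  have bW : sizeF φ (solve M' V) ≤ 2 * (K * a) := (sizeF_solve_le hM' hV hq').trans (by gcongr)
  have bWs : besF φ s (solve M' V) ≤ c₁ * (as + A * a) := by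
    calc besF φ s (solve M' V)
        ≤ 2 * (K * as + g * m * (K * A) * (2 * (K * a))) := by
          refine (besF_solve_le hM' hV hq' hk').trans ?_
          rw [hg, hm]
          gcongr
      _ ≤ 2 * (K * as + g * m * (K * A) * (2 * (K * a))) + (2 * K * (A * a) + 4 * g * m * K ^ 2 * as) :=
          le_self_add
      _ = _ := by rw [hc₁]; push_cast; ring
  have bP : sizeF φ (diffSource M M' V) ≤ 4 * (1 + m₁) * K ^ 2 * (δ * a) := by
    calc sizeF φ (diffSource M M' V) ≤ (1 + m₁) * (K * δ + K * δ) * (2 * (K * a)) := by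
          refine (sizeF_mulF_le hN hW').trans ?_
          rw [hm₁]
          gcongr
      _ = _ := by ring
  have bPs : besF φ s (diffSource M M' V) ≤ c₂ * T := by
    calc besF φ s (diffSource M M' V)
        ≤ m * (K * (δs + δ * A) * (2 * (K * a)) + K * δ * (c₁ * (as + A * a))) := by
          refine (besF_mulF_le φ hN.bm hW'.bm s).trans ?_
          rw [hm]
          gcongr
          exact le_self_add.trans bW
      _ = m * (2 * K ^ 2 * ((δs + δ * A) * a) + K * c₁ * (δ * (as + A * a))) := by ring
      _ ≤ m * (2 * K ^ 2 * T + K * c₁ * T) := by gcongr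
      _ = _ := by rw [hc₂]; push_cast; ring
  have bP' : sizeF φ (gradOp (diffSource M M' V)) ≤ 8 * g * (1 + m₁) * K ^ 2 * (δ * a) := by
    calc sizeF φ (gradOp (diffSource M M' V))
        ≤ gradConst φ * sizeF φ (diffSource M M' V) + gradConst φ * sizeF φ (diffSource M M' V) :=
          add_le_add (supF_gradOp_le φ hP) ((besF_gradOp_le φ hP 1).trans
            (by gcongr; exact le_add_self))
      _ ≤ g * (4 * (1 + m₁) * K ^ 2 * (δ * a)) + g * (4 * (1 + m₁) * K ^ 2 * (δ * a)) := by
          rw [hg]; gcongr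
      _ = _ := by ring
  have bU : sizeF φ (solve M (gradOp (diffSource M M' V))) ≤ c₃ * (δ * a) := by
    refine (sizeF_solve_le hM hP' hq).trans ((mul_le_mul_right bP' 2).trans_eq ?_)
    rw [hc₃]; push_cast; ring
  have bUs : besF φ s (solve M (gradOp (diffSource M M' V))) ≤ c₄ * T := by
    calc besF φ s (solve M (gradOp (diffSource M M' V)))
        ≤ 2 * (g * (c₂ * T) + g * m * (K * A) * (2 * (8 * g * (1 + m₁) * K ^ 2 * (δ * a)))) := by
          refine (besF_solve_le hM hP' hq hk).trans ?_
          rw [hg, hm]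
          gcongr
          exact (besF_gradOp_le φ hP s).trans (by rw [hg]; gcongr)
      _ = 2 * (g * c₂ * T + g * m * K * c₃ * (A * (δ * a))) := by rw [hc₃]; push_cast; ring
      _ ≤ 2 * (g * c₂ * T + g * m * K * c₃ * T) := by gcongr
      _ = _ := by rw [hc₄]; push_cast; ring
  calc besF φ s (fun i x z => mulF M (solve M (gradOp (diffSource M M' V))) i x z +
        diffSource M M' V i x z)
      ≤ besF φ s (mulF M (solve M (gradOp (diffSource M M' V)))) + besF φ s (diffSource M M' V) := by
        rw [besF, besF, besF, ← Finset.sum_add_distrib]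
        exact Finset.sum_le_sum fun i _ => Bes_add_le φ s (BM_mulF hM.bm hU.bm i) (hP.bm i)
    _ ≤ m * (K * A * (c₃ * (δ * a)) + 1 * (c₄ * T)) + c₂ * T := by
        refine add_le_add ((besF_mulF_le φ hM.bm hU.bm s).trans ?_) bPs
        rw [hm]
        gcongr
        exact le_self_add.trans bU
    _ = m * (K * c₃ * (A * (δ * a)) + c₄ * T) + c₂ * T := by ring
    _ ≤ m * (K * c₃ * T + c₄ * T) + c₂ * T := by gcongr
    _ = _ := by push_cast; ring

theorem Rminus_sub_eq {η η' f : 𝓢'(Sp d, ℂ)} (hM : GoodMat φ (coefMat φ η))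
    (hM' : GoodMat φ (coefMat φ η'))
    (hN : GoodMat φ fun i l x z => coefMat φ η i l x z - coefMat φ η' i l x z)
    (hq : factor φ (coefMat φ η) ≤ 2⁻¹) (hq' : factor φ (coefMat φ η') ≤ 2⁻¹)
    (hf : besovAbsD φ 0 f < ⊤) (hηr : IsRealDist η) (hη : besovAbsD φ 0 η < ⊤)
    (hηr' : IsRealDist η') (hη' : besovAbsD φ 0 η' < ⊤) (hfr : IsRealDist f) :
    Rminus φ η f - Rminus φ η' f = fun x => duhDiv (fun i x z =>
      mulF (coefMat φ η) (solve (coefMat φ η)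
        (gradOp (diffSource (coefMat φ η) (coefMat φ η') (coef φ f)))) i x z +
      diffSource (coefMat φ η) (coefMat φ η') (coef φ f) i x z) x 0 := by
  rw [Rminus_eq hM hq hf hηr hη hfr, Rminus_eq hM' hq' hf hηr' hη' hfr]
  ext x
  rw [← duhDiv_congr (mulF_solve_sub hM hM' hN (goodField_coef hf) hq hq'),
    Pi.sub_apply]
  exact (duhDiv_sub φ (goodField_fixedField hM hq hf) (goodField_fixedField hM' hq' hf) x 0).symm

variable (φ) in
-- The threshold combines the smallness needed for the coefficient bounds with the contraction
-- conditions at regularities 1 and 1 + r, which is why it depends on r; the Ḃ^r norms of the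
-- interfaces stay arbitrary.
theorem exists_besovFun_Rminus_sub_le {r : ℝ} (hr : 0 ≤ r) :
    ∃ cstar : ℝ≥0, 0 < cstar ∧ ∃ C : ℝ≥0, ∀ η₁ η₂ f : 𝓢'(Sp d, ℂ),
      MemData φ r η₁ → MemData φ r η₂ → MemData φ r f →
      besovAbsD φ 0 η₁ < cstar → besovAbsD φ 0 η₂ < cstar →
      UniqueFixedPt φ η₁ f ∧ UniqueFixedPt φ η₂ f ∧
      besovFun φ r (Rminus φ η₁ f - Rminus φ η₂ f) ≤
        C * (besovAbsD φ r η₁ + besovAbsD φ r η₂)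
            * besovAbsD φ 0 (η₁ - η₂) * besovAbsD φ 0 f
          + C * besovAbsD φ 0 (η₁ - η₂) * besovAbsD φ r f
          + C * besovAbsD φ r (η₁ - η₂) * besovAbsD φ 0 f := by
  have hs : 0 < 1 + r := by linarith
  obtain ⟨K₁, t₁, ht₁, h₁⟩ := exists_coefMat_bounds φ hr
  obtain ⟨K₂, t₂, ht₂, h₂⟩ := exists_coefMat_sub_bounds φ hr
  obtain ⟨g, hg, -⟩ := ENNReal.lt_iff_exists_coe.1 (gradConst_lt_top φ)
  obtain ⟨m, hm, -⟩ := ENNReal.lt_iff_exists_coe.1 (mulConst_lt_top φ hs)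
  obtain ⟨m₁, hm₁, -⟩ := ENNReal.lt_iff_exists_coe.1 (mulConst_lt_top φ one_pos)
  -- The first three terms are the constants in the contraction factor at regularity 1, the one at
  -- regularity 1 + r, and the sup norm of the matrix; the final 1 keeps B positive so that it can
  -- be inverted.
  set B : ℝ≥0 := 4 * g * (1 + m₁) * K₁ + g * m * K₁ + K₁ + 1 with hB
  set t₃ : ℝ≥0 := B⁻¹ * 2⁻¹ with ht₃
  -- One constant dominating those for the matrices, for their difference and for the gradient of
  -- the heat extension of f.
  obtain ⟨C, hC⟩ := exists_besF_mulF_solve_sub_le (φ := φ) hs (K₁ + K₂ + 9 * (d + 1) * coefConst φ)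
  obtain ⟨C', hC'⟩ := exists_besovAbsD_le φ
  have hBpos : 0 < B := by positivity
  have small : ∀ η : 𝓢'(Sp d, ℂ), besovAbsD φ 0 η < min t₁ (min t₂ t₃) →
      GoodMat φ (coefMat φ η) ∧ factor φ (coefMat φ η) ≤ 2⁻¹ ∧ supM (coefMat φ η) ≤ 1 ∧
        gradConst φ * mulConst φ (1 + r) * supM (coefMat φ η) ≤ 2⁻¹ := by
    intro η hη
    simp only [ENNReal.coe_min, lt_min_iff] at hη
    obtain ⟨hM, b0, b1, -⟩ := h₁ η hη.1
    have hb : B * besovAbsD φ 0 η ≤ 2⁻¹ := by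
      calc (B : ℝ≥0∞) * besovAbsD φ 0 η ≤ B * t₃ := by gcongr; exact hη.2.2.le
        _ = ((B * t₃ : ℝ≥0) : ℝ≥0∞) := by push_cast; rfl
        _ = 2⁻¹ := by rw [ht₃, mul_inv_cancel_left₀ hBpos.ne']; simp
    have hle : ∀ c : ℝ≥0, c ≤ B → (c : ℝ≥0∞) * besovAbsD φ 0 η ≤ 2⁻¹ := fun c hc =>
      le_trans (by gcongr) hb
    refine ⟨hM, ?_, ?_, ?_⟩
    · refine le_trans ?_ (hle (4 * g * (1 + m₁) * K₁) ?_)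
      · calc factor φ (coefMat φ η) ≤ 2 * g * (1 + m₁) *
              (K₁ * besovAbsD φ 0 η + K₁ * besovAbsD φ 0 η) := by
              rw [factor, hg, hm₁]; gcongr
          _ = _ := by push_cast; ring
      · rw [hB, add_assoc, add_assoc]; exact le_self_add
    · refine b0.trans ((hle K₁ ?_).trans (by simp))
      rw [hB, add_assoc, add_comm K₁, ← add_assoc]; exact le_add_self
    · refine le_trans ?_ (hle (g * m * K₁) ?_)
      · calc gradConst φ * mulConst φ (1 + r) * supM (coefMat φ η)
            ≤ g * m * (K₁ * besovAbsD φ 0 η) := by rw [hg, hm]; gcongr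
          _ = _ := by push_cast; ring
      · rw [hB, add_comm (4 * g * (1 + m₁) * K₁), add_assoc, add_assoc]; exact le_self_add
  refine ⟨min t₁ (min t₂ t₃), lt_min ht₁ (lt_min ht₂ (by positivity)), heatConst φ * C,
    fun η₁ η₂ f hη₁ hη₂ hf s₁ s₂ => ?_⟩
  have fin : ∀ u : 𝓢'(Sp d, ℂ), MemData φ r u → besovAbsD φ 0 u < ⊤ := fun u hu => by
    have h : besov φ (0 + 1) u < ⊤ := by rw [zero_add]; exact hu.2.1
    exact (hC' 0 u h).trans_lt (ENNReal.mul_lt_top ENNReal.coe_lt_top h)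
  obtain ⟨hM₁, hq₁, hu₁, hk₁⟩ := small η₁ s₁
  obtain ⟨hM₂, hq₂, hu₂, hk₂⟩ := small η₂ s₂
  have f0 := fin f hf
  refine ⟨uniqueFixedPt hM₁ hq₁ f0 hη₁.1 (fin _ hη₁) hf.1,
    uniqueFixedPt hM₂ hq₂ f0 hη₂.1 (fin _ hη₂) hf.1, ?_⟩
  simp only [ENNReal.coe_min, lt_min_iff] at s₁ s₂
  obtain ⟨-, -, -, b₁⟩ := h₁ η₁ s₁.1
  obtain ⟨-, -, -, b₂⟩ := h₁ η₂ s₂.1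
  obtain ⟨hN, n0, n1, nr⟩ := h₂ η₁ η₂ s₁.2.1 s₂.2.1
  set K : ℝ≥0 := K₁ + K₂ + 9 * (d + 1) * coefConst φ with hK
  have k₁ : K₁ ≤ K := by rw [hK, add_assoc]; exact le_self_add
  have k₂ : K₂ ≤ K := by rw [hK, add_comm K₁, add_assoc]; exact le_self_add
  have k₃ : 9 * (d + 1) * coefConst φ ≤ K := le_add_self
  rw [Rminus_sub_eq hM₁ hM₂ hN hq₁ hq₂ f0 hη₁.1 (fin _ hη₁) hη₂.1 (fin _ hη₂) hf.1]
  have hV := goodField_coef f0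
  have hP : GoodField φ (diffSource (coefMat φ η₁) (coefMat φ η₂) (coef φ f)) :=
    GoodField.mulF hN (GoodField.solve hM₂ hV hq₂)
  have hQ := GoodField.mulF hM₁ (GoodField.solve hM₁ (GoodField.gradOp φ hP) hq₁)
  refine (besovFun_duhDiv_le (G := fun i x z => _) ⟨fun l => (hQ.bm l).add (hP.bm l), fun l =>
    (Bes_add_le φ 1 (hQ.bm l) (hP.bm l)).trans_lt (ENNReal.add_lt_top.2 ⟨hQ.bes l, hP.bes l⟩)⟩
    r).trans ?_
  have main := hC (coefMat φ η₁) (coefMat φ η₂) (coef φ f) (besovAbsD φ r η₁ + besovAbsD φ r η₂)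
    (besovAbsD φ 0 (η₁ - η₂)) (besovAbsD φ r (η₁ - η₂)) (besovAbsD φ 0 f) (besovAbsD φ r f)
    hM₁ hM₂ hN hV hq₁ hq₂ hu₁ hk₁ hk₂
    (b₁.trans (by gcongr; exact le_self_add)) (b₂.trans (by gcongr; exact le_add_self))
    (n0.trans (by gcongr)) (n1.trans (by gcongr))
    (nr.trans (by rw [diffSize]; gcongr))
    ((sizeF_coef_le f0).trans (by gcongr)) ((besF_coef_le f0 r).trans (by gcongr))
  refine (mul_le_mul_right main _).trans_eq ?_
  push_cast; ring

end FinalEstimate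

end MuskatDN

end

theorem proposition3p6 (d : ℕ) (hd : 0 < d) (φ : MuskatDN.DyadicCutoff d) (r : ℝ) (hr : 0 ≤ r) :
    ∃ cstar : ℝ≥0, 0 < cstar ∧ ∃ C : ℝ≥0, ∀ η₁ η₂ f : 𝓢'(MuskatDN.Sp d, ℂ),
      MuskatDN.MemData φ r η₁ → MuskatDN.MemData φ r η₂ → MuskatDN.MemData φ r f →
      MuskatDN.besovAbsD φ 0 η₁ < cstar → MuskatDN.besovAbsD φ 0 η₂ < cstar →
      MuskatDN.UniqueFixedPt φ η₁ f ∧ MuskatDN.UniqueFixedPt φ η₂ f ∧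
      MuskatDN.besovFun φ r (MuskatDN.Rminus φ η₁ f - MuskatDN.Rminus φ η₂ f) ≤
        C * (MuskatDN.besovAbsD φ r η₁ + MuskatDN.besovAbsD φ r η₂)
            * MuskatDN.besovAbsD φ 0 (η₁ - η₂) * MuskatDN.besovAbsD φ 0 f
          + C * MuskatDN.besovAbsD φ 0 (η₁ - η₂) * MuskatDN.besovAbsD φ r f
          + C * MuskatDN.besovAbsD φ r (η₁ - η₂) * MuskatDN.besovAbsD φ 0 f := by
  have : NeZero d := ⟨hd.ne'⟩
  exact MuskatDN.exists_besovFun_Rminus_sub_le φ hr
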